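/- \textbf{Setting.} A \emph{Sommerfeld surface} $S$ with $M$ sheets and $N$ branch points is a Hausdorff space $S$ with a proper continuous map $\psi:S\to\mathbb R^2$ and distinct points $P_1,\dots,P_N\in\mathbb R^2$, $P_j=(X_1^{(j)},X_2^{(j)})$, such that every point of $\mathbb R^2\setminus\{P_1,\dots,P_N\}$ has exactly $M$ preimages, and near each $s\in S$ there is a local complex coordinate $\zeta$, centred at $s$, in which $\psi$ is $\zeta\mapsto\psi(s)+\zeta^m$ for some $m\ge1$ (identifying $\mathbb R^2$ with $\mathbb C$ by $(x_1,x_2)\mapsto x_1+ix_2$), with $m=1$ if $s$ does not lie over any $P_j$. Assume $S$ is connected. Let $\mathrm{Re}\,k>0$, $\mathrm{Im}\,k\ge0$, and let $u:S\to\mathbb C$ obey the Helmholtz equation on $S$: $u$ is continuous; on each sheet over $\mathbb R^2\setminus\{P_j\}$ it is twice continuously differentiable in $(x_1,x_2)$ with $(\partial_{x_1}^2+\partial_{x_2}^2+k^2)u=0$; and each $P_j$ has a neighbourhood such that $\iint(|\nabla u|^2+|u|^2)\,dx_1dx_2$, summed over all sheets above it, is finite (Meixner condition). Let $$T=\bigcup_{j=1}^N\Big(\{x_1+ix_2=X_1^{(j)}+iX_2^{(j)}\}\cup\{x_1-ix_2=X_1^{(j)}-iX_2^{(j)}\}\Big)\subset\mathbb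 C^2 .$$ For a point $s_0\in S$ not over any $P_j$ and a continuous path $\sigma$ in $\mathbb C^2\setminus T$ from $\psi(s_0)$ to $A$, the branch $u_c(\cdot\,;\sigma)$ near $A$ is the result of analytic continuation along $\sigma$ of the holomorphic germ at $\psi(s_0)\in\mathbb R^2\subset\mathbb C^2$ that coincides, for real arguments, with $u$ on the sheet of $S$ through $s_0$. \textbf{Green's integrals.} For $x=(x_1,x_2)\in\mathbb C^2$ let $$A_1(x)=(\mathrm{Re}\,x_1-\mathrm{Im}\,x_2,\ \mathrm{Im}\,x_1+\mathrm{Re}\,x_2),\qquad A_2(x)=(\mathrm{Re}\,x_1+\mathrm{Im}\,x_2,\ \mathrm{Re}\,x_2-\mathrm{Im}\,x_1)$$ be its associated real points. Green's integral at $x$ over a closed contour $\Gamma$ on $S$, whose projection avoids $A_1(x),A_2(x),P_1,\dots,P_N$, is $$\int_\Gamma\Big[\frac{\partial G}{\partial n'}u-\frac{\partial u}{\partial n'}G\Big]dl',\qquad G=-\tfrac i4H_0^{(1)}\Big(k\sqrt{(x_1-x_1')^2+(x_2-x_2')^2}\Big),$$ with the normal to the right of $\Gamma$ and a branch of $G$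 that is continuous and single-valued along $\Gamma$. For a non-real $B\in\mathbb C^2\setminus T$ (then $A_1(B),A_2(B),P_1,\dots,P_N$ are distinct) take a base point $b\in\mathbb R^2$, different from these points and such that the segment from $b$ to any one of them avoids the others. Let $\lambda_a$ be the loop that goes from $b$ straight towards $a$, encircles $a$ once anticlockwise on a circle of small radius, and returns to $b$. The \emph{basic contour} is $\Gamma_0=\lambda_{A_1(B)}\lambda_{A_2(B)}$; the \emph{double-eight (Pochhammer) contour} based on $A_\ell(B)$ and $P_j$ is $\delta\Gamma_{\ell,j}=\lambda_{A_\ell(B)}\lambda_{P_j}\lambda_{A_\ell(B)}^{-1}\lambda_{P_j}^{-1}$, $\ell\in\{1,2\}$, $1\le j\le N$. Each of them lifts to $M$ closed contours on $S$, one for each starting point over $b$. \textbf{Theorem.} Put $Q=M+\sum_{j=1}^N\big(M-\#\psi^{-1}(P_j)\big)$, which depends only on the topology of $S$ (as a branched covering of the plane). Let $A\in\mathbb C^2\setminus T$. There are a connected open neighbourhood $U\subset\mathbb C^2\setminus T$ of $A$ and analytic functions $g_1,\dots,g_Q$ on $U$, solutions of the complex Helmholtz equation $(\partial_{x_1}^2+\partial_{x_2}^2+k^2)g_q=0$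 in $U$, such that: (i) for all $s_0$ and all paths $\sigma$ in $\mathbb C^2\setminus T$ from $\psi(s_0)$ to $A$, the analytic continuation along $\sigma$ exists, and the resulting branch $u_c(\cdot\,;\sigma)$ is analytic in the whole of $U$; (ii) every branch is an integer linear combination of the $g_q$: there are $b_q(\sigma)\in\mathbb Z$ with $u_c(x;\sigma)=\sum_{q=1}^Qb_q(\sigma)\,g_q(x)$ for all $x\in U$; (iii) for every $B\in U\setminus\mathbb R^2$ there are a base point and a radius as above such that, for $x$ near $B$, the $g_q(x)$ are Green's integrals at $x$ over $Q$ distinct contours on $S$: one lift of the basic contour $\Gamma_0$ and $Q-1$ lifts of the double-eight contours $\delta\Gamma_{\ell,j}$. -/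

import Mathlib

open Filter Topology MeasureTheory ComplexConjugate

noncomputable section

/-- A Sommerfeld surface `S` with `M` sheets and `N` branch points: a finite branched covering
`proj : S → ℝ²`.  Off the branch points `P_j` it is an `M`-sheeted covering; around a point lying
over a branch point it looks like `ζ ↦ P_j + ζ ^ m`.
The real plane is identified with `ℂ` through `(x₁, x₂) ↦ x₁ + i x₂`. -/
structure SommerfeldSurface (S : Type*) [TopologicalSpace S] [T2Space S] (M N : ℕ) where
  /-- The branch points `P_j` of the plane. -/
  branchPt : Fin N → ℂ
  branchPt_injective : Function.Injective branchPt
  /-- The natural projection of the surface to the plane. -/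
  proj : S → ℂ
  isProperMap_proj : IsProperMap proj
  ncard_fiber : ∀ z, z ∉ Set.range branchPt → (proj ⁻¹' {z}).ncard = M
  local_form : ∀ s, ∃ e : OpenPartialHomeomorph S ℂ, ∃ m : ℕ, s ∈ e.source ∧ 0 < m ∧
    (proj s ∉ Set.range branchPt → m = 1) ∧ ∀ s' ∈ e.source, proj s' = proj s + e s' ^ m

/-! ### The Hankel function -/

/-- The Bessel function `J₀`. -/
def besselJZero (z : ℂ) : ℂ :=
  ∑' m : ℕ, (-1) ^ m * (z ^ 2 / 4) ^ m / (m.factorial : ℂ) ^ 2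

/-- The Bessel function `Y₀` on the Riemann surface of the logarithm: its value at the point
`z = exp l` of that surface, `l` being the logarithm of `z`. -/
def besselYZeroLog (l : ℂ) : ℂ :=
  (2 / Real.pi : ℂ) * ((l - Real.log 2 + Real.eulerMascheroniConstant) * besselJZero (Complex.exp l)
    - ∑' m : ℕ, (-1) ^ m * (harmonic m : ℂ) * (Complex.exp l ^ 2 / 4) ^ m
        / (m.factorial : ℂ) ^ 2)

/-- The Hankel function `H₀⁽¹⁾` on the Riemann surface of the logarithm, as an entire function of
the logarithm `l` of its argument: `hankelLog l = H₀⁽¹⁾(exp l)`. -/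
def hankelLog (l : ℂ) : ℂ :=
  besselJZero (Complex.exp l) + Complex.I * besselYZeroLog l

/-! ### The complex Helmholtz equation in `ℂ²` -/

/-- The real plane inside `ℂ²`. -/
def toC2 (z : ℂ) : ℂ × ℂ := ((z.re : ℂ), (z.im : ℂ))

/-- `(∂²/∂x₁² + ∂²/∂x₂² + k²) v = 0` at the point `x` of `ℂ²`. -/
def ComplexHelmholtzAt (k : ℂ) (v : ℂ × ℂ → ℂ) (x : ℂ × ℂ) : Prop :=
  iteratedDeriv 2 (fun t => v (t, x.2)) x.1 + iteratedDeriv 2 (fun t => v (x.1, t)) x.2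
    + k ^ 2 * v x = 0

/-- The two real points associated with a point of `ℂ²`, as points of the real plane `ℂ`:
`A₁ = (Re x₁ - Im x₂, Im x₁ + Re x₂)` and `A₂ = (Re x₁ + Im x₂, Re x₂ - Im x₁)`. -/
def realPt (l : Fin 2) (x : ℂ × ℂ) : ℂ :=
  if l = 0 then ⟨x.1.re - x.2.im, x.1.im + x.2.re⟩ else ⟨x.1.re + x.2.im, x.2.re - x.1.im⟩

/-- The complex squared distance `(x₁ - x₁')² + (x₂ - x₂')²` from a point `x` of `ℂ²` to a point
`w = x₁' + i x₂'` of the real plane. -/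
def sqDist (x : ℂ × ℂ) (w : ℂ) : ℂ := (x.1 - w.re) ^ 2 + (x.2 - w.im) ^ 2

/-! ### Contours in the real plane -/

/-- The circle with centre `a` through `p`, run through once anticlockwise from `p` to `p`. -/
def circleLoop (a p : ℂ) : Path p p where
  toFun t := a + (p - a) * Complex.exp (2 * Real.pi * Complex.I * ((t : ℝ) : ℂ))
  continuous_toFun := by fun_prop
  source' := by simp
  target' := by simp

/-- The point of the circle of radius `r` around `a` which is nearest to `b`. -/
def circlePt (b a : ℂ) (r : ℝ) : ℂ := a + r * ((b - a) / (‖b - a‖ : ℂ))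

/-- The loop based at `b` that goes straight towards `a`, encircles `a` once anticlockwise at
distance `r` and returns to `b`. -/
def lasso (b a : ℂ) (r : ℝ) : Path b b :=
  ((Path.segment b (circlePt b a r)).trans (circleLoop a (circlePt b a r))).trans
    (Path.segment (circlePt b a r) b)

/-- The basic contour: a loop based at `b` that encircles `a₁` and then `a₂` once
anticlockwise. -/
def basicContour (b a₁ a₂ : ℂ) (r : ℝ) : Path b b := (lasso b a₁ r).trans (lasso b a₂ r)

/-- The double-eight (Pochhammer) contour based on the points `a` and `p`: it encircles `a`, then
`p`, then `a` backwards, then `p` backwards. -/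
def doubleEight (b a p : ℂ) (r : ℝ) : Path b b :=
  (((lasso b a r).trans (lasso b p r)).trans (lasso b a r).symm).trans (lasso b p r).symm

namespace SommerfeldSurface

variable {S : Type*} [TopologicalSpace S] [T2Space S] {M N : ℕ} (X : SommerfeldSurface S M N)

/-- The sheet of the surface through the point `s` (not over a branch point): the local inverse of
the projection which takes `proj s` to `s`. -/
def sheet (s : S) (z : ℂ) : S := (X.local_form s).choose.symm (z - X.proj s)

lemma sheet_self {s : S} (hs : X.proj s ∉ Set.range X.branchPt) : X.sheet s (X.proj s) = s := by
  obtain ⟨m, h1, h2, h3, h4⟩ := (X.local_form s).choose_spec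
  have hm := h3 hs
  subst hm
  have h0 : (X.local_form s).choose s = 0 := by simpa using h4 s h1
  rw [sheet, sub_self, ← h0]
  exact (X.local_form s).choose.left_inv h1

lemma eventually_proj_sheet {s : S} (hs : X.proj s ∉ Set.range X.branchPt) :
    ∀ᶠ z in 𝓝 (X.proj s), X.proj (X.sheet s z) = z ∧ ContinuousAt (X.sheet s) z := by
  obtain ⟨m, h1, h2, h3, h4⟩ := (X.local_form s).choose_spec
  have hm := h3 hs
  subst hm
  have h0 : (X.local_form s).choose s = 0 := by simpa using h4 s h1
  have ht : (0 : ℂ) ∈ (X.local_form s).choose.target := by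
    rw [← h0]; exact (X.local_form s).choose.map_source h1
  have hc : Tendsto (fun z => z - X.proj s) (𝓝 (X.proj s)) (𝓝 0) := by
    have : ContinuousAt (fun z => z - X.proj s) (X.proj s) := by fun_prop
    simpa [ContinuousAt] using this
  filter_upwards [hc ((X.local_form s).choose.open_target.mem_nhds ht)] with z hz
  refine ⟨?_, ?_⟩
  · rw [sheet, h4 _ ((X.local_form s).choose.map_target hz), (X.local_form s).choose.right_inv hz]
    ring
  · exact ContinuousAt.comp (g := (X.local_form s).choose.symm) (f := fun z => z - X.proj s)
      ((X.local_form s).choose.continuousAt_symm hz) (by fun_prop)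

/-- The real differential of a function on the surface, in the Cartesian coordinates of the
sheet. -/
def grad (u : S → ℂ) (s : S) : ℂ →L[ℝ] ℂ := fderiv ℝ (fun z => u (X.sheet s z)) (X.proj s)

/-- `u` obeys the Helmholtz equation with wavenumber `k` on the surface: it is continuous, it
solves the equation on every sheet off the branch points, and it satisfies the Meixner condition
(finite energy near every branch point, on all sheets). -/
structure IsHelmholtz (k : ℂ) (u : S → ℂ) : Prop where
  continuous : Continuous u
  contDiffAt : ∀ s, X.proj s ∉ Set.range X.branchPt →
    ContDiffAt ℝ 2 (fun z => u (X.sheet s z)) (X.proj s)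
  helmholtz : ∀ s, X.proj s ∉ Set.range X.branchPt →
    Laplacian.laplacian (fun z => u (X.sheet s z)) (X.proj s) + k ^ 2 * u s = 0
  meixner : ∀ j, ∃ ε > 0, ∫⁻ z in Metric.ball (X.branchPt j) ε,
    ∑' s : X.proj ⁻¹' {z}, (‖X.grad u s‖ₑ ^ 2 + ‖u s‖ₑ ^ 2) < ⊤

/-- The set `T`: the union of the complex characteristics
`x₁ + i x₂ = X₁ + i X₂` and `x₁ - i x₂ = X₁ - i X₂` through the branch points. -/
def branchLines : Set (ℂ × ℂ) :=
  {x | ∃ j, x.1 + Complex.I * x.2 = X.branchPt j ∨ x.1 - Complex.I * x.2 = conj (X.branchPt j)}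

/-- The function `v` is, near `A`, the branch `u_c(· ; σ)` of the continuation of `u`: the result of
analytic continuation along the path `σ` in `ℂ²` of the germ which, for real arguments, is equal to
`u` on the sheet of the surface through `s₀`. -/
def IsBranch (u : S → ℂ) (s₀ : S) {A : ℂ × ℂ} (σ : Path (toC2 (X.proj s₀)) A)
    (v : ℂ × ℂ → ℂ) : Prop :=
  ∃ f : unitInterval → ℂ × ℂ → ℂ,
    (∀ t, AnalyticAt ℂ (f t) (σ t)) ∧
    (∀ t, ∀ᶠ t' in 𝓝 t, f t' =ᶠ[𝓝 (σ t')] f t) ∧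
    (∀ᶠ z in 𝓝 (X.proj s₀), f 0 (toC2 z) = u (X.sheet s₀ z)) ∧
    f 1 =ᶠ[𝓝 A] v

/-- The integrand `(∂G/∂n') u - (∂u/∂n') G` of Green's formula at the point `s` of the surface,
where `n` is the (not normalised) normal vector, `G = -(i/4) H₀⁽¹⁾(k r)`, and `l` is the chosen
logarithm of `k r`.  The derivative of `l` in the direction `n` is
`-((x₁ - x₁') n₁ + (x₂ - x₂') n₂) / r²`. -/
def greenIntegrand (u : S → ℂ) (x : ℂ × ℂ) (s : S) (l n : ℂ) : ℂ :=
  -(Complex.I / 4) * deriv hankelLog l *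
      (-((x.1 - (X.proj s).re) * n.re + (x.2 - (X.proj s).im) * n.im) / sqDist x (X.proj s)) * u s
    - X.grad u s n * (-(Complex.I / 4) * hankelLog l)

/-- `c` is the value at `x ∈ ℂ²` of Green's integral of `u` over the closed lift to the surface,
starting at `s`, of the closed plane contour `γ`.  The logarithm `L` of `k r`, and with it the branch
of the kernel, is continuous and closes up along the contour; the normal points to the right of
the contour, so that `n dl = -i γ' dt`. -/
def IsGreenIntegral (k : ℂ) (u : S → ℂ) {b : ℂ} (γ : Path b b) (s : S) (x : ℂ × ℂ) (c : ℂ) :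
    Prop :=
  ∃ (Γ : Path s s) (l : ℂ) (L : Path l l), (∀ t, X.proj (Γ t) = γ t) ∧
    (∀ t, X.proj (Γ t) ∉ Set.range X.branchPt) ∧
    (∀ t, sqDist x (γ t) ≠ 0) ∧
    (∀ t, Complex.exp (2 * L t) = k ^ 2 * sqDist x (γ t)) ∧
    c = ∫ t in (0 : ℝ)..1,
      X.greenIntegrand u x (Γ.extend t) (L.extend t) (-Complex.I * deriv γ.extend t)

/-- The singular points of the integrand of Green's formula in the real plane: the two real points
associated with `x`, and the branch points. -/
def singularPts (x : ℂ × ℂ) : Set ℂ := {realPt 0 x, realPt 1 x} ∪ Set.range X.branchPt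

/-- `b` sees every singular point along a straight segment, and this segment stays at distance
more than `r` from the other singular points. -/
def IsStarBase (x : ℂ × ℂ) (b : ℂ) (r : ℝ) : Prop :=
  0 < r ∧ ∀ a ∈ X.singularPts x, r < dist b a ∧
    ∀ a' ∈ X.singularPts x, a' ≠ a → ∀ w ∈ segment ℝ b a, r < dist w a'

/-- The plane contours used for the point `x`: the basic contour around `A₁` and `A₂`, and the
double-eight contours based on `A_ℓ` and `P_j`; together with the starting point of their lift. -/
def contour (x : ℂ × ℂ) (b : ℂ) (r : ℝ) :
    Option (Fin 2 × Fin N × X.proj ⁻¹' {b}) → Path b b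
  | none => basicContour b (realPt 0 x) (realPt 1 x) r
  | some (l, j, _) => doubleEight b (realPt l x) (X.branchPt j) r

/-- The starting point of the lift: `s₁` for the basic contour. -/
def liftStart {b : ℂ} (s₁ : X.proj ⁻¹' {b}) :
    Option (Fin 2 × Fin N × X.proj ⁻¹' {b}) → S
  | none => s₁
  | some (_, _, s) => s

/-- The number of basis functions, `Q = M + ∑ j, (M - m_j)`, where `m_j` is the number of points of
the surface over `P_j`. -/
def basisSize : ℕ := M + ∑ j, (M - (X.proj ⁻¹' {X.branchPt j}).ncard)

end SommerfeldSurface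

end

/-! A point x of ℂ² is the same thing as the pair of its associated real points, A₁ = z with z = x₁
+ i x₂, and A₂ = w̄ with w = x₁ - i x₂; it lies off T exactly when neither of them is a branch point
(`notMem_branchLines_iff`). The squared distance from x to a real point ζ factors as (ζ - z)(ζ̄ -
w), and E = J₀(k r) is the Riemann function of ∂∂̄ + κ with κ = k²/4. For a plane solution U,
Riemann's form (E ∂U - U ∂E) dζ + (U ∂̄E - E ∂̄U) dζ̄ is closed in ζ and entire in x. If Ω(x, ·) is
a primitive of it, then (U(z) + Ω(x, z))/2 and (U(w̄) - Ω(x, w̄))/2 are holomorphic in x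
(`analyticOnNhd_halfOne`, `analyticOnNhd_halfTwo`), and at real points they add up to U. So the
complexified field is a sum of two half-solutions h₀ and h₁, of which the first follows A₁ and the
second A₂. They continue independently of each other as A₁ and A₂ move over the surface.

Cut the plane along rays from the branch points, directed away from a base point. The sheets over
the cut plane are labelled by the fibre over the base point, and crossing the j-th cut permutes them
by σ_j. Crossing it turns h_l on the sheet s into h_l on σ_j s plus an entire function, ± half of
the jump of Ω. Put f(s) = h₀(s) + h₁(s), and let D_l(j, s) be h_l(s) - h_l(σ_j s) minus that entire
function (`cross`). Every branch at A is then f(s₀) plus an element of the lattice generated by the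
D_l(j, s) (`exists_isBranch`, `eventuallyEq_of_isBranch`). The D_l(j, s) solve the Helmholtz
equation because each is the difference of two continuations of the same f(s) (`helmholtzOp_cross`).

Two relations reduce the number of generators. First, D₀(j, s) + D₁(j, s) = f(s) - f(σ_j s). Second,
the sum of D_l(j, s) over a σ_j-invariant set of sheets vanishes: by the Meixner condition there are
arbitrarily small circles around P_j with arbitrarily little energy, and the integrals of Riemann's
form over their lifts tend to zero (`sum_jump_eq_zero`). The sheets fall into σ_j-invariant classes,
one for each point of S above P_j (`exists_class`), so one D₀ per such point may be dropped. As S is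
connected, the σ_j act transitively (`eq_univ_of_perm_invariant`), and the D₁ along the M - 1 edges
of a spanning tree, together with f(s₀) and the remaining D₀, recover every f(s) and every D₁. This
gives 1 + (M - 1) + ∑ (M - m_j) = Q generators (`exists_generators`), where m_j is the number of
points above P_j.

It remains to recognise the generators as Green's integrals. The kernel is (l E + R)/(2π), where l
is the logarithm of k r and R is entire in r². Hence Green's form is i l/(2π) times Riemann's form,
plus a regular part, plus simple poles at A₁ and A₂ (`greenForm_eq`). On a circle around one real
point, subtracting an exact form and a pole leaves a bounded closed form with vanishing integral,
and the lasso yields h_l up to a multiple of Ω at the starting point (`lasso_realPt`). The integral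
over a lasso around P_j need not be known: the double-eight runs through it twice in opposite
directions, with values of l that differ by ± π i, so that only half of the integral of Riemann's
form survives. The total is D_l(j, s), while the basic contour gives f(s). -/

noncomputable section

/-! ### Real-linear maps of the plane and closed forms -/

/-- The real-linear map `v ↦ p v + q v̄` of the complex plane. -/
def wirtinger (p q : ℂ) : ℂ →L[ℝ] ℂ :=
  p • ContinuousLinearMap.id ℝ ℂ + q • (Complex.conjCLE : ℂ →L[ℝ] ℂ)

@[simp] lemma wirtinger_apply (p q v : ℂ) : wirtinger p q v = p * v + q * conj v := by
  simp [wirtinger]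

lemma wirtinger_ext {p q p' q' : ℂ} (hp : p = p') (hq : q = q') :
    wirtinger p q = wirtinger p' q' := by rw [hp, hq]

/-- The two coefficients are the Wirtinger derivatives. This is what allows the gradient of the
field to be handled through ∂u and ∂̄u. -/
lemma eq_wirtinger (L : ℂ →L[ℝ] ℂ) :
    L = wirtinger ((L 1 - Complex.I * L Complex.I) / 2) ((L 1 + Complex.I * L Complex.I) / 2) := by
  have key : ∀ v : ℂ, L v = (v.re : ℂ) * L 1 + (v.im : ℂ) * L Complex.I := by
    intro v
    conv_lhs => rw [← Complex.re_add_im v]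
    rw [map_add]
    congr 1
    · simpa using L.map_smul v.re 1
    · simpa using L.map_smul v.im Complex.I
  ext v
  rw [key v, wirtinger_apply]
  conv_rhs => rw [← Complex.re_add_im v]
  simp only [map_add, map_mul, Complex.conj_ofReal, Complex.conj_I]
  linear_combination (v.im : ℂ) * L Complex.I * Complex.I_sq

lemma norm_wirtinger_le (p q : ℂ) : ‖wirtinger p q‖ ≤ ‖p‖ + ‖q‖ := by
  refine ContinuousLinearMap.opNorm_le_bound _ (by positivity) fun v => ?_
  rw [wirtinger_apply]
  refine (norm_add_le _ _).trans ?_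
  simp [add_mul]

lemma HasFDerivAt.wirtinger_mul {f g : ℂ → ℂ} {p q p' q' ζ : ℂ}
    (hf : HasFDerivAt f (wirtinger p q) ζ) (hg : HasFDerivAt g (wirtinger p' q') ζ) :
    HasFDerivAt (fun y => f y * g y)
      (wirtinger (p * g ζ + f ζ * p') (q * g ζ + f ζ * q')) ζ := by
  refine (hf.mul hg).congr_fderiv ?_
  ext v
  simp
  ring

lemma HasFDerivAt.wirtinger_add {f g : ℂ → ℂ} {p q p' q' ζ : ℂ}
    (hf : HasFDerivAt f (wirtinger p q) ζ) (hg : HasFDerivAt g (wirtinger p' q') ζ) :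
    HasFDerivAt (fun y => f y + g y) (wirtinger (p + p') (q + q')) ζ := by
  refine (hf.add hg).congr_fderiv ?_
  ext v
  simp
  ring

lemma HasFDerivAt.wirtinger_sub {f g : ℂ → ℂ} {p q p' q' ζ : ℂ}
    (hf : HasFDerivAt f (wirtinger p q) ζ) (hg : HasFDerivAt g (wirtinger p' q') ζ) :
    HasFDerivAt (fun y => f y - g y) (wirtinger (p - p') (q - q')) ζ := by
  refine (hf.sub hg).congr_fderiv ?_
  ext v
  simp
  ring

lemma HasFDerivAt.wirtinger_const_mul {f : ℂ → ℂ} {p q ζ : ℂ} (c : ℂ)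
    (hf : HasFDerivAt f (wirtinger p q) ζ) :
    HasFDerivAt (fun y => c * f y) (wirtinger (c * p) (c * q)) ζ := by
  refine (hf.const_mul c).congr_fderiv ?_
  ext v
  simp
  ring

lemma HasFDerivAt.wirtinger_comp {f : ℂ → ℂ} {g : ℂ → ℂ} {g' p q ζ : ℂ}
    (hg : HasDerivAt g g' (f ζ)) (hf : HasFDerivAt f (wirtinger p q) ζ) :
    HasFDerivAt (fun y => g (f y)) (wirtinger (g' * p) (g' * q)) ζ := by
  refine ((hg.hasFDerivAt.restrictScalars ℝ).comp ζ hf).congr_fderiv ?_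
  ext v
  simp
  ring

lemma hasFDerivAt_wirtinger_sub_const (z ζ : ℂ) :
    HasFDerivAt (fun y => y - z) (wirtinger 1 0) ζ := by
  refine ((hasFDerivAt_id ζ).sub_const z).congr_fderiv ?_
  ext v
  simp

lemma hasFDerivAt_wirtinger_conj_sub_const (w ζ : ℂ) :
    HasFDerivAt (fun y => conj y - w) (wirtinger 0 1) ζ := by
  refine (((Complex.conjCLE : ℂ →L[ℝ] ℂ).hasFDerivAt).sub_const w).congr_fderiv ?_
  ext v
  simp

/-- The form `P dζ + Q dζ̄` is differentiable and closed on `K`. -/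
def IsClosedForm (P Q : ℂ → ℂ) (K : Set ℂ) : Prop :=
  ∀ ζ ∈ K, ∃ p m q, HasFDerivAt P (wirtinger p m) ζ ∧ HasFDerivAt Q (wirtinger m q) ζ

lemma IsClosedForm.continuousOn_fst {P Q : ℂ → ℂ} {K : Set ℂ} (h : IsClosedForm P Q K) :
    ContinuousOn P K := fun ζ hζ => by
  obtain ⟨p, m, q, h1, h2⟩ := h ζ hζ
  exact h1.continuousAt.continuousWithinAt

lemma IsClosedForm.continuousOn_snd {P Q : ℂ → ℂ} {K : Set ℂ} (h : IsClosedForm P Q K) :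
    ContinuousOn Q K := fun ζ hζ => by
  obtain ⟨p, m, q, h1, h2⟩ := h ζ hζ
  exact h2.continuousAt.continuousWithinAt

/-- The shared coefficient `m`, that is ∂̄P = ∂Q, makes the derivative of the form symmetric.
Homotopy invariance of curve integrals is applied to this symmetric form. -/
lemma IsClosedForm.exists_fderiv {P Q : ℂ → ℂ} {K : Set ℂ} (h : IsClosedForm P Q K) :
    ∃ dω : ℂ → ℂ →L[ℝ] ℂ →L[ℝ] ℂ,
      (∀ ζ ∈ K, HasFDerivAt (fun y => wirtinger (P y) (Q y)) (dω ζ) ζ) ∧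
      ∀ ζ ∈ K, ∀ u v, dω ζ u v = dω ζ v u := by
  choose! p m q hP hQ using h
  refine ⟨fun ζ => (wirtinger (p ζ) (m ζ)).smulRight (ContinuousLinearMap.id ℝ ℂ) +
    (wirtinger (m ζ) (q ζ)).smulRight (Complex.conjCLE : ℂ →L[ℝ] ℂ), fun ζ hζ => ?_, ?_⟩
  · exact ((hP ζ hζ).smul_const _).add ((hQ ζ hζ).smul_const (Complex.conjCLE : ℂ →L[ℝ] ℂ))
  · intro ζ _ u v
    simp
    ring

/-- The primitive of the closed form `P dζ + Q dζ̄` which vanishes at `b`: its integral along the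
segment from `b`. -/
def segPrimitive (P Q : ℂ → ℂ) (b ζ : ℂ) : ℂ :=
  curveIntegral (fun y => wirtinger (P y) (Q y)) (Path.segment b ζ)

lemma segPrimitive_self (P Q : ℂ → ℂ) (b : ℂ) : segPrimitive P Q b b = 0 := by
  simp [segPrimitive]

lemma segPrimitive_eq (P Q : ℂ → ℂ) (b ζ : ℂ) : segPrimitive P Q b ζ =
    ∫ t in (0 : ℝ)..1, (P (b + t * (ζ - b)) * (ζ - b) + Q (b + t * (ζ - b)) * conj (ζ - b)) := by
  rw [segPrimitive, curveIntegral_segment]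
  refine intervalIntegral.integral_congr fun t _ => ?_
  have : AffineMap.lineMap b ζ t = b + t * (ζ - b) := by
    rw [AffineMap.lineMap_apply]; simp; ring
  simp only [this, wirtinger_apply]

-- The integral over the boundary of the triangle b, ζ, y vanishes, so near ζ the primitive differs
-- by a constant from the integral along the segment from ζ.
open unitInterval in
theorem IsClosedForm.hasFDerivAt_segPrimitive {P Q : ℂ → ℂ} {K : Set ℂ} {b ζ : ℂ}
    (h : IsClosedForm P Q K) (hK : IsOpen K) (hs : StarConvex ℝ b K) (hζ : ζ ∈ K) :
    HasFDerivAt (segPrimitive P Q b) (wirtinger (P ζ) (Q ζ)) ζ := by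
  obtain ⟨dω, hω, hsymm⟩ := h.exists_fderiv
  set ω : ℂ → ℂ →L[ℝ] ℂ := fun y => wirtinger (P y) (Q y) with hωdef
  obtain ⟨ε, hε, hball⟩ := Metric.isOpen_iff.1 hK ζ hζ
  have key : ∀ y ∈ Metric.ball ζ ε, curveIntegral ω (.segment b ζ) + curveIntegral ω (.segment ζ y)
      = curveIntegral ω (.segment b y) := by
    intro y hy
    -- The affine homotopy sweeps out the triangle. It stays in `K` because each of its points lies
    -- on a segment from `b` to a point of the ball around ζ.
    set φ := ContinuousMap.Homotopy.affine (Path.segment b ζ : C(I, ℂ)) (Path.segment b y)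
    have hφs : Set.range φ ⊆ K := by
      rw [Set.range_subset_iff]
      rintro ⟨s, t⟩
      have e1 : φ (s, t) = AffineMap.lineMap b (AffineMap.lineMap ζ y (s : ℝ)) (t : ℝ) := by
        simp only [φ, ContinuousMap.Homotopy.affine_apply, AffineMap.lineMap_apply]
        simp [AffineMap.lineMap_apply]
        ring
      rw [e1]
      have hm : AffineMap.lineMap ζ y (s : ℝ) ∈ K :=
        hball ((convex_ball ζ ε).lineMap_mem (Metric.mem_ball_self hε) hy s.2)
      have := hs hm (a := 1 - (t : ℝ)) (b := t) (by linarith [t.2.2]) t.2.1 (by ring)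
      convert this using 1
      rw [AffineMap.lineMap_apply_module]
    have := φ.curveIntegral_add_curveIntegral_eq_of_hasFDerivWithinAt (t := Set.range φ) (ω := ω)
      (dω := dω) ?_ ?_ ?_ ?_ ?_
    · convert! this using 2
      · dsimp [φ]
        rw [← Path.cast_segment (Path.target (Path.segment b ζ)) (Path.target (Path.segment b y)),
          curveIntegral_cast]
      · dsimp [φ]
        rw [← Path.cast_segment (Path.source (Path.segment b ζ)) (Path.source (Path.segment b y)),
          curveIntegral_cast]
        simp
    · intros
      apply Set.mem_range_self
    · exact fun x hx => (hω x (hφs hx)).hasFDerivWithinAt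
    · rw [(isCompact_range <| map_continuous _).isClosed.closure_eq]
      exact fun x hx => (hω x <| hφs hx).continuousAt.continuousWithinAt
    · intro x hx u _ v _
      exact hsymm x (hφs hx) u v
    · have : Set.EqOn (fun x : ℝ × ℝ => Set.IccExtend zero_le_one (φ.extend x.1) x.2)
          (fun x => AffineMap.lineMap (AffineMap.lineMap b ζ x.2) (AffineMap.lineMap b y x.2) x.1)
          (Set.Icc 0 1) := by
        rw [Set.Icc_prod_eq]
        rintro ⟨x, y⟩ ⟨hx, hy⟩
        lift x to I using hx
        lift y to I using hy
        simp [φ]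
      exact .congr (by fun_prop) this
  have hloc : HasFDerivAt (fun y => curveIntegral ω (.segment b ζ) + curveIntegral ω (.segment ζ y))
      (ω ζ) ζ := by
    refine .const_add _ (HasFDerivAt.curveIntegral_segment_source' ?_)
    filter_upwards [hK.mem_nhds hζ] with y hy using (hω y hy).continuousAt
  refine hloc.congr_of_eventuallyEq ?_
  filter_upwards [Metric.ball_mem_nhds ζ hε] with y hy
  rw [key y hy]
  rfl

/-! ### Integrals of closed forms over circles. -/

lemma circleLoop_apply (a p : ℂ) (t : unitInterval) : circleLoop a p t =
    a + (p - a) * Complex.exp (2 * Real.pi * Complex.I * ((t : ℝ) : ℂ)) := rfl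

lemma circleLoop_extend (a p : ℂ) {t : ℝ} (ht : t ∈ Set.Icc (0 : ℝ) 1) :
    (circleLoop a p).extend t = a + (p - a) * Complex.exp (2 * Real.pi * Complex.I * (t : ℂ)) := by
  rw [Path.extend_apply _ ht]; rfl

lemma hasDerivAt_circle_param (a p : ℂ) (t : ℝ) :
    HasDerivAt (fun t : ℝ => a + (p - a) * Complex.exp (2 * Real.pi * Complex.I * (t : ℂ)))
      (2 * Real.pi * Complex.I * ((p - a) * Complex.exp (2 * Real.pi * Complex.I * (t : ℂ))))
      t := by
  have h1 : HasDerivAt (fun t : ℝ => 2 * Real.pi * Complex.I * (t : ℂ))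
      (2 * Real.pi * Complex.I) t := by
    simpa using (Complex.ofRealCLM.hasDerivAt (x := t)).const_mul (2 * Real.pi * Complex.I)
  have h2 := ((h1.cexp).const_mul (p - a)).const_add a
  refine h2.congr_deriv ?_
  ring

lemma deriv_circleLoop_extend (a p : ℂ) {t : ℝ} (ht : t ∈ Set.Ioo (0 : ℝ) 1) :
    deriv (circleLoop a p).extend t =
      2 * Real.pi * Complex.I * ((p - a) * Complex.exp (2 * Real.pi * Complex.I * (t : ℂ))) := by
  refine ((hasDerivAt_circle_param a p t).congr_of_eventuallyEq ?_).deriv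
  filter_upwards [Ioo_mem_nhds ht.1 ht.2] with s hs
  exact circleLoop_extend a p ⟨hs.1.le, hs.2.le⟩

lemma norm_exp_two_pi_mul_I (t : ℝ) : ‖Complex.exp (2 * Real.pi * Complex.I * (t : ℂ))‖ = 1 := by
  have : (2 * Real.pi * Complex.I * (t : ℂ)) = ((2 * Real.pi * t : ℝ) : ℂ) * Complex.I := by
    push_cast; ring
  rw [this, Complex.norm_exp_ofReal_mul_I]

open unitInterval in
/-- The integral of a closed form does not change when a circle is moved. -/
theorem IsClosedForm.curveIntegral_circleLoop_eq {P Q : ℂ → ℂ} {K : Set ℂ} {a p a' p' : ℂ}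
    (h : IsClosedForm P Q K)
    (hK : ∀ s t : I, circleLoop (AffineMap.lineMap a a' (s : ℝ)) (AffineMap.lineMap p p' (s : ℝ)) t
      ∈ K) :
    curveIntegral (fun y => wirtinger (P y) (Q y)) (circleLoop a p) =
      curveIntegral (fun y => wirtinger (P y) (Q y)) (circleLoop a' p') := by
  obtain ⟨dω, hω, hsymm⟩ := h.exists_fderiv
  set ω : ℂ → ℂ →L[ℝ] ℂ := fun y => wirtinger (P y) (Q y) with hωdef
  set φ := ContinuousMap.Homotopy.affine (circleLoop a p : C(I, ℂ)) (circleLoop a' p')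
  have hφ : ∀ s t : I, φ (s, t) = circleLoop (AffineMap.lineMap a a' (s : ℝ))
      (AffineMap.lineMap p p' (s : ℝ)) t := by
    intro s t
    rw [circleLoop_apply (AffineMap.lineMap a a' (s : ℝ))]
    simp only [φ, ContinuousMap.Homotopy.affine_apply, AffineMap.lineMap_apply,
      ContinuousMap.coe_coe, circleLoop_apply]
    simp
    ring
  have hφs : Set.range φ ⊆ K := by
    rw [Set.range_subset_iff]
    rintro ⟨s, t⟩
    rw [hφ]
    exact hK s t
  have := φ.curveIntegral_add_curveIntegral_eq_of_hasFDerivWithinAt (t := Set.range φ) (ω := ω)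
      (dω := dω) ?_ ?_ ?_ ?_ ?_
  -- All intermediate curves are closed, so both ends trace the same path and their contributions
  -- cancel.
  · have e : curveIntegral ω (φ.evalAt 1) = curveIntegral ω (φ.evalAt 0) := by
      rw [curveIntegral_eq_intervalIntegral_deriv, curveIntegral_eq_intervalIntegral_deriv]
      have : (φ.evalAt 1).extend = (φ.evalAt 0).extend := by
        have : (φ.evalAt 1 : I → ℂ) = φ.evalAt 0 := by
          funext s
          have h1 : φ.evalAt 1 s = φ (s, 1) := rfl
          have h2 : φ.evalAt 0 s = φ (s, 0) := rfl
          rw [h1, h2, hφ, hφ]; simp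
        ext s
        exact congr_fun this _
      rw [this]
    rw [e] at this
    exact add_right_cancel this
  · intros
    apply Set.mem_range_self
  · exact fun x hx => (hω x (hφs hx)).hasFDerivWithinAt
  · rw [(isCompact_range <| map_continuous _).isClosed.closure_eq]
    exact fun x hx => (hω x <| hφs hx).continuousAt.continuousWithinAt
  · intro x hx u _ v _
    exact hsymm x (hφs hx) u v
  · have : Set.EqOn (fun x : ℝ × ℝ => Set.IccExtend zero_le_one (φ.extend x.1) x.2)
        (fun x => AffineMap.lineMap
          (a + (p - a) * Complex.exp (2 * Real.pi * Complex.I * ((x.2 : ℝ) : ℂ)))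
          (a' + (p' - a') * Complex.exp (2 * Real.pi * Complex.I * ((x.2 : ℝ) : ℂ))) x.1)
        (Set.Icc 0 1) := by
      rw [Set.Icc_prod_eq]
      rintro ⟨x, y⟩ ⟨hx, hy⟩
      lift x to I using hx
      lift y to I using hy
      simp [φ, circleLoop_apply]
    refine .congr ?_ this
    have h1 : ContDiff ℝ 2 (fun x : ℝ × ℝ => ((x.2 : ℝ) : ℂ)) :=
      Complex.ofRealCLM.contDiff.comp contDiff_snd
    fun_prop

lemma norm_curveIntegral_circleLoop_le {ω : ℂ → ℂ →L[ℝ] ℂ} {a p : ℂ} {C : ℝ}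
    (hC : ∀ t : unitInterval, ‖ω (circleLoop a p t)‖ ≤ C) :
    ‖curveIntegral ω (circleLoop a p)‖ ≤ C * (2 * Real.pi * ‖p - a‖) := by
  rw [curveIntegral_eq_intervalIntegral_deriv]
  have := intervalIntegral.norm_integral_le_of_norm_le_const_ae (a := 0) (b := 1)
    (f := fun t => ω ((circleLoop a p).extend t) (deriv (circleLoop a p).extend t))
    (C := C * (2 * Real.pi * ‖p - a‖)) ?_
  · simpa using this
  have h1 : ∀ᵐ t : ℝ, t ≠ 1 := by simp [ae_iff]
  filter_upwards [h1] with t ht1 ht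
  rw [Set.uIoc_of_le zero_le_one] at ht
  have ht' : t ∈ Set.Ioo (0 : ℝ) 1 := ⟨ht.1, lt_of_le_of_ne ht.2 ht1⟩
  refine (ContinuousLinearMap.le_opNorm _ _).trans ?_
  rw [deriv_circleLoop_extend a p ht']
  have e : ‖2 * Real.pi * Complex.I * ((p - a) * Complex.exp (2 * Real.pi * Complex.I * (t : ℂ)))‖
      = 2 * Real.pi * ‖p - a‖ := by
    rw [norm_mul, norm_mul (p - a), norm_exp_two_pi_mul_I]
    simp [abs_of_pos Real.pi_pos]
  rw [e]
  gcongr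
  rw [Path.extend_apply _ ⟨ht.1.le, ht.2⟩]
  exact hC _

/-- A bounded closed form on a punctured disc has vanishing integral along circles around the
puncture. -/
theorem IsClosedForm.curveIntegral_circleLoop_eq_zero {P Q : ℂ → ℂ} {a p z : ℂ} {C : ℝ}
    (h : IsClosedForm P Q (Metric.closedBall a ‖p - a‖ \ {z})) (hz : z ∈ Metric.ball a ‖p - a‖)
    (hC : ∀ ζ ∈ Metric.closedBall a ‖p - a‖ \ {z}, ‖P ζ‖ + ‖Q ζ‖ ≤ C) :
    curveIntegral (fun y => wirtinger (P y) (Q y)) (circleLoop a p) = 0 := by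
  have hne : ∀ t : unitInterval, circleLoop a p t ≠ z := by
    intro t ht
    rw [← ht, mem_ball_iff_norm, circleLoop_apply] at hz
    simp [norm_exp_two_pi_mul_I] at hz
  -- The circle is shrunk by the homothety with centre `z` and ratio ρ. It stays in the disc by
  -- convexity and never meets `z`; its length is proportional to ρ while the form is bounded.
  have hmem : ∀ ρ : ℝ, 0 < ρ → ρ ≤ 1 → ∀ t,
      circleLoop (z + ρ * (a - z)) (z + ρ * (p - z)) t ∈ Metric.closedBall a ‖p - a‖ \ {z} := by
    intro ρ hρ hρ1 t
    have e : circleLoop (z + ρ * (a - z)) (z + ρ * (p - z)) t = z + ρ * (circleLoop a p t - z) := by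
      simp only [circleLoop_apply]; ring
    rw [e]
    refine ⟨?_, ?_⟩
    · have h1 : circleLoop a p t ∈ Metric.closedBall a ‖p - a‖ := by
        rw [mem_closedBall_iff_norm, circleLoop_apply]
        simp [norm_exp_two_pi_mul_I]
      have := (convex_closedBall a ‖p - a‖).add_smul_sub_mem (Metric.ball_subset_closedBall hz) h1
        (t := ρ) ⟨hρ.le, hρ1⟩
      simpa using this
    · simp only [Set.mem_singleton_iff, add_eq_left, mul_eq_zero, not_or]
      exact ⟨by exact_mod_cast hρ.ne', sub_ne_zero.2 (hne t)⟩
  have key : ∀ ρ : ℝ, 0 < ρ → ρ ≤ 1 →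
      ‖curveIntegral (fun y => wirtinger (P y) (Q y)) (circleLoop a p)‖ ≤
        ρ * (C * (2 * Real.pi * ‖p - a‖)) := by
    intro ρ hρ hρ1
    rw [h.curveIntegral_circleLoop_eq (a' := z + ρ * (a - z)) (p' := z + ρ * (p - z))]
    · refine (norm_curveIntegral_circleLoop_le (C := C) fun t => ?_).trans ?_
      · exact (norm_wirtinger_le _ _).trans (hC _ (hmem ρ hρ hρ1 t))
      · have : z + ρ * (p - z) - (z + ρ * (a - z)) = ρ * (p - a) := by ring
        rw [this, norm_mul, Complex.norm_real, Real.norm_of_nonneg hρ.le]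
        exact le_of_eq (by ring)
    · intro s t
      -- The straight homotopy between the two circles consists of homothetic images with these
      -- ratios.
      have := hmem (1 - s + s * ρ) ?_ ?_ t
      · convert this using 3 <;> (simp [AffineMap.lineMap_apply]; ring)
      · rcases eq_or_lt_of_le s.2.2 with h1 | h1
        · rw [h1]; linarith
        · have := mul_nonneg s.2.1 hρ.le
          linarith
      · nlinarith [s.2.1, s.2.2]
  refine norm_le_zero_iff.1 (ge_of_tendsto (x := 𝓝[>] (0 : ℝ))
    (f := fun ρ : ℝ => ρ * (C * (2 * Real.pi * ‖p - a‖))) ?_ ?_)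
  · have : ContinuousAt (fun ρ : ℝ => ρ * (C * (2 * Real.pi * ‖p - a‖))) 0 := by fun_prop
    simpa [ContinuousAt] using this.mono_left nhdsWithin_le_nhds
  · filter_upwards [Ioc_mem_nhdsGT (zero_lt_one' ℝ)] with ρ hρ using key ρ hρ.1 hρ.2

/-! ### Holomorphic functions of two variables -/

/-- The Cauchy integral over the sphere, as a linear functional on continuous functions. -/
def circleIntegralCLM (c : ℂ) {r : ℝ} (hr : 0 ≤ r) : C(Metric.sphere c r, ℂ) →L[ℂ] ℂ :=
  LinearMap.mkContinuous
    { toFun := fun h => ∫ θ in (0 : ℝ)..2 * Real.pi,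
        deriv (circleMap c r) θ * h ⟨circleMap c r θ, circleMap_mem_sphere c hr θ⟩
      map_add' := fun h h' => by
        have hc : Continuous fun θ : ℝ => (⟨circleMap c r θ, circleMap_mem_sphere c hr θ⟩ :
            Metric.sphere c r) := by fun_prop
        simp only [ContinuousMap.add_apply, mul_add]
        refine intervalIntegral.integral_add ?_ ?_
        all_goals
          refine Continuous.intervalIntegrable ?_ _ _
          simp only [deriv_circleMap]
          fun_prop
      map_smul' := fun a h => by
        simp only [ContinuousMap.smul_apply, smul_eq_mul, RingHom.id_apply]
        rw [← intervalIntegral.integral_const_mul]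
        congr 1
        ext θ
        ring }
    (r * (2 * Real.pi)) fun h => by
      refine (intervalIntegral.norm_integral_le_of_norm_le_const (C := r * ‖h‖) fun θ _ => ?_).trans
        ?_
      · rw [norm_mul]
        simp only [deriv_circleMap, norm_mul, Complex.norm_I, mul_one, norm_circleMap_zero,
          abs_of_nonneg hr]
        gcongr
        exact h.norm_coe_le_norm _
      · rw [sub_zero, abs_of_pos Real.two_pi_pos]
        exact le_of_eq (by ring)

lemma circleIntegralCLM_apply (c : ℂ) {r : ℝ} (hr : 0 ≤ r) (h : C(Metric.sphere c r, ℂ))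
    (g : ℂ → ℂ) (hg : ∀ y : Metric.sphere c r, g y = h y) :
    circleIntegralCLM c hr h = ∮ y in C(c, r), g y := by
  rw [circleIntegral]
  change (∫ θ in (0 : ℝ)..2 * Real.pi, _) = _
  congr 1
  ext θ
  rw [smul_eq_mul, ← hg]

/-- A holomorphic function of two variables is analytic. -/
theorem DifferentiableOn.analyticOnNhd_prod {f : ℂ × ℂ → ℂ} {s : Set (ℂ × ℂ)}
    (hf : DifferentiableOn ℂ f s) (hs : IsOpen s) : AnalyticOnNhd ℂ f s := by
  rintro ⟨z₀, w₀⟩ h₀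
  obtain ⟨r, hr, hball⟩ : ∃ r > 0,
      Metric.closedBall z₀ r ×ˢ Metric.closedBall w₀ r ⊆ s := by
    obtain ⟨ε, hε, h⟩ := Metric.isOpen_iff.1 hs _ h₀
    refine ⟨ε / 2, half_pos hε, fun x hx => h ?_⟩
    rw [Set.mem_prod, Metric.mem_closedBall, Metric.mem_closedBall] at hx
    rw [Metric.mem_ball, Prod.dist_eq]
    exact max_lt (hx.1.trans_lt (half_lt_self hε)) (hx.2.trans_lt (half_lt_self hε))
  set K := Metric.sphere z₀ r
  set L := Metric.sphere w₀ r
  have hcont : ContinuousOn f s := hf.continuousOn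
  have hKL : ∀ p : K × L, ((p.1 : ℂ), (p.2 : ℂ)) ∈ s := fun p =>
    hball ⟨Metric.sphere_subset_closedBall p.1.2, Metric.sphere_subset_closedBall p.2.2⟩
  -- Cauchy's formula in the first variable is applied with values in the Banach algebra C(L, ℂ), so
  -- that the one-variable theory yields a power series in that variable.
  let g : C(K, C(L, ℂ)) := ContinuousMap.curry ⟨fun p : K × L => f (p.1, p.2),
    hcont.comp_continuous (by fun_prop) hKL⟩
  classical
  let F : ℂ → C(L, ℂ) := fun ζ => if h : ζ ∈ K then g ⟨ζ, h⟩ else 0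
  have hF : ContinuousOn F K := by
    rw [continuousOn_iff_continuous_domRestrict]
    convert g.continuous using 1
    ext1 ζ
    simp [F, Set.domRestrict]
  have hFi : CircleIntegrable F z₀ r := hF.circleIntegrable hr.le
  let G : ℂ → C(L, ℂ) := fun z => (2 * Real.pi * Complex.I : ℂ)⁻¹ • ∮ ζ in C(z₀, r),
    (ζ - z)⁻¹ • F ζ
  have hG : AnalyticAt ℂ G z₀ :=
    (hasFPowerSeriesOn_cauchy_integral (R := ⟨r, hr.le⟩) hFi hr).analyticAt
  let c : C(L, ℂ) := ⟨fun y => (y : ℂ), continuous_subtype_val⟩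
  have hunit : ∀ w ∈ Metric.ball w₀ r, IsUnit (c - algebraMap ℂ C(L, ℂ) w) := by
    intro w hw
    rw [ContinuousMap.isUnit_iff_forall_ne_zero]
    intro y hy
    have hy' : (y : ℂ) = w := by simpa [c, sub_eq_zero] using hy
    have h1 := y.2
    rw [hy'] at h1
    rw [Metric.mem_ball] at hw
    exact hw.ne (Metric.mem_sphere.1 h1)
  -- The Cauchy kernel in the second variable is an inverse in the Banach algebra, hence analytic in
  -- `w`. Multiplying by it and applying the circle functional gives the double Cauchy integral.
  let Φ : ℂ → C(L, ℂ) := fun w => Ring.inverse (c - algebraMap ℂ C(L, ℂ) w)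
  have hΦ : AnalyticAt ℂ Φ w₀ := by
    obtain ⟨v, hv⟩ := hunit w₀ (Metric.mem_ball_self hr)
    have h1 : AnalyticAt ℂ (Ring.inverse : C(L, ℂ) → C(L, ℂ)) (c - algebraMap ℂ C(L, ℂ) w₀) := by
      rw [← hv]; exact analyticAt_inverse v
    have h2 : AnalyticAt ℂ (fun w => c - algebraMap ℂ C(L, ℂ) w) w₀ :=
      analyticAt_const.sub ((Algebra.linearMap ℂ C(L, ℂ)).toContinuousLinearMap.analyticAt w₀)
    exact AnalyticAt.comp (g := Ring.inverse) h1 h2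
  have hΦval : ∀ w ∈ Metric.ball w₀ r, ∀ y : L, Φ w y = ((y : ℂ) - w)⁻¹ := by
    intro w hw y
    have h1 := Ring.mul_inverse_cancel _ (hunit w hw)
    have h2 := congr_fun (congr_arg DFunLike.coe h1) y
    have h3 : ((y : ℂ) - w) * Φ w y = 1 := by simpa [c] using h2
    exact eq_inv_of_mul_eq_one_right h3
  have hH : AnalyticAt ℂ (fun x : ℂ × ℂ => (2 * Real.pi * Complex.I : ℂ)⁻¹ *
      circleIntegralCLM w₀ hr.le (Φ x.2 * G x.1)) (z₀, w₀) := by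
    have h1 : AnalyticAt ℂ (fun x : ℂ × ℂ => Φ x.2) (z₀, w₀) :=
      AnalyticAt.comp (g := Φ) (f := Prod.snd) (x := (z₀, w₀)) hΦ analyticAt_snd
    have h2 : AnalyticAt ℂ (fun x : ℂ × ℂ => G x.1) (z₀, w₀) :=
      AnalyticAt.comp (g := G) (f := Prod.fst) (x := (z₀, w₀)) hG analyticAt_fst
    have h3 : AnalyticAt ℂ (fun x : ℂ × ℂ => Φ x.2 * G x.1) (z₀, w₀) := h1.mul h2
    exact analyticAt_const.mul
      (((circleIntegralCLM w₀ hr.le).analyticAt _).comp (f := fun x : ℂ × ℂ => Φ x.2 * G x.1) h3)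
  refine hH.congr ?_
  filter_upwards [prod_mem_nhds (Metric.ball_mem_nhds z₀ hr) (Metric.ball_mem_nhds w₀ hr)]
    with x hx
  have hGval : ∀ y : L, G x.1 y = f (x.1, y) := by
    intro y
    have h1 : DifferentiableOn ℂ (fun ζ => f (ζ, y)) (Metric.closedBall z₀ r) := by
      refine hf.comp (by fun_prop) fun ζ hζ => hball ⟨hζ, Metric.sphere_subset_closedBall y.2⟩
    have h2 := (h1.diffContOnCl_ball subset_rfl).two_pi_i_inv_smul_circleIntegral_sub_inv_smul hx.1
    rw [← h2]
    have h3 : (∮ ζ in C(z₀, r), (ζ - x.1)⁻¹ • F ζ) y = ∮ ζ in C(z₀, r), (ζ - x.1)⁻¹ • f (ζ, y) := by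
      rw [circleIntegral, circleIntegral]
      have hint : CircleIntegrable (fun ζ => (ζ - x.1)⁻¹ • F ζ) z₀ r := by
        refine ContinuousOn.circleIntegrable hr.le (ContinuousOn.smul (ContinuousOn.inv₀
          (f := fun ζ => ζ - x.1) (by fun_prop) fun ζ hζ h => ?_) hF)
        rw [sub_eq_zero] at h
        rw [h] at hζ
        exact (Metric.mem_ball.1 hx.1).ne (Metric.mem_sphere.1 hζ)
      have := (ContinuousMap.evalCLM ℂ y : C(L, ℂ) →L[ℂ] ℂ).intervalIntegral_comp_comm hint.out
      refine Eq.trans this.symm ?_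
      congr 1
      ext θ
      have hθ : circleMap z₀ r θ ∈ K := circleMap_mem_sphere z₀ hr.le θ
      simp [F, g, hθ]
    simp only [G, ContinuousMap.smul_apply, h3]
  have h1 : DifferentiableOn ℂ (fun y => f (x.1, y)) (Metric.closedBall w₀ r) := by
    refine hf.comp (by fun_prop) fun y hy => hball ⟨Metric.ball_subset_closedBall hx.1, hy⟩
  have h2 := (h1.diffContOnCl_ball subset_rfl).two_pi_i_inv_smul_circleIntegral_sub_inv_smul hx.2
  rw [circleIntegralCLM_apply w₀ hr.le _ (fun y => (y - x.2)⁻¹ • f (x.1, y)) fun y => ?_]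
  · exact h2
  · simp [hΦval x.2 hx.2, hGval]

/-- Differentiation under the integral sign over `[0, 1]`. -/
theorem hasFDerivAt_integral_of_continuousOn {E : Type*} [NormedAddCommGroup E] [NormedSpace ℂ E]
    [ProperSpace E] {f : E → ℝ → ℂ} {f' : E → ℝ → E →L[ℂ] ℂ} {s : Set E} (hs : IsOpen s)
    (hf : ∀ x ∈ s, ContinuousOn (f x) (Set.Icc 0 1))
    (hf' : ContinuousOn (fun p : E × ℝ => f' p.1 p.2) (s ×ˢ Set.Icc 0 1))
    (hd : ∀ x ∈ s, ∀ t ∈ Set.Icc (0 : ℝ) 1, HasFDerivAt (fun y => f y t) (f' x t) x)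
    {x₀ : E} (hx₀ : x₀ ∈ s) :
    HasFDerivAt (fun x => ∫ t in (0 : ℝ)..1, f x t) (∫ t in (0 : ℝ)..1, f' x₀ t) x₀ := by
  obtain ⟨ε, hε, hball⟩ := Metric.nhds_basis_closedBall.mem_iff.1 (hs.mem_nhds hx₀)
  obtain ⟨C, hC⟩ := ((isCompact_closedBall x₀ ε).prod isCompact_Icc).exists_bound_of_continuousOn
    (hf'.mono (Set.prod_mono hball subset_rfl))
  have hI : Set.uIoc (0 : ℝ) 1 ⊆ Set.Icc 0 1 := by
    rw [Set.uIoc_of_le zero_le_one]; exact Set.Ioc_subset_Icc_self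
  refine intervalIntegral.hasFDerivAt_integral_of_dominated_of_fderiv_le (𝕜 := ℂ)
    (bound := fun _ => C) (Metric.closedBall_mem_nhds x₀ hε) ?_ ?_ ?_ ?_ ?_ ?_
  · filter_upwards [hs.mem_nhds hx₀] with x hx
    exact ((hf x hx).mono hI).aestronglyMeasurable measurableSet_uIoc
  · exact ContinuousOn.intervalIntegrable_of_Icc zero_le_one (hf x₀ hx₀)
  · refine ContinuousOn.aestronglyMeasurable ?_ measurableSet_uIoc
    exact hf'.comp (f := fun t : ℝ => (x₀, t)) (by fun_prop) fun t ht => ⟨hx₀, hI ht⟩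
  · refine ae_of_all _ fun t ht x hx => ?_
    exact hC (x, t) ⟨hx, hI ht⟩
  · exact intervalIntegrable_const
  · exact ae_of_all _ fun t ht x hx => hd x (hball hx) t (hI ht)

lemma AnalyticOnNhd.eq_zero_of_eventually_real {f : ℂ → ℂ} {a : ℝ} {r : ℝ}
    (hf : AnalyticOnNhd ℂ f (Metric.ball (a : ℂ) r)) (h : ∀ᶠ t : ℝ in 𝓝 a, f t = 0) (hr : 0 < r) :
    Set.EqOn f 0 (Metric.ball (a : ℂ) r) := by
  refine hf.eqOn_zero_of_preconnected_of_frequently_eq_zero (convex_ball _ _).isPreconnected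
    (Metric.mem_ball_self hr) ?_
  have h1 : Tendsto (fun t : ℝ => (t : ℂ)) (𝓝[≠] a) (𝓝[≠] (a : ℂ)) := by
    refine tendsto_nhdsWithin_of_tendsto_nhds_of_eventually_within _
      (Complex.continuous_ofReal.continuousAt.tendsto.mono_left nhdsWithin_le_nhds) ?_
    filter_upwards [self_mem_nhdsWithin] with t ht
    simpa using ht
  exact h1.frequently (h.filter_mono nhdsWithin_le_nhds).frequently

/-- An analytic function which vanishes on the real plane near a real point vanishes near that
point. -/
theorem AnalyticAt.eventually_eq_zero_of_real {v : ℂ × ℂ → ℂ} {p : ℂ}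
    (hv : AnalyticAt ℂ v (toC2 p)) (h : ∀ᶠ z in 𝓝 p, v (toC2 z) = 0) :
    v =ᶠ[𝓝 (toC2 p)] 0 := by
  obtain ⟨r, hr, hball⟩ := Metric.eventually_nhds_iff_ball.1 hv.eventually_analyticAt
  have hc : ContinuousAt (fun q : ℝ × ℝ => (⟨q.1, q.2⟩ : ℂ)) (p.re, p.im) :=
    (Complex.equivRealProdCLM.symm.continuous).continuousAt
  have h' : ∀ᶠ q : ℝ × ℝ in 𝓝 (p.re, p.im), v ((q.1 : ℂ), (q.2 : ℂ)) = 0 := hc.eventually h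
  rw [nhds_prod_eq] at h'
  have hsw : ∀ᶠ b : ℝ in 𝓝 p.im, ∀ᶠ a : ℝ in 𝓝 p.re, v ((a : ℂ), (b : ℂ)) = 0 :=
    (Filter.eventually_swap_iff.1 h').curry
  have hmem : ∀ t s : ℂ, t ∈ Metric.ball (p.re : ℂ) r → s ∈ Metric.ball (p.im : ℂ) r →
      AnalyticAt ℂ v (t, s) := fun t s ht hs => hball _ (by
    rw [Metric.mem_ball, Prod.dist_eq]; exact max_lt ht hs)
  -- The variables are complexified one after the other: first the identity theorem in the first
  -- variable for real values of the second, then in the second variable.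
  have h1 : ∀ᶠ b : ℝ in 𝓝 p.im, ∀ t ∈ Metric.ball (p.re : ℂ) r, v (t, b) = 0 := by
    have hb : ∀ᶠ b : ℝ in 𝓝 p.im, (b : ℂ) ∈ Metric.ball (p.im : ℂ) r :=
      Complex.continuous_ofReal.continuousAt.eventually (Metric.ball_mem_nhds _ hr)
    filter_upwards [hsw, hb] with b hb1 hb2 t ht
    refine AnalyticOnNhd.eq_zero_of_eventually_real (f := fun t => v (t, b)) ?_ hb1 hr ht
    exact fun t ht => (hmem t b ht hb2).along_fst
  filter_upwards [Metric.ball_mem_nhds (toC2 p) hr] with x hx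
  rw [Metric.mem_ball, Prod.dist_eq, max_lt_iff] at hx
  refine AnalyticOnNhd.eq_zero_of_eventually_real (f := fun s => v (x.1, s)) (a := p.im) ?_ ?_ hr
    hx.2
  · exact fun s hs => (hmem x.1 s hx.1 hs).along_snd
  · filter_upwards [h1] with b hb using hb x.1 hx.1

/-! ### Bessel functions as entire functions of the squared distance -/

/-- The sum of a power series. -/
def entireSeries (c : ℕ → ℂ) (q : ℂ) : ℂ := ∑' m, c m * q ^ m

/-- The coefficients of the derivative of a power series. -/
def derivCoeff (c : ℕ → ℂ) (m : ℕ) : ℂ := (m + 1) * c (m + 1)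

/-- Coefficients which decrease like those of the exponential series. -/
def ExpBounded (c : ℕ → ℂ) : Prop :=
  ∃ B C : ℝ, 0 ≤ B ∧ 0 ≤ C ∧ ∀ m, ‖c m‖ ≤ B * (C ^ m / m.factorial)

lemma ExpBounded.derivCoeff {c : ℕ → ℂ} (h : ExpBounded c) : ExpBounded (derivCoeff c) := by
  obtain ⟨B, C, hB, hC, h⟩ := h
  refine ⟨B * C, C, by positivity, hC, fun m => ?_⟩
  have h1 : ‖_root_.derivCoeff c m‖ = (m + 1) * ‖c (m + 1)‖ := by
    rw [_root_.derivCoeff, norm_mul]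
    congr 1
    exact_mod_cast Complex.norm_natCast (m + 1)
  rw [h1]
  refine (mul_le_mul_of_nonneg_left (h (m + 1)) (by positivity)).trans (le_of_eq ?_)
  rw [Nat.factorial_succ]
  push_cast
  field_simp
  ring

lemma ExpBounded.summable_norm {c : ℕ → ℂ} (h : ExpBounded c) (q : ℂ) :
    Summable fun m => ‖c m * q ^ m‖ := by
  obtain ⟨B, C, hB, hC, h⟩ := h
  refine Summable.of_nonneg_of_le (fun _ => norm_nonneg _) (fun m => ?_)
    ((Real.summable_pow_div_factorial (C * ‖q‖)).mul_left B)
  rw [norm_mul, norm_pow]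
  refine (mul_le_mul_of_nonneg_right (h m) (by positivity)).trans (le_of_eq ?_)
  rw [mul_pow]
  ring

lemma ExpBounded.summable {c : ℕ → ℂ} (h : ExpBounded c) (q : ℂ) :
    Summable fun m => c m * q ^ m := (h.summable_norm q).of_norm

lemma ExpBounded.hasDerivAt {c : ℕ → ℂ} (h : ExpBounded c) (q : ℂ) :
    HasDerivAt (entireSeries c) (entireSeries (_root_.derivCoeff c) q) q := by
  set R : ℝ := ‖q‖ + 1
  have hR : 0 ≤ R := by positivity
  have hs := h.derivCoeff.summable_norm (R : ℂ)
  have hu : Summable fun m : ℕ => ‖(m : ℂ) * c m * (R : ℂ) ^ (m - 1)‖ := by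
    rw [← summable_nat_add_iff 1]
    refine hs.congr fun m => ?_
    simp [_root_.derivCoeff]
  have key := hasDerivAt_tsum_of_isPreconnected (g := fun m q => c m * q ^ m)
    (g' := fun m q => (m : ℂ) * c m * q ^ (m - 1)) (t := Metric.ball 0 R) (y₀ := 0) (y := q)
    hu Metric.isOpen_ball (convex_ball _ _).isPreconnected ?_ ?_ ?_ (h.summable 0) ?_
  · refine key.congr_deriv ?_
    rw [Summable.tsum_eq_zero_add]
    · simp [entireSeries, _root_.derivCoeff]
    · refine Summable.of_norm_bounded hu fun m => ?_
      simp only [norm_mul, norm_pow, Complex.norm_real, Real.norm_of_nonneg hR]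
      gcongr
      linarith
  · intro m y _
    refine ((hasDerivAt_pow m y).const_mul (c m)).congr_deriv ?_
    ring
  · intro m y hy
    simp only [norm_mul, norm_pow, Complex.norm_real, Real.norm_of_nonneg hR]
    gcongr
    simpa using (Metric.mem_ball.1 hy).le
  · exact Metric.mem_ball_self (by positivity)
  · simp [R]

lemma ExpBounded.differentiable {c : ℕ → ℂ} (h : ExpBounded c) :
    Differentiable ℂ (entireSeries c) := fun q => (h.hasDerivAt q).differentiableAt

lemma ExpBounded.continuous {c : ℕ → ℂ} (h : ExpBounded c) : Continuous (entireSeries c) :=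
  h.differentiable.continuous

lemma entireSeries_zero (c : ℕ → ℂ) : entireSeries c 0 = c 0 := by
  rw [entireSeries, tsum_eq_single 0]
  · simp
  · intro m hm
    simp [hm]

/-- The operator q d²/dq² + d/dq maps q^(m+1) to (m+1)² q^m, so the differential equations below
become two-term recursions. -/
lemma ExpBounded.bessel_operator {c : ℕ → ℂ} (h : ExpBounded c) (q : ℂ) :
    q * entireSeries (_root_.derivCoeff (_root_.derivCoeff c)) q +
      entireSeries (_root_.derivCoeff c) q =
      ∑' m : ℕ, ((m : ℂ) + 1) ^ 2 * c (m + 1) * q ^ m := by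
  have h1 := h.derivCoeff.derivCoeff.summable q
  have e1 : q * entireSeries (_root_.derivCoeff (_root_.derivCoeff c)) q =
      ∑' m : ℕ, ((m : ℂ) * (m + 1) * c (m + 1)) * q ^ m := by
    rw [Summable.tsum_eq_zero_add, entireSeries, ← tsum_mul_left]
    · simp only [Nat.cast_zero, zero_mul, zero_add]
      congr 1
      ext m
      simp only [_root_.derivCoeff]
      push_cast
      ring
    · rw [← summable_nat_add_iff 1]
      refine (h1.mul_left q).congr fun m => ?_
      simp only [_root_.derivCoeff]
      push_cast
      ring
  rw [e1, entireSeries, ← Summable.tsum_add]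
  · congr 1
    ext m
    simp only [_root_.derivCoeff]
    ring
  · rw [← summable_nat_add_iff 1]
    refine (h1.mul_left q).congr fun m => ?_
    simp only [_root_.derivCoeff]
    push_cast
    ring
  · exact h.derivCoeff.summable q

/-- The coefficients of `J₀(k √q)` as a power series in `q`, with `κ = k² / 4`. -/
def besselCoeff (κ : ℂ) (m : ℕ) : ℂ := (-κ) ^ m / (m.factorial : ℂ) ^ 2

/-- The coefficients of the regular part of `2 π G` as a power series in `q`. -/
def regularCoeff (κ : ℂ) (m : ℕ) : ℂ :=
  (Real.eulerMascheroniConstant - Real.log 2 - Complex.I * Real.pi / 2 - (harmonic m : ℂ)) *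
    besselCoeff κ m

lemma norm_besselCoeff (κ : ℂ) (m : ℕ) :
    ‖besselCoeff κ m‖ = ‖κ‖ ^ m / (m.factorial : ℝ) ^ 2 := by
  simp [besselCoeff]

lemma expBounded_besselCoeff (κ : ℂ) : ExpBounded (besselCoeff κ) := by
  refine ⟨1, ‖κ‖, zero_le_one, norm_nonneg _, fun m => ?_⟩
  rw [norm_besselCoeff, one_mul]
  have h1 : (1 : ℝ) ≤ m.factorial := by exact_mod_cast m.factorial_pos
  gcongr
  nlinarith

lemma harmonic_le_factorial (m : ℕ) : (harmonic m : ℚ) ≤ m.factorial := by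
  have h1 : harmonic m ≤ m := by
    rw [harmonic]
    refine (Finset.sum_le_card_nsmul _ _ 1 fun i _ => ?_).trans (by simp)
    refine inv_le_one_of_one_le₀ ?_
    exact_mod_cast Nat.succ_le_succ (Nat.zero_le i)
  exact h1.trans (by exact_mod_cast m.self_le_factorial)

/-- One of the two factorials in the denominator absorbs the harmonic number, and the other is left
for the exponential bound. -/
lemma expBounded_regularCoeff (κ : ℂ) : ExpBounded (regularCoeff κ) := by
  set a : ℂ := Real.eulerMascheroniConstant - Real.log 2 - Complex.I * Real.pi / 2
  refine ⟨‖a‖ + 1, ‖κ‖, by positivity, norm_nonneg _, fun m => ?_⟩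
  rw [regularCoeff, norm_mul, norm_besselCoeff]
  have h1 : (1 : ℝ) ≤ m.factorial := by exact_mod_cast m.factorial_pos
  have h0 : 0 ≤ harmonic m := Finset.sum_nonneg fun i _ => by positivity
  have h2 : ‖(harmonic m : ℂ)‖ ≤ m.factorial := by
    rw [Complex.norm_ratCast, abs_of_nonneg (by exact_mod_cast h0)]
    exact_mod_cast harmonic_le_factorial m
  have h3 : ‖a - (harmonic m : ℂ)‖ ≤ (‖a‖ + 1) * m.factorial := by
    refine (norm_sub_le _ _).trans ?_
    nlinarith [norm_nonneg a]
  refine (mul_le_mul_of_nonneg_right h3 (by positivity)).trans (le_of_eq ?_)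
  field_simp

lemma besselCoeff_succ (κ : ℂ) (m : ℕ) :
    ((m : ℂ) + 1) ^ 2 * besselCoeff κ (m + 1) = -κ * besselCoeff κ m := by
  have h1 : ((m : ℂ) + 1) ≠ 0 := by exact_mod_cast Nat.succ_ne_zero m
  have h2 : (m.factorial : ℂ) ≠ 0 := by exact_mod_cast m.factorial_ne_zero
  rw [besselCoeff, besselCoeff, Nat.factorial_succ]
  push_cast
  field_simp
  ring

/-- `J₀(k √q)` as a function of `q`, with `κ = k² / 4`, and its first two derivatives. -/
def besselE (κ : ℂ) : ℂ → ℂ := entireSeries (besselCoeff κ)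
/-- The derivative of `besselE`. -/
def besselE' (κ : ℂ) : ℂ → ℂ := entireSeries (derivCoeff (besselCoeff κ))
/-- The second derivative of `besselE`. -/
def besselE'' (κ : ℂ) : ℂ → ℂ := entireSeries (derivCoeff (derivCoeff (besselCoeff κ)))
/-- The regular part of `2 π G` as a function of `q`. -/
def regularM (κ : ℂ) : ℂ → ℂ := entireSeries (regularCoeff κ)
/-- The derivative of `regularM`. -/
def regularM' (κ : ℂ) : ℂ → ℂ := entireSeries (derivCoeff (regularCoeff κ))
/-- The second derivative of `regularM`. -/
def regularM'' (κ : ℂ) : ℂ → ℂ := entireSeries (derivCoeff (derivCoeff (regularCoeff κ)))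

lemma hasDerivAt_besselE (κ q : ℂ) : HasDerivAt (besselE κ) (besselE' κ q) q :=
  (expBounded_besselCoeff κ).hasDerivAt q
lemma hasDerivAt_besselE' (κ q : ℂ) : HasDerivAt (besselE' κ) (besselE'' κ q) q :=
  (expBounded_besselCoeff κ).derivCoeff.hasDerivAt q
lemma hasDerivAt_regularM (κ q : ℂ) : HasDerivAt (regularM κ) (regularM' κ q) q :=
  (expBounded_regularCoeff κ).hasDerivAt q
lemma hasDerivAt_regularM' (κ q : ℂ) : HasDerivAt (regularM' κ) (regularM'' κ q) q :=
  (expBounded_regularCoeff κ).derivCoeff.hasDerivAt q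

@[fun_prop] lemma continuous_besselE (κ : ℂ) : Continuous (besselE κ) :=
  (expBounded_besselCoeff κ).continuous
@[fun_prop] lemma continuous_besselE' (κ : ℂ) : Continuous (besselE' κ) :=
  (expBounded_besselCoeff κ).derivCoeff.continuous
@[fun_prop] lemma continuous_besselE'' (κ : ℂ) : Continuous (besselE'' κ) :=
  (expBounded_besselCoeff κ).derivCoeff.derivCoeff.continuous
@[fun_prop] lemma continuous_regularM (κ : ℂ) : Continuous (regularM κ) :=
  (expBounded_regularCoeff κ).continuous
@[fun_prop] lemma continuous_regularM' (κ : ℂ) : Continuous (regularM' κ) :=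
  (expBounded_regularCoeff κ).derivCoeff.continuous

lemma besselE_zero (κ : ℂ) : besselE κ 0 = 1 := by
  simp [besselE, entireSeries_zero, besselCoeff]

/-- With q = αβ, the operator q d²/dq² + d/dq is ∂²/∂α∂β. This is therefore the equation ∂∂̄E = -κE
of the Riemann function in characteristic coordinates. -/
lemma besselE_ode (κ q : ℂ) : q * besselE'' κ q + besselE' κ q + κ * besselE κ q = 0 := by
  have h := (expBounded_besselCoeff κ).bessel_operator q
  rw [besselE'', besselE', h, besselE, entireSeries, ← tsum_mul_left, ← Summable.tsum_add]
  · rw [← tsum_zero (β := ℕ)]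
    congr 1
    ext m
    rw [besselCoeff_succ]
    ring
  · simp only [besselCoeff_succ]
    exact (((expBounded_besselCoeff κ).summable q).mul_left (-κ)).congr fun m => by ring
  · exact ((expBounded_besselCoeff κ).summable q).mul_left κ

/-- Applying the same operator to ½ log q · E leaves the extra term E'. The regular part has to
compensate it for the full kernel to be a solution. -/
lemma regularM_ode (κ q : ℂ) :
    q * regularM'' κ q + regularM' κ q + κ * regularM κ q + besselE' κ q = 0 := by
  have h := (expBounded_regularCoeff κ).bessel_operator q
  have hrec : ∀ m : ℕ, ((m : ℂ) + 1) ^ 2 * regularCoeff κ (m + 1) * q ^ m =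
      -(κ * (regularCoeff κ m * q ^ m)) - derivCoeff (besselCoeff κ) m * q ^ m := by
    intro m
    have h1 : ((m : ℂ) + 1) ≠ 0 := by exact_mod_cast Nat.succ_ne_zero m
    have h2 := besselCoeff_succ κ m
    have h3 : ((m : ℂ) + 1)⁻¹ * ((m + 1) ^ 2 * besselCoeff κ (m + 1)) =
        (m + 1) * besselCoeff κ (m + 1) := by field_simp
    rw [regularCoeff, regularCoeff, derivCoeff, harmonic_succ]
    push_cast
    linear_combination ((Real.eulerMascheroniConstant - Real.log 2 - Complex.I * Real.pi / 2 -
      (harmonic m : ℂ)) * q ^ m) * h2 - q ^ m * h3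
  have s1 := ((expBounded_regularCoeff κ).summable q).mul_left κ
  have s2 := (expBounded_besselCoeff κ).derivCoeff.summable q
  rw [regularM'', regularM', h, tsum_congr hrec, Summable.tsum_sub s1.neg s2, tsum_neg,
    tsum_mul_left]
  simp only [regularM, besselE', entireSeries]
  ring

/-- This splits the Green kernel into l times the Riemann function plus a function entire in r². The
constant -iπ/2 in `regularCoeff` accounts for the J₀ in H₀⁽¹⁾ = J₀ + i Y₀. -/
lemma hankelLog_eq {k : ℂ} (hk : k ≠ 0) (l : ℂ) :
    -(Complex.I / 4) * hankelLog l =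
      (2 * Real.pi : ℂ)⁻¹ * (l * besselE (k ^ 2 / 4) (Complex.exp (2 * l) / k ^ 2) +
        regularM (k ^ 2 / 4) (Complex.exp (2 * l) / k ^ 2)) := by
  set q := Complex.exp (2 * l) / k ^ 2
  set κ := k ^ 2 / 4
  have hz : Complex.exp l ^ 2 / 4 = κ * q := by
    rw [← Complex.exp_nat_mul]
    simp only [κ, q]
    push_cast
    field_simp
  have e1 : besselJZero (Complex.exp l) = besselE κ q := by
    rw [besselJZero, besselE, entireSeries]
    congr 1
    ext m
    rw [hz, besselCoeff, mul_pow, neg_pow]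
    ring_nf
  have e2 : ∑' m : ℕ, (-1) ^ m * (harmonic m : ℂ) * (Complex.exp l ^ 2 / 4) ^ m
        / (m.factorial : ℂ) ^ 2 =
      (Real.eulerMascheroniConstant - Real.log 2 - Complex.I * Real.pi / 2) * besselE κ q
        - regularM κ q := by
    rw [regularM, besselE, entireSeries, entireSeries, ← tsum_mul_left, ← Summable.tsum_sub]
    · congr 1
      ext m
      rw [hz, regularCoeff, besselCoeff, mul_pow, neg_pow]
      ring_nf
    · exact ((expBounded_besselCoeff κ).summable q).mul_left _
    · exact (expBounded_regularCoeff κ).summable q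
  have hpi : (Real.pi : ℂ) ≠ 0 := by exact_mod_cast Real.pi_ne_zero
  rw [hankelLog, besselYZeroLog, e1, e2]
  field_simp
  linear_combination (-(2 : ℂ) * Complex.I * besselE κ q * Real.pi - 4 * besselE κ q * l -
    4 * regularM κ q) * Complex.I_sq

lemma deriv_hankelLog_eq {k : ℂ} (hk : k ≠ 0) {l q : ℂ} (hq : Complex.exp (2 * l) = k ^ 2 * q) :
    -(Complex.I / 4) * deriv hankelLog l =
      (2 * Real.pi : ℂ)⁻¹ * (besselE (k ^ 2 / 4) q +
        2 * q * (l * besselE' (k ^ 2 / 4) q + regularM' (k ^ 2 / 4) q)) := by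
  have hq' : Complex.exp (2 * l) / k ^ 2 = q := by rw [hq]; field_simp
  have hqd : HasDerivAt (fun l => Complex.exp (2 * l) / k ^ 2) (2 * q) l := by
    have h1 : HasDerivAt (fun l : ℂ => 2 * l) 2 l := by
      simpa using (hasDerivAt_id l).const_mul (2 : ℂ)
    refine ((h1.cexp).div_const (k ^ 2)).congr_deriv ?_
    rw [← hq']
    ring
  set κ := k ^ 2 / 4
  have hE : HasDerivAt (fun l => besselE κ (Complex.exp (2 * l) / k ^ 2)) (besselE' κ q * (2 * q))
      l := HasDerivAt.comp (h₂ := besselE κ) l (hq' ▸ hasDerivAt_besselE κ q) hqd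
  have hM : HasDerivAt (fun l => regularM κ (Complex.exp (2 * l) / k ^ 2))
      (regularM' κ q * (2 * q)) l :=
    HasDerivAt.comp (h₂ := regularM κ) l (hq' ▸ hasDerivAt_regularM κ q) hqd
  have h := (((hasDerivAt_id l).mul hE).add hM).const_mul (2 * Real.pi : ℂ)⁻¹
  have hfun : hankelLog = fun l => (-(Complex.I / 4))⁻¹ * ((2 * Real.pi : ℂ)⁻¹ *
      (l * besselE κ (Complex.exp (2 * l) / k ^ 2) +
        regularM κ (Complex.exp (2 * l) / k ^ 2))) := by
    funext l
    rw [← hankelLog_eq hk l, ← mul_assoc, inv_mul_cancel₀ (by simp [Complex.I_ne_zero]), one_mul]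
  have h' := (h.const_mul (-(Complex.I / 4))⁻¹)
  have e : deriv hankelLog l = (-(Complex.I / 4))⁻¹ * ((2 * Real.pi : ℂ)⁻¹ *
      (1 * besselE κ (Complex.exp (2 * l) / k ^ 2) + id l * (besselE' κ q * (2 * q)) +
        regularM' κ q * (2 * q))) := by
    rw [hfun]; exact h'.deriv
  rw [e, ← mul_assoc, mul_inv_cancel₀ (by simp [Complex.I_ne_zero]), one_mul]
  simp only [id, hq']
  ring

/-! ### The Riemann function and the half-solutions -/

/-- The characteristic coordinate `x₁ + i x₂`. -/
def charZ : ℂ × ℂ →L[ℂ] ℂ :=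
  ContinuousLinearMap.fst ℂ ℂ ℂ + Complex.I • ContinuousLinearMap.snd ℂ ℂ ℂ

/-- The characteristic coordinate `x₁ - i x₂`. -/
def charW : ℂ × ℂ →L[ℂ] ℂ :=
  ContinuousLinearMap.fst ℂ ℂ ℂ - Complex.I • ContinuousLinearMap.snd ℂ ℂ ℂ

lemma charZ_apply (x : ℂ × ℂ) : charZ x = x.1 + Complex.I * x.2 := by simp [charZ]

lemma charW_apply (x : ℂ × ℂ) : charW x = x.1 - Complex.I * x.2 := by simp [charW]

lemma charZ_toC2 (p : ℂ) : charZ (toC2 p) = p := by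
  simp only [charZ_apply, toC2]
  conv_rhs => rw [← Complex.re_add_im p]
  ring

lemma charW_toC2 (p : ℂ) : charW (toC2 p) = conj p := by
  simp only [charW_apply, toC2]
  apply Complex.ext <;> simp

lemma realPt_zero (x : ℂ × ℂ) : realPt 0 x = charZ x := by
  rw [charZ_apply]
  apply Complex.ext <;> simp [realPt]
  ring

lemma realPt_one (x : ℂ × ℂ) : realPt 1 x = conj (charW x) := by
  rw [charW_apply]
  apply Complex.ext <;> simp [realPt]
  ring

lemma continuous_realPt (l : Fin 2) : Continuous (realPt l) := by
  fin_cases l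
  · have : realPt 0 = fun x => charZ x := funext realPt_zero
    simpa only [Fin.zero_eta, this] using charZ.continuous
  · have : realPt 1 = fun x => conj (charW x) := funext realPt_one
    simp only [Fin.mk_one, this]
    exact Complex.continuous_conj.comp charW.continuous

lemma realPt_toC2 (l : Fin 2) (p : ℂ) : realPt l (toC2 p) = p := by
  fin_cases l
  · simp only [Fin.zero_eta, realPt_zero, charZ_toC2]
  · simp only [Fin.mk_one, realPt_one, charW_toC2, Complex.conj_conj]

/-- In characteristic coordinates the squared distance is a product of one factor for each
associated real point; as a function of real ζ it vanishes exactly at these points. -/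
lemma sqDist_eq (x : ℂ × ℂ) (ζ : ℂ) : sqDist x ζ = (ζ - charZ x) * (conj ζ - charW x) := by
  rw [charZ_apply, charW_apply, sqDist]
  have h1 : conj ζ = (ζ.re : ℂ) - ζ.im * Complex.I := by
    apply Complex.ext <;> simp
  rw [h1]
  conv_rhs => rw [← Complex.re_add_im ζ]
  simp only [Complex.add_re, Complex.ofReal_re, Complex.mul_re, Complex.I_re, mul_zero,
    Complex.ofReal_im, Complex.I_im, mul_one, sub_self, add_zero, Complex.add_im, Complex.mul_im,
    zero_add]
  linear_combination ((x.2 - (ζ.im : ℂ)) ^ 2) * Complex.I_sq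

@[fun_prop] lemma continuous_sqDist : Continuous fun p : (ℂ × ℂ) × ℂ => sqDist p.1 p.2 := by
  simp only [sqDist_eq]
  fun_prop

/-- `U`, with Wirtinger derivatives `Uz` and `Ub`, solves `∂∂̄ U = -κ U` on `K`. -/
def IsPlaneSolution (κ : ℂ) (U Uz Ub : ℂ → ℂ) (K : Set ℂ) : Prop :=
  ∀ ζ ∈ K, HasFDerivAt U (wirtinger (Uz ζ) (Ub ζ)) ζ ∧
    (∃ a, HasFDerivAt Uz (wirtinger a (-κ * U ζ)) ζ) ∧
    ∃ b, HasFDerivAt Ub (wirtinger (-κ * U ζ) b) ζ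

lemma IsPlaneSolution.mono {κ : ℂ} {U Uz Ub : ℂ → ℂ} {K K' : Set ℂ}
    (h : IsPlaneSolution κ U Uz Ub K) (hK : K' ⊆ K) : IsPlaneSolution κ U Uz Ub K' :=
  fun ζ hζ => h ζ (hK hζ)

lemma IsPlaneSolution.continuousOn {κ : ℂ} {U Uz Ub : ℂ → ℂ} {K : Set ℂ}
    (h : IsPlaneSolution κ U Uz Ub K) : ContinuousOn U K := fun ζ hζ =>
  (h ζ hζ).1.continuousAt.continuousWithinAt

lemma IsPlaneSolution.continuousOn_z {κ : ℂ} {U Uz Ub : ℂ → ℂ} {K : Set ℂ}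
    (h : IsPlaneSolution κ U Uz Ub K) : ContinuousOn Uz K := fun ζ hζ =>
  (h ζ hζ).2.1.choose_spec.continuousAt.continuousWithinAt

lemma IsPlaneSolution.continuousOn_b {κ : ℂ} {U Uz Ub : ℂ → ℂ} {K : Set ℂ}
    (h : IsPlaneSolution κ U Uz Ub K) : ContinuousOn Ub K := fun ζ hζ =>
  (h ζ hζ).2.2.choose_spec.continuousAt.continuousWithinAt

/-- The `dζ` coefficient of Riemann's form. -/
def riemannP (κ : ℂ) (U Uz : ℂ → ℂ) (x : ℂ × ℂ) (ζ : ℂ) : ℂ :=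
  besselE κ (sqDist x ζ) * Uz ζ - U ζ * (besselE' κ (sqDist x ζ) * (conj ζ - charW x))

/-- The `dζ̄` coefficient of Riemann's form. -/
def riemannQ (κ : ℂ) (U Ub : ℂ → ℂ) (x : ℂ × ℂ) (ζ : ℂ) : ℂ :=
  U ζ * (besselE' κ (sqDist x ζ) * (ζ - charZ x)) - besselE κ (sqDist x ζ) * Ub ζ

lemma hasFDerivAt_sqDist (x : ℂ × ℂ) (ζ : ℂ) :
    HasFDerivAt (sqDist x) (wirtinger (conj ζ - charW x) (ζ - charZ x)) ζ := by
  have : sqDist x = fun ζ => (ζ - charZ x) * (conj ζ - charW x) := funext (sqDist_eq x)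
  rw [this]
  refine ((hasFDerivAt_wirtinger_sub_const _ ζ).wirtinger_mul
    (hasFDerivAt_wirtinger_conj_sub_const _ ζ)).congr_fderiv (wirtinger_ext ?_ ?_) <;> ring

/-- This is Green's second identity in Wirtinger form: the products of first derivatives cancel, and
both `U` and the Riemann function satisfy ∂∂̄ = -κ. -/
theorem IsPlaneSolution.isClosedForm {κ : ℂ} {U Uz Ub : ℂ → ℂ} {K : Set ℂ}
    (h : IsPlaneSolution κ U Uz Ub K) (x : ℂ × ℂ) :
    IsClosedForm (riemannP κ U Uz x) (riemannQ κ U Ub x) K := by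
  intro ζ hζ
  obtain ⟨hU, ⟨a, hz⟩, b, hb⟩ := h ζ hζ
  have hq := hasFDerivAt_sqDist x ζ
  have hE := HasFDerivAt.wirtinger_comp (hasDerivAt_besselE κ (sqDist x ζ)) hq
  have hE' := HasFDerivAt.wirtinger_comp (hasDerivAt_besselE' κ (sqDist x ζ)) hq
  have hα := hasFDerivAt_wirtinger_sub_const (charZ x) ζ
  have hβ := hasFDerivAt_wirtinger_conj_sub_const (charW x) ζ
  have hP := (hE.wirtinger_mul hz).wirtinger_sub (hU.wirtinger_mul (hE'.wirtinger_mul hβ))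
  have hQ := (hU.wirtinger_mul (hE'.wirtinger_mul hα)).wirtinger_sub (hE.wirtinger_mul hb)
  refine ⟨_, _, _, hP, hQ.congr_fderiv (wirtinger_ext ?_ rfl)⟩
  have hq' := sqDist_eq x ζ
  have ode := besselE_ode κ (sqDist x ζ)
  linear_combination (2 * U ζ) * ode + (-2 * U ζ * besselE'' κ (sqDist x ζ)) * hq'

/-- `Ω` is a family of primitives of Riemann's form on `K`, holomorphic in the parameter. -/
structure IsRiemannPrimitive (κ : ℂ) (U Uz Ub : ℂ → ℂ) (Ω : ℂ × ℂ → ℂ → ℂ) (K : Set ℂ) :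
    Prop where
  solution : IsPlaneSolution κ U Uz Ub K
  hasFDerivAt : ∀ x, ∀ ζ ∈ K,
    HasFDerivAt (Ω x) (wirtinger (riemannP κ U Uz x ζ) (riemannQ κ U Ub x ζ)) ζ
  differentiable : ∀ ζ ∈ K, Differentiable ℂ fun x => Ω x ζ

/-- The derivative of the squared distance in its complex argument. -/
def sqDistDeriv (x : ℂ × ℂ) (ζ : ℂ) : ℂ × ℂ →L[ℂ] ℂ :=
  -((conj ζ - charW x) • charZ) - (ζ - charZ x) • charW

lemma hasFDerivAt_sqDist_left (x : ℂ × ℂ) (ζ : ℂ) :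
    HasFDerivAt (fun x => sqDist x ζ) (sqDistDeriv x ζ) x := by
  have : (fun x => sqDist x ζ) = fun x => (ζ - charZ x) * (conj ζ - charW x) :=
    funext fun x => sqDist_eq x ζ
  rw [this]
  refine ((charZ.hasFDerivAt.const_sub ζ).mul (charW.hasFDerivAt.const_sub (conj ζ))).congr_fderiv
    ?_
  ext <;> simp [sqDistDeriv] <;> ring

/-- The derivative of `riemannP` in its complex argument. -/
def riemannPDeriv (κ : ℂ) (U Uz : ℂ → ℂ) (x : ℂ × ℂ) (ζ : ℂ) : ℂ × ℂ →L[ℂ] ℂ :=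
  (besselE' κ (sqDist x ζ) * Uz ζ) • sqDistDeriv x ζ -
    U ζ • ((besselE'' κ (sqDist x ζ) * (conj ζ - charW x)) • sqDistDeriv x ζ -
      besselE' κ (sqDist x ζ) • charW)

/-- The derivative of `riemannQ` in its complex argument. -/
def riemannQDeriv (κ : ℂ) (U Ub : ℂ → ℂ) (x : ℂ × ℂ) (ζ : ℂ) : ℂ × ℂ →L[ℂ] ℂ :=
  U ζ • ((besselE'' κ (sqDist x ζ) * (ζ - charZ x)) • sqDistDeriv x ζ -
      besselE' κ (sqDist x ζ) • charZ) -
    (besselE' κ (sqDist x ζ) * Ub ζ) • sqDistDeriv x ζ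

lemma hasFDerivAt_riemannP (κ : ℂ) (U Uz : ℂ → ℂ) (x : ℂ × ℂ) (ζ : ℂ) :
    HasFDerivAt (fun x => riemannP κ U Uz x ζ) (riemannPDeriv κ U Uz x ζ) x := by
  have hq := hasFDerivAt_sqDist_left x ζ
  have hE := (hasDerivAt_besselE κ (sqDist x ζ)).comp_hasFDerivAt x hq
  have hE' := (hasDerivAt_besselE' κ (sqDist x ζ)).comp_hasFDerivAt x hq
  refine ((hE.mul_const (Uz ζ)).sub
    ((hE'.mul (charW.hasFDerivAt.const_sub (conj ζ))).const_mul (U ζ))).congr_fderiv ?_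
  ext <;> simp [riemannPDeriv] <;> ring

lemma hasFDerivAt_riemannQ (κ : ℂ) (U Ub : ℂ → ℂ) (x : ℂ × ℂ) (ζ : ℂ) :
    HasFDerivAt (fun x => riemannQ κ U Ub x ζ) (riemannQDeriv κ U Ub x ζ) x := by
  have hq := hasFDerivAt_sqDist_left x ζ
  have hE := (hasDerivAt_besselE κ (sqDist x ζ)).comp_hasFDerivAt x hq
  have hE' := (hasDerivAt_besselE' κ (sqDist x ζ)).comp_hasFDerivAt x hq
  refine (((hE'.mul (charZ.hasFDerivAt.const_sub ζ)).const_mul (U ζ)).sub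
    (hE.mul_const (Ub ζ))).congr_fderiv ?_
  ext <;> simp [riemannQDeriv] <;> ring

/-- The parameter x enters only through the Riemann function, which is entire in it. Differentiation
under the integral therefore works for all x, wherever its real points are. -/
theorem IsPlaneSolution.differentiable_segPrimitive {κ : ℂ} {U Uz Ub : ℂ → ℂ} {K : Set ℂ}
    (h : IsPlaneSolution κ U Uz Ub K) {b ζ : ℂ}
    (hseg : ∀ t ∈ Set.Icc (0 : ℝ) 1, b + t * (ζ - b) ∈ K) :
    Differentiable ℂ fun x => segPrimitive (riemannP κ U Uz x) (riemannQ κ U Ub x) b ζ := by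
  simp only [segPrimitive_eq]
  set y : ℝ → ℂ := fun t => b + t * (ζ - b) with hy
  have hyc : Continuous y := by fun_prop
  have cq : Continuous fun p : (ℂ × ℂ) × ℝ => sqDist p.1 (y p.2) :=
    Continuous.comp (g := fun p : (ℂ × ℂ) × ℂ => sqDist p.1 p.2)
      (f := fun p : (ℂ × ℂ) × ℝ => (p.1, y p.2)) continuous_sqDist
      (continuous_fst.prodMk (hyc.comp continuous_snd))
  have cU : ContinuousOn (fun p : (ℂ × ℂ) × ℝ => U (y p.2)) (Set.univ ×ˢ Set.Icc 0 1) :=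
    (h.continuousOn.comp hyc.continuousOn hseg).comp continuousOn_snd fun p hp => hp.2
  have cz : ContinuousOn (fun p : (ℂ × ℂ) × ℝ => Uz (y p.2)) (Set.univ ×ˢ Set.Icc 0 1) :=
    (h.continuousOn_z.comp hyc.continuousOn hseg).comp continuousOn_snd fun p hp => hp.2
  have cb : ContinuousOn (fun p : (ℂ × ℂ) × ℝ => Ub (y p.2)) (Set.univ ×ˢ Set.Icc 0 1) :=
    (h.continuousOn_b.comp hyc.continuousOn hseg).comp continuousOn_snd fun p hp => hp.2
  have c2 : Continuous fun p : (ℂ × ℂ) × ℝ => besselE κ (sqDist p.1 (y p.2)) :=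
    (continuous_besselE κ).comp cq
  have c3 : Continuous fun p : (ℂ × ℂ) × ℝ => besselE' κ (sqDist p.1 (y p.2)) :=
    (continuous_besselE' κ).comp cq
  have c4 : Continuous fun p : (ℂ × ℂ) × ℝ => besselE'' κ (sqDist p.1 (y p.2)) :=
    (continuous_besselE'' κ).comp cq
  have c5 : Continuous fun p : (ℂ × ℂ) × ℝ => sqDistDeriv p.1 (y p.2) := by
    simp only [sqDistDeriv]; fun_prop
  have cf : ContinuousOn (fun p : (ℂ × ℂ) × ℝ => riemannP κ U Uz p.1 (y p.2) * (ζ - b) +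
      riemannQ κ U Ub p.1 (y p.2) * conj (ζ - b)) (Set.univ ×ˢ Set.Icc 0 1) := by
    have k4 : ContinuousOn (fun p : (ℂ × ℂ) × ℝ => charW p.1) (Set.univ ×ˢ Set.Icc 0 1) := by
      fun_prop
    have k5 : ContinuousOn (fun p : (ℂ × ℂ) × ℝ => charZ p.1) (Set.univ ×ˢ Set.Icc 0 1) := by
      fun_prop
    have k6 : ContinuousOn (fun p : (ℂ × ℂ) × ℝ => y p.2) (Set.univ ×ˢ Set.Icc 0 1) := by fun_prop
    have k7 : ContinuousOn (fun p : (ℂ × ℂ) × ℝ => conj (y p.2)) (Set.univ ×ˢ Set.Icc 0 1) :=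
      Complex.continuous_conj.comp_continuousOn k6
    have cP : ContinuousOn (fun p : (ℂ × ℂ) × ℝ => riemannP κ U Uz p.1 (y p.2))
        (Set.univ ×ˢ Set.Icc 0 1) :=
      (c2.continuousOn.mul cz).sub (cU.mul (c3.continuousOn.mul (k7.sub k4)))
    have cQ : ContinuousOn (fun p : (ℂ × ℂ) × ℝ => riemannQ κ U Ub p.1 (y p.2))
        (Set.univ ×ˢ Set.Icc 0 1) :=
      (cU.mul (c3.continuousOn.mul (k6.sub k5))).sub (c2.continuousOn.mul cb)
    exact (cP.mul continuousOn_const).add (cQ.mul continuousOn_const)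
  intro x₀
  refine (hasFDerivAt_integral_of_continuousOn (f := fun x t => riemannP κ U Uz x (y t) * (ζ - b) +
      riemannQ κ U Ub x (y t) * conj (ζ - b))
    (f' := fun x t => (ζ - b) • riemannPDeriv κ U Uz x (y t) +
      conj (ζ - b) • riemannQDeriv κ U Ub x (y t)) isOpen_univ ?_ ?_ ?_
    (Set.mem_univ x₀)).differentiableAt
  · intro x _
    exact cf.comp (f := fun t : ℝ => (x, t)) (by fun_prop) fun t ht => ⟨Set.mem_univ _, ht⟩
  · have k4 : Continuous fun p : (ℂ × ℂ) × ℝ => charW p.1 := by fun_prop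
    have k5 : Continuous fun p : (ℂ × ℂ) × ℝ => charZ p.1 := by fun_prop
    have k6 : Continuous fun p : (ℂ × ℂ) × ℝ => y p.2 := by fun_prop
    have k7 : Continuous fun p : (ℂ × ℂ) × ℝ => conj (y p.2) :=
      Complex.continuous_conj.comp k6
    exact (((c3.continuousOn.mul cz).smul c5.continuousOn).sub (cU.smul
        (((c4.mul (k7.sub k4)).smul c5).sub (c3.smul continuous_const)).continuousOn)).const_smul
      (ζ - b) |>.add (((cU.smul
        (((c4.mul (k6.sub k5)).smul c5).sub (c3.smul continuous_const)).continuousOn).sub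
          ((c3.continuousOn.mul cb).smul c5.continuousOn)).const_smul (conj (ζ - b)))
  · intro x _ t _
    exact ((hasFDerivAt_riemannP κ U Uz x (y t)).mul_const (ζ - b)).add
      ((hasFDerivAt_riemannQ κ U Ub x (y t)).mul_const (conj (ζ - b)))

/-- The free constant `C`, entire in x, is needed to make the primitive over a cone agree with that
over the cut plane. -/
theorem IsPlaneSolution.isRiemannPrimitive {κ : ℂ} {U Uz Ub : ℂ → ℂ} {K : Set ℂ}
    (h : IsPlaneSolution κ U Uz Ub K) (hK : IsOpen K) {b : ℂ} (hs : StarConvex ℝ b K)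
    {C : ℂ × ℂ → ℂ} (hC : Differentiable ℂ C) :
    IsRiemannPrimitive κ U Uz Ub
      (fun x ζ => segPrimitive (riemannP κ U Uz x) (riemannQ κ U Ub x) b ζ + C x) K where
  solution := h
  hasFDerivAt x ζ hζ := ((h.isClosedForm x).hasFDerivAt_segPrimitive hK hs hζ).add_const _
  differentiable ζ hζ := by
    refine (h.differentiable_segPrimitive fun t ht => ?_).add hC
    have := hs.add_smul_sub_mem hζ ht.1 ht.2
    simpa using this

lemma IsRiemannPrimitive.mono {κ : ℂ} {U Uz Ub : ℂ → ℂ} {Ω : ℂ × ℂ → ℂ → ℂ} {K K' : Set ℂ}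
    (h : IsRiemannPrimitive κ U Uz Ub Ω K) (hK : K' ⊆ K) : IsRiemannPrimitive κ U Uz Ub Ω K' :=
  ⟨h.solution.mono hK, fun x ζ hζ => h.hasFDerivAt x ζ (hK hζ),
    fun ζ hζ => h.differentiable ζ (hK hζ)⟩

lemma IsPlaneSolution.continuousAt_riemann {κ : ℂ} {U Uz Ub : ℂ → ℂ} {K : Set ℂ}
    (h : IsPlaneSolution κ U Uz Ub K) {ζ : ℂ} (hζ : ζ ∈ K) (x : ℂ × ℂ) :
    ContinuousAt (fun p : (ℂ × ℂ) × ℂ => riemannP κ U Uz p.1 p.2) (x, ζ) ∧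
    ContinuousAt (fun p : (ℂ × ℂ) × ℂ => riemannQ κ U Ub p.1 p.2) (x, ζ) := by
  obtain ⟨hU, ⟨a, hz⟩, b, hb⟩ := h ζ hζ
  have cU : ContinuousAt (fun p : (ℂ × ℂ) × ℂ => U p.2) (x, ζ) :=
    ContinuousAt.comp (f := Prod.snd) (x := (x, ζ)) hU.continuousAt continuousAt_snd
  have cz : ContinuousAt (fun p : (ℂ × ℂ) × ℂ => Uz p.2) (x, ζ) :=
    ContinuousAt.comp (f := Prod.snd) (x := (x, ζ)) hz.continuousAt continuousAt_snd
  have cb : ContinuousAt (fun p : (ℂ × ℂ) × ℂ => Ub p.2) (x, ζ) :=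
    ContinuousAt.comp (f := Prod.snd) (x := (x, ζ)) hb.continuousAt continuousAt_snd
  have c2 : ContinuousAt (fun p : (ℂ × ℂ) × ℂ => besselE κ (sqDist p.1 p.2)) (x, ζ) :=
    ((continuous_besselE κ).comp continuous_sqDist).continuousAt
  have c3 : ContinuousAt (fun p : (ℂ × ℂ) × ℂ => besselE' κ (sqDist p.1 p.2)) (x, ζ) :=
    ((continuous_besselE' κ).comp continuous_sqDist).continuousAt
  have c4 : ContinuousAt (fun p : (ℂ × ℂ) × ℂ => charW p.1) (x, ζ) :=
    (charW.continuous.comp continuous_fst).continuousAt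
  have c5 : ContinuousAt (fun p : (ℂ × ℂ) × ℂ => charZ p.1) (x, ζ) :=
    (charZ.continuous.comp continuous_fst).continuousAt
  have c6 : ContinuousAt (fun p : (ℂ × ℂ) × ℂ => conj p.2) (x, ζ) :=
    (Complex.continuous_conj.comp continuous_snd).continuousAt
  constructor
  · exact (c2.mul cz).sub (cU.mul (c3.mul (c6.sub c4)))
  · exact (cU.mul (c3.mul (continuousAt_snd.sub c5))).sub (c2.mul cb)

/-- Differentiability of `x ↦ Ω x (e x)`. -/
lemma IsRiemannPrimitive.hasFDerivAt_comp {κ : ℂ} {U Uz Ub : ℂ → ℂ} {Ω : ℂ × ℂ → ℂ → ℂ}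
    {K : Set ℂ} (h : IsRiemannPrimitive κ U Uz Ub Ω K) (hK : IsOpen K) (e : ℂ × ℂ →L[ℝ] ℂ)
    {x₀ : ℂ × ℂ} (hx₀ : e x₀ ∈ K) :
    HasFDerivAt (fun x => Ω x (e x))
      ((wirtinger (riemannP κ U Uz x₀ (e x₀)) (riemannQ κ U Ub x₀ (e x₀))).comp e +
        (fderiv ℂ (fun x => Ω x (e x₀)) x₀).restrictScalars ℝ) x₀ := by
  have h2 : HasFDerivAt (fun x => Ω x (e x₀))
      ((fderiv ℂ (fun x => Ω x (e x₀)) x₀).restrictScalars ℝ) x₀ :=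
    (h.differentiable _ hx₀ x₀).hasFDerivAt.restrictScalars ℝ
  set φ := wirtinger (riemannP κ U Uz x₀ (e x₀)) (riemannQ κ U Ub x₀ (e x₀)) with hφ
  have h1 : HasFDerivAt (fun x => Ω x (e x) - Ω x (e x₀)) (φ.comp e) x₀ := by
    have cW : ContinuousAt (fun p : (ℂ × ℂ) × ℂ =>
        wirtinger (riemannP κ U Uz p.1 p.2) (riemannQ κ U Ub p.1 p.2)) (x₀, e x₀) := by
      obtain ⟨c1, c2⟩ := h.solution.continuousAt_riemann hx₀ x₀
      exact (c1.smul continuousAt_const).add (c2.smul continuousAt_const)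
    -- Both arguments move. Joint continuity of Riemann's form in (x, ζ) allows the mean value
    -- inequality in ζ with a bound uniform in x.
    have key : (fun x => Ω x (e x) - Ω x (e x₀) - φ (e x - e x₀)) =o[𝓝 x₀]
        fun x => e x - e x₀ := by
      rw [Asymptotics.isLittleO_iff]
      intro ε hε
      have hev : ∀ᶠ p : (ℂ × ℂ) × ℂ in 𝓝 (x₀, e x₀), p.2 ∈ K ∧
          ‖wirtinger (riemannP κ U Uz p.1 p.2) (riemannQ κ U Ub p.1 p.2) - φ‖ < ε := by
        refine (continuousAt_snd.eventually (hK.mem_nhds hx₀)).and ?_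
        have := Metric.tendsto_nhds.1 cW ε hε
        simpa only [dist_eq_norm] using this
      rw [nhds_prod_eq] at hev
      obtain ⟨pa, hpa, pb, hpb, hab⟩ := Filter.eventually_prod_iff.1 hev
      obtain ⟨δ, hδ, hball⟩ := Metric.eventually_nhds_iff_ball.1 hpb
      filter_upwards [hpa, e.continuous.continuousAt.eventually (Metric.ball_mem_nhds (e x₀) hδ)]
        with x hx hxe
      exact Convex.norm_image_sub_le_of_norm_hasFDerivWithin_le' (s := Metric.ball (e x₀) δ)
        (fun ζ hζ => (h.hasFDerivAt x ζ (hab hx (hball ζ hζ)).1).hasFDerivWithinAt)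
        (fun ζ hζ => (hab hx (hball ζ hζ)).2.le) (convex_ball _ _) (Metric.mem_ball_self hδ) hxe
    rw [hasFDerivAt_iff_isLittleO]
    have hO : (fun x => e x - e x₀) =O[𝓝 x₀] fun x => x - x₀ := by
      simp only [← map_sub]
      exact e.isBigO_comp _ _
    refine (key.trans_isBigO hO).congr_left fun x => ?_
    simp
  refine ((h1.add h2).congr_of_eventuallyEq (Eventually.of_forall fun x => ?_))
  simp

/-- The half-solution attached to the first characteristic. -/
def halfOne (U : ℂ → ℂ) (Ω : ℂ × ℂ → ℂ → ℂ) (x : ℂ × ℂ) : ℂ :=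
  (U (charZ x) + Ω x (charZ x)) / 2

/-- The half-solution attached to the second characteristic. -/
def halfTwo (U : ℂ → ℂ) (Ω : ℂ × ℂ → ℂ → ℂ) (x : ℂ × ℂ) : ℂ :=
  (U (conj (charW x)) - Ω x (conj (charW x))) / 2

/-- At a real point both characteristic ends coincide, so the primitive cancels. -/
lemma halfOne_add_halfTwo_toC2 (U : ℂ → ℂ) (Ω : ℂ × ℂ → ℂ → ℂ) (p : ℂ) :
    halfOne U Ω (toC2 p) + halfTwo U Ω (toC2 p) = U p := by
  simp only [halfOne, halfTwo, charZ_toC2, charW_toC2, Complex.conj_conj]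
  ring

/-- At ζ = z the squared distance vanishes and E = 1, so the dζ̄ coefficient of Riemann's form is
-∂̄U. It cancels the antiholomorphic part of dU, and the real derivative becomes complex linear. -/
theorem IsRiemannPrimitive.analyticOnNhd_halfOne {κ : ℂ} {U Uz Ub : ℂ → ℂ} {Ω : ℂ × ℂ → ℂ → ℂ}
    {K : Set ℂ} (h : IsRiemannPrimitive κ U Uz Ub Ω K) (hK : IsOpen K) :
    AnalyticOnNhd ℂ (halfOne U Ω) {x | realPt 0 x ∈ K} := by
  refine DifferentiableOn.analyticOnNhd_prod (fun x hx => ?_)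
    (hK.preimage (continuous_realPt 0))
  have hx' : charZ x ∈ K := by rw [← realPt_zero]; exact hx
  have h1 := h.hasFDerivAt_comp hK (charZ.restrictScalars ℝ) (x₀ := x) hx'
  have h2 : HasFDerivAt (fun x : ℂ × ℂ => U (charZ x))
      ((wirtinger (Uz (charZ x)) (Ub (charZ x))).comp (charZ.restrictScalars ℝ)) x :=
    HasFDerivAt.comp (g := U) x (h.solution _ hx').1 (charZ.restrictScalars ℝ).hasFDerivAt
  have h3 := (h2.add h1).mul_const (2⁻¹ : ℂ)
  have h4 := hasFDerivAt_of_restrictScalars ℝ (f' := (2⁻¹ : ℂ) •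
    ((Uz (charZ x) + riemannP κ U Uz x (charZ x)) • charZ +
      fderiv ℂ (fun y => Ω y (charZ x)) x)) h3 ?_
  · refine (h4.differentiableAt.congr_of_eventuallyEq
      (Eventually.of_forall fun y => ?_)).differentiableWithinAt
    simp only [halfOne, div_eq_mul_inv]
    rfl
  · have hQ : riemannQ κ U Ub x (charZ x) = -Ub (charZ x) := by
      simp [riemannQ, sqDist_eq, besselE_zero]
    ext v <;> simp [hQ] <;> ring_nf

/-- At ζ = w̄ the dζ coefficient equals ∂U and is cancelled by the minus sign. Only the derivative
in ζ̄ = w survives, and this is holomorphic in x. -/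
theorem IsRiemannPrimitive.analyticOnNhd_halfTwo {κ : ℂ} {U Uz Ub : ℂ → ℂ} {Ω : ℂ × ℂ → ℂ → ℂ}
    {K : Set ℂ} (h : IsRiemannPrimitive κ U Uz Ub Ω K) (hK : IsOpen K) :
    AnalyticOnNhd ℂ (halfTwo U Ω) {x | realPt 1 x ∈ K} := by
  refine DifferentiableOn.analyticOnNhd_prod (fun x hx => ?_)
    (hK.preimage (continuous_realPt 1))
  let e : ℂ × ℂ →L[ℝ] ℂ := (Complex.conjCLE : ℂ →L[ℝ] ℂ).comp (charW.restrictScalars ℝ)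
  have he : ∀ x, e x = conj (charW x) := fun x => rfl
  have hx' : e x ∈ K := by rw [he, ← realPt_one]; exact hx
  have h1 := h.hasFDerivAt_comp hK e (x₀ := x) hx'
  have h2 : HasFDerivAt (fun x : ℂ × ℂ => U (e x))
      ((wirtinger (Uz (e x)) (Ub (e x))).comp e) x :=
    HasFDerivAt.comp (g := U) x (h.solution _ hx').1 e.hasFDerivAt
  have h3 := (h2.sub h1).mul_const (2⁻¹ : ℂ)
  have h4 := hasFDerivAt_of_restrictScalars ℝ (f' := (2⁻¹ : ℂ) •
    ((Ub (e x) - riemannQ κ U Ub x (e x)) • charW -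
      fderiv ℂ (fun y => Ω y (e x)) x)) h3 ?_
  · refine (h4.differentiableAt.congr_of_eventuallyEq
      (Eventually.of_forall fun y => ?_)).differentiableWithinAt
    simp only [halfTwo, div_eq_mul_inv]
    rfl
  · have hP : riemannP κ U Uz x (e x) = Uz (e x) := by
      simp [riemannP, sqDist_eq, besselE_zero, he]
    rw [hP]
    ext v <;> simp [he] <;> ring_nf

/-! ### Sections of the projection -/

namespace SommerfeldSurface

variable {S : Type*} [TopologicalSpace S] [T2Space S] {M N : ℕ} (X : SommerfeldSurface S M N)

/-- A point of the surface which does not lie over a branch point. -/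
def Regular (s : S) : Prop := X.proj s ∉ Set.range X.branchPt

lemma continuous_proj : Continuous X.proj := X.isProperMap_proj.continuous

lemma isOpen_compl_range_branchPt : IsOpen (Set.range X.branchPt)ᶜ :=
  (Set.finite_range _).isClosed.isOpen_compl

/-- Near a regular point the projection is an open embedding. -/
lemma exists_chart {s : S} (hs : X.Regular s) : ∃ e : OpenPartialHomeomorph S ℂ,
    s ∈ e.source ∧ ∀ s' ∈ e.source, X.proj s' = X.proj s + e s' := by
  obtain ⟨e, m, h1, h2, h3, h4⟩ := X.local_form s
  have hm := h3 hs
  subst hm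
  exact ⟨e, h1, fun s' h' => by simpa using h4 s' h'⟩

lemma isLocalHomeomorphOn_proj : IsLocalHomeomorphOn X.proj {s | X.Regular s} := by
  refine IsLocalHomeomorphOn.mk _ _ fun s hs => ?_
  obtain ⟨e, h1, h2⟩ := X.exists_chart hs
  refine ⟨e.trans (Homeomorph.addLeft (X.proj s)).toOpenPartialHomeomorph, ?_, fun s' h' => ?_⟩
  · simpa using h1
  · have h'' : s' ∈ e.source := by simpa using h'
    simpa using h2 s' h''

/-- A fibre is compact by properness. It is discrete even over a branch point, because ζ^m vanishes
only at the centre of the chart. -/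
lemma finite_fiber (z : ℂ) : (X.proj ⁻¹' {z}).Finite := by
  have hc : IsCompact (X.proj ⁻¹' {z}) := X.isProperMap_proj.isCompact_preimage isCompact_singleton
  refine hc.finite ?_
  rw [isDiscrete_iff_nhdsWithin]
  intro s hs
  obtain ⟨e, m, h1, h2, h3, h4⟩ := X.local_form s
  refine le_antisymm ?_ (pure_le_nhdsWithin hs)
  rw [le_pure_iff]
  refine mem_nhdsWithin.2 ⟨e.source, e.open_source, h1, fun s' h' => ?_⟩
  have e1 := h4 s' h'.1
  have e0 := h4 s h1
  have h2' := h2.ne'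
  rw [show X.proj s' = X.proj s from h'.2.trans hs.symm] at e1
  have e1' : e s' = 0 := by simpa [h2'] using e1
  have e0' : e s = 0 := by simpa [h2'] using e0
  exact e.injOn h'.1 h1 (e1'.trans e0'.symm)

lemma isCoveringMapOn_proj : IsCoveringMapOn X.proj (Set.range X.branchPt)ᶜ :=
  IsClosedMap.isCoveringMapOn_of_isLocalHomeomorphOn X.isProperMap_proj.isClosedMap
    (fun z _ => X.finite_fiber z) X.isLocalHomeomorphOn_proj

/-- `Y` is a continuous section of the projection over `K`, off the branch points. -/
structure IsSection (Y : ℂ → S) (K : Set ℂ) : Prop where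
  continuousOn : ContinuousOn Y K
  proj_eq : ∀ z ∈ K, X.proj (Y z) = z
  notMem : ∀ z ∈ K, z ∉ Set.range X.branchPt

variable {X}

lemma IsSection.mono {Y : ℂ → S} {K K' : Set ℂ} (h : X.IsSection Y K) (hK : K' ⊆ K) :
    X.IsSection Y K' :=
  ⟨h.continuousOn.mono hK, fun z hz => h.proj_eq z (hK hz), fun z hz => h.notMem z (hK hz)⟩

lemma IsSection.regular {Y : ℂ → S} {K : Set ℂ} (h : X.IsSection Y K) {z : ℂ} (hz : z ∈ K) :
    X.Regular (Y z) := by rw [Regular, h.proj_eq z hz]; exact h.notMem z hz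

/-- Lifts through the projection which agree at a point agree near it. -/
lemma eventuallyEq_of_lift {A : Type*} [TopologicalSpace A] {f g : A → S} {a : A} {l : Filter A}
    (hf : Tendsto f l (𝓝 (f a))) (hg : Tendsto g l (𝓝 (f a))) (ha : X.Regular (f a))
    (hp : ∀ᶠ x in l, X.proj (f x) = X.proj (g x)) : f =ᶠ[l] g := by
  obtain ⟨e, h1, h2⟩ := X.exists_chart ha
  have hs := e.open_source.mem_nhds h1
  filter_upwards [hf hs, hg hs, hp] with x hx hx' hpx
  refine e.injOn hx hx' ?_
  have e1 := h2 _ hx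
  have e2 := h2 _ hx'
  rw [e1, e2] at hpx
  exact add_left_cancel hpx

/-- Lifts of a map on a preconnected set which agree at a point agree. -/
theorem eqOn_of_lift {A : Type*} [TopologicalSpace A] {f g : A → S} {K : Set A}
    (hK : IsPreconnected K) (hf : ContinuousOn f K) (hg : ContinuousOn g K)
    (hr : ∀ a ∈ K, X.Regular (f a)) (hp : ∀ a ∈ K, X.proj (f a) = X.proj (g a)) {a : A}
    (ha : a ∈ K) (hfg : f a = g a) : Set.EqOn f g K := by
  have hKp : PreconnectedSpace K := Subtype.preconnectedSpace hK
  have hf' : Continuous (fun x : K => f x) := continuousOn_iff_continuous_domRestrict.1 hf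
  have hg' : Continuous (fun x : K => g x) := continuousOn_iff_continuous_domRestrict.1 hg
  have hcl : IsClopen {x : K | f x = g x} := by
    refine ⟨isClosed_eq hf' hg', ?_⟩
    rw [isOpen_iff_mem_nhds]
    intro x hx
    have h2 := hg'.continuousAt (x := x)
    rw [ContinuousAt, ← show f x = g x from hx] at h2
    exact eventuallyEq_of_lift (X := X) (f := fun x : K => f x) (g := fun x : K => g x) (a := x)
      hf'.continuousAt h2 (hr x x.2) (Eventually.of_forall fun y => hp y y.2)
  have := hcl.eq_univ ⟨⟨a, ha⟩, hfg⟩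
  intro x hx
  have : (⟨x, hx⟩ : K) ∈ {x : K | f x = g x} := by rw [this]; trivial
  exact this

lemma IsSection.eqOn {Y Y' : ℂ → S} {K : Set ℂ} (h : X.IsSection Y K) (h' : X.IsSection Y' K)
    (hK : IsPreconnected K) {z : ℂ} (hz : z ∈ K) (hY : Y z = Y' z) : Set.EqOn Y Y' K :=
  eqOn_of_lift (X := X) hK h.continuousOn h'.continuousOn (fun _ ha => h.regular ha)
    (fun a ha => by rw [h.proj_eq a ha, h'.proj_eq a ha]) hz hY

/-- Sections exist over simply connected domains. -/
theorem exists_isSection {K : Set ℂ} (hK : IsOpen K) {b z : ℂ} (hs : StarConvex ℝ b K)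
    (hP : ∀ z ∈ K, z ∉ Set.range X.branchPt) (hz : z ∈ K) {s : S} (hsz : X.proj s = z) :
    ∃ Y, X.IsSection Y K ∧ Y z = s := by
  have := hs.contractibleSpace ⟨z, hz⟩
  have := hK.locallyPathConnectedSpace
  obtain ⟨f, ⟨h1, h2⟩, -⟩ := X.isCoveringMapOn_proj.existsUnique_continuousMap_lifts
    (A := K) ⟨Subtype.val, continuous_subtype_val⟩ (a₀ := ⟨z, hz⟩) (e₀ := s) hsz
    (fun a => hP a a.2)
  classical
  obtain ⟨Y, hY⟩ : ∃ Y : ℂ → S, ∀ z : K, Y z = f z :=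
    ⟨fun z => if hz : z ∈ K then f ⟨z, hz⟩ else s, by simp⟩
  refine ⟨Y, ⟨?_, fun z hz => ?_, hP⟩, by rw [← h1, ← hY]⟩
  · rw [continuousOn_iff_continuous_domRestrict]
    convert! map_continuous f
    ext z
    exact hY z
  · rw [hY ⟨z, hz⟩]
    exact congrFun h2 ⟨z, hz⟩

/-- The hypotheses on `u` are expressed through the chosen local inverse `sheet`. This transfers
them to any section. -/
lemma IsSection.eventuallyEq_sheet {Y : ℂ → S} {K : Set ℂ} (h : X.IsSection Y K) (hK : IsOpen K)
    {z : ℂ} (hz : z ∈ K) : Y =ᶠ[𝓝 z] X.sheet (Y z) := by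
  have hr := h.regular hz
  have h1 := X.eventually_proj_sheet hr
  rw [h.proj_eq z hz] at h1
  have hself := X.sheet_self hr
  rw [h.proj_eq z hz] at hself
  have hc := h1.self_of_nhds.2
  rw [ContinuousAt, hself] at hc
  refine eventuallyEq_of_lift (X := X) (a := z) (h.continuousOn.continuousAt (hK.mem_nhds hz))
    hc hr ?_
  filter_upwards [h1, hK.mem_nhds hz] with y hy hyK
  rw [hy.1, h.proj_eq y hyK]

/-! ### The wave field on a section -/

/-- The Wirtinger derivative `∂u` on the surface. -/
def gradZ (X : SommerfeldSurface S M N) (u : S → ℂ) (s : S) : ℂ :=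
  (X.grad u s 1 - Complex.I * X.grad u s Complex.I) / 2

/-- The Wirtinger derivative `∂̄u` on the surface. -/
def gradB (X : SommerfeldSurface S M N) (u : S → ℂ) (s : S) : ℂ :=
  (X.grad u s 1 + Complex.I * X.grad u s Complex.I) / 2

lemma grad_eq (u : S → ℂ) (s : S) : X.grad u s = wirtinger (X.gradZ u s) (X.gradB u s) :=
  eq_wirtinger _

lemma norm_gradZ_le (u : S → ℂ) (s : S) : ‖X.gradZ u s‖ ≤ ‖X.grad u s‖ := by
  have h1 := (X.grad u s).le_opNorm 1
  have h2 := (X.grad u s).le_opNorm Complex.I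
  have h3 := norm_sub_le (X.grad u s 1) (Complex.I * X.grad u s Complex.I)
  simp only [norm_mul, Complex.norm_I, one_mul, mul_one, norm_one] at h1 h2 h3
  rw [gradZ, norm_div, Complex.norm_ofNat]
  linarith

lemma norm_gradB_le (u : S → ℂ) (s : S) : ‖X.gradB u s‖ ≤ ‖X.grad u s‖ := by
  have h1 := (X.grad u s).le_opNorm 1
  have h2 := (X.grad u s).le_opNorm Complex.I
  have h3 := norm_add_le (X.grad u s 1) (Complex.I * X.grad u s Complex.I)
  simp only [norm_mul, Complex.norm_I, one_mul, mul_one, norm_one] at h1 h2 h3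
  rw [gradB, norm_div, Complex.norm_ofNat]
  linarith

end SommerfeldSurface

/-- A `C²` solution of the Helmholtz equation in the Wirtinger derivatives. -/
theorem isPlaneSolution_of_laplacian {k : ℂ} {f : ℂ → ℂ} {ζ : ℂ} (hf : ContDiffAt ℝ 2 f ζ)
    (h : Laplacian.laplacian f ζ + k ^ 2 * f ζ = 0) :
    HasFDerivAt f (wirtinger ((fderiv ℝ f ζ 1 - Complex.I * fderiv ℝ f ζ Complex.I) / 2)
      ((fderiv ℝ f ζ 1 + Complex.I * fderiv ℝ f ζ Complex.I) / 2)) ζ ∧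
    (∃ a, HasFDerivAt (fun y => (fderiv ℝ f y 1 - Complex.I * fderiv ℝ f y Complex.I) / 2)
      (wirtinger a (-(k ^ 2 / 4) * f ζ)) ζ) ∧
    ∃ b, HasFDerivAt (fun y => (fderiv ℝ f y 1 + Complex.I * fderiv ℝ f y Complex.I) / 2)
      (wirtinger (-(k ^ 2 / 4) * f ζ) b) ζ := by
  have hd : HasFDerivAt (fderiv ℝ f) (fderiv ℝ (fderiv ℝ f) ζ) ζ :=
    ((hf.fderiv_right (m := 1) (by norm_num)).differentiableAt (by norm_num)).hasFDerivAt
  set D := fderiv ℝ (fderiv ℝ f) ζ with hD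
  -- Symmetry of the second derivative makes both mixed Wirtinger derivatives equal to a quarter of
  -- the Laplacian.
  have hsymm : D 1 Complex.I = D Complex.I 1 :=
    (hf.isSymmSndFDerivAt (by simp)).eq 1 Complex.I
  have hlap : Laplacian.laplacian f ζ = D 1 1 + D Complex.I Complex.I := by
    rw [InnerProductSpace.laplacian_eq_iteratedFDeriv_complexPlane]
    simp [iteratedFDeriv_two_apply, hD]
  have h1 : HasFDerivAt (fun y => fderiv ℝ f y 1) (D.flip 1) ζ := by
    have := hd.clm_apply (hasFDerivAt_const (1 : ℂ) ζ)
    refine this.congr_fderiv ?_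
    ext v; simp
  have hI : HasFDerivAt (fun y => fderiv ℝ f y Complex.I) (D.flip Complex.I) ζ := by
    have := hd.clm_apply (hasFDerivAt_const (Complex.I : ℂ) ζ)
    refine this.congr_fderiv ?_
    ext v; simp
  refine ⟨?_, ?_, ?_⟩
  · rw [← eq_wirtinger]
    exact (hf.differentiableAt (by norm_num)).hasFDerivAt
  · have h2 := (h1.sub (hI.const_mul Complex.I)).mul_const (2⁻¹ : ℂ)
    set L := (2⁻¹ : ℂ) • (D.flip 1 - Complex.I • D.flip Complex.I) with hL
    refine ⟨(L 1 - Complex.I * L Complex.I) / 2, ?_⟩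
    have hq : (L 1 + Complex.I * L Complex.I) / 2 = -(k ^ 2 / 4) * f ζ := by
      simp only [hL, smul_apply, sub_apply,
        ContinuousLinearMap.flip_apply, smul_eq_mul]
      linear_combination (1 / 4 : ℂ) * h - (1 / 4 : ℂ) * hlap - (Complex.I / 4) * hsymm -
        (D Complex.I Complex.I) / 4 * Complex.I_sq
    rw [← hq, ← eq_wirtinger]
    simp only [div_eq_mul_inv]
    exact h2
  · have h2 := (h1.add (hI.const_mul Complex.I)).mul_const (2⁻¹ : ℂ)
    set L := (2⁻¹ : ℂ) • (D.flip 1 + Complex.I • D.flip Complex.I) with hL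
    refine ⟨(L 1 + Complex.I * L Complex.I) / 2, ?_⟩
    have hq : (L 1 - Complex.I * L Complex.I) / 2 = -(k ^ 2 / 4) * f ζ := by
      simp only [hL, smul_apply, add_apply,
        ContinuousLinearMap.flip_apply, smul_eq_mul]
      linear_combination (1 / 4 : ℂ) * h - (1 / 4 : ℂ) * hlap + (Complex.I / 4) * hsymm -
        (D Complex.I Complex.I) / 4 * Complex.I_sq
    rw [← hq, ← eq_wirtinger]
    simp only [div_eq_mul_inv]
    exact h2

namespace SommerfeldSurface

variable {S : Type*} [TopologicalSpace S] [T2Space S] {M N : ℕ} {X : SommerfeldSurface S M N}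

lemma IsSection.grad_eq_fderiv {Y : ℂ → S} {K : Set ℂ} (h : X.IsSection Y K) (hK : IsOpen K)
    {z : ℂ} (hz : z ∈ K) (u : S → ℂ) : X.grad u (Y z) = fderiv ℝ (fun y => u (Y y)) z := by
  rw [grad, h.proj_eq z hz]
  refine Filter.EventuallyEq.fderiv_eq ?_
  filter_upwards [h.eventuallyEq_sheet hK hz] with y hy
  rw [hy]

/-- On every section the wave field solves the Helmholtz equation of the plane. -/
theorem IsHelmholtz.isPlaneSolution {k : ℂ} {u : S → ℂ} (hu : X.IsHelmholtz k u) {Y : ℂ → S}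
    {K : Set ℂ} (h : X.IsSection Y K) (hK : IsOpen K) :
    IsPlaneSolution (k ^ 2 / 4) (fun z => u (Y z)) (fun z => X.gradZ u (Y z))
      (fun z => X.gradB u (Y z)) K := by
  intro z hz
  have he : (fun y => u (X.sheet (Y z) y)) =ᶠ[𝓝 z] fun y => u (Y y) := by
    filter_upwards [h.eventuallyEq_sheet hK hz] with y hy
    rw [hy]
  have hr := h.regular hz
  have h1 := hu.contDiffAt _ hr
  have h2 := hu.helmholtz _ hr
  rw [h.proj_eq z hz] at h1 h2
  rw [InnerProductSpace.laplacian_congr_nhds he |>.self_of_nhds] at h2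
  obtain ⟨k1, ⟨a, k2⟩, b, k3⟩ := isPlaneSolution_of_laplacian (h1.congr_of_eventuallyEq he.symm) h2
  have hZ : (fun y => X.gradZ u (Y y)) =ᶠ[𝓝 z] fun y => (fderiv ℝ (fun y => u (Y y)) y 1 -
      Complex.I * fderiv ℝ (fun y => u (Y y)) y Complex.I) / 2 := by
    filter_upwards [hK.mem_nhds hz] with y hy
    rw [gradZ, h.grad_eq_fderiv hK hy]
  have hB : (fun y => X.gradB u (Y y)) =ᶠ[𝓝 z] fun y => (fderiv ℝ (fun y => u (Y y)) y 1 +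
      Complex.I * fderiv ℝ (fun y => u (Y y)) y Complex.I) / 2 := by
    filter_upwards [hK.mem_nhds hz] with y hy
    rw [gradB, h.grad_eq_fderiv hK hy]
  refine ⟨?_, ⟨a, k2.congr_of_eventuallyEq hZ⟩, b, k3.congr_of_eventuallyEq hB⟩
  rw [hZ.self_of_nhds, hB.self_of_nhds]
  exact k1

end SommerfeldSurface

/-! ### The slit plane -/

/-- Off finitely many lines. -/
lemma exists_generic_base {E : Set ℂ} (hE : E.Finite) {O : Set ℂ} (hO : IsOpen O)
    (hne : O.Nonempty) :
    ∃ b ∈ O, b ∉ E ∧ ∀ p ∈ E, ∀ q ∈ E, p ≠ q → ((q - b) / (p - b)).im ≠ 0 := by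
  -- For each pair the excluded set is the line through `p` and `q`. Finitely many lines and points
  -- have dense complement.
  have key : ∀ p q : ℂ, p ≠ q → IsOpen {b : ℂ | ((b - p) / (q - p)).im ≠ 0} ∧
      Dense {b : ℂ | ((b - p) / (q - p)).im ≠ 0} := by
    intro p q hpq
    have hq : (q - p)⁻¹ ≠ 0 := inv_ne_zero (sub_ne_zero.2 hpq.symm)
    have hop : IsOpenMap fun b : ℂ => ((b - p) / (q - p)).im := by
      have h1 : IsOpenMap fun b : ℂ => (b - p) * (q - p)⁻¹ :=
        (Homeomorph.mulRight₀ _ hq).isOpenMap.comp (Homeomorph.subRight p).isOpenMap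
      simp only [div_eq_mul_inv]
      exact Complex.isOpenMap_im.comp h1
    refine ⟨?_, (dense_compl_singleton (0 : ℝ)).preimage hop⟩
    exact isOpen_compl_singleton.preimage
      (f := fun b : ℂ => ((b - p) / (q - p)).im) (by fun_prop)
  have h1 : Dense (Eᶜ) := hE.countable.dense_compl ℝ
  have h2 : Dense (⋂ r ∈ {r : ℂ × ℂ | r ∈ E ×ˢ E ∧ r.1 ≠ r.2},
      {b : ℂ | ((b - r.1) / (r.2 - r.1)).im ≠ 0}) :=
    dense_biInter_of_isOpen (fun r hr => (key r.1 r.2 hr.2).1)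
      (((hE.prod hE).subset fun r hr => hr.1).countable) fun r hr => (key r.1 r.2 hr.2).2
  have h3 := h2.inter_of_isOpen_right h1 hE.isClosed.isOpen_compl
  obtain ⟨b, hbO, hb, hbE⟩ := h3.inter_open_nonempty O hO hne
  refine ⟨b, hbO, hbE, fun p hp q hq hpq => ?_⟩
  have hb' : ((b - p) / (q - p)).im ≠ 0 := by
    have := Set.mem_iInter₂.1 hb (p, q) ⟨⟨hp, hq⟩, hpq⟩
    exact this
  have hpb : p - b ≠ 0 := sub_ne_zero.2 fun h => hbE (h ▸ hp)
  have hqp : q - p ≠ 0 := sub_ne_zero.2 hpq.symm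
  have e : (q - b) / (p - b) = 1 - ((b - p) / (q - p))⁻¹ := by
    have : b - p ≠ 0 := by rw [← neg_sub]; exact neg_ne_zero.2 hpb
    rw [inv_div, eq_sub_iff_add_eq, ← neg_sub p b, div_neg, ← sub_eq_add_neg, ← sub_div,
      div_eq_one_iff_eq hpb]
    ring
  rw [e, Complex.sub_im, Complex.one_im, zero_sub, neg_ne_zero, Complex.inv_im]
  refine div_ne_zero (neg_ne_zero.2 hb') ?_
  intro h0
  rw [Complex.normSq_eq_zero] at h0
  exact hb' (by rw [h0]; rfl)

namespace SommerfeldSurface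

variable {S : Type*} [TopologicalSpace S] [T2Space S] {M N : ℕ} (X : SommerfeldSurface S M N)

/-- A base point in the plane, seeing all branch points in different directions. -/
structure SlitSystem where
  /-- The base point. -/
  base : ℂ
  /-- The opening of the cones around the cuts. -/
  width : ℝ
  width_pos : 0 < width
  base_ne : ∀ j, base ≠ X.branchPt j
  -- A quantitative form of the requirement that no two branch points are collinear with the base
  -- point. It keeps the i-th cut out of the cone around the j-th.
  width_le : ∀ i j, i ≠ j →
    width * (|((X.branchPt i - base) / (X.branchPt j - base)).re| + 1) ≤
      |((X.branchPt i - base) / (X.branchPt j - base)).im|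

lemma exists_slitSystem {b : ℂ} (hb : b ∉ Set.range X.branchPt)
    (h : ∀ i j, i ≠ j → ((X.branchPt i - b) / (X.branchPt j - b)).im ≠ 0) :
    ∃ Θ : X.SlitSystem, Θ.base = b := by
  have key : ∀ᶠ w in 𝓝[>] (0 : ℝ), ∀ i j, i ≠ j →
      w * (|((X.branchPt i - b) / (X.branchPt j - b)).re| + 1) ≤
      |((X.branchPt i - b) / (X.branchPt j - b)).im| := by
    simp only [eventually_all]
    intro i j hij
    have hc : ContinuousAt
        (fun w : ℝ => w * (|((X.branchPt i - b) / (X.branchPt j - b)).re| + 1)) 0 := by fun_prop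
    have := hc.eventually (eventually_lt_nhds (b := |((X.branchPt i - b) / (X.branchPt j - b)).im|)
      (by simpa using h i j hij))
    exact (this.mono fun w hw => hw.le).filter_mono nhdsWithin_le_nhds
  obtain ⟨w, hw, hw0⟩ := (key.and self_mem_nhdsWithin).exists
  exact ⟨⟨b, w, hw0, fun j hj => hb ⟨j, hj.symm⟩, hw⟩, rfl⟩

variable {X}

namespace SlitSystem

variable (Θ : X.SlitSystem)

/-- The affine coordinate with `P_j` at the origin and the base point at `1`. -/
def coord (j : Fin N) (ζ : ℂ) : ℂ := (ζ - X.branchPt j) / (Θ.base - X.branchPt j)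

/-- The point with the given coordinate. -/
def point (j : Fin N) (c : ℂ) : ℂ := X.branchPt j + (Θ.base - X.branchPt j) * c

lemma base_sub_ne (j : Fin N) : Θ.base - X.branchPt j ≠ 0 := sub_ne_zero.2 (Θ.base_ne j)

@[simp] lemma coord_point (j : Fin N) (c : ℂ) : Θ.coord j (Θ.point j c) = c := by
  have := Θ.base_sub_ne j
  simp [coord, point, this]

lemma point_coord (j : Fin N) (ζ : ℂ) : Θ.point j (Θ.coord j ζ) = ζ := by
  have := Θ.base_sub_ne j
  rw [coord, point, mul_div_cancel₀ _ this]
  ring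

@[simp] lemma coord_base (j : Fin N) : Θ.coord j Θ.base = 1 := div_self (Θ.base_sub_ne j)

@[simp] lemma coord_branchPt (j : Fin N) : Θ.coord j (X.branchPt j) = 0 := by simp [coord]

@[fun_prop] lemma continuous_coord (j : Fin N) : Continuous (Θ.coord j) := by
  unfold coord; fun_prop

@[fun_prop] lemma continuous_point (j : Fin N) : Continuous (Θ.point j) := by
  unfold point; fun_prop

lemma coord_combo (j : Fin N) {a b : ℝ} (hab : a + b = 1) (p q : ℂ) :
    Θ.coord j (a • p + b • q) = a • Θ.coord j p + b • Θ.coord j q := by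
  have hab' : (a : ℂ) + b = 1 := by exact_mod_cast hab
  simp only [coord, Complex.real_smul]
  rw [mul_div_assoc', mul_div_assoc', ← add_div]
  congr 1
  linear_combination (X.branchPt j) * hab'

/-- The plane cut along the rays from the branch points away from the base point, and cones around
the cuts. -/
def dom : Option (Fin N) → Set ℂ
  | none => {ζ | ∀ j, Θ.coord j ζ ∈ Complex.slitPlane}
  -- The apex of this cone is the base point, at coordinate 1. The cone is truncated so that it
  -- starts beyond `P_j`.
  | some j => {ζ | (Θ.coord j ζ).re < 0 ∧
      |(Θ.coord j ζ).im| < Θ.width * (1 - (Θ.coord j ζ).re)}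

/-- The part of the cone on the left of the cut. -/
def up (j : Fin N) : Set ℂ := Θ.dom (some j) ∩ {ζ | 0 < (Θ.coord j ζ).im}

/-- The part of the cone on the right of the cut. -/
def low (j : Fin N) : Set ℂ := Θ.dom (some j) ∩ {ζ | (Θ.coord j ζ).im < 0}

lemma isOpen_dom (K : Option (Fin N)) : IsOpen (Θ.dom K) := by
  match K with
  | none =>
    simp only [dom, Set.ofPred_forall]
    exact isOpen_iInter_of_finite fun j =>
      Complex.isOpen_slitPlane.preimage (Θ.continuous_coord j)
  | some j =>
    have h1 : Continuous fun ζ => (Θ.coord j ζ).re := Complex.continuous_re.comp (by fun_prop)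
    have h2 : Continuous fun ζ => |(Θ.coord j ζ).im| :=
      (Complex.continuous_im.comp (by fun_prop)).abs
    exact (isOpen_lt h1 continuous_const).inter (isOpen_lt h2 (by fun_prop))

lemma isOpen_up (j : Fin N) : IsOpen (Θ.up j) := (Θ.isOpen_dom _).inter
  (isOpen_lt continuous_const (Complex.continuous_im.comp (Θ.continuous_coord j)))

lemma isOpen_low (j : Fin N) : IsOpen (Θ.low j) := (Θ.isOpen_dom _).inter
  (isOpen_lt (Complex.continuous_im.comp (Θ.continuous_coord j)) continuous_const)

lemma base_mem : Θ.base ∈ Θ.dom none := fun j => by simp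

lemma starConvex_dom : StarConvex ℝ Θ.base (Θ.dom none) := by
  intro ζ hζ a b ha hb hab j
  rw [Θ.coord_combo j hab, coord_base]
  exact Complex.starConvex_one_slitPlane (hζ j) ha hb hab

lemma convex_dom (j : Fin N) : Convex ℝ (Θ.dom (some j)) := by
  intro p hp q hq a b ha hb hab
  have h1 := hp.1
  have h2 := hq.1
  have h3 := abs_lt.1 hp.2
  have h4 := abs_lt.1 hq.2
  have hb' : b = 1 - a := by linarith
  simp only [dom, Set.mem_ofPred_eq, Θ.coord_combo j hab]
  simp only [Complex.real_smul, Complex.add_re,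
    Complex.re_ofReal_mul, Complex.add_im, Complex.im_ofReal_mul, abs_lt]
  rcases ha.eq_or_lt with h | h
  · have : b = 1 := by linarith
    subst h this
    simp only [zero_mul, zero_add, one_mul]
    exact ⟨h2, by linarith, by linarith⟩
  · have k1 := mul_pos h (neg_pos.2 h1)
    have k2 := mul_nonneg hb (neg_pos.2 h2).le
    have k3 := mul_pos h (sub_pos.2 h3.1)
    have k4 := mul_pos h (sub_pos.2 h3.2)
    have k5 := mul_nonneg hb (sub_pos.2 h4.1).le
    have k6 := mul_nonneg hb (sub_pos.2 h4.2).le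
    subst hb'
    refine ⟨by nlinarith, by nlinarith, by nlinarith⟩

lemma convex_up (j : Fin N) : Convex ℝ (Θ.up j) := by
  refine (Θ.convex_dom j).inter ?_
  intro p hp q hq a b ha hb hab
  simp only [Set.mem_ofPred_eq] at hp hq
  simp only [Set.mem_ofPred_eq, Θ.coord_combo j hab]
  simp only [Complex.real_smul, Complex.add_im, Complex.im_ofReal_mul]
  rcases ha.eq_or_lt with h | h
  · have : b = 1 := by linarith
    subst h this; simpa using hq
  · have := mul_pos h hp
    have := mul_nonneg hb hq.le
    linarith

lemma convex_low (j : Fin N) : Convex ℝ (Θ.low j) := by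
  refine (Θ.convex_dom j).inter ?_
  intro p hp q hq a b ha hb hab
  simp only [Set.mem_ofPred_eq] at hp hq
  simp only [Set.mem_ofPred_eq, Θ.coord_combo j hab]
  simp only [Complex.real_smul, Complex.add_im, Complex.im_ofReal_mul]
  rcases ha.eq_or_lt with h | h
  · have : b = 1 := by linarith
    subst h this; simpa using hq
  · have := mul_neg_of_pos_of_neg h hp
    have := mul_nonpos_of_nonneg_of_nonpos hb hq.le
    linarith

/-- A reference point on the left of the cut. -/
def upPt (j : Fin N) : ℂ := Θ.point j ⟨-1, Θ.width⟩

/-- A reference point on the right of the cut. -/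
def lowPt (j : Fin N) : ℂ := Θ.point j ⟨-1, -Θ.width⟩

lemma upPt_mem (j : Fin N) : Θ.upPt j ∈ Θ.up j := by
  have := Θ.width_pos
  refine ⟨⟨by simp [upPt], ?_⟩, by simpa [upPt] using this⟩
  simp only [upPt, coord_point, abs_of_pos this]
  linarith

lemma lowPt_mem (j : Fin N) : Θ.lowPt j ∈ Θ.low j := by
  have := Θ.width_pos
  refine ⟨⟨by simp [lowPt], ?_⟩, by simpa [lowPt] using this⟩
  simp only [lowPt, coord_point, abs_neg, abs_of_pos this]
  linarith

/-- A point of the i-th cut has the form base + (1 + τ)(P_i - base) with τ ≥ 0. By homogeneity, if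
it lay in the j-th cone, the direction of P_i would be closer to that of P_j than `width_le`
permits. -/
lemma coord_mem_slitPlane {i j : Fin N} (hij : i ≠ j) {ζ : ℂ} (hζ : ζ ∈ Θ.dom (some j)) :
    Θ.coord i ζ ∈ Complex.slitPlane := by
  by_contra hc
  rw [Complex.mem_slitPlane_iff, not_or, not_lt, not_not] at hc
  obtain ⟨h1, h2⟩ := hc
  set τ : ℝ := -(Θ.coord i ζ).re with hτ
  have hc' : Θ.coord i ζ = -(τ : ℂ) := by
    apply Complex.ext <;> simp [hτ, h2]
  have e1 : ζ = X.branchPt i + (Θ.base - X.branchPt i) * -(τ : ℂ) := by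
    rw [← hc']; exact (Θ.point_coord i ζ).symm
  have hj := Θ.base_sub_ne j
  have hj' : X.branchPt j - Θ.base ≠ 0 := by rw [← neg_sub]; exact neg_ne_zero.2 hj
  have e2 : Θ.coord j ζ =
      1 - ((1 + τ : ℝ) : ℂ) * ((X.branchPt i - Θ.base) / (X.branchPt j - Θ.base)) := by
    rw [coord, e1, eq_sub_iff_add_eq, ← neg_sub (X.branchPt j) Θ.base, div_neg, mul_div_assoc',
      neg_add_eq_sub, ← sub_div, div_eq_one_iff_eq hj']
    push_cast
    ring
  have hw := Θ.width_le i j hij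
  have hw0 := Θ.width_pos
  obtain ⟨-, h4⟩ := hζ
  rw [e2] at h4
  set w := (X.branchPt i - Θ.base) / (X.branchPt j - Θ.base)
  have hτ0 : 0 ≤ τ := by linarith
  simp only [Complex.sub_im, Complex.one_im, Complex.im_ofReal_mul, zero_sub, abs_neg, abs_mul,
    Complex.sub_re, Complex.one_re, Complex.re_ofReal_mul, sub_sub_cancel,
    abs_of_nonneg (by linarith : 0 ≤ 1 + τ)] at h4
  have h5 : |w.im| < Θ.width * w.re := by
    have : (1 + τ) * |w.im| < (1 + τ) * (Θ.width * w.re) := by linarith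
    exact lt_of_mul_lt_mul_left this (by linarith)
  have h6 := mul_le_mul_of_nonneg_left (le_abs_self w.re) hw0.le
  linarith

lemma mem_dom_none {j : Fin N} {ζ : ℂ} (hζ : ζ ∈ Θ.dom (some j)) (h : (Θ.coord j ζ).im ≠ 0) :
    ζ ∈ Θ.dom none := by
  intro i
  rcases eq_or_ne i j with rfl | hij
  · exact Complex.mem_slitPlane_iff.2 (Or.inr h)
  · exact Θ.coord_mem_slitPlane hij hζ

lemma up_subset (j : Fin N) : Θ.up j ⊆ Θ.dom none := fun _ h => Θ.mem_dom_none h.1 h.2.ne'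

lemma low_subset (j : Fin N) : Θ.low j ⊆ Θ.dom none := fun _ h => Θ.mem_dom_none h.1 h.2.ne

lemma mem_up_or_low {j : Fin N} {ζ : ℂ} (hζ : ζ ∈ Θ.dom (some j)) (h : ζ ∈ Θ.dom none) :
    ζ ∈ Θ.up j ∨ ζ ∈ Θ.low j := by
  have h1 := Complex.mem_slitPlane_iff.1 (h j)
  rcases h1 with h1 | h1
  · exact absurd h1 hζ.1.not_gt
  · rcases lt_or_gt_of_ne h1 with h | h
    · exact Or.inr ⟨hζ, h⟩
    · exact Or.inl ⟨hζ, h⟩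

/-- Different cones overlap only off all cuts, so every change of chart can be made through the slit
plane. -/
lemma inter_subset {i j : Fin N} (hij : i ≠ j) {ζ : ℂ} (hi : ζ ∈ Θ.dom (some i))
    (hj : ζ ∈ Θ.dom (some j)) : ζ ∈ Θ.dom none := by
  intro l
  rcases eq_or_ne l i with rfl | h
  · exact Θ.coord_mem_slitPlane hij hj
  · exact Θ.coord_mem_slitPlane h hi

lemma notMem_of_mem_dom {K : Option (Fin N)} {ζ : ℂ} (hζ : ζ ∈ Θ.dom K) :
    ζ ∉ Set.range X.branchPt := by
  rintro ⟨i, rfl⟩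
  match K with
  | none => simpa using hζ i
  | some j =>
    rcases eq_or_ne i j with rfl | hij
    · simpa using hζ.1
    · simpa using Θ.coord_mem_slitPlane hij hζ

lemma exists_mem_dom {ζ : ℂ} (hζ : ζ ∉ Set.range X.branchPt) : ∃ K, ζ ∈ Θ.dom K := by
  by_cases h : ζ ∈ Θ.dom none
  · exact ⟨none, h⟩
  · simp only [dom, Set.mem_ofPred_eq, not_forall] at h
    obtain ⟨j, hj⟩ := h
    rw [Complex.mem_slitPlane_iff, not_or, not_lt, not_not] at hj
    have hre : (Θ.coord j ζ).re ≠ 0 := by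
      intro h0
      have hc : Θ.coord j ζ = 0 := Complex.ext h0 hj.2
      exact hζ ⟨j, by rw [← Θ.point_coord j ζ, hc]; simp [point]⟩
    have hlt := lt_of_le_of_ne hj.1 hre
    refine ⟨some j, hlt, ?_⟩
    rw [hj.2, abs_zero]
    exact mul_pos Θ.width_pos (by linarith)

/-! ### The sheets -/

lemma exists_sec (K : Option (Fin N)) {z : ℂ} (hz : z ∈ Θ.dom K) {s : S} (hs : X.proj s = z) :
    ∃ Y, X.IsSection Y (Θ.dom K) ∧ Y z = s := by
  match K with
  | none =>
    exact exists_isSection (Θ.isOpen_dom none) Θ.starConvex_dom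
      (fun _ h => Θ.notMem_of_mem_dom h) hz hs
  | some j =>
    exact exists_isSection (Θ.isOpen_dom _) ((Θ.convex_dom j).starConvex hz)
      (fun _ h => Θ.notMem_of_mem_dom h) hz hs

lemma isPreconnected_dom (K : Option (Fin N)) : IsPreconnected (Θ.dom K) := by
  match K with
  | none => exact (Θ.starConvex_dom.isPathConnected Θ.base_mem).isConnected.isPreconnected
  | some j => exact (Θ.convex_dom j).isPreconnected

/-- The points of the surface over the base point. -/
abbrev Fiber : Type _ := X.proj ⁻¹' {Θ.base}

/-- The sheet over the slit plane through a point of the base fibre. -/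
def secBase (s : Θ.Fiber) : ℂ → S := (Θ.exists_sec none Θ.base_mem s.2).choose

lemma isSection_secBase (s : Θ.Fiber) : X.IsSection (Θ.secBase s) (Θ.dom none) :=
  (Θ.exists_sec none Θ.base_mem s.2).choose_spec.1

lemma secBase_base (s : Θ.Fiber) : Θ.secBase s Θ.base = s :=
  (Θ.exists_sec none Θ.base_mem s.2).choose_spec.2

lemma exists_secBase {z : ℂ} (hz : z ∈ Θ.dom none) {s : S} (hs : X.proj s = z) :
    ∃ s', Θ.secBase s' z = s := by
  obtain ⟨Y, hY, hYz⟩ := Θ.exists_sec none hz hs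
  refine ⟨⟨Y Θ.base, hY.proj_eq _ Θ.base_mem⟩, ?_⟩
  rw [← hYz]
  exact (Θ.isSection_secBase _).eqOn hY (Θ.isPreconnected_dom none) Θ.base_mem
    (Θ.secBase_base _) hz

lemma secBase_injective {z : ℂ} (hz : z ∈ Θ.dom none) {s s' : Θ.Fiber}
    (h : Θ.secBase s z = Θ.secBase s' z) : s = s' := by
  have := (Θ.isSection_secBase s).eqOn (Θ.isSection_secBase s') (Θ.isPreconnected_dom none) hz h
    Θ.base_mem
  rw [secBase_base, secBase_base] at this
  exact Subtype.ext this

/-- The sheets over the slit plane and over the cones. -/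
def sec : Option (Fin N) → Θ.Fiber → ℂ → S
  | none, s => Θ.secBase s
  -- A sheet over a cone gets its label from its left side. The transition on the left is then the
  -- identity, and the one on the right is the permutation.
  | some j, s => (Θ.exists_sec (some j) (Θ.upPt_mem j).1
      ((Θ.isSection_secBase s).proj_eq _ (Θ.up_subset j (Θ.upPt_mem j)))).choose

lemma isSection_sec (K : Option (Fin N)) (s : Θ.Fiber) : X.IsSection (Θ.sec K s) (Θ.dom K) := by
  match K with
  | none => exact Θ.isSection_secBase s
  | some j =>
    exact (Θ.exists_sec (some j) (Θ.upPt_mem j).1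
      ((Θ.isSection_secBase s).proj_eq _ (Θ.up_subset j (Θ.upPt_mem j)))).choose_spec.1

lemma sec_base (s : Θ.Fiber) : Θ.sec none s Θ.base = s := Θ.secBase_base s

lemma sec_eq_up (j : Fin N) (s : Θ.Fiber) :
    Set.EqOn (Θ.sec (some j) s) (Θ.sec none s) (Θ.up j) :=
  ((Θ.isSection_sec (some j) s).mono Set.inter_subset_left).eqOn
    ((Θ.isSection_sec none s).mono (Θ.up_subset j)) (Θ.convex_up j).isPreconnected (Θ.upPt_mem j)
    (Θ.exists_sec (some j) (Θ.upPt_mem j).1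
      ((Θ.isSection_secBase s).proj_eq _ (Θ.up_subset j (Θ.upPt_mem j)))).choose_spec.2

lemma sec_none_injective {z : ℂ} (hz : z ∈ Θ.dom none) {s s' : Θ.Fiber}
    (h : Θ.sec none s z = Θ.sec none s' z) : s = s' := Θ.secBase_injective hz h

instance : Finite Θ.Fiber := X.finite_fiber _

/-- Continuing a sheet through the cone and reading off its label on the right is injective, since
continuing back recovers the sheet; the fibre is finite. -/
lemma exists_perm (j : Fin N) : ∃ σ : Equiv.Perm Θ.Fiber, ∀ s,
    Θ.sec none (σ s) (Θ.lowPt j) = Θ.sec (some j) s (Θ.lowPt j) := by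
  have hl := Θ.lowPt_mem j
  choose f hf using fun s : Θ.Fiber => Θ.exists_secBase (Θ.low_subset j hl)
    ((Θ.isSection_sec (some j) s).proj_eq _ hl.1)
  have hinj : Function.Injective f := by
    intro s s' h
    have h1 : Θ.sec (some j) s (Θ.lowPt j) = Θ.sec (some j) s' (Θ.lowPt j) := by
      rw [← hf s, ← hf s', h]
    have h2 := (Θ.isSection_sec (some j) s).eqOn (Θ.isSection_sec (some j) s')
      (Θ.isPreconnected_dom _) hl.1 h1 (Θ.upPt_mem j).1
    rw [Θ.sec_eq_up j s (Θ.upPt_mem j), Θ.sec_eq_up j s' (Θ.upPt_mem j)] at h2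
    exact Θ.sec_none_injective (Θ.up_subset j (Θ.upPt_mem j)) h2
  exact ⟨Equiv.ofBijective f (Finite.injective_iff_bijective.1 hinj), hf⟩

/-- The permutation of the sheets across the cut. -/
def perm (j : Fin N) : Equiv.Perm Θ.Fiber := (Θ.exists_perm j).choose

lemma sec_eq_low (j : Fin N) (s : Θ.Fiber) :
    Set.EqOn (Θ.sec (some j) s) (Θ.sec none (Θ.perm j s)) (Θ.low j) :=
  ((Θ.isSection_sec (some j) s).mono Set.inter_subset_left).eqOn
    ((Θ.isSection_sec none _).mono (Θ.low_subset j)) (Θ.convex_low j).isPreconnected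
    (Θ.lowPt_mem j) ((Θ.exists_perm j).choose_spec s).symm

lemma exists_sec_eq {K : Option (Fin N)} {z : ℂ} (hz : z ∈ Θ.dom K) {s : S} (hs : X.proj s = z) :
    ∃ s', Θ.sec K s' z = s := by
  match K with
  | none => exact Θ.exists_secBase hz hs
  | some j =>
    obtain ⟨Y, hY, hYz⟩ := Θ.exists_sec (some j) hz hs
    have hu := Θ.upPt_mem j
    obtain ⟨s', hs'⟩ := Θ.exists_secBase (Θ.up_subset j hu) (hY.proj_eq _ hu.1)
    refine ⟨s', ?_⟩
    rw [← hYz]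
    refine (Θ.isSection_sec _ s').eqOn hY (Θ.isPreconnected_dom _) hu.1 ?_ hz
    rw [Θ.sec_eq_up j s' hu]
    exact hs'

/-! ### Riemann primitives on the sheets -/

variable (k : ℂ) (u : S → ℂ)

/-- The wave field on a sheet. -/
def field (K : Option (Fin N)) (s : Θ.Fiber) (z : ℂ) : ℂ := u (Θ.sec K s z)

/-- The primitive of Riemann's form on the slit plane, zero at the base point. -/
def primBase (s : Θ.Fiber) (x : ℂ × ℂ) (ζ : ℂ) : ℂ :=
  segPrimitive (riemannP (k ^ 2 / 4) (Θ.field u none s) (fun z => X.gradZ u (Θ.sec none s z)) x)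
    (riemannQ (k ^ 2 / 4) (Θ.field u none s) (fun z => X.gradB u (Θ.sec none s z)) x) Θ.base ζ

/-- The primitives of Riemann's form on the sheets. -/
def prim : Option (Fin N) → Θ.Fiber → ℂ × ℂ → ℂ → ℂ
  | none, s, x, ζ => Θ.primBase k u s x ζ
  -- The integration constant makes this primitive agree with the one on the slit plane at the
  -- reference point on the left.
  | some j, s, x, ζ =>
    segPrimitive (riemannP (k ^ 2 / 4) (Θ.field u (some j) s)
        (fun z => X.gradZ u (Θ.sec (some j) s z)) x)
      (riemannQ (k ^ 2 / 4) (Θ.field u (some j) s) (fun z => X.gradB u (Θ.sec (some j) s z)) x)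
      (Θ.upPt j) ζ + Θ.primBase k u s x (Θ.upPt j)

/-- The jump of the primitive across the cut. -/
def jump (j : Fin N) (s : Θ.Fiber) (x : ℂ × ℂ) : ℂ :=
  Θ.prim k u (some j) s x (Θ.lowPt j) - Θ.prim k u none (Θ.perm j s) x (Θ.lowPt j)

variable {k u} (hu : X.IsHelmholtz k u)
include hu

lemma isPlaneSolution (K : Option (Fin N)) (s : Θ.Fiber) :
    IsPlaneSolution (k ^ 2 / 4) (Θ.field u K s) (fun z => X.gradZ u (Θ.sec K s z))
      (fun z => X.gradB u (Θ.sec K s z)) (Θ.dom K) :=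
  hu.isPlaneSolution (Θ.isSection_sec K s) (Θ.isOpen_dom K)

lemma isRiemannPrimitive (K : Option (Fin N)) (s : Θ.Fiber) :
    IsRiemannPrimitive (k ^ 2 / 4) (Θ.field u K s) (fun z => X.gradZ u (Θ.sec K s z))
      (fun z => X.gradB u (Θ.sec K s z)) (Θ.prim k u K s) (Θ.dom K) := by
  have h0 : IsRiemannPrimitive (k ^ 2 / 4) (Θ.field u none s)
      (fun z => X.gradZ u (Θ.sec none s z)) (fun z => X.gradB u (Θ.sec none s z))
      (Θ.prim k u none s) (Θ.dom none) := by
    have := (Θ.isPlaneSolution hu none s).isRiemannPrimitive (Θ.isOpen_dom none) Θ.starConvex_dom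
      (C := fun _ => 0) (differentiable_const _)
    simp only [add_zero] at this
    exact this
  match K with
  | none => exact h0
  | some j =>
    exact (Θ.isPlaneSolution hu (some j) s).isRiemannPrimitive (Θ.isOpen_dom _)
      ((Θ.convex_dom j).starConvex (Θ.upPt_mem j).1)
      (h0.differentiable _ (Θ.up_subset j (Θ.upPt_mem j)))

lemma differentiable_jump (j : Fin N) (s : Θ.Fiber) : Differentiable ℂ (Θ.jump k u j s) :=
  ((Θ.isRiemannPrimitive hu (some j) s).differentiable _ (Θ.lowPt_mem j).1).sub
    ((Θ.isRiemannPrimitive hu none _).differentiable _ (Θ.low_subset j (Θ.lowPt_mem j)))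

lemma prim_eq_up (j : Fin N) (s : Θ.Fiber) (x : ℂ × ℂ) :
    Set.EqOn (Θ.prim k u (some j) s x) (Θ.prim k u none s x) (Θ.up j) := by
  have h1 := fun ζ (hζ : ζ ∈ Θ.up j) =>
    (Θ.isRiemannPrimitive hu (some j) s).hasFDerivAt x ζ hζ.1
  have h2 := fun ζ (hζ : ζ ∈ Θ.up j) =>
    (Θ.isRiemannPrimitive hu none s).hasFDerivAt x ζ (Θ.up_subset j hζ)
  refine (Θ.isOpen_up j).eqOn_of_fderiv_eq (𝕜 := ℝ) (Θ.convex_up j).isPreconnected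
    (fun ζ hζ => (h1 ζ hζ).differentiableAt.differentiableWithinAt)
    (fun ζ hζ => (h2 ζ hζ).differentiableAt.differentiableWithinAt) (fun ζ hζ => ?_)
    (Θ.upPt_mem j) ?_
  · rw [(h1 ζ hζ).fderiv, (h2 ζ hζ).fderiv]
    simp only [riemannP, riemannQ, field, Θ.sec_eq_up j s hζ]
  · simp only [prim, segPrimitive_self, zero_add]

/-- Both sides are primitives of the same form on a convex set, so their difference does not depend
on ζ. The jump is thus a function of x alone. -/
lemma prim_eq_low (j : Fin N) (s : Θ.Fiber) (x : ℂ × ℂ) {ζ : ℂ} (hζ : ζ ∈ Θ.low j) :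
    Θ.prim k u (some j) s x ζ = Θ.prim k u none (Θ.perm j s) x ζ + Θ.jump k u j s x := by
  have h1 := fun ζ (hζ : ζ ∈ Θ.low j) =>
    (Θ.isRiemannPrimitive hu (some j) s).hasFDerivAt x ζ hζ.1
  have h2 := fun ζ (hζ : ζ ∈ Θ.low j) =>
    ((Θ.isRiemannPrimitive hu none (Θ.perm j s)).hasFDerivAt x ζ (Θ.low_subset j hζ)).add_const
      (Θ.jump k u j s x)
  refine (Θ.isOpen_low j).eqOn_of_fderiv_eq (𝕜 := ℝ) (Θ.convex_low j).isPreconnected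
    (fun ζ hζ => (h1 ζ hζ).differentiableAt.differentiableWithinAt)
    (fun ζ hζ => (h2 ζ hζ).differentiableAt.differentiableWithinAt) (fun ζ hζ => ?_)
    (Θ.lowPt_mem j) ?_ hζ
  · rw [(h1 ζ hζ).fderiv, (h2 ζ hζ).fderiv]
    simp only [riemannP, riemannQ, field, Θ.sec_eq_low j s hζ]
  · simp only [jump]; ring

end SlitSystem

end SommerfeldSurface

/-! ### Circles of small energy -/

/-- A density of finite mass near `P` has small mean on suitable small circles around `P`. -/
theorem exists_circle_lintegral_le {g : ℂ → ENNReal} (hg : Measurable g) {P w : ℂ} (hw : ‖w‖ = 1)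
    {ε : ℝ} (hε : 0 < ε) (hfin : ∫⁻ z in Metric.ball P ε, g z < ⊤) {δ : ℝ} (hδ : 0 < δ) :
    ∃ r ∈ Set.Ioo 0 ε, ENNReal.ofReal (r ^ 2) * ∫⁻ t in Set.Ioo (0 : ℝ) 1,
      g (P + r * w * Complex.exp (2 * Real.pi * Complex.I * (t : ℂ))) ≤ ENNReal.ofReal δ := by
  -- If every circle violated the bound, integration in polar coordinates would bound the mass below
  -- by the integral of 2πδ/r over (0, ε), which diverges.
  by_contra! hcon
  set G : ℂ → ENNReal := (Metric.ball P ε).indicator g with hG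
  have hGm : Measurable G := hg.indicator measurableSet_ball
  -- The rotation by -w matches the polar angle φ in (-π, π) with the parameter of a circle starting
  -- in the direction `w`, through φ = -π + 2πt.
  set F : ℂ → ENNReal := fun z => G (P + w * -z) with hF
  have hFm : Measurable F := hGm.comp (by fun_prop)
  have hw' : -w ∈ Submonoid.unitSphere ℂ := by
    simp [Submonoid.unitSphere, hw]
  have hFint : ∫⁻ z, F z = ∫⁻ z in Metric.ball P ε, g z := by
    have h1 : ∀ z, F z = G (P + rotation ⟨-w, hw'⟩ z) := by
      intro z
      have : rotation ⟨-w, hw'⟩ z = -w * z := rfl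
      rw [this, hF]
      simp
    simp only [h1]
    rw [(rotation ⟨-w, hw'⟩).measurePreserving.lintegral_comp
      (f := fun z => G (P + z)) (hGm.comp (by fun_prop)), lintegral_add_left_eq_self,
      hG, lintegral_indicator measurableSet_ball]
  have hpolar := Complex.lintegral_comp_polarCoord_symm F
  rw [hFint, polarCoord_target] at hpolar
  have hms : Measurable fun p : ℝ × ℝ => ENNReal.ofReal p.1 • F (Complex.polarCoord.symm p) := by
    have : Measurable fun p : ℝ × ℝ => Complex.polarCoord.symm p := by
      simp only [Complex.polarCoord_symm_apply]
      fun_prop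
    exact (Measurable.ennreal_ofReal measurable_fst).mul (hFm.comp this)
  rw [Measure.volume_eq_prod, ← Measure.prod_restrict, lintegral_prod _ hms.aemeasurable] at hpolar
  have hang : ∀ r ∈ Set.Ioo 0 ε, ∫⁻ φ in Set.Ioo (-Real.pi) Real.pi,
      F (Complex.polarCoord.symm (r, φ)) = ENNReal.ofReal (2 * Real.pi) *
        ∫⁻ t in Set.Ioo (0 : ℝ) 1,
          g (P + r * w * Complex.exp (2 * Real.pi * Complex.I * (t : ℂ))) := by
    intro r hr
    have himg : (fun t : ℝ => -Real.pi + 2 * Real.pi * t) '' Set.Ioo 0 1 =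
        Set.Ioo (-Real.pi) Real.pi := by
      have hpi := Real.pi_pos
      ext y
      constructor
      · rintro ⟨t, ht, rfl⟩
        have := mul_pos hpi ht.1
        have := mul_pos hpi (sub_pos.2 ht.2)
        exact ⟨by simp only; linarith, by simp only; linarith⟩
      · intro hy
        refine ⟨(y + Real.pi) / (2 * Real.pi), ⟨?_, ?_⟩, ?_⟩
        · have := hy.1; exact div_pos (by linarith) (by linarith)
        · have := hy.2; rw [div_lt_one (by linarith)]; linarith
        · field_simp; ring
    rw [← himg, lintegral_image_eq_lintegral_abs_deriv_mul measurableSet_Ioo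
      (f' := fun _ => 2 * Real.pi)]
    · rw [← lintegral_const_mul]
      · refine setLIntegral_congr_fun measurableSet_Ioo fun t ht => ?_
        simp only [abs_of_pos Real.two_pi_pos]
        congr 1
        have e1 : Complex.polarCoord.symm (r, -Real.pi + 2 * Real.pi * t) =
            -(r * Complex.exp (2 * Real.pi * Complex.I * (t : ℂ))) := by
          rw [Complex.polarCoord_symm_apply]
          simp only [Complex.ofReal_cos, Complex.ofReal_sin]
          rw [Complex.cos_add_sin_I]
          rw [show ((-Real.pi + 2 * Real.pi * t : ℝ) : ℂ) * Complex.I =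
            -(Real.pi * Complex.I) + 2 * Real.pi * Complex.I * t by push_cast; ring,
            Complex.exp_add, Complex.exp_neg, Complex.exp_pi_mul_I]
          ring
        rw [hF]
        simp only [e1, neg_neg]
        rw [show P + w * (r * Complex.exp (2 * Real.pi * Complex.I * (t : ℂ))) =
          P + r * w * Complex.exp (2 * Real.pi * Complex.I * (t : ℂ)) by ring]
        refine Set.indicator_of_mem ?_ _
        rw [Metric.mem_ball, dist_eq_norm, add_sub_cancel_left, norm_mul, norm_mul, hw,
          norm_exp_two_pi_mul_I, mul_one, mul_one, Complex.norm_real, Real.norm_eq_abs,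
          abs_of_pos hr.1]
        exact hr.2
      · exact hg.comp (by fun_prop)
    · intro t _
      have : HasDerivAt (fun t : ℝ => -Real.pi + 2 * Real.pi * t) (2 * Real.pi) t := by
        simpa using ((hasDerivAt_id t).const_mul (2 * Real.pi)).const_add (-Real.pi)
      exact this.hasDerivWithinAt
    · intro t _ t' _ h
      have hpi := Real.pi_pos
      simpa [hpi.ne'] using h
  have hlow : ∫⁻ r in Set.Ioo 0 ε, ENNReal.ofReal (2 * Real.pi * δ * r⁻¹) ≤
      ∫⁻ z in Metric.ball P ε, g z := by
    rw [← hpolar]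
    refine le_trans ?_ (lintegral_mono_set (Set.Ioo_subset_Ioi_self : Set.Ioo 0 ε ⊆ _))
    refine setLIntegral_mono' measurableSet_Ioo fun r hr => ?_
    have hr0 := hr.1
    simp only [smul_eq_mul]
    have hFr : Measurable fun φ : ℝ => F (Complex.polarCoord.symm (r, φ)) := by
      simp only [Complex.polarCoord_symm_apply]
      exact hFm.comp (by fun_prop)
    rw [lintegral_const_mul _ hFr, hang r hr]
    have h1 := (hcon r hr).le
    have h2 : ENNReal.ofReal (2 * Real.pi * δ * r⁻¹) =
        ENNReal.ofReal (2 * Real.pi * r⁻¹) * ENNReal.ofReal δ := by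
      rw [← ENNReal.ofReal_mul (by positivity)]
      congr 1; ring
    rw [h2]
    refine (mul_le_mul_right h1 _).trans ?_
    rw [← mul_assoc, ← mul_assoc, ← ENNReal.ofReal_mul (by positivity),
      ← ENNReal.ofReal_mul hr0.le]
    rw [show 2 * Real.pi * r⁻¹ * r ^ 2 = r * (2 * Real.pi) by field_simp]
  have hnot : ∫⁻ r in Set.Ioo 0 ε, ENNReal.ofReal (2 * Real.pi * δ * r⁻¹) = ⊤ := by
    by_contra hne
    have hI : IntegrableOn (fun r : ℝ => 2 * Real.pi * δ * r⁻¹) (Set.Ioo 0 ε) := by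
      refine ⟨by fun_prop, ?_⟩
      rw [hasFiniteIntegral_iff_ofReal]
      · exact lt_top_iff_ne_top.2 hne
      · refine (ae_restrict_iff' measurableSet_Ioo).2 (Eventually.of_forall fun r hr => ?_)
        have := hr.1
        simp only [Pi.zero_apply]
        positivity
    have hI' : IntegrableOn (fun r : ℝ => r⁻¹) (Set.Ioo 0 ε) := by
      have := hI.const_mul (2 * Real.pi * δ)⁻¹
      refine this.congr (Eventually.of_forall fun r => ?_)
      have := Real.pi_pos.ne'
      simp only
      rw [← mul_assoc, inv_mul_cancel₀ (by positivity), one_mul]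
    have h3 : IntervalIntegrable (fun r : ℝ => r⁻¹) volume 0 ε :=
      (intervalIntegrable_iff_integrableOn_Ioo_of_le hε.le).2 hI'
    rw [intervalIntegrable_inv_iff] at h3
    rcases h3 with h3 | h3
    · exact hε.ne h3
    · exact h3 Set.left_mem_uIcc
  rw [hnot] at hlow
  exact absurd hfin (by simpa using hlow)

namespace SommerfeldSurface

variable {S : Type*} [TopologicalSpace S] [T2Space S] {M N : ℕ} {X : SommerfeldSurface S M N}

/-! ### Riemann's form on the surface -/

/-- Riemann's form on the surface, in the Cartesian coordinates of the sheet. -/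
def riemannForm (X : SommerfeldSurface S M N) (k : ℂ) (u : S → ℂ) (x : ℂ × ℂ) (s : S) :
    ℂ →L[ℝ] ℂ :=
  wirtinger
    (besselE (k ^ 2 / 4) (sqDist x (X.proj s)) * X.gradZ u s -
      u s * (besselE' (k ^ 2 / 4) (sqDist x (X.proj s)) * (conj (X.proj s) - charW x)))
    (u s * (besselE' (k ^ 2 / 4) (sqDist x (X.proj s)) * (X.proj s - charZ x)) -
      besselE (k ^ 2 / 4) (sqDist x (X.proj s)) * X.gradB u s)

lemma IsSection.riemannForm_eq {Y : ℂ → S} {K : Set ℂ} (h : X.IsSection Y K) {ζ : ℂ} (hζ : ζ ∈ K)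
    (k : ℂ) (u : S → ℂ) (x : ℂ × ℂ) : X.riemannForm k u x (Y ζ) =
      wirtinger (riemannP (k ^ 2 / 4) (fun z => u (Y z)) (fun z => X.gradZ u (Y z)) x ζ)
        (riemannQ (k ^ 2 / 4) (fun z => u (Y z)) (fun z => X.gradB u (Y z)) x ζ) := by
  simp only [riemannForm, riemannP, riemannQ, h.proj_eq ζ hζ]

lemma Regular.exists_local_section {s : S} (hs : X.Regular s) : ∃ (K : Set ℂ) (Y : ℂ → S),
    IsOpen K ∧ X.proj s ∈ K ∧ X.IsSection Y K ∧ ∀ᶠ s' in 𝓝 s, s' = Y (X.proj s') := by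
  obtain ⟨ε, hε, hb⟩ := Metric.isOpen_iff.1 X.isOpen_compl_range_branchPt _ hs
  have hm := Metric.mem_ball_self (x := X.proj s) hε
  obtain ⟨Y, hY, hYs⟩ := exists_isSection (X := X) Metric.isOpen_ball
    ((convex_ball (X.proj s) ε).starConvex hm) (fun z hz => hb hz) hm (s := s) rfl
  refine ⟨_, Y, Metric.isOpen_ball, hm, hY, ?_⟩
  have hc : ContinuousAt (fun s' => Y (X.proj s')) s :=
    ContinuousAt.comp (hY.continuousOn.continuousAt (Metric.isOpen_ball.mem_nhds hm))
      X.continuous_proj.continuousAt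
  rw [ContinuousAt, hYs] at hc
  refine eventuallyEq_of_lift (X := X) (f := fun s' => s') (a := s) tendsto_id hc hs ?_
  filter_upwards [X.continuous_proj.continuousAt.eventually (Metric.isOpen_ball.mem_nhds hm)]
    with s' hs'
  rw [hY.proj_eq _ hs']

/-! ### Continuity of the gradient and of Riemann's form at regular points. -/

section Helmholtz

variable {k : ℂ} {u : S → ℂ} (hu : X.IsHelmholtz k u) {s : S} (hs : X.Regular s)
include hu hs

lemma IsHelmholtz.continuousAt_gradZ : ContinuousAt (X.gradZ u) s := by
  obtain ⟨K, Y, hK, hm, hY, he⟩ := hs.exists_local_section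
  refine ContinuousAt.congr (f := fun s' => X.gradZ u (Y (X.proj s'))) ?_ ?_
  · exact ContinuousAt.comp (g := fun z => X.gradZ u (Y z))
      ((hu.isPlaneSolution hY hK).continuousOn_z.continuousAt (hK.mem_nhds hm))
      X.continuous_proj.continuousAt
  · filter_upwards [he] with s' h'
    rw [← h']

lemma IsHelmholtz.continuousAt_gradB : ContinuousAt (X.gradB u) s := by
  obtain ⟨K, Y, hK, hm, hY, he⟩ := hs.exists_local_section
  refine ContinuousAt.congr (f := fun s' => X.gradB u (Y (X.proj s'))) ?_ ?_
  · exact ContinuousAt.comp (g := fun z => X.gradB u (Y z))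
      ((hu.isPlaneSolution hY hK).continuousOn_b.continuousAt (hK.mem_nhds hm))
      X.continuous_proj.continuousAt
  · filter_upwards [he] with s' h'
    rw [← h']

lemma IsHelmholtz.continuousAt_riemannForm (x : ℂ × ℂ) :
    ContinuousAt (X.riemannForm k u x) s := by
  have h1 := hu.continuousAt_gradZ hs
  have h2 := hu.continuousAt_gradB hs
  have h3 := hu.continuous.continuousAt (x := s)
  have h4 : ContinuousAt X.proj s := X.continuous_proj.continuousAt
  have h5 : ContinuousAt (fun s => sqDist x (X.proj s)) s :=
    (continuous_sqDist.comp (continuous_const.prodMk X.continuous_proj)).continuousAt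
  have h6 := (continuous_besselE (k ^ 2 / 4)).continuousAt.comp h5
  have h7 := (continuous_besselE' (k ^ 2 / 4)).continuousAt.comp h5
  have h8 : ContinuousAt (fun s => conj (X.proj s)) s :=
    (Complex.continuous_conj.comp X.continuous_proj).continuousAt
  exact (((h6.mul h1).sub (h3.mul (h7.mul (h8.sub continuousAt_const)))).smul
    continuousAt_const).add (((h3.mul (h7.mul (h4.sub continuousAt_const))).sub
      (h6.mul h2)).smul continuousAt_const)

end Helmholtz

lemma exists_norm_le_of_continuous {f : ℂ → ℂ} (hf : Continuous f) {B : Set ℂ}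
    (hB : Bornology.IsBounded B) : ∃ C : ℝ, ∀ ζ ∈ B, ‖f ζ‖ ≤ C := by
  obtain ⟨C, hC⟩ := hB.isCompact_closure.exists_bound_of_continuousOn hf.continuousOn
  exact ⟨C, fun ζ hζ => hC ζ (subset_closure hζ)⟩

lemma exists_riemann_coeff_bound (κ : ℂ) (x : ℂ × ℂ) {B : Set ℂ} (hB : Bornology.IsBounded B) :
    ∃ C1 C2 C3 : ℝ, ∀ ζ ∈ B, ‖besselE κ (sqDist x ζ)‖ ≤ C1 ∧
      ‖besselE' κ (sqDist x ζ) * (conj ζ - charW x)‖ ≤ C2 ∧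
      ‖besselE' κ (sqDist x ζ) * (ζ - charZ x)‖ ≤ C3 := by
  have hcq : Continuous fun ζ => sqDist x ζ :=
    Continuous.comp (g := fun p : (ℂ × ℂ) × ℂ => sqDist p.1 p.2) (f := fun ζ => (x, ζ))
      continuous_sqDist (continuous_const.prodMk continuous_id)
  have c1 : Continuous fun ζ => besselE κ (sqDist x ζ) := (continuous_besselE _).comp hcq
  have c2 : Continuous fun ζ => besselE' κ (sqDist x ζ) := (continuous_besselE' _).comp hcq
  have c3 : Continuous fun ζ => conj ζ - charW x := Complex.continuous_conj.sub continuous_const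
  have c4 : Continuous fun ζ => ζ - charZ x := continuous_id.sub continuous_const
  obtain ⟨C1, h1⟩ := exists_norm_le_of_continuous c1 hB
  obtain ⟨C2, h2⟩ := exists_norm_le_of_continuous (c2.mul c3) hB
  obtain ⟨C3, h3⟩ := exists_norm_le_of_continuous (c2.mul c4) hB
  exact ⟨C1, C2, C3, fun ζ hζ => ⟨h1 ζ hζ, h2 ζ hζ, h3 ζ hζ⟩⟩

/-- On bounded sets Riemann's form is controlled by the energy density. -/
lemma exists_norm_riemannForm_le (k : ℂ) (u : S → ℂ) (x : ℂ × ℂ) {B : Set ℂ}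
    (hB : Bornology.IsBounded B) : ∃ C, 0 ≤ C ∧ ∀ s, X.proj s ∈ B →
      ‖X.riemannForm k u x s‖ ≤ C * (‖X.grad u s‖ + ‖u s‖) := by
  obtain ⟨C1, C2, C3, hC⟩ := exists_riemann_coeff_bound (k ^ 2 / 4) x hB
  refine ⟨2 * |C1| + |C2| + |C3|, by positivity, fun s hs => ?_⟩
  obtain ⟨h1, h2, h3⟩ := hC _ hs
  refine (norm_wirtinger_le _ _).trans ?_
  have k1 := h1.trans (le_abs_self C1)
  have k2 := h2.trans (le_abs_self C2)
  have k3 := h3.trans (le_abs_self C3)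
  have m1 : ‖besselE (k ^ 2 / 4) (sqDist x (X.proj s)) * X.gradZ u s‖ ≤ |C1| * ‖X.grad u s‖ := by
    rw [norm_mul]
    exact mul_le_mul k1 (norm_gradZ_le u s) (norm_nonneg _) (abs_nonneg _)
  have m2 : ‖besselE (k ^ 2 / 4) (sqDist x (X.proj s)) * X.gradB u s‖ ≤ |C1| * ‖X.grad u s‖ := by
    rw [norm_mul]
    exact mul_le_mul k1 (norm_gradB_le u s) (norm_nonneg _) (abs_nonneg _)
  have m3 : ‖u s * (besselE' (k ^ 2 / 4) (sqDist x (X.proj s)) * (conj (X.proj s) - charW x))‖ ≤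
      ‖u s‖ * |C2| := by
    rw [norm_mul]
    exact mul_le_mul_of_nonneg_left k2 (norm_nonneg _)
  have m4 : ‖u s * (besselE' (k ^ 2 / 4) (sqDist x (X.proj s)) * (X.proj s - charZ x))‖ ≤
      ‖u s‖ * |C3| := by
    rw [norm_mul]
    exact mul_le_mul_of_nonneg_left k3 (norm_nonneg _)
  refine (add_le_add (norm_sub_le _ _) (norm_sub_le _ _)).trans ?_
  refine (add_le_add (add_le_add m1 m3) (add_le_add m4 m2)).trans ?_
  have p1 := mul_nonneg (abs_nonneg C1) (norm_nonneg (u s))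
  have p2 := mul_nonneg (abs_nonneg C2) (norm_nonneg (X.grad u s))
  have p3 := mul_nonneg (abs_nonneg C3) (norm_nonneg (X.grad u s))
  linarith

namespace SlitSystem

variable (Θ : X.SlitSystem)

/-! ### Small circles around a branch point -/

/-- Discs around `P_j` of radius less than `R`, in the coordinate at `P_j`, meet no other cut. -/
def IsSmall (j : Fin N) (R : ℝ) : Prop :=
  0 < R ∧ R ≤ Θ.width ∧ ∀ c : ℂ, ‖c‖ < R → ∀ i, i ≠ j →
    Θ.coord i (Θ.point j c) ∈ Complex.slitPlane

lemma coord_branchPt_mem {i j : Fin N} (hij : i ≠ j) :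
    Θ.coord i (X.branchPt j) ∈ Complex.slitPlane := by
  have hw := Θ.width_le j i hij.symm
  have hw0 := Θ.width_pos
  have hi := Θ.base_sub_ne i
  have hi' : X.branchPt i - Θ.base ≠ 0 := by rw [← neg_sub]; exact neg_ne_zero.2 hi
  have e : Θ.coord i (X.branchPt j) =
      1 - (X.branchPt j - Θ.base) / (X.branchPt i - Θ.base) := by
    rw [coord, eq_sub_iff_add_eq, ← neg_sub (X.branchPt i) Θ.base, div_neg,
      neg_add_eq_sub, ← sub_div, div_eq_one_iff_eq hi']
    ring
  rw [e, Complex.mem_slitPlane_iff]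
  right
  simp only [Complex.sub_im, Complex.one_im, zero_sub, neg_ne_zero]
  intro h0
  rw [h0, abs_zero] at hw
  have : 0 < Θ.width * (|((X.branchPt j - Θ.base) / (X.branchPt i - Θ.base)).re| + 1) := by
    positivity
  linarith

lemma eventually_isSmall (j : Fin N) : ∀ᶠ R in 𝓝[>] (0 : ℝ), Θ.IsSmall j R := by
  have h1 : ∀ᶠ c in 𝓝 (0 : ℂ), ∀ i, i ≠ j → Θ.coord i (Θ.point j c) ∈ Complex.slitPlane := by
    simp only [eventually_all]
    intro i hij
    have hc : ContinuousAt (fun c => Θ.coord i (Θ.point j c)) 0 := by fun_prop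
    refine hc.eventually (Complex.isOpen_slitPlane.mem_nhds ?_)
    have : Θ.point j 0 = X.branchPt j := by simp [point]
    simp only [this]
    exact Θ.coord_branchPt_mem hij
  obtain ⟨ε, hε, hb⟩ := Metric.eventually_nhds_iff.1 h1
  filter_upwards [Ioo_mem_nhdsGT (lt_min hε Θ.width_pos)] with R hR
  refine ⟨hR.1, (hR.2.trans_le (min_le_right _ _)).le, fun c hc => hb ?_⟩
  rw [dist_zero_right]
  exact hc.trans (hR.2.trans_le (min_le_left _ _))

variable {Θ}

lemma IsSmall.mem_dom_none {j : Fin N} {R : ℝ} (h : Θ.IsSmall j R) {c : ℂ} (hc : ‖c‖ < R)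
    (hs : c ∈ Complex.slitPlane) : Θ.point j c ∈ Θ.dom none := by
  intro i
  rcases eq_or_ne i j with rfl | hij
  · simpa using hs
  · exact h.2.2 c hc i hij

lemma IsSmall.mem_dom_some {j : Fin N} {R : ℝ} (h : Θ.IsSmall j R) {c : ℂ} (hc : ‖c‖ < R)
    (hs : c.re < 0) : Θ.point j c ∈ Θ.dom (some j) := by
  have hw := Θ.width_pos
  simp only [dom, Set.mem_ofPred_eq, coord_point]
  refine ⟨hs, ?_⟩
  have h1 := (Complex.abs_im_le_norm c).trans_lt (hc.trans_le h.2.1)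
  have h2 := mul_pos hw (neg_pos.2 hs)
  linarith

end SlitSystem

/-- Parametrisation of the circle by the distance from the cut. -/
lemma exists_cut_param {c : ℂ} (hc : c ∈ Complex.slitPlane) : ∃ τ ∈ Set.Ioo (0 : ℝ) 1,
    ∀ t : ℝ, c * Complex.exp (2 * Real.pi * Complex.I * (t : ℂ)) =
      (‖c‖ : ℂ) * ⟨-Real.cos (2 * Real.pi * (t - τ)), -Real.sin (2 * Real.pi * (t - τ))⟩ := by
  have hpi := Real.pi_pos
  have h1 := Complex.neg_pi_lt_arg c
  have h2 := lt_of_le_of_ne (Complex.arg_le_pi c) (Complex.mem_slitPlane_iff_arg.1 hc).1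
  -- The time τ at which the argument arg c + 2πτ reaches π, where the circle meets the cut. It is
  -- interior to (0, 1) as |arg c| < π.
  refine ⟨1 / 2 - c.arg / (2 * Real.pi), ⟨?_, ?_⟩, fun t => ?_⟩
  · have : c.arg / (2 * Real.pi) < 1 / 2 := by rw [div_lt_iff₀ (by linarith)]; linarith
    linarith
  · have : -(1 / 2) < c.arg / (2 * Real.pi) := by rw [lt_div_iff₀ (by linarith)]; linarith
    linarith
  · have e0 : (⟨-Real.cos (2 * Real.pi * (t - (1 / 2 - c.arg / (2 * Real.pi)))),
        -Real.sin (2 * Real.pi * (t - (1 / 2 - c.arg / (2 * Real.pi))))⟩ : ℂ) =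
        Complex.exp ((c.arg + 2 * Real.pi * t : ℝ) * Complex.I) := by
      have e : 2 * Real.pi * (t - (1 / 2 - c.arg / (2 * Real.pi))) =
          (c.arg + 2 * Real.pi * t) - Real.pi := by field_simp; ring
      rw [e, Real.cos_sub_pi, Real.sin_sub_pi, neg_neg, neg_neg]
      apply Complex.ext
      · rw [Complex.exp_ofReal_mul_I_re]
      · rw [Complex.exp_ofReal_mul_I_im]
    rw [e0]
    conv_lhs => rw [← Complex.norm_mul_exp_arg_mul_I c]
    rw [mul_assoc, ← Complex.exp_add]
    congr 2
    push_cast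
    ring

/-- The circle meets the negative axis only when the cosine is 1, and within less than one turn this
happens only at `x = 0`. -/
lemma cut_param_mem_slitPlane {ρ x : ℝ} (hρ : 0 < ρ) (h0 : x ≠ 0) (h1 : -1 < x) (h2 : x < 1) :
    (ρ : ℂ) * ⟨-Real.cos (2 * Real.pi * x), -Real.sin (2 * Real.pi * x)⟩ ∈
      Complex.slitPlane := by
  have hpi := Real.pi_pos
  rw [Complex.mem_slitPlane_iff, Complex.re_ofReal_mul, Complex.im_ofReal_mul]
  by_contra hcon
  rw [not_or, not_lt, not_not] at hcon
  obtain ⟨hre, him⟩ := hcon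
  have hsin : Real.sin (2 * Real.pi * x) = 0 := by simpa [hρ.ne'] using him
  have hcos : 0 ≤ Real.cos (2 * Real.pi * x) := by
    simp only at hre
    by_contra hneg
    push Not at hneg
    nlinarith
  have hcos1 : Real.cos (2 * Real.pi * x) = 1 := by
    nlinarith [Real.sin_sq_add_cos_sq (2 * Real.pi * x)]
  rw [Real.cos_eq_one_iff_of_lt_of_lt (by nlinarith) (by nlinarith)] at hcos1
  have : x = 0 := by simpa [hpi.ne'] using hcos1
  exact h0 this

namespace SlitSystem

variable {Θ : X.SlitSystem}

/-- The lift of a small circle around `P_j`, together with the primitive of Riemann's form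
along it. -/
theorem IsSmall.exists_circle_lift {j : Fin N} {R : ℝ} (h : Θ.IsSmall j R) {c : ℂ}
    (hc : ‖c‖ < R) (hs : c ∈ Complex.slitPlane) (s : Θ.Fiber) :
    ∃ Γ : ℝ → S, Γ 0 = Θ.sec none s (Θ.point j c) ∧
      Γ 1 = Θ.sec none (Θ.perm j s) (Θ.point j c) ∧
      (∀ t ∈ Set.Icc (0 : ℝ) 1, ContinuousAt Γ t ∧ X.Regular (Γ t) ∧
        X.proj (Γ t) = Θ.point j (c * Complex.exp (2 * Real.pi * Complex.I * (t : ℂ)))) ∧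
      (∀ᵐ t : ℝ, t ∈ Set.Icc (0 : ℝ) 1 → X.proj (Γ t) ∈ Θ.dom none) ∧
      ∀ k u, X.IsHelmholtz k u → ∀ x, ∃ H : ℝ → ℂ,
        H 0 = Θ.prim k u none s x (Θ.point j c) ∧
        H 1 = Θ.prim k u none (Θ.perm j s) x (Θ.point j c) + Θ.jump k u j s x ∧
        ∀ t ∈ Set.Icc (0 : ℝ) 1, HasDerivAt H (X.riemannForm k u x (Γ t)
          ((Θ.base - X.branchPt j) * (c * (2 * Real.pi * Complex.I *
            Complex.exp (2 * Real.pi * Complex.I * (t : ℂ)))))) t := by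
  obtain ⟨τ, hτ, hpar⟩ := exists_cut_param hs
  have hρ : 0 < ‖c‖ := norm_pos_iff.2 (Complex.slitPlane_ne_zero hs)
  set E : ℝ → ℂ := fun t => c * Complex.exp (2 * Real.pi * Complex.I * (t : ℂ)) with hE
  have hEn : ∀ t, ‖E t‖ < R := fun t => by
    rw [hE]; simp only [norm_mul, norm_exp_two_pi_mul_I, mul_one]; exact hc
  set γ : ℝ → ℂ := fun t => Θ.point j (E t) with hγ
  have hγc : Continuous γ := by
    have : Continuous E := by fun_prop
    exact (Θ.continuous_point j).comp this
  have hγd : ∀ t : ℝ, HasDerivAt γ ((Θ.base - X.branchPt j) * (c * (2 * Real.pi * Complex.I *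
      Complex.exp (2 * Real.pi * Complex.I * (t : ℂ))))) t := by
    intro t
    have h1 : HasDerivAt (fun t : ℝ => 2 * Real.pi * Complex.I * (t : ℂ))
        (2 * Real.pi * Complex.I) t := by
      simpa using (Complex.ofRealCLM.hasDerivAt (x := t)).const_mul (2 * Real.pi * Complex.I)
    refine (((h1.cexp.const_mul c).const_mul (Θ.base - X.branchPt j)).const_add
      (X.branchPt j)).congr_deriv ?_
    ring
  have hD : ∀ t, t ≠ τ → t ∈ Set.Ioo (τ - 1) (τ + 1) → γ t ∈ Θ.dom none := by
    intro t hne ht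
    refine h.mem_dom_none (hEn t) ?_
    rw [hE]; simp only [hpar]
    exact cut_param_mem_slitPlane hρ (sub_ne_zero.2 hne) (by linarith [ht.1]) (by linarith [ht.2])
  have hpi := Real.pi_pos
  -- Within a quarter turn of the crossing the coordinate has negative real part, so the small
  -- circle lies in the cone.
  have hN : ∀ t ∈ Set.Ioo (τ - 1 / 4) (τ + 1 / 4), γ t ∈ Θ.dom (some j) := by
    intro t ht
    refine h.mem_dom_some (hEn t) ?_
    rw [hE]; simp only [hpar, Complex.re_ofReal_mul]
    have : 0 < Real.cos (2 * Real.pi * (t - τ)) :=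
      Real.cos_pos_of_mem_Ioo ⟨by nlinarith [ht.1], by nlinarith [ht.2]⟩
    nlinarith
  have hup : ∀ t ∈ Set.Ioo (τ - 1 / 4) τ, γ t ∈ Θ.up j := by
    intro t ht
    refine ⟨hN t ⟨ht.1, by linarith [ht.2]⟩, ?_⟩
    simp only [hγ, Set.mem_ofPred_eq, coord_point]
    rw [hE]; simp only [hpar, Complex.im_ofReal_mul]
    have : Real.sin (2 * Real.pi * (t - τ)) < 0 :=
      Real.sin_neg_of_neg_of_neg_pi_lt (by nlinarith [ht.2]) (by nlinarith [ht.1])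
    nlinarith
  have hlow : ∀ t ∈ Set.Ioo τ (τ + 1 / 4), γ t ∈ Θ.low j := by
    intro t ht
    refine ⟨hN t ⟨by linarith [ht.1], ht.2⟩, ?_⟩
    simp only [hγ, Set.mem_ofPred_eq, coord_point]
    rw [hE]; simp only [hpar, Complex.im_ofReal_mul]
    have : 0 < Real.sin (2 * Real.pi * (t - τ)) :=
      Real.sin_pos_of_pos_of_lt_pi (by nlinarith [ht.1]) (by nlinarith [ht.2])
    nlinarith
  -- An anticlockwise circle crosses the cut from left to right, so the lift passes from the sheet
  -- `s` to `perm j s`. Near τ it coincides with the sheet over the cone, which gives continuity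
  -- there.
  set Γ : ℝ → S := fun t => if t < τ then Θ.sec none s (γ t) else
    if τ < t then Θ.sec none (Θ.perm j s) (γ t) else Θ.sec (some j) s (γ t) with hΓ
  have hcases : ∀ t ∈ Set.Icc (0 : ℝ) 1, ∃ K s', γ t ∈ Θ.dom K ∧
      (Γ =ᶠ[𝓝 t] fun t => Θ.sec K s' (γ t)) ∧ ∀ k u, X.IsHelmholtz k u → ∀ x, ∃ a,
      (fun t => if t < τ then Θ.prim k u none s x (γ t) else
        if τ < t then Θ.prim k u none (Θ.perm j s) x (γ t) + Θ.jump k u j s x else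
          Θ.prim k u (some j) s x (γ t)) =ᶠ[𝓝 t] fun t => Θ.prim k u K s' x (γ t) + a := by
    intro t ht
    rcases lt_trichotomy t τ with hlt | rfl | hgt
    · refine ⟨none, s, hD t hlt.ne ⟨by linarith [ht.1, hτ.2], by linarith⟩, ?_,
        fun k u hu x => ⟨0, ?_⟩⟩ <;> filter_upwards [Iio_mem_nhds hlt] with t' ht'
      · simp only [hΓ, if_pos (show t' < τ from ht')]
      · simp only [if_pos (show t' < τ from ht'), add_zero]
    · have hnhds := Ioo_mem_nhds (show t - 1 / 4 < t by linarith) (show t < t + 1 / 4 by linarith)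
      refine ⟨some j, s, hN t ⟨by linarith, by linarith⟩, ?_, fun k u hu x => ⟨0, ?_⟩⟩ <;>
        filter_upwards [hnhds] with t' ht'
      · rcases lt_trichotomy t' t with h1 | h1 | h1
        · simp only [hΓ, if_pos h1]
          exact (Θ.sec_eq_up j s (hup t' ⟨ht'.1, h1⟩)).symm
        · simp only [hΓ, h1, lt_irrefl, if_false]
        · simp only [hΓ, if_neg h1.not_gt, if_pos h1]
          exact (Θ.sec_eq_low j s (hlow t' ⟨h1, ht'.2⟩)).symm
      · rcases lt_trichotomy t' t with h1 | h1 | h1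
        · simp only [if_pos h1, add_zero]
          exact (Θ.prim_eq_up hu j s x (hup t' ⟨ht'.1, h1⟩)).symm
        · simp only [h1, lt_irrefl, if_false, add_zero]
        · simp only [if_neg h1.not_gt, if_pos h1, add_zero]
          exact (Θ.prim_eq_low hu j s x (hlow t' ⟨h1, ht'.2⟩)).symm
    · refine ⟨none, Θ.perm j s, hD t hgt.ne' ⟨by linarith, by linarith [ht.2, hτ.1]⟩, ?_,
        fun k u hu x => ⟨Θ.jump k u j s x, ?_⟩⟩ <;> filter_upwards [Ioi_mem_nhds hgt] with t' ht'
      · simp only [hΓ, if_neg (show τ < t' from ht').not_gt, if_pos (show τ < t' from ht')]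
      · simp only [if_neg (show τ < t' from ht').not_gt, if_pos (show τ < t' from ht')]
  have hγ0 : γ 0 = Θ.point j c := by simp [hγ, hE]
  have hγ1 : γ 1 = Θ.point j c := by
    simp only [hγ, hE, Complex.ofReal_one, mul_one, Complex.exp_two_pi_mul_I]
  refine ⟨Γ, ?_, ?_, fun t ht => ?_, ?_, fun k u hu x => ⟨fun t => if t < τ then
    Θ.prim k u none s x (γ t) else if τ < t then Θ.prim k u none (Θ.perm j s) x (γ t) +
      Θ.jump k u j s x else Θ.prim k u (some j) s x (γ t), ?_, ?_, fun t ht => ?_⟩⟩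
  · simp only [hΓ, if_pos hτ.1, hγ0]
  · simp only [hΓ, if_neg hτ.2.not_gt, if_pos hτ.2, hγ1]
  · obtain ⟨K, s', hm, he, -⟩ := hcases t ht
    have hsec := Θ.isSection_sec K s'
    refine ⟨?_, ?_, ?_⟩
    · refine ContinuousAt.congr ?_ he.symm
      exact ContinuousAt.comp (hsec.continuousOn.continuousAt ((Θ.isOpen_dom K).mem_nhds hm))
        hγc.continuousAt
    · rw [he.self_of_nhds]; exact hsec.regular hm
    · rw [he.self_of_nhds]; exact hsec.proj_eq _ hm
  · have hae : ∀ᵐ t : ℝ, t ≠ τ := by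
      rw [ae_iff]; simp
    filter_upwards [hae] with t htne ht
    have hm := hD t htne ⟨by linarith [ht.1, hτ.2], by linarith [ht.2, hτ.1]⟩
    obtain ⟨K, s', hm', he, -⟩ := hcases t ht
    rw [he.self_of_nhds, (Θ.isSection_sec K s').proj_eq _ hm']
    exact hm
  · simp only [if_pos hτ.1, hγ0]
  · simp only [if_neg hτ.2.not_gt, if_pos hτ.2, hγ1]
  · obtain ⟨K, s', hm, he, hH⟩ := hcases t ht
    obtain ⟨a, ha⟩ := hH k u hu x
    refine HasDerivAt.congr_of_eventuallyEq ?_ ha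
    rw [he.self_of_nhds, (Θ.isSection_sec K s').riemannForm_eq hm]
    exact (((Θ.isRiemannPrimitive hu K s').hasFDerivAt x _ hm).comp_hasDerivAt t
      (hγd t)).add_const a

end SlitSystem

end SommerfeldSurface

namespace SommerfeldSurface

variable {S : Type*} [TopologicalSpace S] [T2Space S] {M N : ℕ} {X : SommerfeldSurface S M N}

namespace SlitSystem

variable (Θ : X.SlitSystem)

/-! ### The jumps around a branch point cancel -/

lemma measurable_energy {k : ℂ} {u : S → ℂ} (hu : X.IsHelmholtz k u) (s : Θ.Fiber) :
    Measurable ((Θ.dom none).indicator fun z =>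
      ‖X.grad u (Θ.sec none s z)‖ₑ ^ 2 + ‖u (Θ.sec none s z)‖ₑ ^ 2) := by
  classical
  rw [← Set.piecewise_eq_indicator]
  refine ContinuousOn.measurable_piecewise ?_ continuousOn_const (Θ.isOpen_dom none).measurableSet
  have hsol := Θ.isPlaneSolution hu none s
  have h1 : ContinuousOn (fun z => X.grad u (Θ.sec none s z)) (Θ.dom none) := by
    simp only [grad_eq]
    exact (hsol.continuousOn_z.smul continuousOn_const).add
      (hsol.continuousOn_b.smul continuousOn_const)
  have h2 : ContinuousOn (fun z => u (Θ.sec none s z)) (Θ.dom none) := hsol.continuousOn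
  have e1 := (ENNReal.continuous_pow 2).comp_continuousOn h1.enorm
  have e2 := (ENNReal.continuous_pow 2).comp_continuousOn h2.enorm
  exact e1.add e2

lemma sum_energy_le [Fintype Θ.Fiber] (u : S → ℂ) {z : ℂ} (hz : z ∈ Θ.dom none) :
    ∑ s : Θ.Fiber, (‖X.grad u (Θ.sec none s z)‖ₑ ^ 2 + ‖u (Θ.sec none s z)‖ₑ ^ 2) ≤
      ∑' s : X.proj ⁻¹' {z}, (‖X.grad u s‖ₑ ^ 2 + ‖u s‖ₑ ^ 2) := by
  rw [← tsum_fintype (L := SummationFilter.unconditional _)]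
  have hinj : Function.Injective fun s : Θ.Fiber =>
      (⟨Θ.sec none s z, (Θ.isSection_sec none s).proj_eq z hz⟩ : X.proj ⁻¹' {z}) := by
    intro s s' h
    exact Θ.sec_none_injective hz (congrArg Subtype.val h)
  exact ENNReal.tsum_comp_le_tsum_of_injective hinj
    (fun s : X.proj ⁻¹' {z} => ‖X.grad u s‖ₑ ^ 2 + ‖u s‖ₑ ^ 2)

/-- A weighted form of 2xy ≤ x² + y², used in place of the Cauchy–Schwarz inequality to pass from
the energy to the integral of Riemann's form. -/
lemma mul_le_add_sq_div {a r δ : ℝ} (hδ : 0 < δ) : a * r ≤ δ + r ^ 2 * a ^ 2 / δ := by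
  have h : 0 ≤ (a * r - δ) ^ 2 / δ := by positivity
  have e : (a * r - δ) ^ 2 / δ = r ^ 2 * a ^ 2 / δ - 2 * (a * r) + δ := by
    field_simp
    ring
  have h2 : 0 ≤ r ^ 2 * a ^ 2 / δ := by positivity
  rw [e] at h
  nlinarith

/-- A circle integral of Riemann's form is small when the energy on the circle is. -/
lemma norm_sub_le_of_energy {k : ℂ} {u : S → ℂ} (hu : X.IsHelmholtz k u) {x : ℂ × ℂ}
    {Γ : ℝ → S} {H v : ℝ → ℂ} {C r δ : ℝ} (hC : 0 ≤ C) (hr : 0 < r) (hδ : 0 < δ)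
    (hΓ : ∀ t ∈ Set.Icc (0 : ℝ) 1, ContinuousAt Γ t ∧ X.Regular (Γ t))
    (hv : Continuous v) (hvn : ∀ t, ‖v t‖ = 2 * Real.pi * r)
    (hH : ∀ t ∈ Set.Icc (0 : ℝ) 1, HasDerivAt H (X.riemannForm k u x (Γ t) (v t)) t)
    (hW : ∀ t ∈ Set.Icc (0 : ℝ) 1,
      ‖X.riemannForm k u x (Γ t)‖ ≤ C * (‖X.grad u (Γ t)‖ + ‖u (Γ t)‖))
    (hE : ENNReal.ofReal (r ^ 2) * ∫⁻ t in Set.Ioo (0 : ℝ) 1,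
      (‖X.grad u (Γ t)‖ₑ ^ 2 + ‖u (Γ t)‖ₑ ^ 2) ≤ ENNReal.ofReal (δ ^ 2)) :
    ‖H 1 - H 0‖ ≤ 6 * Real.pi * C * δ := by
  have hpi := Real.pi_pos
  have cg : ContinuousOn (fun t => X.grad u (Γ t)) (Set.Icc 0 1) := fun t ht => by
    obtain ⟨h1, h2⟩ := hΓ t ht
    have c1 := ContinuousAt.comp (f := Γ) (hu.continuousAt_gradZ h2) h1
    have c2 := ContinuousAt.comp (f := Γ) (hu.continuousAt_gradB h2) h1
    simp only [grad_eq]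
    exact ((c1.smul continuousAt_const).add (c2.smul continuousAt_const)).continuousWithinAt
  have cu : ContinuousOn (fun t => u (Γ t)) (Set.Icc 0 1) := fun t ht =>
    (ContinuousAt.comp (f := Γ) hu.continuous.continuousAt (hΓ t ht).1).continuousWithinAt
  have cW : ContinuousOn (fun t => X.riemannForm k u x (Γ t) (v t)) (Set.Icc 0 1) := by
    refine ContinuousOn.clm_apply (fun t ht => ?_) hv.continuousOn
    obtain ⟨h1, h2⟩ := hΓ t ht
    exact (ContinuousAt.comp (f := Γ) (hu.continuousAt_riemannForm h2 x) h1).continuousWithinAt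
  set G : ℝ → ℝ := fun t => ‖X.grad u (Γ t)‖ ^ 2 + ‖u (Γ t)‖ ^ 2 with hG
  have cG : ContinuousOn G (Set.Icc 0 1) := (cg.norm.pow 2).add (cu.norm.pow 2)
  have hu01 : Set.uIcc (0 : ℝ) 1 = Set.Icc 0 1 := Set.uIcc_of_le zero_le_one
  have hftc : ∫ t in (0 : ℝ)..1, X.riemannForm k u x (Γ t) (v t) = H 1 - H 0 :=
    intervalIntegral.integral_eq_sub_of_hasDerivAt (fun t ht => hH t (hu01 ▸ ht))
      ((hu01 ▸ cW).intervalIntegrable)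
  have hGint : IntervalIntegrable G volume 0 1 := (hu01 ▸ cG).intervalIntegrable
  have hGle : r ^ 2 * ∫ t in (0 : ℝ)..1, G t ≤ δ ^ 2 := by
    have h1 : ENNReal.ofReal (∫ t in (0 : ℝ)..1, G t) = ∫⁻ t in Set.Ioo (0 : ℝ) 1,
        (‖X.grad u (Γ t)‖ₑ ^ 2 + ‖u (Γ t)‖ₑ ^ 2) := by
      rw [intervalIntegral.integral_of_le zero_le_one, integral_Ioc_eq_integral_Ioo,
        ofReal_integral_eq_lintegral_ofReal]
      · refine lintegral_congr fun t => ?_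
        rw [hG]
        simp only
        rw [ENNReal.ofReal_add (by positivity) (by positivity), ENNReal.ofReal_pow (norm_nonneg _),
          ENNReal.ofReal_pow (norm_nonneg _), ofReal_norm, ofReal_norm]
      · exact (intervalIntegrable_iff_integrableOn_Ioo_of_le zero_le_one).1 hGint
      · exact Eventually.of_forall fun t => by simp only [hG, Pi.zero_apply]; positivity
    rw [← h1, ← ENNReal.ofReal_mul (by positivity)] at hE
    exact (ENNReal.ofReal_le_ofReal_iff (by positivity)).1 hE
  have hb : ‖∫ t in (0 : ℝ)..1, X.riemannForm k u x (Γ t) (v t)‖ ≤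
      ∫ t in (0 : ℝ)..1, 2 * Real.pi * C * (δ + 2 * r ^ 2 / δ * G t) := by
    refine intervalIntegral.norm_integral_le_of_norm_le zero_le_one
      (Eventually.of_forall fun t ht => ?_) ?_
    · have ht' : t ∈ Set.Icc (0 : ℝ) 1 := ⟨ht.1.le, ht.2⟩
      have h1 := ContinuousLinearMap.le_opNorm (X.riemannForm k u x (Γ t)) (v t)
      rw [hvn t] at h1
      have h2 := mul_le_mul_of_nonneg_right (hW t ht') (by positivity : 0 ≤ 2 * Real.pi * r)
      have h3 := mul_le_add_sq_div (a := ‖X.grad u (Γ t)‖ + ‖u (Γ t)‖) (r := r) hδ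
      have h4 : (‖X.grad u (Γ t)‖ + ‖u (Γ t)‖) ^ 2 ≤ 2 * G t := by
        simp only [hG]
        nlinarith [sq_nonneg (‖X.grad u (Γ t)‖ - ‖u (Γ t)‖)]
      have h5 : r ^ 2 * (‖X.grad u (Γ t)‖ + ‖u (Γ t)‖) ^ 2 / δ ≤ 2 * r ^ 2 / δ * G t := by
        rw [div_mul_eq_mul_div]
        refine div_le_div_of_nonneg_right ?_ hδ.le
        nlinarith [sq_nonneg r]
      refine h1.trans (h2.trans ?_)
      have h6 := mul_le_mul_of_nonneg_left (h3.trans (add_le_add_right h5 δ))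
        (by positivity : 0 ≤ 2 * Real.pi * C)
      refine le_trans (le_of_eq ?_) h6
      ring
    · exact (intervalIntegrable_const.add (hGint.const_mul _)).const_mul _
  rw [hftc] at hb
  refine hb.trans ?_
  rw [intervalIntegral.integral_const_mul, intervalIntegral.integral_add intervalIntegrable_const
    (hGint.const_mul _), intervalIntegral.integral_const_mul, intervalIntegral.integral_const]
  -- The bound r² ∫ G ≤ δ² makes the quadratic term at most 2δ, and 2πC(δ + 2δ) = 6πCδ.
  have h7 : 2 * r ^ 2 / δ * ∫ t in (0 : ℝ)..1, G t ≤ 2 * δ := by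
    rw [div_mul_eq_mul_div, div_le_iff₀ hδ]
    nlinarith
  have h8 : 0 ≤ 2 * Real.pi * C := by positivity
  simp only [sub_zero, one_smul]
  nlinarith

/-- By the Meixner condition the jumps over an invariant set of sheets cancel. -/
theorem sum_jump_eq_zero {k : ℂ} {u : S → ℂ} (hu : X.IsHelmholtz k u) (j : Fin N)
    (C : Finset Θ.Fiber) (hC : ∀ s, Θ.perm j s ∈ C ↔ s ∈ C) (x : ℂ × ℂ) :
    ∑ s ∈ C, Θ.jump k u j s x = 0 := by
  classical
  have := Fintype.ofFinite Θ.Fiber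
  obtain ⟨R, hR⟩ := (Θ.eventually_isSmall j).exists
  obtain ⟨ε, hε, hfin⟩ := hu.meixner j
  set d : ℝ := ‖Θ.base - X.branchPt j‖ with hd
  have hd0 : 0 < d := norm_pos_iff.2 (Θ.base_sub_ne j)
  have hdC : (d : ℂ) ≠ 0 := by exact_mod_cast hd0.ne'
  set w : ℂ := (Θ.base - X.branchPt j) / d with hw
  have hwn : ‖w‖ = 1 := by
    rw [hw, norm_div, Complex.norm_real, Real.norm_eq_abs, abs_of_pos hd0, ← hd,
      div_self hd0.ne']
  obtain ⟨B, hB0, hB⟩ := exists_norm_riemannForm_le (X := X) k u x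
    (Metric.isBounded_ball (x := X.branchPt j) (r := R * d))
  -- The energy is summed over all sheets, so that one circle of small energy serves every lift at
  -- once.
  set g : ℂ → ENNReal := fun z => ∑ s : Θ.Fiber, (Θ.dom none).indicator (fun z =>
    ‖X.grad u (Θ.sec none s z)‖ₑ ^ 2 + ‖u (Θ.sec none s z)‖ₑ ^ 2) z with hg
  have hgm : Measurable g := Finset.measurable_sum _ fun s _ => Θ.measurable_energy hu s
  have hgle : ∀ z, g z ≤ ∑' s : X.proj ⁻¹' {z}, (‖X.grad u s‖ₑ ^ 2 + ‖u s‖ₑ ^ 2) := by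
    intro z
    by_cases hz : z ∈ Θ.dom none
    · simp only [hg, Set.indicator_of_mem hz]
      exact Θ.sum_energy_le u hz
    · simp only [hg, Set.indicator_of_notMem hz, Finset.sum_const_zero, zero_le]
  set ε' := min ε (R * d) with hε'
  have hε'0 : 0 < ε' := lt_min hε (mul_pos hR.1 hd0)
  have hfin' : ∫⁻ z in Metric.ball (X.branchPt j) ε', g z < ⊤ := by
    refine lt_of_le_of_lt ?_ hfin
    exact (lintegral_mono fun z => hgle z).trans
      (lintegral_mono_set (Metric.ball_subset_ball (min_le_left _ _)))
  have hbound : ∀ δ : ℝ, 0 < δ → ‖∑ s ∈ C, Θ.jump k u j s x‖ ≤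
      C.card * (6 * Real.pi * B * δ) := by
    intro δ hδ
    obtain ⟨r, hr, hle⟩ := exists_circle_lintegral_le hgm hwn hε'0 hfin' (pow_pos hδ 2)
    set c : ℂ := ((r / d : ℝ) : ℂ) with hc
    have hcd : (0 : ℝ) < r / d := div_pos hr.1 hd0
    have hcn : ‖c‖ = r / d := by
      rw [hc, Complex.norm_real, Real.norm_eq_abs, abs_of_pos hcd]
    have hcR : ‖c‖ < R := by
      rw [hcn, div_lt_iff₀ hd0]
      exact hr.2.trans_le (min_le_right _ _)
    have hcs : c ∈ Complex.slitPlane := Complex.ofReal_mem_slitPlane.2 hcd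
    have hpt : ∀ e : ℂ, Θ.point j (c * e) = X.branchPt j + r * w * e := by
      intro e
      simp only [point, hc, hw]
      push_cast
      field_simp
    have hone : ∀ s : Θ.Fiber, ‖Θ.prim k u none (Θ.perm j s) x (Θ.point j c) +
        Θ.jump k u j s x - Θ.prim k u none s x (Θ.point j c)‖ ≤ 6 * Real.pi * B * δ := by
      intro s
      obtain ⟨Γ, -, -, hΓ, hae, hH⟩ := hR.exists_circle_lift hcR hcs s
      obtain ⟨H, hH0, hH1, hHd⟩ := hH k u hu x
      rw [← hH0, ← hH1]
      refine norm_sub_le_of_energy hu hB0 hr.1 hδ (fun t ht => ⟨(hΓ t ht).1, (hΓ t ht).2.1⟩)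
        (by fun_prop) (fun t => ?_) hHd (fun t ht => hB _ ?_) (le_trans ?_ hle)
      · rw [norm_mul, norm_mul, norm_mul, norm_exp_two_pi_mul_I, hcn, ← hd]
        simp only [norm_mul, Complex.norm_ofNat, Complex.norm_real, Real.norm_eq_abs,
          abs_of_pos Real.pi_pos, Complex.norm_I]
        field_simp
      · rw [(hΓ t ht).2.2, hpt, Metric.mem_ball, dist_eq_norm, add_sub_cancel_left, norm_mul,
          norm_mul, hwn, norm_exp_two_pi_mul_I, mul_one, mul_one, Complex.norm_real,
          Real.norm_eq_abs, abs_of_pos hr.1]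
        exact hr.2.trans_le (min_le_right _ _)
      · gcongr ENNReal.ofReal (r ^ 2) * ?_
        refine lintegral_mono_ae ((ae_restrict_iff' measurableSet_Ioo).2 ?_)
        filter_upwards [hae] with t ht htI
        have ht' : t ∈ Set.Icc (0 : ℝ) 1 := ⟨htI.1.le, htI.2.le⟩
        have hm := ht ht'
        obtain ⟨s', hs'⟩ := Θ.exists_sec_eq hm (s := Γ t) rfl
        rw [← hpt, ← (hΓ t ht').2.2]
        simp only [hg, Set.indicator_of_mem hm]
        have := Finset.single_le_sum (f := fun s => ‖X.grad u (Θ.sec none s (X.proj (Γ t)))‖ₑ ^ 2 +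
          ‖u (Θ.sec none s (X.proj (Γ t)))‖ₑ ^ 2) (fun _ _ => zero_le) (Finset.mem_univ s')
        simp only [hs'] at this
        exact this
    -- Along the lift from `s` the primitive changes from that of `s` to that of `perm j s` plus the
    -- jump. Over an invariant set the primitives cancel after reindexing.
    have hsum : ∑ s ∈ C, Θ.jump k u j s x = ∑ s ∈ C, (Θ.prim k u none (Θ.perm j s) x (Θ.point j c) +
        Θ.jump k u j s x - Θ.prim k u none s x (Θ.point j c)) := by
      rw [Finset.sum_sub_distrib, Finset.sum_add_distrib]
      have : ∑ s ∈ C, Θ.prim k u none (Θ.perm j s) x (Θ.point j c) =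
          ∑ s ∈ C, Θ.prim k u none s x (Θ.point j c) :=
        Finset.sum_equiv (Θ.perm j) (fun s => (hC s).symm) fun s _ => rfl
      rw [this]
      ring
    rw [hsum]
    refine (norm_sum_le _ _).trans ((Finset.sum_le_sum fun s _ => hone s).trans ?_)
    rw [Finset.sum_const, nsmul_eq_mul]
  by_contra hne
  have hpos := norm_pos_iff.2 hne
  set T := ‖∑ s ∈ C, Θ.jump k u j s x‖ with hT
  set a : ℝ := C.card * (6 * Real.pi * B) with ha
  have ha0 : 0 ≤ a := by have := Real.pi_pos; positivity
  -- This δ makes the bound a·T/(2(a + 1)), which is less than T.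
  have h1 := hbound (T / (2 * (a + 1))) (by positivity)
  have h2 : (C.card : ℝ) * (6 * Real.pi * B * (T / (2 * (a + 1)))) = a * T / (2 * (a + 1)) := by
    rw [ha]; ring
  rw [h2, le_div_iff₀ (by positivity)] at h1
  nlinarith

/-! ### The points over a branch point -/

/-- The sheets near `P_j` are distributed over the points of the surface above `P_j`. -/
theorem exists_class (j : Fin N) : ∃ cl : Θ.Fiber → X.proj ⁻¹' {X.branchPt j},
    Function.Surjective cl ∧ ∀ s, cl (Θ.perm j s) = cl s := by
  set fib := X.proj ⁻¹' {X.branchPt j} with hfib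
  -- Disjoint neighbourhoods of the points above `P_j`. By properness they contain all points of the
  -- surface above a small disc, and the class of a sheet is the neighbourhood it enters.
  obtain ⟨V, hV, hdisj⟩ := (X.finite_fiber (X.branchPt j)).t2_separation
  have hev : ∀ᶠ z in 𝓝 (X.branchPt j), ∀ s ∈ X.proj ⁻¹' {z}, ∃ y ∈ fib, s ∈ V y := by
    refine X.isProperMap_proj.isClosedMap.eventually_nhds_fiber _ fun y hy => ?_
    filter_upwards [(hV y).2.mem_nhds (hV y).1] with s hs
    exact ⟨y, hy, hs⟩
  obtain ⟨R0, hR0, hball⟩ := Metric.eventually_nhds_iff.1 hev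
  set d : ℝ := ‖Θ.base - X.branchPt j‖ with hd
  have hd0 : 0 < d := norm_pos_iff.2 (Θ.base_sub_ne j)
  obtain ⟨R, hR, hRd⟩ := ((Θ.eventually_isSmall j).and
    (Ioo_mem_nhdsGT (div_pos hR0 hd0))).exists
  have hcover : ∀ c : ℂ, ‖c‖ < R → ∀ s, X.proj s = Θ.point j c → ∃ y ∈ fib, s ∈ V y := by
    intro c hc s hs
    refine hball ?_ s hs
    rw [dist_eq_norm, point, add_sub_cancel_left, norm_mul, ← hd]
    have h1 := hRd.2
    rw [lt_div_iff₀ hd0] at h1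
    nlinarith
  -- A connected set above the small disc lies in one of the disjoint open neighbourhoods. This lets
  -- paths transport the class.
  have hconn : ∀ A : Set S, IsPreconnected A → (∀ s ∈ A, ∃ c : ℂ, ‖c‖ < R ∧
      X.proj s = Θ.point j c) → ∀ y ∈ fib, (A ∩ V y).Nonempty → A ⊆ V y := by
    intro A hA hAc y hy hne
    refine hA.subset_left_of_subset_union (v := ⋃ y' ∈ fib \ {y}, V y') (hV y).2
      (isOpen_biUnion fun y' _ => (hV y').2) ?_ ?_ hne
    · refine Set.disjoint_iUnion₂_right.2 fun y' hy' => ?_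
      exact hdisj hy hy'.1 (fun h => hy'.2 h.symm)
    · intro s hs
      obtain ⟨c, hc, hsc⟩ := hAc s hs
      obtain ⟨y', hy', hsy⟩ := hcover c hc s hsc
      rcases eq_or_ne y' y with rfl | h
      · exact Or.inl hsy
      · exact Or.inr (Set.mem_biUnion ⟨hy', h⟩ hsy)
  set c0 : ℝ := R / 2 with hc0
  have hR00 := hR.1
  have hc0n : ∀ τ ∈ Set.Ioc 0 c0, ‖(τ : ℂ)‖ < R ∧ (τ : ℂ) ∈ Complex.slitPlane := by
    intro τ hτ
    refine ⟨?_, Complex.ofReal_mem_slitPlane.2 hτ.1⟩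
    rw [Complex.norm_real, Real.norm_eq_abs, abs_of_pos hτ.1]
    have := hτ.2
    linarith
  have hc00 : c0 ∈ Set.Ioc 0 c0 := ⟨by linarith, le_rfl⟩
  have hdom : ∀ τ ∈ Set.Ioc 0 c0, Θ.point j (τ : ℂ) ∈ Θ.dom none := fun τ hτ =>
    hR.mem_dom_none (hc0n τ hτ).1 (hc0n τ hτ).2
  have hex : ∀ s : Θ.Fiber, ∃ y : fib, Θ.sec none s (Θ.point j (c0 : ℂ)) ∈ V y := by
    intro s
    obtain ⟨y, hy, h⟩ := hcover c0 (hc0n c0 hc00).1 _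
      ((Θ.isSection_sec none s).proj_eq _ (hdom c0 hc00))
    exact ⟨⟨y, hy⟩, h⟩
  choose cl hcl using hex
  have huniq : ∀ (s : S) (y y' : fib), s ∈ V y → s ∈ V y' → y = y' := by
    intro s y y' h h'
    by_contra hne
    exact Set.disjoint_left.1 (hdisj y.2 y'.2 (fun h => hne (Subtype.ext h))) h h'
  refine ⟨cl, fun y => ?_, fun s => ?_⟩
  · obtain ⟨e, m, h1, h2, -, h4⟩ := X.local_form (y : S)
    have hy0 : e y = 0 := by
      have := h4 y h1
      simpa [h2.ne'] using this
    have ht : (0 : ℂ) ∈ e.target := by rw [← hy0]; exact e.map_source h1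
    -- With this root the ray τω in the chart projects to points P_j + τ^m (base - P_j) of the
    -- segment towards the base point. So some sheet comes arbitrarily close to `y`.
    obtain ⟨ω, hω⟩ := IsAlgClosed.exists_pow_nat_eq (Θ.base - X.branchPt j) h2
    have hcs : ContinuousAt (fun τ : ℝ => (τ : ℂ) * ω) 0 := by fun_prop
    have hev1 : ∀ᶠ τ : ℝ in 𝓝 0, (τ : ℂ) * ω ∈ e.target ∧ e.symm ((τ : ℂ) * ω) ∈ V y := by
      have k1 : ∀ᶠ ζ in 𝓝 (0 : ℂ), ζ ∈ e.target ∧ e.symm ζ ∈ V y := by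
        refine (eventually_mem_set.2 (e.open_target.mem_nhds ht)).and ?_
        refine (e.continuousAt_symm ht).eventually ((hV y).2.mem_nhds ?_)
        rw [← hy0, e.left_inv h1]
        exact (hV y).1
      have k2 : Tendsto (fun τ : ℝ => (τ : ℂ) * ω) (𝓝 0) (𝓝 0) := by
        simpa [ContinuousAt] using hcs
      exact k2.eventually k1
    obtain ⟨τ, ⟨hτ1, hτ2⟩, hτ⟩ := ((hev1.filter_mono nhdsWithin_le_nhds).and
      (Ioo_mem_nhdsGT (lt_min one_pos hc00.1))).exists
    have hτ0 : 0 < τ := hτ.1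
    have hτ1' : τ ≤ 1 := (hτ.2.trans_le (min_le_left _ _)).le
    have hτc : τ ^ m ∈ Set.Ioc 0 c0 := by
      refine ⟨pow_pos hτ0 m, ?_⟩
      calc τ ^ m ≤ τ ^ 1 := pow_le_pow_of_le_one hτ0.le hτ1' h2
        _ = τ := pow_one τ
        _ ≤ c0 := (hτ.2.trans_le (min_le_right _ _)).le
    have hproj : X.proj (e.symm ((τ : ℂ) * ω)) = Θ.point j ((τ ^ m : ℝ) : ℂ) := by
      rw [h4 _ (e.map_target hτ1), e.right_inv hτ1, mul_pow, hω, show X.proj y = X.branchPt j from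
        y.2, point]
      push_cast
      ring
    obtain ⟨s, hs⟩ := Θ.exists_sec_eq (hdom _ hτc) hproj
    refine ⟨s, huniq _ _ _ (hcl s) ?_⟩
    have hsub := hconn ((fun τ : ℝ => Θ.sec none s (Θ.point j (τ : ℂ))) '' Set.Icc (τ ^ m) c0)
      ?_ ?_ y y.2 ⟨_, ⟨τ ^ m, ⟨le_rfl, hτc.2⟩, rfl⟩, ?_⟩
    · exact hsub ⟨c0, ⟨hτc.2, le_rfl⟩, rfl⟩
    · refine isPreconnected_Icc.image _ ?_
      refine (Θ.isSection_sec none s).continuousOn.comp (by fun_prop) fun t ht => ?_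
      exact hdom t ⟨hτc.1.trans_le ht.1, ht.2⟩
    · rintro _ ⟨t, ht, rfl⟩
      have ht' : t ∈ Set.Ioc 0 c0 := ⟨hτc.1.trans_le ht.1, ht.2⟩
      exact ⟨t, (hc0n t ht').1, (Θ.isSection_sec none s).proj_eq _ (hdom t ht')⟩
    · simp only [hs]
      exact hτ2
  -- The lift of a small circle connects the sheet `s` with `perm j s` above the disc, so both have
  -- the same class.
  · obtain ⟨Γ, hΓ0, hΓ1, hΓ, -⟩ := hR.exists_circle_lift (hc0n c0 hc00).1 (hc0n c0 hc00).2 s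
    refine huniq _ _ _ (hcl _) ?_
    have hsub := hconn (Γ '' Set.Icc 0 1) ?_ ?_ (cl s) (cl s).2 ⟨_, ⟨0, by simp, rfl⟩, ?_⟩
    · rw [← hΓ1]
      exact hsub ⟨1, by simp, rfl⟩
    · exact isPreconnected_Icc.image _ fun t ht => (hΓ t ht).1.continuousWithinAt
    · rintro _ ⟨t, ht, rfl⟩
      refine ⟨_, ?_, (hΓ t ht).2.2⟩
      rw [norm_mul, norm_exp_two_pi_mul_I, mul_one]
      exact (hc0n c0 hc00).1
    · rw [hΓ0]
      exact hcl s

/-! ### Connectivity -/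

end SlitSystem

/-- A punctured disc is the image of a half-plane under the exponential. -/
lemma isPreconnected_punctured_ball {r : ℝ} (hr : 0 < r) :
    IsPreconnected (Metric.ball (0 : ℂ) r \ {0}) := by
  have h1 : Metric.ball (0 : ℂ) r \ {0} = Complex.exp '' {τ | τ.re < Real.log r} := by
    ext ζ
    constructor
    · rintro ⟨h1, h2⟩
      have h0 : ζ ≠ 0 := h2
      refine ⟨Complex.log ζ, ?_, Complex.exp_log h0⟩
      simp only [Set.mem_ofPred_eq, Complex.log_re]
      exact Real.log_lt_log (norm_pos_iff.2 h0) (by simpa using h1)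
    · rintro ⟨τ, hτ, rfl⟩
      refine ⟨?_, Complex.exp_ne_zero τ⟩
      rw [Metric.mem_ball, dist_zero_right, Complex.norm_exp]
      exact (Real.lt_log_iff_exp_lt hr).1 hτ
  rw [h1]
  exact (convex_halfSpace_re_lt _).isPreconnected.image _ Complex.continuous_exp.continuousOn

/-- Points over branch points have punctured neighbourhoods which are regular and connected. -/
lemma exists_punctured_nhds (p : S) : ∃ V ∈ 𝓝 p, p ∈ V ∧
    IsPreconnected (V \ {p}) ∧ (∀ q ∈ V \ {p}, X.Regular q) ∧ (∃ᶠ q in 𝓝 p, q ∈ V \ {p}) := by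
  obtain ⟨e, m, h1, h2, -, h4⟩ := X.local_form p
  have hp0 : e p = 0 := by
    have := h4 p h1
    simpa [h2.ne'] using this
  have ht : (0 : ℂ) ∈ e.target := by rw [← hp0]; exact e.map_source h1
  have hes : e.symm 0 = p := by rw [← hp0, e.left_inv h1]
  have hfin : (Set.range X.branchPt \ {X.proj p}).Finite :=
    (Set.finite_range X.branchPt).subset Set.sdiff_subset
  have hev : ∀ᶠ ζ in 𝓝 (0 : ℂ), ζ ∈ e.target ∧
      X.proj p + ζ ^ m ∉ Set.range X.branchPt \ {X.proj p} := by
    refine (eventually_mem_set.2 (e.open_target.mem_nhds ht)).and ?_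
    have hc : ContinuousAt (fun ζ : ℂ => X.proj p + ζ ^ m) 0 := by fun_prop
    refine hc.eventually (hfin.isClosed.isOpen_compl.mem_nhds ?_)
    simp [h2.ne']
  obtain ⟨r, hr, hb⟩ := Metric.eventually_nhds_iff.1 hev
  have hb' : ∀ ζ ∈ Metric.ball (0 : ℂ) r, ζ ∈ e.target ∧
      X.proj p + ζ ^ m ∉ Set.range X.branchPt \ {X.proj p} := fun ζ hζ => hb hζ
  have himg : e.symm '' Metric.ball 0 r \ {p} = e.symm '' (Metric.ball 0 r \ {0}) := by
    ext q
    constructor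
    · rintro ⟨⟨ζ, hζ, rfl⟩, hq⟩
      refine ⟨ζ, ⟨hζ, fun h => hq ?_⟩, rfl⟩
      rw [Set.mem_singleton_iff] at h ⊢
      rw [h, hes]
    · rintro ⟨ζ, ⟨hζ, hne⟩, rfl⟩
      refine ⟨⟨ζ, hζ, rfl⟩, fun h => hne ?_⟩
      rw [Set.mem_singleton_iff, ← hes] at h
      exact e.symm.injOn (hb' ζ hζ).1 ht h
  have hsub : Metric.ball (0 : ℂ) r ⊆ e.target := fun ζ hζ => (hb' ζ hζ).1
  refine ⟨e.symm '' Metric.ball 0 r, ?_, ⟨0, Metric.mem_ball_self hr, hes⟩, ?_, ?_, ?_⟩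
  · refine (e.symm.isOpen_image_of_subset_source Metric.isOpen_ball hsub).mem_nhds ?_
    exact ⟨0, Metric.mem_ball_self hr, hes⟩
  · rw [himg]
    exact (isPreconnected_punctured_ball hr).image _
      (e.continuousOn_symm.mono (Set.sdiff_subset.trans hsub))
  · rw [himg]
    rintro _ ⟨ζ, ⟨hζ, hne⟩, rfl⟩ hmem
    rw [h4 _ (e.map_target (hsub hζ)), e.right_inv (hsub hζ)] at hmem
    refine (hb' ζ hζ).2 ⟨hmem, fun h => ?_⟩
    have hne' : ζ ≠ 0 := hne
    simp [h2.ne', hne'] at h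
  · rw [himg, frequently_iff]
    intro O hO
    have k1 : ∀ᶠ ζ in 𝓝 (0 : ℂ), e.symm ζ ∈ O := by
      refine (e.continuousAt_symm ht).eventually ?_
      rw [hes]; exact hO
    have k2 : ∀ᶠ ζ in 𝓝[≠] (0 : ℂ), e.symm ζ ∈ O ∧ ζ ∈ Metric.ball (0 : ℂ) r ∧ ζ ≠ 0 :=
      (k1.filter_mono nhdsWithin_le_nhds).and ((eventually_nhdsWithin_of_eventually_nhds
        (Metric.ball_mem_nhds 0 hr)).and self_mem_nhdsWithin)
    obtain ⟨ζ, hζ1, hζ2, hζ3⟩ := k2.exists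
    exact ⟨e.symm ζ, hζ1, ζ, ⟨hζ2, hζ3⟩, rfl⟩

lemma dense_regular : Dense {p | X.Regular p} := by
  intro p
  by_cases hp : X.Regular p
  · exact subset_closure hp
  · obtain ⟨V, -, -, -, h4, h5⟩ := exists_punctured_nhds (X := X) p
    exact mem_closure_iff_frequently.2 (h5.mono h4)

namespace SlitSystem

variable (Θ : X.SlitSystem)

/-- The part of the surface covered by the sheets in `T`. -/
def cover (T : Set Θ.Fiber) : Set S :=
  {p | ∃ K, ∃ s ∈ T, X.proj p ∈ Θ.dom K ∧ p = Θ.sec K s (X.proj p)}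

lemma isOpen_cover (T : Set Θ.Fiber) : IsOpen (Θ.cover T) := by
  rw [isOpen_iff_mem_nhds]
  rintro p ⟨K, s, hs, hm, hp⟩
  have hY := Θ.isSection_sec K s
  have hr : X.Regular p := Θ.notMem_of_mem_dom hm
  have hmem := X.continuous_proj.continuousAt.eventually ((Θ.isOpen_dom K).mem_nhds hm)
  have hc : ContinuousAt (fun s' => Θ.sec K s (X.proj s')) p :=
    ContinuousAt.comp (hY.continuousOn.continuousAt ((Θ.isOpen_dom K).mem_nhds hm))
      X.continuous_proj.continuousAt
  rw [ContinuousAt, ← hp] at hc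
  have he := eventuallyEq_of_lift (X := X) (f := fun s' => s') (a := p) tendsto_id hc hr (by
    filter_upwards [hmem] with q hq
    rw [hY.proj_eq _ hq])
  filter_upwards [he, hmem] with q h1 h2
  exact ⟨K, s, hs, h2, h1⟩

lemma cover_union (T : Set Θ.Fiber) : {p | X.Regular p} ⊆ Θ.cover T ∪ Θ.cover Tᶜ := by
  intro p hp
  obtain ⟨K, hK⟩ := Θ.exists_mem_dom hp
  obtain ⟨s, hs⟩ := Θ.exists_sec_eq hK (s := p) rfl
  by_cases h : s ∈ T
  · exact Or.inl ⟨K, s, h, hK, hs.symm⟩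
  · exact Or.inr ⟨K, s, h, hK, hs.symm⟩

lemma exists_sec_none_eq {T : Set Θ.Fiber} (hT : ∀ j s, Θ.perm j s ∈ T ↔ s ∈ T)
    {K : Option (Fin N)} {z : ℂ} (hz : z ∈ Θ.dom K) (h0 : z ∈ Θ.dom none) (s : Θ.Fiber) :
    ∃ s', Θ.sec K s z = Θ.sec none s' z ∧ (s' ∈ T ↔ s ∈ T) := by
  match K with
  | none => exact ⟨s, rfl, Iff.rfl⟩
  | some j =>
    rcases Θ.mem_up_or_low hz h0 with h | h
    · exact ⟨s, Θ.sec_eq_up j s h, Iff.rfl⟩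
    · exact ⟨Θ.perm j s, Θ.sec_eq_low j s h, hT j s⟩

/-- A point of the surface may lie on sheets over several charts. Its labels differ only by the
permutations, so membership in an invariant set does not depend on the choice. -/
lemma mem_iff_of_sec_eq {T : Set Θ.Fiber} (hT : ∀ j s, Θ.perm j s ∈ T ↔ s ∈ T)
    {K K' : Option (Fin N)} {z : ℂ} (hz : z ∈ Θ.dom K) (hz' : z ∈ Θ.dom K') {s s' : Θ.Fiber}
    (h : Θ.sec K s z = Θ.sec K' s' z) : s ∈ T ↔ s' ∈ T := by
  by_cases h0 : z ∈ Θ.dom none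
  · obtain ⟨t, ht, htT⟩ := Θ.exists_sec_none_eq hT hz h0 s
    obtain ⟨t', ht', htT'⟩ := Θ.exists_sec_none_eq hT hz' h0 s'
    rw [ht, ht'] at h
    rw [← htT, ← htT', Θ.sec_none_injective h0 h]
  · match K, K' with
    | none, _ => exact absurd hz h0
    | _, none => exact absurd hz' h0
    | some i, some j =>
      rcases eq_or_ne i j with rfl | hij
      · have hu := Θ.upPt_mem i
        have h1 := (Θ.isSection_sec (some i) s).eqOn (Θ.isSection_sec (some i) s')
          (Θ.isPreconnected_dom _) hz h hu.1
        rw [Θ.sec_eq_up i s hu, Θ.sec_eq_up i s' hu] at h1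
        rw [Θ.sec_none_injective (Θ.up_subset i hu) h1]
      · exact absurd (Θ.inter_subset hij hz hz') h0

lemma disjoint_cover {T : Set Θ.Fiber} (hT : ∀ j s, Θ.perm j s ∈ T ↔ s ∈ T) :
    Disjoint (Θ.cover T) (Θ.cover Tᶜ) := by
  rw [Set.disjoint_left]
  rintro p ⟨K, s, hs, hm, hp⟩ ⟨K', s', hs', hm', hp'⟩
  exact hs' ((Θ.mem_iff_of_sec_eq hT hm hm' (hp.symm.trans hp')).1 hs)

/-- The permutations of the sheets act transitively, as the surface is connected. -/
theorem eq_univ_of_perm_invariant [PreconnectedSpace S] {T : Set Θ.Fiber}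
    (hT : ∀ j, ∀ s ∈ T, Θ.perm j s ∈ T) (hne : T.Nonempty) : T = Set.univ := by
  replace hT : ∀ j s, Θ.perm j s ∈ T ↔ s ∈ T := by
    refine fun j s => ⟨fun h => ?_, hT j s⟩
    have := Equiv.Perm.perm_symm_mapsTo_of_mapsTo (Θ.perm j) (s := T) (fun s hs => hT j s hs) h
    simpa using this
  by_contra hcon
  have hne' : (Tᶜ).Nonempty := Set.nonempty_compl.2 hcon
  have hd := Θ.disjoint_cover hT
  have hunion : closure (Θ.cover T) ∪ closure (Θ.cover Tᶜ) = Set.univ := by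
    rw [← closure_union]
    exact Set.eq_univ_of_univ_subset
      (dense_regular.closure_eq.symm.subset.trans (closure_mono (Θ.cover_union T)))
  -- The two open covers are disjoint on the regular points. At a point over a branch point, a
  -- connected punctured neighbourhood cannot meet both, so the closures would separate the
  -- connected surface.
  have hdisj : Disjoint (closure (Θ.cover T)) (closure (Θ.cover Tᶜ)) := by
    rw [Set.disjoint_left]
    intro p hp hp'
    by_cases hr : X.Regular p
    · rcases Θ.cover_union T hr with h | h
      · exact Set.disjoint_left.1 (hd.closure_right (Θ.isOpen_cover T)) h hp'
      · exact Set.disjoint_left.1 (hd.symm.closure_right (Θ.isOpen_cover Tᶜ)) h hp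
    · obtain ⟨V, hV, hpV, hconn, hreg, -⟩ := exists_punctured_nhds (X := X) p
      have hne1 : ∀ T', p ∈ closure (Θ.cover T') → (V \ {p} ∩ Θ.cover T').Nonempty := by
        intro T' h
        obtain ⟨q, hq1, hq2⟩ := mem_closure_iff_nhds.1 h V hV
        refine ⟨q, ⟨hq1, fun h => ?_⟩, hq2⟩
        obtain ⟨K, s, -, hm, -⟩ := hq2
        rw [h] at hm
        exact hr (Θ.notMem_of_mem_dom hm)
      obtain ⟨q, -, hq1, hq2⟩ := hconn _ _ (Θ.isOpen_cover T) (Θ.isOpen_cover Tᶜ)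
        (Set.Subset.trans (fun q hq => hreg q hq) (Θ.cover_union T))
        (hne1 T hp) (hne1 Tᶜ hp')
      exact Set.disjoint_left.1 hd hq1 hq2
  have hmem : ∀ T' : Set Θ.Fiber, T'.Nonempty → (closure (Θ.cover T')).Nonempty := by
    rintro T' ⟨s, hs⟩
    refine ⟨s, subset_closure ⟨none, s, hs, ?_, ?_⟩⟩
    · rw [show X.proj s = Θ.base from s.2]; exact Θ.base_mem
    · rw [show X.proj s = Θ.base from s.2, Θ.sec_base]
  have := (isPreconnected_univ (α := S))
  rw [isPreconnected_closed_iff] at this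
  obtain ⟨p, -, h1, h2⟩ := this _ _ isClosed_closure isClosed_closure hunion.symm.subset
    (by simpa using hmem T hne) (by simpa using hmem Tᶜ hne')
  exact Set.disjoint_left.1 hdisj h1 h2

lemma card_fiber : Nat.card Θ.Fiber = M := by
  have := X.ncard_fiber Θ.base (fun ⟨j, hj⟩ => Θ.base_ne j hj.symm)
  rwa [← Nat.card_coe_set_eq] at this

lemma nonempty_fiber [Nonempty S] : Nonempty Θ.Fiber := by
  obtain ⟨p, hp⟩ := (dense_regular (X := X)).nonempty
  obtain ⟨K, hK⟩ := Θ.exists_mem_dom hp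
  obtain ⟨s, -⟩ := Θ.exists_sec_eq hK (s := p) rfl
  exact ⟨s⟩

end SlitSystem

end SommerfeldSurface

namespace SommerfeldSurface

variable {S : Type*} [TopologicalSpace S] [T2Space S] {M N : ℕ} {X : SommerfeldSurface S M N}

/-- Avoiding T decouples into one condition for each real point, which is why the two half-solutions
can be continued separately. -/
lemma notMem_branchLines_iff (X : SommerfeldSurface S M N) (x : ℂ × ℂ) :
    x ∉ X.branchLines ↔ ∀ l, realPt l x ∉ Set.range X.branchPt := by
  have h0 : ∀ j, x.1 + Complex.I * x.2 = X.branchPt j ↔ X.branchPt j = realPt 0 x := fun j => by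
    rw [realPt_zero, charZ_apply, eq_comm]
  have h1 : ∀ j, x.1 - Complex.I * x.2 = conj (X.branchPt j) ↔ X.branchPt j = realPt 1 x :=
    fun j => by
      rw [realPt_one, charW_apply]
      constructor
      · intro h; rw [h, Complex.conj_conj]
      · intro h; rw [h, Complex.conj_conj]
  rw [Fin.forall_fin_two]
  simp only [branchLines, Set.mem_ofPred_eq, h0, h1, Set.mem_range, not_exists, not_or,
    forall_and]

namespace SlitSystem

variable (Θ : X.SlitSystem) (k : ℂ) (u : S → ℂ)

/-! ### The half-solutions on the sheets -/

/-- The half-solutions on the sheets, attached to the two characteristics. -/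
def half (l : Fin 2) (K : Option (Fin N)) (s : Θ.Fiber) : ℂ × ℂ → ℂ :=
  if l = 0 then halfOne (Θ.field u K s) (Θ.prim k u K s)
  else halfTwo (Θ.field u K s) (Θ.prim k u K s)

/-- Half of the jump of the half-solution across the cut. -/
def halfJump (l : Fin 2) (j : Fin N) (s : Θ.Fiber) (x : ℂ × ℂ) : ℂ :=
  if l = 0 then Θ.jump k u j s x / 2 else -(Θ.jump k u j s x / 2)

/-- The difference between the half-solution on a sheet and its continuation across the cut. -/
def cross (l : Fin 2) (j : Fin N) (s : Θ.Fiber) : ℂ × ℂ → ℂ :=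
  Θ.half k u l none s - Θ.half k u l none (Θ.perm j s) - Θ.halfJump k u l j s

/-- The complexification of the wave field on a sheet. -/
def full (s : Θ.Fiber) : ℂ × ℂ → ℂ := Θ.half k u 0 none s + Θ.half k u 1 none s

/-- The jump enters the two half-solutions with opposite signs and disappears when both real points
cross the cut together. -/
lemma cross_add_cross (j : Fin N) (s : Θ.Fiber) :
    Θ.cross k u 0 j s + Θ.cross k u 1 j s = Θ.full k u s - Θ.full k u (Θ.perm j s) := by
  ext x
  simp [cross, full, halfJump]
  ring

/-- The lattice spanned by the differences `cross`. -/
def lattice : AddSubgroup (ℂ × ℂ → ℂ) :=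
  AddSubgroup.closure (Set.range fun p : Fin 2 × Fin N × Θ.Fiber => Θ.cross k u p.1 p.2.1 p.2.2)

lemma cross_mem (l : Fin 2) (j : Fin N) (s : Θ.Fiber) : Θ.cross k u l j s ∈ Θ.lattice k u :=
  AddSubgroup.subset_closure ⟨(l, j, s), rfl⟩

/-- By `cross_add_cross` the sheets congruent to s' modulo the lattice are closed under all
permutations. Transitivity does the rest. -/
lemma full_sub_full_mem [PreconnectedSpace S] (s s' : Θ.Fiber) :
    Θ.full k u s - Θ.full k u s' ∈ Θ.lattice k u := by
  have := Θ.eq_univ_of_perm_invariant (T := {s | Θ.full k u s - Θ.full k u s' ∈ Θ.lattice k u})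
    (fun j s hs => ?_) ⟨s', by simp⟩
  · have h : s ∈ Set.univ := trivial
    rw [← this] at h
    exact h
  · simp only [Set.mem_ofPred_eq] at hs ⊢
    have e : Θ.full k u (Θ.perm j s) - Θ.full k u s' = (Θ.full k u s - Θ.full k u s') -
        (Θ.cross k u 0 j s + Θ.cross k u 1 j s) := by
      rw [cross_add_cross]; abel
    rw [e]
    exact AddSubgroup.sub_mem _ hs
      (AddSubgroup.add_mem _ (Θ.cross_mem k u 0 j s) (Θ.cross_mem k u 1 j s))

/-- The domain over which both characteristics lie in given charts. -/
def chart (K₀ K₁ : Option (Fin N)) : Set (ℂ × ℂ) :=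
  {x | realPt 0 x ∈ Θ.dom K₀ ∧ realPt 1 x ∈ Θ.dom K₁}

lemma isOpen_chart (K₀ K₁ : Option (Fin N)) : IsOpen (Θ.chart K₀ K₁) :=
  ((Θ.isOpen_dom K₀).preimage (continuous_realPt 0)).inter
    ((Θ.isOpen_dom K₁).preimage (continuous_realPt 1))

lemma half_zero_add_half_one_toC2 (K : Option (Fin N)) (s : Θ.Fiber) (p : ℂ) :
    Θ.half k u 0 K s (toC2 p) + Θ.half k u 1 K s (toC2 p) = u (Θ.sec K s p) := by
  simp only [half, if_true, one_ne_zero, if_false]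
  exact halfOne_add_halfTwo_toC2 _ _ p

variable {k u} (hu : X.IsHelmholtz k u)
include hu

lemma analyticOnNhd_half (l : Fin 2) (K : Option (Fin N)) (s : Θ.Fiber) :
    AnalyticOnNhd ℂ (Θ.half k u l K s) {x | realPt l x ∈ Θ.dom K} := by
  fin_cases l
  · exact (Θ.isRiemannPrimitive hu K s).analyticOnNhd_halfOne (Θ.isOpen_dom K)
  · exact (Θ.isRiemannPrimitive hu K s).analyticOnNhd_halfTwo (Θ.isOpen_dom K)

lemma differentiable_halfJump (l : Fin 2) (j : Fin N) (s : Θ.Fiber) :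
    Differentiable ℂ (Θ.halfJump k u l j s) := by
  have : Differentiable ℂ fun x => Θ.jump k u j s x / 2 := by
    simp only [div_eq_mul_inv]
    exact (Θ.differentiable_jump hu j s).mul_const _
  fin_cases l
  · exact this
  · exact this.neg

lemma half_eq_up (l : Fin 2) (j : Fin N) (s : Θ.Fiber) {x : ℂ × ℂ} (hx : realPt l x ∈ Θ.up j) :
    Θ.half k u l (some j) s x = Θ.half k u l none s x := by
  fin_cases l
  · have hx' : charZ x ∈ Θ.up j := by rw [← realPt_zero]; exact hx
    simp only [half, Fin.zero_eta, if_true, halfOne, field, Θ.prim_eq_up hu j s x hx',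
      Θ.sec_eq_up j s hx']
  · have hx' : conj (charW x) ∈ Θ.up j := by rw [← realPt_one]; exact hx
    simp only [half, Fin.mk_one, one_ne_zero, if_false, halfTwo, field,
      Θ.prim_eq_up hu j s x hx', Θ.sec_eq_up j s hx']

lemma half_eq_low (l : Fin 2) (j : Fin N) (s : Θ.Fiber) {x : ℂ × ℂ} (hx : realPt l x ∈ Θ.low j) :
    Θ.half k u l (some j) s x = Θ.half k u l none (Θ.perm j s) x + Θ.halfJump k u l j s x := by
  fin_cases l
  · have hx' : charZ x ∈ Θ.low j := by rw [← realPt_zero]; exact hx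
    simp only [half, Fin.zero_eta, if_true, halfOne, field, Θ.prim_eq_low hu j s x hx',
      Θ.sec_eq_low j s hx', halfJump]
    ring
  · have hx' : conj (charW x) ∈ Θ.low j := by rw [← realPt_one]; exact hx
    simp only [half, Fin.mk_one, one_ne_zero, if_false, halfTwo, field,
      Θ.prim_eq_low hu j s x hx', Θ.sec_eq_low j s hx', halfJump]
    ring

lemma analyticOnNhd_cross (l : Fin 2) (j : Fin N) (s : Θ.Fiber) :
    AnalyticOnNhd ℂ (Θ.cross k u l j s) {x | realPt l x ∈ Θ.dom none} :=
  ((Θ.analyticOnNhd_half hu l none s).sub (Θ.analyticOnNhd_half hu l none _)).sub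
    (((Θ.differentiable_halfJump hu l j s).differentiableOn.analyticOnNhd_prod isOpen_univ).mono
      (Set.subset_univ _))

lemma analyticOnNhd_full (s : Θ.Fiber) : AnalyticOnNhd ℂ (Θ.full k u s) (Θ.chart none none) :=
  ((Θ.analyticOnNhd_half hu 0 none s).mono fun _ h => h.1).add
    ((Θ.analyticOnNhd_half hu 1 none s).mono fun _ h => h.2)

lemma analyticOnNhd_of_mem_lattice {v : ℂ × ℂ → ℂ} (hv : v ∈ Θ.lattice k u) :
    AnalyticOnNhd ℂ v (Θ.chart none none) := by
  refine AddSubgroup.closure_induction (p := fun v _ => AnalyticOnNhd ℂ v (Θ.chart none none))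
    ?_ (fun x _ => analyticAt_const) (fun _ _ _ _ h h' => h.add h') (fun _ _ h => h.neg) hv
  rintro _ ⟨⟨l, j, s⟩, rfl⟩
  refine (Θ.analyticOnNhd_cross hu l j s).mono fun x hx => ?_
  fin_cases l
  · exact hx.1
  · exact hx.2

/-! ### Change of charts -/

/-- `R` is the entire function by which the half-solutions in two charts differ. -/
lemma exists_half_eq_none (l : Fin 2) {K : Option (Fin N)} (s : Θ.Fiber) {x : ℂ × ℂ}
    (hx : realPt l x ∈ Θ.dom K) (h0 : realPt l x ∈ Θ.dom none) :
    ∃ s' R, Differentiable ℂ R ∧ Θ.half k u l K s =ᶠ[𝓝 x] Θ.half k u l none s' + R ∧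
      Θ.half k u l none s - Θ.half k u l none s' - R ∈ Θ.lattice k u := by
  match K with
  | none => exact ⟨s, 0, differentiable_const _, by simp, by simp⟩
  | some j =>
    rcases Θ.mem_up_or_low hx h0 with h | h
    · refine ⟨s, 0, differentiable_const _, ?_, by simp⟩
      filter_upwards [(continuous_realPt l).continuousAt.eventually ((Θ.isOpen_up j).mem_nhds h)]
        with y hy
      simpa using Θ.half_eq_up hu l j s hy
    · refine ⟨Θ.perm j s, Θ.halfJump k u l j s, Θ.differentiable_halfJump hu l j s, ?_,
        Θ.cross_mem k u l j s⟩
      filter_upwards [(continuous_realPt l).continuousAt.eventually ((Θ.isOpen_low j).mem_nhds h)]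
        with y hy
      exact Θ.half_eq_low hu l j s hy

lemma exists_half_none_eq (l : Fin 2) {K : Option (Fin N)} (s : Θ.Fiber) {x : ℂ × ℂ}
    (hx : realPt l x ∈ Θ.dom K) (h0 : realPt l x ∈ Θ.dom none) :
    ∃ s' R, Differentiable ℂ R ∧ Θ.half k u l none s =ᶠ[𝓝 x] Θ.half k u l K s' + R ∧
      Θ.half k u l none s - Θ.half k u l none s' - R ∈ Θ.lattice k u := by
  match K with
  | none => exact ⟨s, 0, differentiable_const _, by simp, by simp⟩
  | some j =>
    rcases Θ.mem_up_or_low hx h0 with h | h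
    · refine ⟨s, 0, differentiable_const _, ?_, by simp⟩
      filter_upwards [(continuous_realPt l).continuousAt.eventually ((Θ.isOpen_up j).mem_nhds h)]
        with y hy
      simpa using (Θ.half_eq_up hu l j s hy).symm
    · refine ⟨(Θ.perm j).symm s, -Θ.halfJump k u l j ((Θ.perm j).symm s),
        (Θ.differentiable_halfJump hu l j _).neg, ?_, ?_⟩
      · filter_upwards [(continuous_realPt l).continuousAt.eventually
          ((Θ.isOpen_low j).mem_nhds h)] with y hy
        have := Θ.half_eq_low hu l j ((Θ.perm j).symm s) hy
        simp only [Equiv.apply_symm_apply] at this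
        simp [this]
      · have := AddSubgroup.neg_mem _ (Θ.cross_mem k u l j ((Θ.perm j).symm s))
        simp only [cross, Equiv.apply_symm_apply] at this
        convert this using 1
        abel

/-- Two distinct cones meet only inside the slit plane, so one passes through that chart. The
lattice condition records the accumulated change in terms of functions on the slit plane. -/
lemma exists_half_eq (l : Fin 2) {K K' : Option (Fin N)} (s : Θ.Fiber) {x : ℂ × ℂ}
    (hx : realPt l x ∈ Θ.dom K) (hx' : realPt l x ∈ Θ.dom K') :
    ∃ s' R, Differentiable ℂ R ∧ Θ.half k u l K s =ᶠ[𝓝 x] Θ.half k u l K' s' + R ∧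
      Θ.half k u l none s - Θ.half k u l none s' - R ∈ Θ.lattice k u := by
  have key : realPt l x ∈ Θ.dom none → ∃ s' R, Differentiable ℂ R ∧
      Θ.half k u l K s =ᶠ[𝓝 x] Θ.half k u l K' s' + R ∧
      Θ.half k u l none s - Θ.half k u l none s' - R ∈ Θ.lattice k u := by
    intro h0
    obtain ⟨s1, R1, hR1, he1, hm1⟩ := Θ.exists_half_eq_none hu l s hx h0
    obtain ⟨s2, R2, hR2, he2, hm2⟩ := Θ.exists_half_none_eq hu l s1 hx' h0
    refine ⟨s2, R2 + R1, hR2.add hR1, ?_, ?_⟩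
    · filter_upwards [he1, he2] with y h1 h2
      rw [h1, Pi.add_apply, h2]
      simp only [Pi.add_apply]
      ring
    · convert AddSubgroup.add_mem _ hm1 hm2 using 1
      abel
  match K, K' with
  | none, _ => exact key hx
  | _, none => exact key hx'
  | some i, some j =>
    rcases eq_or_ne i j with rfl | hij
    · exact ⟨s, 0, differentiable_const _, by simp, by simp⟩
    · exact key (Θ.inter_subset hij hx hx')

omit hu in
variable (k u) in
/-- The germs at `x` which arise by continuation from the sheet `s₀`. -/
def IsGerm (s₀ : Θ.Fiber) (x : ℂ × ℂ) (g : ℂ × ℂ → ℂ) : Prop :=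
  -- The germ may live in any chart, but the lattice condition always refers to the slit-plane
  -- functions with the same labels. This is the invariant carried along a path.
  ∃ K₀ K₁ s s' R, x ∈ Θ.chart K₀ K₁ ∧ Differentiable ℂ R ∧
    Θ.half k u 0 none s + Θ.half k u 1 none s' + R - Θ.full k u s₀ ∈ Θ.lattice k u ∧
    g =ᶠ[𝓝 x] Θ.half k u 0 K₀ s + Θ.half k u 1 K₁ s' + R

lemma analyticOnNhd_germ {R : ℂ × ℂ → ℂ} (hR : Differentiable ℂ R) (K₀ K₁ : Option (Fin N))
    (s s' : Θ.Fiber) : AnalyticOnNhd ℂ (Θ.half k u 0 K₀ s + Θ.half k u 1 K₁ s' + R)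
      (Θ.chart K₀ K₁) :=
  (((Θ.analyticOnNhd_half hu 0 K₀ s).mono fun _ h => h.1).add
    ((Θ.analyticOnNhd_half hu 1 K₁ s').mono fun _ h => h.2)).add
    ((hR.differentiableOn.analyticOnNhd_prod isOpen_univ).mono (Set.subset_univ _))

variable {Θ}

/-- A germ may be represented in any chart around the point. -/
lemma IsGerm.change {s₀ : Θ.Fiber} {x : ℂ × ℂ} {g : ℂ × ℂ → ℂ} (h : Θ.IsGerm k u s₀ x g)
    {K₀ K₁ : Option (Fin N)} (hx : x ∈ Θ.chart K₀ K₁) : ∃ s s' R, Differentiable ℂ R ∧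
      Θ.half k u 0 none s + Θ.half k u 1 none s' + R - Θ.full k u s₀ ∈ Θ.lattice k u ∧
      g =ᶠ[𝓝 x] Θ.half k u 0 K₀ s + Θ.half k u 1 K₁ s' + R := by
  obtain ⟨K, K', s, s', R, hxK, hR, hm, he⟩ := h
  obtain ⟨s1, R1, hR1, he1, hm1⟩ := Θ.exists_half_eq hu 0 s hxK.1 hx.1
  obtain ⟨s2, R2, hR2, he2, hm2⟩ := Θ.exists_half_eq hu 1 s' hxK.2 hx.2
  refine ⟨s1, s2, R + R1 + R2, (hR.add hR1).add hR2, ?_, ?_⟩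
  · convert AddSubgroup.sub_mem _ hm (AddSubgroup.add_mem _ hm1 hm2) using 1
    abel
  · filter_upwards [he, he1, he2] with y h h1 h2
    rw [h]
    simp only [Pi.add_apply] at h1 h2 ⊢
    rw [h1, h2]
    ring

omit hu in
lemma IsGerm.congr {s₀ : Θ.Fiber} {x : ℂ × ℂ} {g g' : ℂ × ℂ → ℂ} (h : Θ.IsGerm k u s₀ x g)
    (he : g' =ᶠ[𝓝 x] g) : Θ.IsGerm k u s₀ x g' := by
  obtain ⟨K, K', s, s', R, hxK, hR, hm, hg⟩ := h
  exact ⟨K, K', s, s', R, hxK, hR, hm, he.trans hg⟩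

lemma IsGerm.analyticAt {s₀ : Θ.Fiber} {x : ℂ × ℂ} {g : ℂ × ℂ → ℂ} (h : Θ.IsGerm k u s₀ x g) :
    AnalyticAt ℂ g x := by
  obtain ⟨K, K', s, s', R, hxK, hR, hm, hg⟩ := h
  exact (Θ.analyticOnNhd_germ hu hR K K' s s' x hxK).congr hg.symm

omit hu in
lemma exists_chart_mem (Θ : X.SlitSystem) {x : ℂ × ℂ} (hx : x ∉ X.branchLines) :
    ∃ K₀ K₁, x ∈ Θ.chart K₀ K₁ := by
  rw [notMem_branchLines_iff] at hx
  obtain ⟨K₀, h0⟩ := Θ.exists_mem_dom (hx 0)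
  obtain ⟨K₁, h1⟩ := Θ.exists_mem_dom (hx 1)
  exact ⟨K₀, K₁, h0, h1⟩

omit hu in
lemma regular_of_notMem {s : S} (h : toC2 (X.proj s) ∉ X.branchLines) : X.Regular s := by
  rw [notMem_branchLines_iff] at h
  have := h 0
  rw [realPt_toC2] at this
  exact this

omit hu in
variable (k u) in
/-- The germ of the wave field at a real point. -/
lemma exists_start_germ [PreconnectedSpace S] (s₀ : Θ.Fiber) {s : S} (hs : X.Regular s) :
    ∃ g, Θ.IsGerm k u s₀ (toC2 (X.proj s)) g ∧
      ∀ᶠ z in 𝓝 (X.proj s), g (toC2 z) = u (X.sheet s z) := by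
  obtain ⟨K, hK⟩ := Θ.exists_mem_dom hs
  obtain ⟨s', hs'⟩ := Θ.exists_sec_eq hK (s := s) rfl
  refine ⟨Θ.half k u 0 K s' + Θ.half k u 1 K s' + 0, ⟨K, K, s', s', 0, ?_,
    differentiable_const _, ?_, EventuallyEq.rfl⟩, ?_⟩
  · exact ⟨by rwa [realPt_toC2], by rwa [realPt_toC2]⟩
  · rw [add_zero]
    exact Θ.full_sub_full_mem k u s' s₀
  · filter_upwards [(Θ.isSection_sec K s').eventuallyEq_sheet (Θ.isOpen_dom K) hK] with z hz
    rw [hs'] at hz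
    simp only [Pi.add_apply, Pi.zero_apply, add_zero]
    rw [Θ.half_zero_add_half_one_toC2, hz]

/-- Continuation along a path off the branch lines. -/
theorem exists_continuation (s₀ : Θ.Fiber) {x y : ℂ × ℂ} (σ : Path x y)
    (hσ : ∀ t, σ t ∉ X.branchLines) {g : ℂ × ℂ → ℂ} (hg : Θ.IsGerm k u s₀ x g) :
    ∃ f : unitInterval → ℂ × ℂ → ℂ, f 0 = g ∧ (∀ t, Θ.IsGerm k u s₀ (σ t) (f t)) ∧
      ∀ t, ∀ᶠ t' in 𝓝 t, f t' =ᶠ[𝓝 (σ t')] f t := by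
  obtain ⟨τ, hτ0, hmono, ⟨n, hn⟩, hτ⟩ := exists_monotone_Icc_subset_open_cover_unitInterval
    (c := fun K : Option (Fin N) × Option (Fin N) => σ ⁻¹' Θ.chart K.1 K.2)
    (fun K => (Θ.isOpen_chart K.1 K.2).preimage σ.continuous) (fun t _ => by
      obtain ⟨K₀, K₁, h⟩ := Θ.exists_chart_mem (hσ t)
      exact Set.mem_iUnion.2 ⟨(K₀, K₁), h⟩)
  have step : ∀ m, ∃ f : unitInterval → ℂ × ℂ → ℂ, f 0 = g ∧
      (∀ t ≤ τ m, Θ.IsGerm k u s₀ (σ t) (f t)) ∧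
      ∀ t ≤ τ m, ∀ᶠ t' in 𝓝 t, t' ≤ τ m → f t' =ᶠ[𝓝 (σ t')] f t := by
    intro m
    induction m with
    | zero =>
      refine ⟨fun _ => g, rfl, fun t ht => ?_, fun t ht => ?_⟩
      · rw [hτ0] at ht
        have : t = 0 := le_antisymm ht t.2.1
        rw [this, σ.source]
        exact hg
      · exact Eventually.of_forall fun t' _ => EventuallyEq.rfl
    | succ m ih =>
      obtain ⟨f, hf0, hf1, hf2⟩ := ih
      obtain ⟨K, hK⟩ := hτ m
      have hmm : τ m ≤ τ (m + 1) := hmono (Nat.le_succ m)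
      -- At the subdivision point the germ is rewritten in the chart of the next piece. The
      -- resulting analytic function then serves on that whole piece.
      obtain ⟨s, s', R, hR, hm, he⟩ := (hf1 (τ m) le_rfl).change hu (hK ⟨le_rfl, hmm⟩)
      set G := Θ.half k u 0 K.1 s + Θ.half k u 1 K.2 s' + R with hG
      refine ⟨fun t => if t ≤ τ m then f t else G, ?_, fun t ht => ?_, fun t ht => ?_⟩
      · simp only [if_pos (show (0 : unitInterval) ≤ τ m from (τ m).2.1), hf0]
      · by_cases h : t ≤ τ m
        · simpa only [if_pos h] using hf1 t h
        · simp only [if_neg h]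
          exact ⟨K.1, K.2, s, s', R, hK ⟨(not_le.1 h).le, ht⟩, hR, hm, EventuallyEq.rfl⟩
      · rcases lt_trichotomy t (τ m) with h | h | h
        · filter_upwards [hf2 t h.le, Iio_mem_nhds h] with t' h1 h2 _
          have h2' : t' ≤ τ m := (show t' < τ m from h2).le
          simp only [if_pos h2', if_pos h.le]
          exact h1 h2'
        · subst h
          have h3 : ∀ᶠ t' in 𝓝 (τ m), G =ᶠ[𝓝 (σ t')] f (τ m) :=
            σ.continuous.continuousAt.eventually he.symm.eventuallyEq_nhds
          filter_upwards [hf2 _ le_rfl, h3] with t' h1 h2 _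
          simp only [le_refl, if_true]
          by_cases h : t' ≤ τ m
          · simpa only [if_pos h] using h1 h
          · simpa only [if_neg h] using h2
        · filter_upwards [Ioi_mem_nhds h] with t' h1 _
          have h1' : ¬ t' ≤ τ m := not_le.2 h1
          simp only [if_neg h1', if_neg (not_le.2 h)]
          exact EventuallyEq.rfl
  obtain ⟨f, hf0, hf1, hf2⟩ := step n
  rw [hn n le_rfl] at hf1 hf2
  refine ⟨f, hf0, fun t => hf1 t t.2.2, fun t => ?_⟩
  filter_upwards [hf2 t t.2.2] with t' h
  exact h t'.2.2

/-- Every continuation of a germ along a path off the branch lines is again a germ. -/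
theorem isGerm_of_continuation (s₀ : Θ.Fiber) {x y : ℂ × ℂ} (σ : Path x y)
    (hσ : ∀ t, σ t ∉ X.branchLines) {f : unitInterval → ℂ × ℂ → ℂ}
    (hf : ∀ t, AnalyticAt ℂ (f t) (σ t)) (hc : ∀ t, ∀ᶠ t' in 𝓝 t, f t' =ᶠ[𝓝 (σ t')] f t)
    (h0 : Θ.IsGerm k u s₀ x (f 0)) (t : unitInterval) : Θ.IsGerm k u s₀ (σ t) (f t) := by
  -- The parameters at which the continuation is a germ of the required kind form a clopen set of
  -- the unit interval.
  have hclopen : IsClopen {t | Θ.IsGerm k u s₀ (σ t) (f t)} := by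
    constructor
    · rw [isClosed_iff_frequently]
      intro t ht
      obtain ⟨K₀, K₁, hK⟩ := Θ.exists_chart_mem (hσ t)
      obtain ⟨r, hr, hb⟩ := Metric.eventually_nhds_iff_ball.1
        ((hf t).eventually_analyticAt.and (eventually_mem_set.2
          ((Θ.isOpen_chart K₀ K₁).mem_nhds hK)))
      obtain ⟨t', h1, h2, h3⟩ := (ht.and_eventually ((hc t).and
        (σ.continuous.continuousAt.eventually (Metric.ball_mem_nhds (σ t) hr)))).exists
      obtain ⟨s, s', R, hR, hm, he⟩ := (show Θ.IsGerm k u s₀ (σ t') (f t') from h1).change hu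
        (hb _ h3).2
      refine ⟨K₀, K₁, s, s', R, hK, hR, hm, ?_⟩
      -- Closedness: agreement near σ(t') spreads, by the identity theorem, over a ball around σ(t)
      -- on which both functions are analytic.
      have heq : Set.EqOn (f t) (Θ.half k u 0 K₀ s + Θ.half k u 1 K₁ s' + R)
          (Metric.ball (σ t) r) := by
        refine AnalyticOnNhd.eqOn_of_preconnected_of_eventuallyEq (𝕜 := ℂ) (fun q hq => (hb q hq).1)
          ((Θ.analyticOnNhd_germ hu hR K₀ K₁ s s').mono fun q hq => (hb q hq).2)
          (convex_ball _ _).isPreconnected h3 ?_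
        exact h2.symm.trans he
      exact heq.eventuallyEq_of_mem (Metric.ball_mem_nhds _ hr)
    · rw [isOpen_iff_eventually]
      rintro t ⟨K, K', s, s', R, hxK, hR, hm, hg⟩
      filter_upwards [hc t, σ.continuous.continuousAt.eventually hg.eventuallyEq_nhds,
        σ.continuous.continuousAt.eventually ((Θ.isOpen_chart K K').mem_nhds hxK)] with t' h1 h2 h3
      exact ⟨K, K', s, s', R, h3, hR, hm, h1.trans h2⟩
  have := hclopen.eq_univ ⟨0, by simpa only [Set.mem_ofPred_eq, σ.source] using h0⟩
  have h : t ∈ Set.univ := trivial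
  rw [← this] at h
  exact h

/-- The wave field continues along every path off the branch lines. -/
theorem exists_isBranch [PreconnectedSpace S] (s₀ : Θ.Fiber) {A : ℂ × ℂ}
    (hA : A ∈ Θ.chart none none) (s : S) (σ : Path (toC2 (X.proj s)) A)
    (hσ : ∀ t, σ t ∉ X.branchLines) :
    ∃ l ∈ Θ.lattice k u, X.IsBranch u s σ (Θ.full k u s₀ + l) := by
  have hs : X.Regular s := regular_of_notMem (by simpa using hσ 0)
  obtain ⟨g, hg, hg0⟩ := exists_start_germ k u s₀ hs
  obtain ⟨f, hf0, hf1, hf2⟩ := exists_continuation hu s₀ σ hσ hg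
  have h1 := hf1 1
  rw [σ.target] at h1
  obtain ⟨s1, s2, R, hR, hm, he⟩ := h1.change hu hA
  -- In the slit chart the final germ is `full s₀` plus its difference from it, and that difference
  -- is the lattice element.
  refine ⟨_, hm, f, fun t => (hf1 t).analyticAt hu, hf2, by rwa [hf0], ?_⟩
  rw [add_sub_cancel]
  exact he

/-- Every branch at a point of the slit chart lies in the coset of the lattice. -/
theorem eventuallyEq_of_isBranch [PreconnectedSpace S] (s₀ : Θ.Fiber) {A : ℂ × ℂ}
    (hA : A ∈ Θ.chart none none) {s : S} {σ : Path (toC2 (X.proj s)) A}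
    (hσ : ∀ t, σ t ∉ X.branchLines) {v : ℂ × ℂ → ℂ} (hv : X.IsBranch u s σ v) :
    ∃ l ∈ Θ.lattice k u, v =ᶠ[𝓝 A] Θ.full k u s₀ + l := by
  have hs : X.Regular s := regular_of_notMem (by simpa using hσ 0)
  obtain ⟨g, hg, hg0⟩ := exists_start_germ k u s₀ hs
  obtain ⟨f, hf1, hf2, hf3, hf4⟩ := hv
  -- The given initial germ is only prescribed on the real plane, which determines an analytic germ.
  have h0 : f 0 =ᶠ[𝓝 (toC2 (X.proj s))] g := by
    have h1 : AnalyticAt ℂ (f 0) (toC2 (X.proj s)) := by simpa using hf1 0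
    have := (h1.sub (hg.analyticAt hu)).eventually_eq_zero_of_real (by
      filter_upwards [hf3, hg0] with z h h'
      rw [Pi.sub_apply, h, h', sub_self])
    filter_upwards [this] with q hq
    exact sub_eq_zero.1 hq
  have h1 := isGerm_of_continuation hu s₀ σ hσ hf1 hf2 (hg.congr h0) 1
  rw [σ.target] at h1
  obtain ⟨s1, s2, R, hR, hm, he⟩ := h1.change hu hA
  refine ⟨_, hm, hf4.symm.trans ?_⟩
  rw [add_sub_cancel]
  exact he

end SlitSystem

end SommerfeldSurface

/-! ### The complex Helmholtz operator -/

/-- The complex Helmholtz operator, for functions analytic near a point. -/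
def helmholtzOp (k : ℂ) (v : ℂ × ℂ → ℂ) (x : ℂ × ℂ) : ℂ :=
  fderiv ℂ (fun y => fderiv ℂ v y (1, 0)) x (1, 0) +
    fderiv ℂ (fun y => fderiv ℂ v y (0, 1)) x (0, 1) + k ^ 2 * v x

lemma AnalyticAt.fderiv_apply {v : ℂ × ℂ → ℂ} {x : ℂ × ℂ} (hv : AnalyticAt ℂ v x) (e : ℂ × ℂ) :
    AnalyticAt ℂ (fun y => fderiv ℂ v y e) x :=
  ((ContinuousLinearMap.apply ℂ ℂ e).analyticAt _).comp hv.fderiv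

lemma AnalyticAt.helmholtzOp {k : ℂ} {v : ℂ × ℂ → ℂ} {x : ℂ × ℂ} (hv : AnalyticAt ℂ v x) :
    AnalyticAt ℂ (helmholtzOp k v) x :=
  (((hv.fderiv_apply _).fderiv_apply _).add ((hv.fderiv_apply _).fderiv_apply _)).add
    (analyticAt_const.mul hv)

lemma AnalyticAt.deriv_deriv_line {v : ℂ × ℂ → ℂ} {x : ℂ × ℂ} (hv : AnalyticAt ℂ v x)
    {e : ℂ × ℂ} {c : ℂ → ℂ × ℂ} {t : ℂ} (hc : ∀ t, HasDerivAt c e t) (ht : c t = x) :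
    deriv (deriv fun t => v (c t)) t = fderiv ℂ (fun y => fderiv ℂ v y e) x e := by
  have h1 : deriv (fun t => v (c t)) =ᶠ[𝓝 t] fun t => fderiv ℂ v (c t) e := by
    have := (hc t).continuousAt.eventually (ht ▸ hv.eventually_analyticAt)
    filter_upwards [this] with s hs
    exact (hs.differentiableAt.hasFDerivAt.comp_hasDerivAt s (hc s)).deriv
  rw [h1.deriv_eq]
  have h2 := (hv.fderiv_apply e).differentiableAt.hasFDerivAt
  subst ht
  exact (h2.comp_hasDerivAt t (hc t)).deriv

lemma AnalyticAt.complexHelmholtzAt_iff {k : ℂ} {v : ℂ × ℂ → ℂ} {x : ℂ × ℂ}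
    (hv : AnalyticAt ℂ v x) : ComplexHelmholtzAt k v x ↔ _root_.helmholtzOp k v x = 0 := by
  have h1 := hv.deriv_deriv_line (e := (1, 0)) (c := fun t => (t, x.2)) (t := x.1)
    (fun t => (hasDerivAt_id t).prodMk (hasDerivAt_const t x.2)) rfl
  have h2 := hv.deriv_deriv_line (e := (0, 1)) (c := fun t => (x.1, t)) (t := x.2)
    (fun t => (hasDerivAt_const t x.1).prodMk (hasDerivAt_id t)) rfl
  rw [ComplexHelmholtzAt, _root_.helmholtzOp, iteratedDeriv_succ, iteratedDeriv_one,
    iteratedDeriv_succ, iteratedDeriv_one, h1, h2]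

lemma helmholtzOp_congr (k : ℂ) {v v' : ℂ × ℂ → ℂ} {x : ℂ × ℂ} (h : v =ᶠ[𝓝 x] v') :
    helmholtzOp k v =ᶠ[𝓝 x] helmholtzOp k v' := by
  have h1 : ∀ e, (fun y => fderiv ℂ v y e) =ᶠ[𝓝 x] fun y => fderiv ℂ v' y e := fun e => by
    filter_upwards [h.fderiv (𝕜 := ℂ)] with y hy
    rw [hy]
  filter_upwards [(h1 (1, 0)).fderiv (𝕜 := ℂ), (h1 (0, 1)).fderiv (𝕜 := ℂ), h] with y h2 h3 h4
  rw [helmholtzOp, helmholtzOp, h2, h3, h4]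

lemma AnalyticAt.helmholtzOp_sub {k : ℂ} {v v' : ℂ × ℂ → ℂ} {x : ℂ × ℂ} (hv : AnalyticAt ℂ v x)
    (hv' : AnalyticAt ℂ v' x) :
    _root_.helmholtzOp k (v - v') x = _root_.helmholtzOp k v x - _root_.helmholtzOp k v' x := by
  have h1 : ∀ e, fderiv ℂ (fun y => fderiv ℂ (v - v') y e) x e =
      fderiv ℂ (fun y => fderiv ℂ v y e) x e - fderiv ℂ (fun y => fderiv ℂ v' y e) x e := by
    intro e
    have h2 : (fun y => fderiv ℂ (v - v') y e) =ᶠ[𝓝 x]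
        (fun y => fderiv ℂ v y e) - fun y => fderiv ℂ v' y e := by
      filter_upwards [hv.eventually_analyticAt, hv'.eventually_analyticAt] with y hy hy'
      rw [fderiv_sub hy.differentiableAt hy'.differentiableAt]
      rfl
    rw [h2.fderiv_eq, fderiv_sub (hv.fderiv_apply e).differentiableAt
      (hv'.fderiv_apply e).differentiableAt]
    rfl
  simp only [_root_.helmholtzOp, h1, Pi.sub_apply]
  ring

/-- The inclusion of the real plane as a real-linear map. -/
def toC2CLM : ℂ →L[ℝ] ℂ × ℂ :=
  (Complex.ofRealCLM.comp Complex.reCLM).prod (Complex.ofRealCLM.comp Complex.imCLM)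

/-- The complex partial derivatives at a real point are determined by the restriction to the real
plane: ∂₁ = ∂ + ∂̄ and ∂₂ = i(∂ - ∂̄). -/
lemma AnalyticAt.fderiv_of_real {v : ℂ × ℂ → ℂ} {f : ℂ → ℂ} {ζ p q : ℂ}
    (hv : AnalyticAt ℂ v (toC2 ζ)) (h : ∀ᶠ y in 𝓝 ζ, v (toC2 y) = f y)
    (hf : HasFDerivAt f (wirtinger p q) ζ) :
    fderiv ℂ v (toC2 ζ) (1, 0) = p + q ∧ fderiv ℂ v (toC2 ζ) (0, 1) = Complex.I * (p - q) := by
  have h1 : HasFDerivAt (fun y => v (toC2 y))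
      (((fderiv ℂ v (toC2 ζ)).restrictScalars ℝ).comp toC2CLM) ζ :=
    HasFDerivAt.comp (g := v) (f := toC2) ζ
      (hv.differentiableAt.hasFDerivAt.restrictScalars ℝ) toC2CLM.hasFDerivAt
  have h2 := h1.unique (hf.congr_of_eventuallyEq h)
  have e1 := DFunLike.congr_fun h2 1
  have eI := DFunLike.congr_fun h2 Complex.I
  simp [toC2CLM] at e1 eI
  refine ⟨e1, eI.trans ?_⟩
  ring

theorem IsPlaneSolution.helmholtzOp_eq_zero {k : ℂ} {U Uz Ub : ℂ → ℂ} {K : Set ℂ}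
    (h : IsPlaneSolution (k ^ 2 / 4) U Uz Ub K) (hK : IsOpen K) {v : ℂ × ℂ → ℂ}
    (hv : ∀ ζ ∈ K, AnalyticAt ℂ v (toC2 ζ) ∧ v (toC2 ζ) = U ζ) {ζ : ℂ} (hζ : ζ ∈ K) :
    helmholtzOp k v (toC2 ζ) = 0 := by
  have h1 : ∀ y ∈ K, fderiv ℂ v (toC2 y) (1, 0) = Uz y + Ub y ∧
      fderiv ℂ v (toC2 y) (0, 1) = Complex.I * (Uz y - Ub y) := fun y hy =>
    (hv y hy).1.fderiv_of_real (by filter_upwards [hK.mem_nhds hy] with z hz using (hv z hz).2)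
      (h y hy).1
  obtain ⟨-, ⟨a, hz⟩, b, hb⟩ := h ζ hζ
  have h2 := ((hv ζ hζ).1.fderiv_apply (1, 0)).fderiv_of_real
    (by filter_upwards [hK.mem_nhds hζ] with z hz using (h1 z hz).1) (hz.wirtinger_add hb)
  have h3 := ((hv ζ hζ).1.fderiv_apply (0, 1)).fderiv_of_real
    (by filter_upwards [hK.mem_nhds hζ] with z hz using (h1 z hz).2)
    ((hz.wirtinger_sub hb).wirtinger_const_mul Complex.I)
  rw [helmholtzOp, h2.1, h3.2, (hv ζ hζ).2]
  linear_combination (a + b + k ^ 2 / 2 * U ζ) * Complex.I_sq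

/-! ### Points of ℂ² as pairs of real points, and connectedness of the charts. -/

/-- The point of `ℂ²` with given associated real points. -/
def ofRealPts (p : ℂ × ℂ) : ℂ × ℂ := ((p.1 + conj p.2) / 2, (p.1 - conj p.2) / (2 * Complex.I))

lemma continuous_ofRealPts : Continuous ofRealPts := by
  unfold ofRealPts
  fun_prop

lemma charZ_ofRealPts (p : ℂ × ℂ) : charZ (ofRealPts p) = p.1 := by
  rw [charZ_apply, ofRealPts]
  field_simp
  ring

lemma charW_ofRealPts (p : ℂ × ℂ) : charW (ofRealPts p) = conj p.2 := by
  rw [charW_apply, ofRealPts]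
  field_simp
  ring

lemma ofRealPts_realPt (x : ℂ × ℂ) : ofRealPts (realPt 0 x, realPt 1 x) = x := by
  rw [realPt_zero, realPt_one, charZ_apply, charW_apply, ofRealPts]
  simp only [Complex.conj_conj]
  ext
  · simp
  · simp only
    field_simp
    ring

lemma setOf_realPt_eq (K₀ K₁ : Set ℂ) :
    {x | realPt 0 x ∈ K₀ ∧ realPt 1 x ∈ K₁} = ofRealPts '' K₀ ×ˢ K₁ := by
  ext x
  constructor
  · exact fun h => ⟨(realPt 0 x, realPt 1 x), h, ofRealPts_realPt x⟩
  · rintro ⟨p, hp, rfl⟩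
    simp only [Set.mem_ofPred_eq, realPt_zero, realPt_one, charZ_ofRealPts, charW_ofRealPts,
      Complex.conj_conj]
    exact hp

lemma isPreconnected_setOf_realPt {K₀ K₁ : Set ℂ} (h₀ : IsPreconnected K₀)
    (h₁ : IsPreconnected K₁) : IsPreconnected {x | realPt 0 x ∈ K₀ ∧ realPt 1 x ∈ K₁} := by
  rw [setOf_realPt_eq]
  exact (h₀.prod h₁).image _ continuous_ofRealPts.continuousOn

/-! ### The Helmholtz equation for the generators. -/

namespace SommerfeldSurface

variable {S : Type*} [TopologicalSpace S] [T2Space S] {M N : ℕ} {X : SommerfeldSurface S M N}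

namespace SlitSystem

variable (Θ : X.SlitSystem) {k : ℂ} {u : S → ℂ}

lemma isPreconnected_chart (K₀ K₁ : Option (Fin N)) : IsPreconnected (Θ.chart K₀ K₁) :=
  isPreconnected_setOf_realPt (Θ.isPreconnected_dom K₀) (Θ.isPreconnected_dom K₁)

lemma toC2_mem_chart {K₀ K₁ : Option (Fin N)} {ζ : ℂ} (h₀ : ζ ∈ Θ.dom K₀) (h₁ : ζ ∈ Θ.dom K₁) :
    toC2 ζ ∈ Θ.chart K₀ K₁ := by
  simp only [chart, Set.mem_ofPred_eq, realPt_toC2]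
  exact ⟨h₀, h₁⟩

lemma helmholtzOp_eqOn_zero {v : ℂ × ℂ → ℂ} {K₀ K₁ : Option (Fin N)}
    (hv : AnalyticOnNhd ℂ v (Θ.chart K₀ K₁)) {x : ℂ × ℂ} (hx : x ∈ Θ.chart K₀ K₁)
    (h : helmholtzOp k v =ᶠ[𝓝 x] 0) : ∀ y ∈ Θ.chart K₀ K₁, helmholtzOp k v y = 0 :=
  AnalyticOnNhd.eqOn_zero_of_preconnected_of_eventuallyEq_zero (fun y hy => (hv y hy).helmholtzOp)
    (Θ.isPreconnected_chart K₀ K₁) hx h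

/-- Near the base point the equation holds on the real plane. It extends to complex arguments by
real uniqueness, and then over the connected chart by the identity theorem. -/
theorem helmholtzOp_full (hu : X.IsHelmholtz k u) (s : Θ.Fiber) :
    ∀ x ∈ Θ.chart none none, helmholtzOp k (Θ.full k u s) x = 0 := by
  have ha := Θ.analyticOnNhd_full hu s
  have hb := Θ.toC2_mem_chart Θ.base_mem Θ.base_mem
  refine Θ.helmholtzOp_eqOn_zero ha hb ((ha _ hb).helmholtzOp.eventually_eq_zero_of_real ?_)
  filter_upwards [(Θ.isOpen_dom none).mem_nhds Θ.base_mem] with ζ hζ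
  exact (Θ.isPlaneSolution hu none s).helmholtzOp_eq_zero (Θ.isOpen_dom none)
    (fun y hy => ⟨ha _ (Θ.toC2_mem_chart hy hy), Θ.half_zero_add_half_one_toC2 k u none s y⟩) hζ

/-- The function `w` inherits the equation from `full` near x, and keeps it throughout its connected
chart. Near y both `full` and `full - c` are then solutions, hence so is `c`. -/
lemma helmholtzOp_of_continuation (hu : X.IsHelmholtz k u) {w c : ℂ × ℂ → ℂ}
    {K₀ K₁ : Option (Fin N)} (hw : AnalyticOnNhd ℂ w (Θ.chart K₀ K₁))
    (hc : AnalyticOnNhd ℂ c (Θ.chart none none)) (s : Θ.Fiber) {x y : ℂ × ℂ}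
    (hx : x ∈ Θ.chart K₀ K₁) (hx' : x ∈ Θ.chart none none) (hy : y ∈ Θ.chart K₀ K₁)
    (hy' : y ∈ Θ.chart none none) (h1 : w =ᶠ[𝓝 x] Θ.full k u s)
    (h2 : w =ᶠ[𝓝 y] Θ.full k u s - c) : ∀ p ∈ Θ.chart none none, helmholtzOp k c p = 0 := by
  have hop := Θ.isOpen_chart none none
  have h3 : ∀ p ∈ Θ.chart K₀ K₁, helmholtzOp k w p = 0 := by
    refine Θ.helmholtzOp_eqOn_zero hw hx ?_
    filter_upwards [helmholtzOp_congr k h1, hop.mem_nhds hx'] with p hp hp'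
    rw [hp, Θ.helmholtzOp_full hu s p hp', Pi.zero_apply]
  refine Θ.helmholtzOp_eqOn_zero hc hy' ?_
  filter_upwards [helmholtzOp_congr k h2, hop.mem_nhds hy',
    (Θ.isOpen_chart K₀ K₁).mem_nhds hy] with p hp hp' hp''
  rw [h3 p hp'', (Θ.analyticOnNhd_full hu s p hp').helmholtzOp_sub (hc p hp'),
    Θ.helmholtzOp_full hu s p hp', zero_sub, eq_comm, neg_eq_zero] at hp
  exact hp

/-- Let only the l-th real point pass through the cone from left to right: the continuation of `full
s` then becomes `full s - cross`. The equation need not be checked for a half-solution by itself. -/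
theorem helmholtzOp_cross (hu : X.IsHelmholtz k u) (l : Fin 2) (j : Fin N) (s : Θ.Fiber) :
    ∀ x ∈ Θ.chart none none, helmholtzOp k (Θ.cross k u l j s) x = 0 := by
  have hup := Θ.upPt_mem j
  have hlow := Θ.lowPt_mem j
  have hup' := Θ.up_subset j hup
  have hlow' := Θ.low_subset j hlow
  have e1 : ∀ l, ∀ᶠ x in 𝓝 (toC2 (Θ.upPt j)), realPt l x ∈ Θ.up j := fun l =>
    (continuous_realPt l).continuousAt.eventually
      ((Θ.isOpen_up j).mem_nhds (by rwa [realPt_toC2]))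
  have e2 : ∀ l, ∀ᶠ x in 𝓝 (toC2 (Θ.lowPt j)), realPt l x ∈ Θ.low j := fun l =>
    (continuous_realPt l).continuousAt.eventually
      ((Θ.isOpen_low j).mem_nhds (by rwa [realPt_toC2]))
  have hc : AnalyticOnNhd ℂ (Θ.cross k u l j s) (Θ.chart none none) :=
    Θ.analyticOnNhd_of_mem_lattice hu (Θ.cross_mem k u l j s)
  fin_cases l
  · refine Θ.helmholtzOp_of_continuation hu (K₀ := some j) (K₁ := none)
      (w := Θ.half k u 0 (some j) s + Θ.half k u 1 none s)
      (((Θ.analyticOnNhd_half hu 0 _ s).mono fun _ h => h.1).add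
        ((Θ.analyticOnNhd_half hu 1 _ s).mono fun _ h => h.2)) hc s
      (Θ.toC2_mem_chart hup.1 hup') (Θ.toC2_mem_chart hup' hup') (Θ.toC2_mem_chart hlow.1 hlow')
      (Θ.toC2_mem_chart hlow' hlow') ?_ ?_
    · filter_upwards [e1 0] with x hx
      simp only [Pi.add_apply, full, Θ.half_eq_up hu 0 j s hx]
    · filter_upwards [e2 0] with x hx
      simp only [Pi.add_apply, Pi.sub_apply, full, cross, Θ.half_eq_low hu 0 j s hx, Fin.zero_eta]
      ring
  · refine Θ.helmholtzOp_of_continuation hu (K₀ := none) (K₁ := some j)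
      (w := Θ.half k u 0 none s + Θ.half k u 1 (some j) s)
      (((Θ.analyticOnNhd_half hu 0 _ s).mono fun _ h => h.1).add
        ((Θ.analyticOnNhd_half hu 1 _ s).mono fun _ h => h.2)) hc s
      (Θ.toC2_mem_chart hup' hup.1) (Θ.toC2_mem_chart hup' hup') (Θ.toC2_mem_chart hlow' hlow.1)
      (Θ.toC2_mem_chart hlow' hlow') ?_ ?_
    · filter_upwards [e1 1] with x hx
      simp only [Pi.add_apply, full, Θ.half_eq_up hu 1 j s hx]
    · filter_upwards [e2 1] with x hx
      simp only [Pi.add_apply, Pi.sub_apply, full, cross, Θ.half_eq_low hu 1 j s hx, Fin.mk_one]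
      ring

end SlitSystem

end SommerfeldSurface

/-! ### Integrals along lifted paths -/

section LineIntegral

variable {T : Type*} [TopologicalSpace T] {a b c : T} {p q r : ℂ}

/-- The integral of the form `F`, at the points of the path `Λ`, in the direction of the plane path
`γ`, exists and is equal to `I`. -/
def HasLineIntegral (F : T → ℂ → ℂ) (Λ : Path a b) (γ : Path p q) (I : ℂ) : Prop :=
  IntervalIntegrable (fun t => F (Λ.extend t) (deriv γ.extend t)) volume 0 1 ∧
    ∫ t in (0 : ℝ)..1, F (Λ.extend t) (deriv γ.extend t) = I

/-- Homogeneity over the reals in the second argument. -/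
def RealHomogeneous (F : T → ℂ → ℂ) : Prop := ∀ a (ρ : ℝ) v, F a (ρ • v) = ρ • F a v

variable {F : T → ℂ → ℂ} {Λ : Path a b} {γ : Path p q} {I : ℂ}

theorem HasLineIntegral.symm (h : HasLineIntegral F Λ γ I) (hF : RealHomogeneous F) :
    HasLineIntegral F Λ.symm γ.symm (-I) := by
  have e : (fun t => F (Λ.symm.extend t) (deriv γ.symm.extend t)) =
      fun t => -(F (Λ.extend (1 - t)) (deriv γ.extend (1 - t))) := by
    funext t
    have := hF (Λ.extend (1 - t)) (-1) (deriv γ.extend (1 - t))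
    simp only [neg_smul, one_smul] at this
    rw [Path.extend_symm, Path.extend_symm, deriv_comp_const_sub, this]
  constructor
  · rw [e]
    have := (h.1.comp_sub_left 1).symm
    simp only [sub_zero, sub_self] at this
    exact this.neg
  · rw [e, intervalIntegral.integral_neg, intervalIntegral.integral_comp_sub_left
      (fun t => F (Λ.extend t) (deriv γ.extend t)), ← h.2]
    simp

lemma lineIntegrand_trans_left (hF : RealHomogeneous F) (Λ : Path a b) (γ : Path p q)
    (Λ' : Path b c) (γ' : Path q r) {t : ℝ} (ht : t < 1 / 2) :
    F ((Λ.trans Λ').extend t) (deriv (γ.trans γ').extend t) =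
      (2 : ℝ) • F (Λ.extend (2 * t)) (deriv γ.extend (2 * t)) := by
  have H : (γ.trans γ').extend =ᶠ[𝓝 t] (fun s => γ.extend (2 * s)) :=
    (eventually_le_nhds ht).mono fun _ => Path.extend_trans_of_le_half _ _
  rw [H.deriv_eq, deriv_comp_mul_left, Path.extend_trans_of_le_half _ _ ht.le, hF]

lemma lineIntegrand_trans_right (hF : RealHomogeneous F) (Λ : Path a b) (γ : Path p q)
    (Λ' : Path b c) (γ' : Path q r) {t : ℝ} (ht : 1 / 2 < t) :
    F ((Λ.trans Λ').extend t) (deriv (γ.trans γ').extend t) =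
      (2 : ℝ) • F (Λ'.extend (2 * t - 1)) (deriv γ'.extend (2 * t - 1)) := by
  have H : (γ.trans γ').extend =ᶠ[𝓝 t] (fun s => γ'.extend (2 * s - 1)) :=
    (eventually_ge_nhds ht).mono fun _ => Path.extend_trans_of_half_le _ _
  have e : (fun s => γ'.extend (2 * s - 1)) = fun s => (fun y => γ'.extend (y - 1)) (2 * s) := rfl
  rw [H.deriv_eq, e, deriv_comp_mul_left (2 : ℝ) (fun y => γ'.extend (y - 1)) t,
    deriv_comp_sub_const,
    Path.extend_trans_of_half_le _ _ ht.le, hF]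

theorem HasLineIntegral.trans {Λ' : Path b c} {γ' : Path q r} {I' : ℂ}
    (h : HasLineIntegral F Λ γ I) (h' : HasLineIntegral F Λ' γ' I') (hF : RealHomogeneous F) :
    HasLineIntegral F (Λ.trans Λ') (γ.trans γ') (I + I') := by
  set G := fun t => F ((Λ.trans Λ').extend t) (deriv (γ.trans γ').extend t) with hG
  set f := fun t => F (Λ.extend t) (deriv γ.extend t) with hf
  set f' := fun t => F (Λ'.extend t) (deriv γ'.extend t) with hf'
  have e1 : G =ᵐ[volume.restrict (Set.uIoc (0 : ℝ) (1 / 2))] fun t => (2 : ℝ) • f (2 * t) := by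
    rw [Set.uIoc_of_le (by positivity), ← restrict_Ioo_eq_restrict_Ioc]
    filter_upwards [ae_restrict_mem measurableSet_Ioo] with t ⟨_, ht⟩
    exact lineIntegrand_trans_left hF Λ γ Λ' γ' ht
  have e2 : G =ᵐ[volume.restrict (Set.uIoc (1 / 2 : ℝ) 1)]
      fun t => (2 : ℝ) • f' (2 * t - 1) := by
    rw [Set.uIoc_of_le (by linarith), ← restrict_Ioo_eq_restrict_Ioc]
    filter_upwards [ae_restrict_mem measurableSet_Ioo] with t ⟨ht, _⟩
    exact lineIntegrand_trans_right hF Λ γ Λ' γ' ht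
  have i1 : IntervalIntegrable G volume 0 (1 / 2) := by
    refine .congr_ae ?_ e1.symm
    simpa using! (h.1.comp_mul_left (c := 2)).smul (2 : ℝ)
  have i2 : IntervalIntegrable G volume (1 / 2) 1 := by
    refine .congr_ae ?_ e2.symm
    simpa using! (h'.1.comp_sub_right 1 |>.comp_mul_left (c := 2)).smul (2 : ℝ)
  refine ⟨i1.trans i2, ?_⟩
  rw [← intervalIntegral.integral_add_adjacent_intervals i1 i2,
    intervalIntegral.integral_congr_ae_restrict e1, intervalIntegral.integral_congr_ae_restrict e2,
    intervalIntegral.integral_smul, intervalIntegral.smul_integral_comp_mul_left,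
    intervalIntegral.integral_smul,
    intervalIntegral.smul_integral_comp_mul_left (f := fun t => f' (t - 1)),
    intervalIntegral.integral_comp_sub_right, ← h.2, ← h'.2]
  norm_num [hf, hf']

/-- `γ` has a derivative which extends continuously. -/
def IsSmoothPath (γ : Path p q) (v : ℝ → ℂ) : Prop :=
  Continuous v ∧ ∀ t ∈ Set.Ioo (0 : ℝ) 1, HasDerivAt γ.extend (v t) t

lemma isSmoothPath_segment (p q : ℂ) : IsSmoothPath (Path.segment p q) fun _ => q - p := by
  refine ⟨continuous_const, fun t ht => ?_⟩
  have h1 : HasDerivAt (fun t : ℝ => AffineMap.lineMap p q t) (q - p) t :=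
    AffineMap.hasDerivAt_lineMap
  refine h1.congr_of_eventuallyEq ?_
  filter_upwards [Ioo_mem_nhds ht.1 ht.2] with s hs
  exact Path.eqOn_extend_segment p q ⟨hs.1.le, hs.2.le⟩

lemma isSmoothPath_circleLoop (a p : ℂ) : IsSmoothPath (circleLoop a p) fun t =>
    2 * Real.pi * Complex.I * ((p - a) * Complex.exp (2 * Real.pi * Complex.I * (t : ℂ))) := by
  refine ⟨by fun_prop, fun t ht => ?_⟩
  refine (hasDerivAt_circle_param a p t).congr_of_eventuallyEq ?_
  filter_upwards [Ioo_mem_nhds ht.1 ht.2] with s hs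
  exact circleLoop_extend a p ⟨hs.1.le, hs.2.le⟩

lemma IsSmoothPath.ae_eq {v : ℝ → ℂ} (h : IsSmoothPath γ v) (F : T → ℂ → ℂ) (Λ : Path a b) :
    (fun t => F (Λ.extend t) (deriv γ.extend t)) =ᵐ[volume.restrict (Set.uIoc (0 : ℝ) 1)]
      fun t => F (Λ.extend t) (v t) := by
  rw [Set.uIoc_of_le zero_le_one, ← restrict_Ioo_eq_restrict_Ioc]
  filter_upwards [ae_restrict_mem measurableSet_Ioo] with t ht
  rw [(h.2 t ht).deriv]

theorem IsSmoothPath.hasLineIntegral {v : ℝ → ℂ} (h : IsSmoothPath γ v)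
    (hF : ContinuousOn (fun t => F (Λ.extend t) (v t)) (Set.Icc 0 1)) :
    HasLineIntegral F Λ γ (∫ t in (0 : ℝ)..1, F (Λ.extend t) (v t)) := by
  refine ⟨IntervalIntegrable.congr_ae ?_ (h.ae_eq F Λ).symm,
    intervalIntegral.integral_congr_ae_restrict (h.ae_eq F Λ)⟩
  exact (hF.mono (by rw [Set.uIcc_of_le zero_le_one])).intervalIntegrable

/-- The integral of an exact form. -/
theorem IsSmoothPath.hasLineIntegral_of_hasDerivAt {v : ℝ → ℂ} (h : IsSmoothPath γ v)
    (hF : ContinuousOn (fun t => F (Λ.extend t) (v t)) (Set.Icc 0 1)) {H : ℝ → ℂ}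
    (hH : ContinuousOn H (Set.Icc 0 1))
    (hd : ∀ t ∈ Set.Ioo (0 : ℝ) 1, HasDerivAt H (F (Λ.extend t) (v t)) t) :
    HasLineIntegral F Λ γ (H 1 - H 0) := by
  have := h.hasLineIntegral (F := F) (Λ := Λ) hF
  rwa [intervalIntegral.integral_eq_sub_of_hasDerivAt_of_le zero_le_one hH hd
    ((hF.mono (by rw [Set.uIcc_of_le zero_le_one])).intervalIntegrable)] at this

end LineIntegral

/-- A continuous logarithm along a path. -/
lemma exists_log_path {p q : ℂ} (γ : Path p q) {g : ℂ → ℂ} (hg : Continuous g)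
    (h0 : ∀ t, g (γ t) ≠ 0) {l : ℂ} (hl : Complex.exp (2 * l) = g p) :
    ∃ (l' : ℂ) (L : Path l l'), ∀ t, Complex.exp (2 * L t) = g (γ t) := by
  have := (convex_Icc (0 : ℝ) 1).contractibleSpace ⟨0, by simp⟩
  have : LocallyPathConnectedSpace unitInterval := (convex_Icc (0 : ℝ) 1).locallyPathConnectedSpace
  obtain ⟨f, ⟨h1, h2⟩, -⟩ := Complex.isCoveringMapOn_exp.existsUnique_continuousMap_lifts
    (A := unitInterval) ⟨fun t => g (γ t), hg.comp γ.continuous⟩ (a₀ := 0) (e₀ := 2 * l)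
    (by simpa using hl) (fun t => h0 t)
  refine ⟨f 1 / 2, ⟨⟨fun t => f t / 2, f.continuous.div_const 2⟩, ?_, rfl⟩, fun t => ?_⟩
  · simp only [h1]
    ring
  · have := congrFun h2 t
    simp only [Function.comp_apply, ContinuousMap.coe_mk] at this
    rw [← this]
    congr 1
    change 2 * (f t / 2) = f t
    ring

/-- A continuous logarithm of a differentiable function is differentiable. -/
lemma hasDerivAt_of_exp_eq {f g : ℝ → ℂ} {g' : ℂ} {t : ℝ} (hf : ContinuousAt f t)
    (he : ∀ᶠ s in 𝓝 t, Complex.exp (f s) = g s) (hg : HasDerivAt g g' t) :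
    HasDerivAt f (g' / g t) t := by
  have h0 : g t ≠ 0 := by rw [← he.self_of_nhds]; exact Complex.exp_ne_zero _
  have h1 : HasDerivAt (fun s => Complex.log (g s / g t) + f t) (g' / g t) t := by
    have h2 : HasDerivAt (fun s => g s / g t) (g' / g t) t := hg.div_const _
    have h3 := (h2.clog_real (by simp [h0])).add_const (f t)
    simpa [h0] using h3
  refine h1.congr_of_eventuallyEq ?_
  -- Continuity keeps the increment in the strip where the principal logarithm inverts the
  -- exponential.
  have h4 : ∀ᶠ s in 𝓝 t, ‖f s - f t‖ < Real.pi := by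
    have := Metric.tendsto_nhds.1 hf Real.pi Real.pi_pos
    simpa only [dist_eq_norm] using this
  filter_upwards [he, h4] with s hs hs'
  have h5 : |(f s - f t).im| < Real.pi := (Complex.abs_im_le_norm _).trans_lt hs'
  rw [abs_lt] at h5
  rw [← hs, ← he.self_of_nhds, ← Complex.exp_sub, Complex.log_exp h5.1 h5.2.le]
  ring

namespace SommerfeldSurface

variable {S : Type*} [TopologicalSpace S] [T2Space S] {M N : ℕ} (X : SommerfeldSurface S M N)

/-! ### Green's form along lifted paths -/

/-- Green's integrand, with the normal to the right of the direction `v`, as a function of the point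
of the surface and of the logarithm. -/
def greenForm (u : S → ℂ) (x : ℂ × ℂ) (a : S × ℂ) (v : ℂ) : ℂ :=
  X.greenIntegrand u x a.1 a.2 (-Complex.I * v)

/-- Riemann's form on `S × ℂ`. -/
def energyForm (k : ℂ) (u : S → ℂ) (x : ℂ × ℂ) (a : S × ℂ) (v : ℂ) : ℂ :=
  X.riemannForm k u x a.1 v

/-- The pair of a point over `ζ` and a logarithm is admissible for Green's integrand. -/
def Admissible (k : ℂ) (x : ℂ × ℂ) (ζ : ℂ) (a : S × ℂ) : Prop :=
  X.proj a.1 = ζ ∧ X.Regular a.1 ∧ sqDist x ζ ≠ 0 ∧ Complex.exp (2 * a.2) = k ^ 2 * sqDist x ζ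

/-- There is a lift of `γ` from `a` to `a'` along which the integrals of Green's form and of
Riemann's form are `c` and `d`. -/
def IsGreenLift (k : ℂ) (u : S → ℂ) (x : ℂ × ℂ) {p q : ℂ} (γ : Path p q) (a a' : S × ℂ)
    (c d : ℂ) : Prop :=
  ∃ Λ : Path a a', (∀ t, X.Admissible k x (γ t) (Λ t)) ∧
    HasLineIntegral (X.greenForm u x) Λ γ c ∧ HasLineIntegral (X.energyForm k u x) Λ γ d

variable {X} {k : ℂ} {u : S → ℂ} {x : ℂ × ℂ}

lemma realHomogeneous_greenForm : RealHomogeneous (X.greenForm u x) := by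
  intro a ρ v
  have e : -Complex.I * ρ • v = ρ • (-Complex.I * v) := by
    rw [mul_smul_comm]
  unfold greenForm greenIntegrand
  rw [e, map_smul, Complex.smul_re, Complex.smul_im]
  simp only [Complex.real_smul, smul_eq_mul, Complex.ofReal_mul]
  ring

lemma realHomogeneous_energyForm : RealHomogeneous (X.energyForm k u x) := fun a ρ v => by
  simp only [energyForm, map_smul]

/-- Inserting the split kernel isolates the three features of Green's form: the logarithm multiplies
Riemann's form, the second part is regular, and the last has simple poles at the two associated real
points. -/
theorem greenForm_eq (hk : k ≠ 0) {ζ : ℂ} {a : S × ℂ} (ha : X.Admissible k x ζ a) (v : ℂ) :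
    X.greenForm u x a v = (2 * Real.pi : ℂ)⁻¹ * (Complex.I * a.2 * X.energyForm k u x a v +
      Complex.I * ((regularM (k ^ 2 / 4) (sqDist x ζ) * X.gradZ u a.1 -
          regularM' (k ^ 2 / 4) (sqDist x ζ) * (conj ζ - charW x) * u a.1) * v +
        (regularM' (k ^ 2 / 4) (sqDist x ζ) * (ζ - charZ x) * u a.1 -
          regularM (k ^ 2 / 4) (sqDist x ζ) * X.gradB u a.1) * conj v) +
      Complex.I / 2 * (besselE (k ^ 2 / 4) (sqDist x ζ) * u a.1) *
        (conj v / (conj ζ - charW x) - v / (ζ - charZ x))) := by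
  obtain ⟨h1, -, h3, h4⟩ := ha
  have hq := sqDist_eq x ζ
  have e1 : -(Complex.I / 4) * hankelLog a.2 = (2 * Real.pi : ℂ)⁻¹ *
      (a.2 * besselE (k ^ 2 / 4) (sqDist x ζ) + regularM (k ^ 2 / 4) (sqDist x ζ)) := by
    rw [hankelLog_eq hk, h4]
    congr 4 <;> field_simp
  have e2 := deriv_hankelLog_eq hk h4
  have hα : ζ - charZ x ≠ 0 := fun h => h3 (by rw [hq, h, zero_mul])
  have hβ : conj ζ - charW x ≠ 0 := fun h => h3 (by rw [hq, h, mul_zero])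
  have e3 : -((x.1 - (ζ.re : ℂ)) * ((-Complex.I * v).re : ℂ) +
      (x.2 - (ζ.im : ℂ)) * ((-Complex.I * v).im : ℂ)) / sqDist x ζ =
      Complex.I / 2 * (conj v / (conj ζ - charW x) - v / (ζ - charZ x)) := by
    rw [div_sub_div _ _ hβ hα, ← mul_div_assoc, hq, mul_comm (conj ζ - charW x)]
    congr 1
    swap
    · ring
    rw [charZ_apply, charW_apply]
    have hv : conj v = (v.re : ℂ) - v.im * Complex.I := by apply Complex.ext <;> simp
    have hζ : conj ζ = (ζ.re : ℂ) - ζ.im * Complex.I := by apply Complex.ext <;> simp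
    have hv' : v = (v.re : ℂ) + v.im * Complex.I := (Complex.re_add_im v).symm
    have hζ' : ζ = (ζ.re : ℂ) + ζ.im * Complex.I := (Complex.re_add_im ζ).symm
    have r1 : (-Complex.I * v).re = v.im := by simp
    have r2 : (-Complex.I * v).im = -v.re := by simp
    rw [r1, r2, hv, hζ]
    conv_rhs => rw [hv', hζ']
    simp only [Complex.add_re, Complex.ofReal_re, Complex.mul_re, Complex.I_re, mul_zero,
      Complex.ofReal_im, Complex.I_im, mul_one, sub_self, add_zero, Complex.add_im, Complex.mul_im,
      zero_add, Complex.ofReal_neg]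
    linear_combination (-(v.im : ℂ) * (x.1 - ζ.re) + (v.re : ℂ) * (x.2 - ζ.im)) * Complex.I_sq
  rw [greenForm, greenIntegrand, h1, e1, e2, e3, grad_eq, energyForm, riemannForm, h1]
  simp only [wirtinger_apply, map_mul, map_neg, Complex.conj_I, neg_neg]
  rw [hq]
  field_simp
  ring

section Lift

variable {p q r : ℂ} {γ : Path p q} {a a' a'' : S × ℂ} {c d c' d' : ℂ}

theorem IsGreenLift.trans {γ' : Path q r} (h : X.IsGreenLift k u x γ a a' c d)
    (h' : X.IsGreenLift k u x γ' a' a'' c' d') :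
    X.IsGreenLift k u x (γ.trans γ') a a'' (c + c') (d + d') := by
  obtain ⟨Λ, h1, h2, h3⟩ := h
  obtain ⟨Λ', h1', h2', h3'⟩ := h'
  refine ⟨Λ.trans Λ', fun t => ?_, h2.trans h2' realHomogeneous_greenForm,
    h3.trans h3' realHomogeneous_energyForm⟩
  rw [Path.trans_apply, Path.trans_apply]
  split_ifs
  · exact h1 _
  · exact h1' _

theorem IsGreenLift.symm (h : X.IsGreenLift k u x γ a a' c d) :
    X.IsGreenLift k u x γ.symm a' a (-c) (-d) := by
  obtain ⟨Λ, h1, h2, h3⟩ := h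
  exact ⟨Λ.symm, fun t => h1 _, h2.symm realHomogeneous_greenForm,
    h3.symm realHomogeneous_energyForm⟩

lemma exp_two_mul_add_int_mul_pi (l : ℂ) (n : ℤ) :
    Complex.exp (2 * (l + n * (Real.pi * Complex.I))) = Complex.exp (2 * l) := by
  rw [Complex.exp_eq_exp_iff_exists_int]
  exact ⟨n, by ring⟩

/-- Changing the branch of the logarithm. -/
theorem IsGreenLift.shift (h : X.IsGreenLift k u x γ a a' c d) (hk : k ≠ 0) (n : ℤ) :
    X.IsGreenLift k u x γ (a.1, a.2 + n * (Real.pi * Complex.I))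
      (a'.1, a'.2 + n * (Real.pi * Complex.I)) (c - n / 2 * d) d := by
  obtain ⟨Λ, h1, h2, h3⟩ := h
  set m : ℂ := n * (Real.pi * Complex.I) with hm
  have hf : Continuous fun a : S × ℂ => (a.1, a.2 + m) := by fun_prop
  have h1' : ∀ t, X.Admissible k x (γ t) (Λ.map hf t) := fun t => by
    obtain ⟨k1, k2, k3, k4⟩ := h1 t
    refine ⟨k1, k2, k3, ?_⟩
    rw [← k4]
    exact exp_two_mul_add_int_mul_pi _ n
  have e1 : ∀ t, (Λ.map hf).extend t = ((Λ.extend t).1, (Λ.extend t).2 + m) := fun t => rfl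
  have hpi : (Real.pi : ℂ) ≠ 0 := by exact_mod_cast Real.pi_ne_zero
  -- The logarithm enters linearly with coefficient i/(2π) times Riemann's form, so adding nπi
  -- changes Green's form by -n/2 times it.
  have e2 : ∀ t v, X.greenForm u x ((Λ.map hf).extend t) v =
      X.greenForm u x (Λ.extend t) v - n / 2 * X.energyForm k u x (Λ.extend t) v := by
    intro t v
    have k1 : X.Admissible k x (γ.extend t) (Λ.extend t) := h1 _
    have k2 : X.Admissible k x (γ.extend t) ((Λ.map hf).extend t) := h1' _
    rw [greenForm_eq hk k1, greenForm_eq hk k2, e1]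
    simp only [energyForm, hm]
    field_simp
    linear_combination (2 * n * (X.riemannForm k u x (Λ.extend t).1) v * Real.pi) * Complex.I_sq
  refine ⟨Λ.map hf, h1', ⟨?_, ?_⟩, h3⟩
  · simp only [e2]
    exact h2.1.sub (h3.1.const_mul _)
  · simp only [e2]
    rw [intervalIntegral.integral_sub h2.1 (h3.1.const_mul _),
      intervalIntegral.integral_const_mul, h2.2, h3.2]

/-- Equal end points mean that the point of the surface and the logarithm both return, so contour
and kernel close up together. -/
theorem IsGreenLift.isGreenIntegral {γ : Path p p} (h : X.IsGreenLift k u x γ a a c d) :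
    X.IsGreenIntegral k u γ a.1 x c := by
  obtain ⟨Λ, h1, h2, -⟩ := h
  exact ⟨Λ.map continuous_fst, a.2, Λ.map continuous_snd, fun t => (h1 t).1, fun t => (h1 t).2.1,
    fun t => (h1 t).2.2.1, fun t => (h1 t).2.2.2, h2.2.symm⟩

variable (hu : X.IsHelmholtz k u)
include hu

lemma continuous_energyForm {Λ : Path a a'} (h : ∀ t, X.Admissible k x (γ t) (Λ t)) {v : ℝ → ℂ}
    (hv : Continuous v) : Continuous fun t => X.energyForm k u x (Λ.extend t) (v t) := by
  rw [continuous_iff_continuousAt]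
  intro t
  have h1 : ContinuousAt (fun t => (Λ.extend t).1) t :=
    (continuous_fst.comp Λ.continuous_extend).continuousAt
  have h2 : X.Admissible k x (γ.extend t) (Λ.extend t) := h _
  exact (ContinuousAt.comp (g := X.riemannForm k u x) (f := fun t => (Λ.extend t).1) (x := t)
    (hu.continuousAt_riemannForm h2.2.1 x)
    h1).clm_apply hv.continuousAt

lemma continuous_greenForm (hk : k ≠ 0) {Λ : Path a a'}
    (h : ∀ t, X.Admissible k x (γ t) (Λ t)) {v : ℝ → ℂ}
    (hv : Continuous v) : Continuous fun t => X.greenForm u x (Λ.extend t) (v t) := by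
  have had : ∀ t, X.Admissible k x (γ.extend t) (Λ.extend t) := fun t => h _
  have e : (fun t => X.greenForm u x (Λ.extend t) (v t)) = _ :=
    funext fun t => greenForm_eq hk (had t) (v t)
  rw [e]
  have c1 : Continuous fun t => (Λ.extend t).1 := continuous_fst.comp Λ.continuous_extend
  have c2 : Continuous fun t => (Λ.extend t).2 := continuous_snd.comp Λ.continuous_extend
  have cγ : Continuous γ.extend := γ.continuous_extend
  have cq : Continuous fun t => sqDist x (γ.extend t) :=
    Continuous.comp (g := fun p : (ℂ × ℂ) × ℂ => sqDist p.1 p.2) (f := fun t => (x, γ.extend t))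
      continuous_sqDist (continuous_const.prodMk cγ)
  have cz : Continuous fun t => X.gradZ u (Λ.extend t).1 := by
    rw [continuous_iff_continuousAt]
    exact fun t => ContinuousAt.comp (g := X.gradZ u) (f := fun t => (Λ.extend t).1) (x := t)
      (hu.continuousAt_gradZ (had t).2.1)
      c1.continuousAt
  have cb : Continuous fun t => X.gradB u (Λ.extend t).1 := by
    rw [continuous_iff_continuousAt]
    exact fun t => ContinuousAt.comp (g := X.gradB u) (f := fun t => (Λ.extend t).1) (x := t)
      (hu.continuousAt_gradB (had t).2.1)
      c1.continuousAt
  have cu : Continuous fun t => u (Λ.extend t).1 := hu.continuous.comp c1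
  have cα : Continuous fun t => γ.extend t - charZ x := cγ.sub continuous_const
  have cβ : Continuous fun t => conj (γ.extend t) - charW x :=
    (Complex.continuous_conj.comp cγ).sub continuous_const
  have cM := (continuous_regularM (k ^ 2 / 4)).comp cq
  have cM' := (continuous_regularM' (k ^ 2 / 4)).comp cq
  have cE := (continuous_besselE (k ^ 2 / 4)).comp cq
  have cv := Complex.continuous_conj.comp hv
  have hα : ∀ t, γ.extend t - charZ x ≠ 0 := fun t h0 =>
    (had t).2.2.1 (by rw [sqDist_eq, h0, zero_mul])
  have hβ : ∀ t, conj (γ.extend t) - charW x ≠ 0 := fun t h0 =>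
    (had t).2.2.1 (by rw [sqDist_eq, h0, mul_zero])
  refine continuous_const.mul ((((continuous_const.mul c2).mul (continuous_energyForm hu h hv)).add
    (continuous_const.mul ((((cM.mul cz).sub ((cM'.mul cβ).mul cu)).mul hv).add
      ((((cM'.mul cα).mul cu).sub (cM.mul cb)).mul cv)))).add
    ((continuous_const.mul (cE.mul cu)).mul ((cv.div cβ hβ).sub (hv.div cα hα))))

/-- Green's integral over a smooth lift. -/
theorem isGreenLift_of_smooth (hk : k ≠ 0) {v : ℝ → ℂ} (hv : IsSmoothPath γ v) (Λ : Path a a')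
    (h : ∀ t, X.Admissible k x (γ t) (Λ t)) {H : ℝ → ℂ} (hH : ContinuousOn H (Set.Icc 0 1))
    (hd : ∀ t ∈ Set.Ioo (0 : ℝ) 1, HasDerivAt H (X.energyForm k u x (Λ.extend t) (v t)) t) :
    X.IsGreenLift k u x γ a a' (∫ t in (0 : ℝ)..1, X.greenForm u x (Λ.extend t) (v t))
      (H 1 - H 0) :=
  ⟨Λ, h, hv.hasLineIntegral (continuous_greenForm hu hk h hv.1).continuousOn,
    hv.hasLineIntegral_of_hasDerivAt (continuous_energyForm hu h hv.1).continuousOn hH hd⟩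

end Lift

end SommerfeldSurface

/-! ### Logarithms on circles -/

section CircleLog

variable {a p z : ℂ}

lemma hasDerivAt_log_circle {f : ℝ → ℂ} (hf : Continuous f)
    (h : ∀ t : ℝ, Complex.exp (f t) =
      a + (p - a) * Complex.exp (2 * Real.pi * Complex.I * (t : ℂ)) - z) (t : ℝ) :
    HasDerivAt f (2 * Real.pi * Complex.I * ((p - a) * Complex.exp (2 * Real.pi * Complex.I *
      (t : ℂ))) / (a + (p - a) * Complex.exp (2 * Real.pi * Complex.I * (t : ℂ)) - z)) t :=
  hasDerivAt_of_exp_eq hf.continuousAt (Eventually.of_forall h)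
    ((hasDerivAt_circle_param a p t).sub_const z)

/-- Factor out the rotating vector (p - a)e^(2πit): the other factor stays within distance 1 of 1
and has a principal logarithm, so the increment is 2πi. -/
lemma exists_log_circle_inside (h : ‖z - a‖ < ‖p - a‖) : ∃ f : ℝ → ℂ, Continuous f ∧
    f 1 = f 0 + 2 * Real.pi * Complex.I ∧ ∀ t : ℝ, Complex.exp (f t) =
      a + (p - a) * Complex.exp (2 * Real.pi * Complex.I * (t : ℂ)) - z := by
  have hpa : p - a ≠ 0 := norm_pos_iff.1 ((norm_nonneg _).trans_lt h)
  set g : ℝ → ℂ := fun t => 1 - (z - a) / ((p - a) * Complex.exp (2 * Real.pi * Complex.I * t))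
    with hg
  have hne : ∀ t : ℝ, (p - a) * Complex.exp (2 * Real.pi * Complex.I * t) ≠ 0 := fun t =>
    mul_ne_zero hpa (Complex.exp_ne_zero _)
  have hgc : Continuous g := by
    refine continuous_const.sub (continuous_const.div (by fun_prop) hne)
  have hgs : ∀ t, g t ∈ Complex.slitPlane := fun t => by
    simp only [hg]
    rw [sub_eq_add_neg]
    refine Complex.mem_slitPlane_of_norm_lt_one ?_
    rw [norm_neg, norm_div, norm_mul, norm_exp_two_pi_mul_I, mul_one,
      div_lt_one (norm_pos_iff.2 hpa)]
    exact h
  refine ⟨fun t => 2 * Real.pi * Complex.I * t + Complex.log (p - a) + Complex.log (g t), ?_, ?_,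
    fun t => ?_⟩
  · exact Continuous.add (by fun_prop) (hgc.clog hgs)
  · simp [hg, Complex.exp_two_pi_mul_I]
    ring
  · rw [Complex.exp_add, Complex.exp_add, Complex.exp_log hpa,
      Complex.exp_log (Complex.slitPlane_ne_zero (hgs t))]
    have := hne t
    simp only [hg]
    field_simp
    ring

/-- Here the constant a - z dominates and is factored out, so the logarithm does not change. -/
lemma exists_log_circle_outside (h : ‖p - a‖ < ‖z - a‖) : ∃ f : ℝ → ℂ, Continuous f ∧
    f 1 = f 0 ∧ ∀ t : ℝ, Complex.exp (f t) =
      a + (p - a) * Complex.exp (2 * Real.pi * Complex.I * (t : ℂ)) - z := by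
  have hza : z - a ≠ 0 := norm_pos_iff.1 ((norm_nonneg _).trans_lt h)
  have haz : a - z ≠ 0 := by rw [← neg_sub]; exact neg_ne_zero.2 hza
  set g : ℝ → ℂ := fun t => 1 + (p - a) * Complex.exp (2 * Real.pi * Complex.I * t) / (a - z)
    with hg
  have hgs : ∀ t, g t ∈ Complex.slitPlane := fun t => by
    refine Complex.mem_slitPlane_of_norm_lt_one ?_
    rw [norm_div, norm_mul, norm_exp_two_pi_mul_I, mul_one, div_lt_one (norm_pos_iff.2 haz),
      norm_sub_rev a z]
    exact h
  refine ⟨fun t => Complex.log (a - z) + Complex.log (g t), ?_, ?_, fun t => ?_⟩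
  · exact continuous_const.add (Continuous.clog (by fun_prop) hgs)
  · simp [hg, Complex.exp_two_pi_mul_I]
  · rw [Complex.exp_add, Complex.exp_log haz,
      Complex.exp_log (Complex.slitPlane_ne_zero (hgs t))]
    simp only [hg]
    field_simp
    ring

end CircleLog

/-! ### The regularised Green form -/

/-- The `dζ` coefficient of Green's form after subtracting an exact form and a pole. -/
def remP (κ : ℂ) (U Uz : ℂ → ℂ) (Ω : ℂ × ℂ → ℂ → ℂ) (x : ℂ × ℂ) (c ζ : ℂ) : ℂ :=
  (2⁻¹ * (Ω x ζ + besselE κ (sqDist x ζ) * U ζ) - c) * (ζ - charZ x)⁻¹ +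
    (regularM' κ (sqDist x ζ) * ((conj ζ - charW x) * U ζ) - regularM κ (sqDist x ζ) * Uz ζ)

/-- The `dζ̄` coefficient of Green's form after subtracting an exact form and a pole. -/
def remQ (κ : ℂ) (U Ub : ℂ → ℂ) (Ω : ℂ × ℂ → ℂ → ℂ) (x : ℂ × ℂ) (c ζ : ℂ) : ℂ :=
  (2⁻¹ * (Ω x ζ - besselE κ (sqDist x ζ) * U ζ) - c) * (conj ζ - charW x)⁻¹ -
    (regularM' κ (sqDist x ζ) * ((ζ - charZ x) * U ζ) - regularM κ (sqDist x ζ) * Ub ζ)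

section Rem

variable {κ : ℂ} {U Uz Ub : ℂ → ℂ} {Ω : ℂ × ℂ → ℂ → ℂ} {K : Set ℂ}

lemma HasFDerivAt.wirtinger_sub_const {f : ℂ → ℂ} {p q ζ : ℂ}
    (hf : HasFDerivAt f (wirtinger p q) ζ) (c : ℂ) :
    HasFDerivAt (fun y => f y - c) (wirtinger p q) ζ := hf.sub_const c

/-- The equation of the regular part supplies the source term E', which is cancelled by the
derivatives of Ω and of E U in the singular quotients. The constants `c₀` and `c₁` only add closed
forms. -/
theorem IsRiemannPrimitive.isClosedForm_rem (h : IsRiemannPrimitive κ U Uz Ub Ω K) {x : ℂ × ℂ}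
    (hK : ∀ ζ ∈ K, ζ - charZ x ≠ 0 ∧ conj ζ - charW x ≠ 0) (c₀ c₁ : ℂ) :
    IsClosedForm (remP κ U Uz Ω x c₀) (remQ κ U Ub Ω x c₁) K := by
  intro ζ hζ
  obtain ⟨hU, ⟨a, hz⟩, b, hb⟩ := h.solution ζ hζ
  have hΩ := h.hasFDerivAt x ζ hζ
  obtain ⟨h0, h1⟩ := hK ζ hζ
  have hq := hasFDerivAt_sqDist x ζ
  have hE := HasFDerivAt.wirtinger_comp (hasDerivAt_besselE κ (sqDist x ζ)) hq
  have hM := HasFDerivAt.wirtinger_comp (hasDerivAt_regularM κ (sqDist x ζ)) hq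
  have hM' := HasFDerivAt.wirtinger_comp (hasDerivAt_regularM' κ (sqDist x ζ)) hq
  have hα := hasFDerivAt_wirtinger_sub_const (charZ x) ζ
  have hβ := hasFDerivAt_wirtinger_conj_sub_const (charW x) ζ
  have iα := HasFDerivAt.wirtinger_comp (f := fun y => y - charZ x) (hasDerivAt_inv h0) hα
  have iβ := HasFDerivAt.wirtinger_comp (f := fun y => conj y - charW x) (hasDerivAt_inv h1) hβ
  have hP := ((((hΩ.wirtinger_add (hE.wirtinger_mul hU)).wirtinger_const_mul
    2⁻¹).wirtinger_sub_const c₀).wirtinger_mul iα).wirtinger_add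
      ((hM'.wirtinger_mul (hβ.wirtinger_mul hU)).wirtinger_sub (hM.wirtinger_mul hz))
  have hQ := ((((hΩ.wirtinger_sub (hE.wirtinger_mul hU)).wirtinger_const_mul
    2⁻¹).wirtinger_sub_const c₁).wirtinger_mul iβ).wirtinger_sub
      ((hM'.wirtinger_mul (hα.wirtinger_mul hU)).wirtinger_sub (hM.wirtinger_mul hb))
  refine ⟨_, _, _, hP, hQ.congr_fderiv (wirtinger_ext ?_ rfl)⟩
  have hq' := sqDist_eq x ζ
  have ode := regularM_ode κ (sqDist x ζ)
  simp only [riemannP, riemannQ]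
  have e1 : (ζ - charZ x) * (ζ - charZ x)⁻¹ = 1 := mul_inv_cancel₀ h0
  have e2 : (conj ζ - charW x) * (conj ζ - charW x)⁻¹ = 1 := mul_inv_cancel₀ h1
  linear_combination (-2 * U ζ) * ode + (2 * U ζ * regularM'' κ (sqDist x ζ)) * hq' -
    (U ζ * besselE' κ (sqDist x ζ)) * e1 - (U ζ * besselE' κ (sqDist x ζ)) * e2

/-- Close to `z` differentiability bounds the difference quotient; at a distance the boundedness of
`f` does. -/
lemma exists_norm_slope_le {f : ℂ → ℂ} {B : Set ℂ} (hB : IsCompact B) (hf : ContinuousOn f B)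
    {z : ℂ} (hd : DifferentiableAt ℝ f z) : ∃ C : ℝ, ∀ ζ ∈ B \ {z}, ‖f ζ - f z‖ / ‖ζ - z‖ ≤ C := by
  obtain ⟨C, hC⟩ := hd.hasFDerivAt.isBigO_sub.bound
  obtain ⟨δ, hδ, hball⟩ := Metric.eventually_nhds_iff.1 hC
  obtain ⟨D, hD⟩ := hB.exists_bound_of_continuousOn hf
  refine ⟨max C ((|D| + ‖f z‖) / δ), fun ζ hζ => ?_⟩
  have hpos : 0 < ‖ζ - z‖ := norm_pos_iff.2 (sub_ne_zero.2 hζ.2)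
  rcases lt_or_ge (dist ζ z) δ with h | h
  · refine le_max_of_le_left ?_
    rw [div_le_iff₀ hpos]
    exact hball h
  · refine le_max_of_le_right ?_
    rw [dist_eq_norm] at h
    refine div_le_div₀ (by positivity) ?_ hδ h
    refine (norm_sub_le _ _).trans ?_
    gcongr
    exact (hD ζ hζ.1).trans (le_abs_self D)

lemma continuousOn_regular_part (hU : ContinuousOn U K) {V : ℂ → ℂ} (hV : ContinuousOn V K)
    (κ : ℂ) (x : ℂ × ℂ) {A : ℂ → ℂ} (hA : Continuous A) :
    ContinuousOn (fun ζ => regularM' κ (sqDist x ζ) * (A ζ * U ζ) - regularM κ (sqDist x ζ) * V ζ)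
      K := by
  have hcq : Continuous fun ζ => sqDist x ζ :=
    Continuous.comp (g := fun p : (ℂ × ℂ) × ℂ => sqDist p.1 p.2) (f := fun ζ => (x, ζ))
      continuous_sqDist (continuous_const.prodMk continuous_id)
  exact ((((continuous_regularM' κ).comp hcq).continuousOn).mul (hA.continuousOn.mul hU)).sub
    ((((continuous_regularM κ).comp hcq).continuousOn).mul hV)

variable (h : IsRiemannPrimitive κ U Uz Ub Ω K)
include h

lemma IsRiemannPrimitive.continuousOn (x : ℂ × ℂ) : ContinuousOn (Ω x) K := fun ζ hζ =>
  (h.hasFDerivAt x ζ hζ).continuousAt.continuousWithinAt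

lemma IsRiemannPrimitive.differentiableAt_combo (x : ℂ × ℂ) (m : ℂ) {ζ : ℂ} (hζ : ζ ∈ K) :
    DifferentiableAt ℝ (fun ζ => 2⁻¹ * (Ω x ζ + m * (besselE κ (sqDist x ζ) * U ζ))) ζ := by
  have hE := HasFDerivAt.wirtinger_comp (hasDerivAt_besselE κ (sqDist x ζ))
    (hasFDerivAt_sqDist x ζ)
  exact (((h.hasFDerivAt x ζ hζ).wirtinger_add ((hE.wirtinger_mul
    (h.solution ζ hζ).1).wirtinger_const_mul m)).wirtinger_const_mul 2⁻¹).differentiableAt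

/-- At ζ = z the numerator (Ω + E U)/2 takes the value `halfOne`. Subtracting this constant makes
the quotient bounded, so the puncture contributes nothing. -/
lemma IsRiemannPrimitive.curveIntegral_rem_zero {x : ℂ × ℂ} {a p : ℂ}
    (hB : Metric.closedBall a ‖p - a‖ ⊆ K) (hz : charZ x ∈ Metric.ball a ‖p - a‖)
    (hw : conj (charW x) ∉ Metric.closedBall a ‖p - a‖) :
    curveIntegral (fun ζ => wirtinger (remP κ U Uz Ω x (halfOne U Ω x) ζ)
      (remQ κ U Ub Ω x 0 ζ)) (circleLoop a p) = 0 := by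
  have hβ : ∀ ζ ∈ Metric.closedBall a ‖p - a‖, conj ζ - charW x ≠ 0 := fun ζ hζ h0 => by
    rw [sub_eq_zero] at h0
    rw [← h0, Complex.conj_conj] at hw
    exact hw hζ
  have hzK := hB (Metric.ball_subset_closedBall hz)
  have hc : IsCompact (Metric.closedBall a ‖p - a‖) := isCompact_closedBall _ _
  have hU := h.solution.continuousOn.mono hB
  obtain ⟨C1, h1⟩ := exists_norm_slope_le hc (f := fun ζ => 2⁻¹ * (Ω x ζ + 1 * (besselE κ
    (sqDist x ζ) * U ζ))) (fun ζ hζ => (h.differentiableAt_combo x 1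
      (hB hζ)).continuousAt.continuousWithinAt) (h.differentiableAt_combo x 1 hzK)
  obtain ⟨C2, h2⟩ := hc.exists_bound_of_continuousOn (continuousOn_regular_part hU
    (h.solution.continuousOn_z.mono hB) κ x (A := fun ζ => conj ζ - charW x)
      (Complex.continuous_conj.sub continuous_const))
  obtain ⟨C3, h3⟩ := hc.exists_bound_of_continuousOn (f := remQ κ U Ub Ω x 0) (by
    have h4 : ContinuousOn (fun ζ => 2⁻¹ * (Ω x ζ + -1 * (besselE κ (sqDist x ζ) * U ζ)))
        (Metric.closedBall a ‖p - a‖) := fun ζ hζ => (h.differentiableAt_combo x (-1)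
          (hB hζ)).continuousAt.continuousWithinAt
    have h5 : ContinuousOn (fun ζ => (conj ζ - charW x)⁻¹) (Metric.closedBall a ‖p - a‖) :=
      (Complex.continuous_conj.sub continuous_const).continuousOn.inv₀ hβ
    refine ((h4.mul h5).sub (continuousOn_regular_part hU
      (h.solution.continuousOn_b.mono hB) κ x (A := fun ζ => ζ - charZ x)
        (continuous_id.sub continuous_const))).congr ?_
    intro ζ _
    simp only [remQ, Pi.sub_apply, Pi.mul_apply]
    ring)
  refine IsClosedForm.curveIntegral_circleLoop_eq_zero (z := charZ x) (C := C1 + C2 + C3)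
    ((h.mono (K' := Metric.closedBall a ‖p - a‖ \ {charZ x})
      (Set.sdiff_subset.trans hB)).isClosedForm_rem (fun ζ hζ =>
        ⟨sub_ne_zero.2 hζ.2, hβ ζ hζ.1⟩) _ _) hz fun ζ hζ => ?_
  refine add_le_add ((norm_add_le _ _).trans (add_le_add ?_ (h2 ζ hζ.1))) (h3 ζ hζ.1)
  refine le_trans (le_of_eq ?_) (h1 ζ hζ)
  rw [norm_mul, norm_inv, ← div_eq_mul_inv]
  congr 2
  simp only [halfOne, sqDist_eq, sub_self, zero_mul, besselE_zero]
  ring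

/-- At ζ = w̄ the numerator (Ω - E U)/2 takes the value `-halfTwo`; this explains the sign of the
constant. -/
lemma IsRiemannPrimitive.curveIntegral_rem_one {x : ℂ × ℂ} {a p : ℂ}
    (hB : Metric.closedBall a ‖p - a‖ ⊆ K) (hw : conj (charW x) ∈ Metric.ball a ‖p - a‖)
    (hz : charZ x ∉ Metric.closedBall a ‖p - a‖) :
    curveIntegral (fun ζ => wirtinger (remP κ U Uz Ω x 0 ζ)
      (remQ κ U Ub Ω x (-halfTwo U Ω x) ζ)) (circleLoop a p) = 0 := by
  have hα : ∀ ζ ∈ Metric.closedBall a ‖p - a‖, ζ - charZ x ≠ 0 := fun ζ hζ h0 => by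
    rw [sub_eq_zero] at h0
    exact hz (h0 ▸ hζ)
  have hwK := hB (Metric.ball_subset_closedBall hw)
  have hc : IsCompact (Metric.closedBall a ‖p - a‖) := isCompact_closedBall _ _
  have hU := h.solution.continuousOn.mono hB
  have hconj : ∀ ζ, conj ζ - charW x = conj (ζ - conj (charW x)) := fun ζ => by simp
  obtain ⟨C1, h1⟩ := exists_norm_slope_le hc (f := fun ζ => 2⁻¹ * (Ω x ζ + -1 * (besselE κ
    (sqDist x ζ) * U ζ))) (fun ζ hζ => (h.differentiableAt_combo x (-1)
      (hB hζ)).continuousAt.continuousWithinAt) (h.differentiableAt_combo x (-1) hwK)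
  obtain ⟨C2, h2⟩ := hc.exists_bound_of_continuousOn (continuousOn_regular_part hU
    (h.solution.continuousOn_b.mono hB) κ x (A := fun ζ => ζ - charZ x)
      (continuous_id.sub continuous_const))
  obtain ⟨C3, h3⟩ := hc.exists_bound_of_continuousOn (f := remP κ U Uz Ω x 0) (by
    have h4 : ContinuousOn (fun ζ => 2⁻¹ * (Ω x ζ + 1 * (besselE κ (sqDist x ζ) * U ζ)))
        (Metric.closedBall a ‖p - a‖) := fun ζ hζ => (h.differentiableAt_combo x 1
          (hB hζ)).continuousAt.continuousWithinAt
    have h5 : ContinuousOn (fun ζ => (ζ - charZ x)⁻¹) (Metric.closedBall a ‖p - a‖) :=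
      (continuous_id.sub continuous_const).continuousOn.inv₀ hα
    refine ((h4.mul h5).add (continuousOn_regular_part hU
      (h.solution.continuousOn_z.mono hB) κ x (A := fun ζ => conj ζ - charW x)
        (Complex.continuous_conj.sub continuous_const))).congr ?_
    intro ζ _
    simp only [remP, Pi.add_apply, Pi.mul_apply]
    ring)
  refine IsClosedForm.curveIntegral_circleLoop_eq_zero (z := conj (charW x)) (C := C3 + (C1 + C2))
    ((h.mono (K' := Metric.closedBall a ‖p - a‖ \ {conj (charW x)})
      (Set.sdiff_subset.trans hB)).isClosedForm_rem (fun ζ hζ => ⟨hα ζ hζ.1, by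
        rw [hconj]
        exact (map_ne_zero _).2 (sub_ne_zero.2 hζ.2)⟩) _ _) hw fun ζ hζ => ?_
  refine add_le_add (h3 ζ hζ.1) ((norm_sub_le _ _).trans (add_le_add ?_ (h2 ζ hζ.1)))
  refine le_trans (le_of_eq ?_) (h1 ζ hζ)
  rw [norm_mul, norm_inv, ← div_eq_mul_inv, hconj, RCLike.norm_conj]
  congr 2
  simp only [halfTwo, sqDist_eq, Complex.conj_conj, sub_self, mul_zero, besselE_zero]
  ring

end Rem

namespace SommerfeldSurface

variable {S : Type*} [TopologicalSpace S] [T2Space S] {M N : ℕ} {X : SommerfeldSurface S M N}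
  {k : ℂ} {u : S → ℂ}

/-! ### Green's integrals over circles and segments in a sheet -/

/-- The lift of a path through a section, with a logarithm. -/
def IsSection.liftPath {Y : ℂ → S} {K : Set ℂ} (hY : X.IsSection Y K) {p q : ℂ} (γ : Path p q)
    (hγ : ∀ t, γ t ∈ K) {l l' : ℂ} (L : Path l l') : Path (Y p, l) (Y q, l') where
  toFun t := (Y (γ t), L t)
  continuous_toFun := (hY.continuousOn.comp_continuous γ.continuous hγ).prodMk L.continuous
  source' := by simp
  target' := by simp

lemma IsSection.admissible_liftPath {Y : ℂ → S} {K : Set ℂ} (hY : X.IsSection Y K) {p q : ℂ}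
    (γ : Path p q) (hγ : ∀ t, γ t ∈ K) {l l' : ℂ} (L : Path l l') {x : ℂ × ℂ}
    (h0 : ∀ t, sqDist x (γ t) ≠ 0)
    (hL : ∀ t, Complex.exp (2 * L t) = k ^ 2 * sqDist x (γ t)) (t : unitInterval) :
    X.Admissible k x (γ t) (hY.liftPath γ hγ L t) :=
  ⟨hY.proj_eq _ (hγ t), hY.regular (hγ t), h0 t, hL t⟩

lemma IsSection.energyForm_eq {Y : ℂ → S} {K : Set ℂ} (hY : X.IsSection Y K) {ζ : ℂ} (hζ : ζ ∈ K)
    (x : ℂ × ℂ) (l v : ℂ) : X.energyForm k u x (Y ζ, l) v =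
      wirtinger (riemannP (k ^ 2 / 4) (fun z => u (Y z)) (fun z => X.gradZ u (Y z)) x ζ)
        (riemannQ (k ^ 2 / 4) (fun z => u (Y z)) (fun z => X.gradB u (Y z)) x ζ) v := by
  rw [energyForm, hY.riemannForm_eq hζ]

section

variable (hu : X.IsHelmholtz k u) (hk : k ≠ 0) {Y : ℂ → S} {K : Set ℂ} (hY : X.IsSection Y K)
  {Ω : ℂ × ℂ → ℂ → ℂ} (hΩ : IsRiemannPrimitive (k ^ 2 / 4) (fun z => u (Y z))
    (fun z => X.gradZ u (Y z)) (fun z => X.gradB u (Y z)) Ω K) {x : ℂ × ℂ}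
include hu hk hY hΩ

theorem isGreenLift_of_section {p q : ℂ} {γ : Path p q} {v : ℝ → ℂ} (hv : IsSmoothPath γ v)
    (hγ : ∀ t, γ t ∈ K) {l l' : ℂ} (L : Path l l') (h0 : ∀ t, sqDist x (γ t) ≠ 0)
    (hL : ∀ t, Complex.exp (2 * L t) = k ^ 2 * sqDist x (γ t)) :
    X.IsGreenLift k u x γ (Y p, l) (Y q, l')
      (∫ t in (0 : ℝ)..1, X.greenForm u x (Y (γ.extend t), L.extend t) (v t)) (Ω x q - Ω x p) := by
  have hγ' : ∀ t, γ.extend t ∈ K := fun t => hγ _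
  have h1 := isGreenLift_of_smooth hu hk hv (hY.liftPath γ hγ L)
    (hY.admissible_liftPath γ hγ L h0 hL) (H := fun t => Ω x (γ.extend t)) ?_ ?_
  · simpa only [Path.extend_one, Path.extend_zero] using! h1
  · exact ((hΩ.continuousOn x).comp_continuous γ.continuous_extend hγ').continuousOn
  · intro t ht
    have e : (hY.liftPath γ hγ L).extend t = (Y (γ.extend t), L.extend t) := rfl
    rw [e, hY.energyForm_eq (hγ' t)]
    exact (hΩ.hasFDerivAt x _ (hγ' t)).comp_hasDerivAt t (hv.2 t ht)

/-- Green's integral over a circle, when the regularised form has vanishing integral. -/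
theorem isGreenLift_circle {a p : ℂ} (hK : ∀ t, circleLoop a p t ∈ K)
    {m n c₀ c₁ : ℂ} {f g : ℝ → ℂ} (hf : Continuous f) (hg : Continuous g)
    (hf1 : f 1 = f 0 + m * (2 * Real.pi * Complex.I))
    (hg1 : g 1 = g 0 - n * (2 * Real.pi * Complex.I))
    (hf2 : ∀ t : ℝ, Complex.exp (f t) =
      a + (p - a) * Complex.exp (2 * Real.pi * Complex.I * (t : ℂ)) - charZ x)
    (hg2 : ∀ t : ℝ, Complex.exp (g t) =
      conj (a + (p - a) * Complex.exp (2 * Real.pi * Complex.I * (t : ℂ))) - charW x)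
    (hint : curveIntegral (fun ζ => wirtinger
      (remP (k ^ 2 / 4) (fun z => u (Y z)) (fun z => X.gradZ u (Y z)) Ω x c₀ ζ)
      (remQ (k ^ 2 / 4) (fun z => u (Y z)) (fun z => X.gradB u (Y z)) Ω x c₁ ζ))
      (circleLoop a p) = 0) {l : ℂ} (hl : Complex.exp (2 * l) = k ^ 2 * sqDist x p) :
    X.IsGreenLift k u x (circleLoop a p) (Y p, l)
      (Y p, l + (m - n) * (Real.pi * Complex.I))
      (m * c₀ - n * c₁ - (m - n) / 2 * Ω x p) 0 := by
  set ζ : ℝ → ℂ := fun t => a + (p - a) * Complex.exp (2 * Real.pi * Complex.I * (t : ℂ)) with hζ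
  set v : ℝ → ℂ := fun t =>
    2 * Real.pi * Complex.I * ((p - a) * Complex.exp (2 * Real.pi * Complex.I * (t : ℂ))) with hv
  have hζd : ∀ t, HasDerivAt ζ (v t) t := hasDerivAt_circle_param a p
  have hζ0 : ζ 0 = p := by simp [hζ]
  have hζ1 : ζ 1 = p := by simp [hζ, Complex.exp_two_pi_mul_I]
  have hα : ∀ t, ζ t - charZ x ≠ 0 := fun t => by rw [← hf2 t]; exact Complex.exp_ne_zero _
  have hβ : ∀ t, conj (ζ t) - charW x ≠ 0 := fun t => by rw [← hg2 t]; exact Complex.exp_ne_zero _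
  have hq : ∀ t, sqDist x (ζ t) ≠ 0 := fun t => by
    rw [sqDist_eq]; exact mul_ne_zero (hα t) (hβ t)
  have hfd : ∀ t, HasDerivAt f (v t / (ζ t - charZ x)) t := hasDerivAt_log_circle hf hf2
  have hgd : ∀ t, HasDerivAt g (conj (v t) / (conj (ζ t) - charW x)) t := fun t =>
    hasDerivAt_of_exp_eq hg.continuousAt (Eventually.of_forall hg2)
      ((((Complex.conjCLE : ℂ →L[ℝ] ℂ).hasFDerivAt.comp_hasDerivAt t (hζd t)).sub_const _))
  -- The squared distance is the product of the two factors with logarithms `f` and `g`, so log(k r)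
  -- moves by half the sum of their increments.
  let L : Path l (l + (m - n) * (Real.pi * Complex.I)) :=
    { toFun := fun t => l + ((f t - f 0) + (g t - g 0)) / 2
      continuous_toFun := by fun_prop
      source' := by simp
      target' := by
        simp only [Set.Icc.coe_one, hf1, hg1]
        ring }
  have hext : ∀ t ∈ Set.Icc (0 : ℝ) 1, (circleLoop a p).extend t = ζ t := fun t ht =>
    circleLoop_extend a p ht
  have hLext : ∀ t ∈ Set.Icc (0 : ℝ) 1, L.extend t = l + ((f t - f 0) + (g t - g 0)) / 2 :=
    fun t ht => by rw [Path.extend_apply _ ht]; rfl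
  have hqs : ∀ t : unitInterval, sqDist x (circleLoop a p t) ≠ 0 := fun t => hq t
  have hexp : ∀ t : ℝ, Complex.exp (2 * (l + ((f t - f 0) + (g t - g 0)) / 2)) =
      k ^ 2 * sqDist x (ζ t) := by
    intro t
    have e : 2 * (l + ((f t - f 0) + (g t - g 0)) / 2) =
        2 * l + (f t + g t) - (f 0 + g 0) := by ring
    have e0 : sqDist x p = Complex.exp (f 0) * Complex.exp (g 0) := by
      rw [hf2, hg2, ← sqDist_eq]
      exact congrArg _ hζ0.symm
    have e1 : sqDist x (ζ t) = Complex.exp (f t) * Complex.exp (g t) := by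
      rw [hf2, hg2, ← sqDist_eq]
    rw [e, Complex.exp_sub, Complex.exp_add, hl, e0, e1, Complex.exp_add, Complex.exp_add]
    have h1 := Complex.exp_ne_zero (f 0)
    have h2 := Complex.exp_ne_zero (g 0)
    field_simp
  have h1 := isGreenLift_of_section hu hk hY hΩ (isSmoothPath_circleLoop a p) hK L hqs
    (fun t => hexp t)
  rw [sub_self] at h1
  convert h1 using 1
  set P := remP (k ^ 2 / 4) (fun z => u (Y z)) (fun z => X.gradZ u (Y z)) Ω x c₀ with hP
  set Q := remQ (k ^ 2 / 4) (fun z => u (Y z)) (fun z => X.gradB u (Y z)) Ω x c₁ with hQ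
  have hKt : ∀ t ∈ Set.Icc (0 : ℝ) 1, ζ t ∈ K := fun t ht => hK ⟨t, ht⟩
  have hpi : (Real.pi : ℂ) ≠ 0 := by exact_mod_cast Real.pi_ne_zero
  have hrem : ∫ t in (0 : ℝ)..1, (P (ζ t) * v t + Q (ζ t) * conj (v t)) = 0 := by
    rw [← hint, curveIntegral_eq_intervalIntegral_deriv]
    refine intervalIntegral.integral_congr_ae_restrict ?_
    rw [Set.uIoc_of_le zero_le_one, ← restrict_Ioo_eq_restrict_Ioc]
    filter_upwards [ae_restrict_mem measurableSet_Ioo] with t ht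
    rw [deriv_circleLoop_extend a p ht, hext t ⟨ht.1.le, ht.2.le⟩, wirtinger_apply]
  have hcont : ContinuousOn (fun t => P (ζ t) * v t + Q (ζ t) * conj (v t)) (Set.Icc 0 1) := by
    have hcl := (hΩ.mono (K' := K ∩ {ζ | ζ - charZ x ≠ 0 ∧ conj ζ - charW x ≠ 0})
      Set.inter_subset_left).isClosedForm_rem (x := x) (fun ζ hζ => hζ.2) c₀ c₁
    have hζc : Continuous ζ := by fun_prop
    have hvc : Continuous v := by fun_prop
    exact ((hcl.continuousOn_fst.comp hζc.continuousOn fun t ht => ⟨hKt t ht, hα t, hβ t⟩).mul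
      hvc.continuousOn).add ((hcl.continuousOn_snd.comp hζc.continuousOn
        fun t ht => ⟨hKt t ht, hα t, hβ t⟩).mul (Complex.continuous_conj.comp hvc).continuousOn)
  have hint2 : IntervalIntegrable (fun t => P (ζ t) * v t + Q (ζ t) * conj (v t)) volume 0 1 :=
    (hcont.mono (by rw [Set.uIcc_of_le zero_le_one])).intervalIntegrable
  set G := fun t => X.greenForm u x (Y ((circleLoop a p).extend t), L.extend t) (v t) with hG
  have hGc : IntervalIntegrable G volume 0 1 := by
    have := continuous_greenForm hu hk (hY.admissible_liftPath (circleLoop a p) hK L hqs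
      (fun t => hexp t)) (isSmoothPath_circleLoop a p).1
    exact this.intervalIntegrable 0 1
  -- 2π times Green's form plus i times the remainder is the differential of i l Ω - i c₀ f - i c₁
  -- g. The increments of l, f and g give the stated value.
  have hFTC := intervalIntegral.integral_eq_sub_of_hasDerivAt_of_le zero_le_one
    (f := fun t => Complex.I * (l + ((f t - f 0) + (g t - g 0)) / 2) * Ω x (ζ t) -
      Complex.I * c₀ * f t - Complex.I * c₁ * g t)
    (f' := fun t => 2 * Real.pi * G t + Complex.I * (P (ζ t) * v t + Q (ζ t) * conj (v t))) ?_ ?_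
    ((hGc.const_mul _).add (hint2.const_mul _))
  · rw [intervalIntegral.integral_add (hGc.const_mul _) (hint2.const_mul _),
      intervalIntegral.integral_const_mul, intervalIntegral.integral_const_mul, hrem, mul_zero,
      add_zero, hζ0, hζ1, hf1, hg1] at hFTC
    have h2 : (2 * Real.pi : ℂ) ≠ 0 := mul_ne_zero two_ne_zero hpi
    apply mul_left_cancel₀ h2
    rw [hFTC]
    linear_combination (-(m - n) * Real.pi * Ω x p + 2 * Real.pi * (m * c₀ - n * c₁)) *
      Complex.I_sq
  · have hζc : Continuous ζ := by fun_prop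
    have := (hΩ.continuousOn x).comp hζc.continuousOn hKt
    exact (((by fun_prop : Continuous fun t : ℝ =>
      Complex.I * (l + ((f t - f 0) + (g t - g 0)) / 2)).continuousOn.mul this).sub
        (by fun_prop)).sub (by fun_prop)
  · intro t ht
    have ht' : t ∈ Set.Icc (0 : ℝ) 1 := ⟨ht.1.le, ht.2.le⟩
    have hΩd := (hΩ.hasFDerivAt x _ (hKt t ht')).comp_hasDerivAt t (hζd t)
    have hd := ((((((hfd t).sub_const (f 0)).add ((hgd t).sub_const (g 0))).div_const
      2).const_add l).const_mul Complex.I).mul hΩd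
    have hd' := (hd.sub ((hfd t).const_mul (Complex.I * c₀))).sub
      ((hgd t).const_mul (Complex.I * c₁))
    refine hd'.congr_deriv ?_
    have had : X.Admissible k x (ζ t) (Y (ζ t), l + ((f t - f 0) + (g t - g 0)) / 2) :=
      ⟨hY.proj_eq _ (hKt t ht'), hY.regular (hKt t ht'), hq t, hexp t⟩
    simp only [hG]
    rw [hext t ht', hLext t ht', greenForm_eq hk had, hY.energyForm_eq (hKt t ht')]
    simp only [hP, hQ, remP, remQ, wirtinger_apply, Function.comp_apply, Pi.add_apply]
    have := hα t
    have := hβ t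
    field_simp
    ring

end

end SommerfeldSurface

/-- A continuous logarithm along a circle which does not enclose the singular points. -/
lemma exists_log_circle_path {k : ℂ} (hk : k ≠ 0) {a p : ℂ} {x : ℂ × ℂ}
    (h : ∀ l, ‖p - a‖ < dist (realPt l x) a) {l : ℂ}
    (hl : Complex.exp (2 * l) = k ^ 2 * sqDist x p) :
    ∃ L : Path l l, ∀ t, Complex.exp (2 * L t) = k ^ 2 * sqDist x (circleLoop a p t) := by
  set ρ := min (dist (realPt 0 x) a) (dist (realPt 1 x) a) with hρ
  have hρp : ‖p - a‖ < ρ := lt_min (h 0) (h 1)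
  have hg : Continuous fun ζ => k ^ 2 * sqDist x ζ := continuous_const.mul
    (Continuous.comp (g := fun p : (ℂ × ℂ) × ℂ => sqDist p.1 p.2) (f := fun ζ => (x, ζ))
      continuous_sqDist (continuous_const.prodMk continuous_id))
  have h0 : ∀ ζ ∈ Metric.ball a ρ, sqDist x ζ ≠ 0 := by
    intro ζ hζ h1
    rw [sqDist_eq, mul_eq_zero, sub_eq_zero, sub_eq_zero] at h1
    rw [Metric.mem_ball, hρ, lt_min_iff, realPt_zero, realPt_one] at hζ
    rcases h1 with h1 | h1
    · rw [← h1] at hζ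
      exact hζ.1.false
    · rw [← h1, Complex.conj_conj] at hζ
      exact hζ.2.false
  have hsc : IsSimplyConnected (Metric.ball a ρ) := by
    have := (convex_ball a ρ).contractibleSpace ⟨p, by rwa [mem_ball_iff_norm]⟩
    exact (inferInstance : SimplyConnectedSpace (Metric.ball a ρ))
  obtain ⟨f, hf, hfe⟩ := Complex.exists_continuousOn_eqOn_exp_comp
    hsc Metric.isOpen_ball
    hg.continuousOn (by
      rintro ⟨ζ, hζ, h1⟩
      exact mul_ne_zero (pow_ne_zero 2 hk) (h0 ζ hζ) h1)
  have hmem : ∀ t, circleLoop a p t ∈ Metric.ball a ρ := fun t => by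
    rw [mem_ball_iff_norm, circleLoop_apply, add_sub_cancel_left, norm_mul, norm_exp_two_pi_mul_I,
      mul_one]
    exact hρp
  refine ⟨⟨⟨fun t => l + (f (circleLoop a p t) - f p) / 2, ?_⟩, ?_, ?_⟩, fun t => ?_⟩
  · exact continuous_const.add (((hf.comp_continuous (circleLoop a p).continuous hmem).sub
      continuous_const).div_const 2)
  · simp
  · simp
  · change Complex.exp (2 * (l + (f (circleLoop a p t) - f p) / 2)) = _
    have e : 2 * (l + (f (circleLoop a p t) - f p) / 2) = 2 * l + f (circleLoop a p t) - f p := by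
      ring
    have e1 := hfe (hmem t)
    have e2 := hfe (show p ∈ Metric.ball a ρ by rwa [mem_ball_iff_norm])
    simp only [Function.comp_apply] at e1 e2
    rw [e, Complex.exp_sub, Complex.exp_add, e1, e2, hl]
    have := mul_ne_zero (pow_ne_zero 2 hk) (h0 p (by rwa [mem_ball_iff_norm]))
    exact mul_div_cancel_left₀ _ this

/-- The increment of the logarithm, in units of `π i`, along a circle around an associated real
point. -/
def logTurn (l : Fin 2) : ℤ := if l = 0 then 1 else -1

/-! ### Green's integrals over lassos, the basic contour and the double-eight contours. -/

namespace SommerfeldSurface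

variable {S : Type*} [TopologicalSpace S] [T2Space S] {M N : ℕ} {X : SommerfeldSurface S M N}
  {k : ℂ} {u : S → ℂ} {x : ℂ × ℂ}

/-- The return runs back along the segment with the logarithm raised by nπi, hence the correction
n/2 · d'. It may take place on another sheet than the way out. -/
theorem IsGreenLift.lasso (hk : k ≠ 0) {b a : ℂ} {r : ℝ} {s s₁ s₂ s₃ : S} {l l' : ℂ} {n : ℤ}
    {c d c' d' c₁ d₁ : ℂ}
    (h₁ : X.IsGreenLift k u x (Path.segment b (circlePt b a r)) (s, l) (s₁, l') c d)
    (h₂ : X.IsGreenLift k u x (circleLoop a (circlePt b a r)) (s₁, l')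
      (s₂, l' + n * (Real.pi * Complex.I)) c₁ d₁)
    (h₃ : X.IsGreenLift k u x (Path.segment b (circlePt b a r)) (s₃, l) (s₂, l') c' d') :
    X.IsGreenLift k u x (_root_.lasso b a r) (s, l) (s₃, l + n * (Real.pi * Complex.I))
      (c + c₁ - (c' - n / 2 * d')) (d + d₁ - d') := by
  have h := (h₃.shift hk n).symm
  rw [Path.segment_symm] at h
  simpa only [_root_.lasso, sub_eq_add_neg] using (h₁.trans h₂).trans h

namespace SlitSystem

variable (Θ : X.SlitSystem)

/-- Around A₁ the factor ζ - z gains 2πi in its logarithm; around A₂ the conjugate factor ζ̄ - w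
loses 2πi. The other factor has no increment, so one half-solution is picked out. -/
theorem isGreenLift_circle_realPt (hu : X.IsHelmholtz k u) (hk : k ≠ 0) (i : Fin 2) (s : Θ.Fiber)
    {a p : ℂ} (hB : Metric.closedBall a ‖p - a‖ ⊆ Θ.dom none)
    (hin : realPt i x ∈ Metric.ball a ‖p - a‖)
    (hout : ∀ i', i' ≠ i → realPt i' x ∉ Metric.closedBall a ‖p - a‖) {l : ℂ}
    (hl : Complex.exp (2 * l) = k ^ 2 * sqDist x p) :
    X.IsGreenLift k u x (circleLoop a p) (Θ.sec none s p, l)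
      (Θ.sec none s p, l + logTurn i * (Real.pi * Complex.I))
      (Θ.half k u i none s x - logTurn i / 2 * Θ.prim k u none s x p) 0 := by
  have hΩ := Θ.isRiemannPrimitive hu none s
  have hY := Θ.isSection_sec none s
  have hmem : ∀ t, circleLoop a p t ∈ Θ.dom none := fun t => hB (by
    rw [mem_closedBall_iff_norm, circleLoop_apply, add_sub_cancel_left, norm_mul,
      norm_exp_two_pi_mul_I, mul_one])
  have hconj : ∀ {g : ℝ → ℂ}, (∀ t : ℝ, Complex.exp (g t) =
      a + (p - a) * Complex.exp (2 * Real.pi * Complex.I * (t : ℂ)) - conj (charW x)) →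
      ∀ t : ℝ, Complex.exp (conj (g t)) =
      conj (a + (p - a) * Complex.exp (2 * Real.pi * Complex.I * (t : ℂ))) - charW x := by
    intro g hg t
    rw [Complex.exp_conj, hg, map_sub, Complex.conj_conj]
  fin_cases i
  · have hz : charZ x ∈ Metric.ball a ‖p - a‖ := by rw [← realPt_zero]; exact hin
    have hw : conj (charW x) ∉ Metric.closedBall a ‖p - a‖ := by
      rw [← realPt_one]; exact hout 1 (by simp)
    obtain ⟨f, hf, hf1, hf2⟩ := exists_log_circle_inside (mem_ball_iff_norm.1 hz)
    obtain ⟨g, hg, hg1, hg2⟩ := exists_log_circle_outside (a := a) (p := p)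
      (z := conj (charW x)) (by rw [mem_closedBall_iff_norm] at hw; exact not_le.1 hw)
    have h := isGreenLift_circle hu hk hY hΩ hmem (m := 1) (n := 0) hf
      (Complex.continuous_conj.comp hg) (by simp [hf1]) (by simp [hg1]) hf2 (hconj hg2)
      (hΩ.curveIntegral_rem_zero hB hz hw) hl
    convert h using 1
    · simp [logTurn]
    · simp only [logTurn, half]
      simp
  · have hw : conj (charW x) ∈ Metric.ball a ‖p - a‖ := by rw [← realPt_one]; exact hin
    have hz : charZ x ∉ Metric.closedBall a ‖p - a‖ := by
      rw [← realPt_zero]; exact hout 0 (by simp)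
    obtain ⟨g, hg, hg1, hg2⟩ := exists_log_circle_inside (mem_ball_iff_norm.1 hw)
    obtain ⟨f, hf, hf1, hf2⟩ := exists_log_circle_outside (a := a) (p := p)
      (z := charZ x) (by rw [mem_closedBall_iff_norm] at hz; exact not_le.1 hz)
    have h := isGreenLift_circle hu hk hY hΩ hmem (m := 0) (n := 1) hf
      (Complex.continuous_conj.comp hg) (by simp [hf1]) (by simp [hg1, map_ofNat]; ring) hf2
      (hconj hg2)
      (hΩ.curveIntegral_rem_one hB hw hz) hl
    convert h using 1
    · simp [logTurn]
    · simp only [logTurn, half]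
      simp

/-- The Green integral `c` is left unspecified because it cancels in the double-eight; only the
integral of Riemann's form is needed. -/
theorem isGreenLift_circle_branchPt (hu : X.IsHelmholtz k u) (hk : k ≠ 0) {j : Fin N} {R : ℝ}
    (hR : Θ.IsSmall j R) (s : Θ.Fiber) {p : ℂ} (hp : ‖Θ.coord j p‖ < R)
    (hps : Θ.coord j p ∈ Complex.slitPlane)
    (hx : ∀ l, ‖p - X.branchPt j‖ < dist (realPt l x) (X.branchPt j)) {l : ℂ}
    (hl : Complex.exp (2 * l) = k ^ 2 * sqDist x p) :
    ∃ c, X.IsGreenLift k u x (circleLoop (X.branchPt j) p) (Θ.sec none s p, l)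
      (Θ.sec none (Θ.perm j s) p, l) c
      (Θ.prim k u none (Θ.perm j s) x p + Θ.jump k u j s x - Θ.prim k u none s x p) := by
  obtain ⟨Γ, hΓ0, hΓ1, hΓ, -, hH⟩ := hR.exists_circle_lift hp hps s
  obtain ⟨H, hH0, hH1, hHd⟩ := hH k u hu x
  obtain ⟨L, hL⟩ := exists_log_circle_path hk hx hl
  rw [Θ.point_coord] at hΓ0 hΓ1 hH0 hH1
  have hcp : ∀ t : ℂ, Θ.point j (Θ.coord j p * t) = X.branchPt j + (p - X.branchPt j) * t := by
    intro t
    have := Θ.base_sub_ne j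
    simp only [point, coord]
    field_simp
  have hΓc : Continuous fun t : unitInterval => Γ t := by
    rw [continuous_iff_continuousAt]
    exact fun t => ContinuousAt.comp (g := Γ) (hΓ t t.2).1 continuous_subtype_val.continuousAt
  let Λ : Path (Θ.sec none s p, l) (Θ.sec none (Θ.perm j s) p, l) :=
    { toFun := fun t => (Γ t, L t)
      continuous_toFun := hΓc.prodMk L.continuous
      source' := by simp [hΓ0]
      target' := by simp [hΓ1] }
  have hΛ : ∀ t, X.Admissible k x (circleLoop (X.branchPt j) p t) (Λ t) := by
    intro t
    have h1 := hΓ t t.2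
    rw [hcp] at h1
    refine ⟨h1.2.2, h1.2.1, ?_, hL t⟩
    intro h0
    have := hL t
    rw [h0, mul_zero] at this
    exact Complex.exp_ne_zero _ this
  refine ⟨∫ t in (0 : ℝ)..1, X.greenForm u x (Λ.extend t) (2 * Real.pi * Complex.I *
    ((p - X.branchPt j) * Complex.exp (2 * Real.pi * Complex.I * (t : ℂ)))), ?_⟩
  rw [← hH0, ← hH1]
  refine isGreenLift_of_smooth hu hk (isSmoothPath_circleLoop _ p) Λ hΛ
    (fun t ht => (hHd t ht).continuousAt.continuousWithinAt) fun t ht => ?_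
  have ht' : t ∈ Set.Icc (0 : ℝ) 1 := ⟨ht.1.le, ht.2.le⟩
  refine (hHd t ht').congr_deriv ?_
  have e : Λ.extend t = (Γ t, L ⟨t, ht'⟩) := Path.extend_apply _ ht'
  rw [e, energyForm]
  congr 1
  have := Θ.base_sub_ne j
  simp only [coord]
  field_simp

/-- The position of the contours used for points near `B`. -/
structure IsContourBase (B : ℂ × ℂ) (b : ℂ) (r : ℝ) : Prop where
  -- The margin 2r leaves room for the real points of x to move by less than r while the contours,
  -- built from `B`, stay fixed.
  star : X.IsStarBase B b (2 * r)
  ne : realPt 0 B ≠ realPt 1 B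
  notMem : ∀ l, realPt l B ∉ Set.range X.branchPt
  segment_subset : ∀ a ∈ X.singularPts B, segment ℝ b (circlePt b a r) ⊆ Θ.dom none
  ball_subset : ∀ l, Metric.closedBall (realPt l B) r ⊆ Θ.dom none
  small : ∀ j, ∃ R, Θ.IsSmall j R ∧ r < R * ‖Θ.base - X.branchPt j‖

variable {Θ} {B : ℂ × ℂ} {b : ℂ} {r : ℝ} (h : Θ.IsContourBase B b r)
include h

lemma IsContourBase.pos : 0 < r := by have := h.star.1; linarith

lemma IsContourBase.isStarBase : X.IsStarBase B b r := by
  have hr := h.pos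
  refine ⟨hr, fun a ha => ⟨?_, fun a' ha' hne w hw => ?_⟩⟩
  · linarith [(h.star.2 a ha).1]
  · linarith [(h.star.2 a ha).2 a' ha' hne w hw]

omit h in
lemma realPt_mem_singularPts (B : ℂ × ℂ) (l : Fin 2) : realPt l B ∈ X.singularPts B := by
  refine Or.inl ?_
  fin_cases l
  · exact Or.inl rfl
  · exact Or.inr rfl

omit h in
lemma branchPt_mem_singularPts (B : ℂ × ℂ) (j : Fin N) : X.branchPt j ∈ X.singularPts B :=
  Or.inr ⟨j, rfl⟩

lemma IsContourBase.norm_sub {a : ℂ} (ha : a ∈ X.singularPts B) : 2 * r < ‖b - a‖ := by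
  rw [← dist_eq_norm]
  exact (h.star.2 a ha).1

lemma IsContourBase.norm_circlePt_sub {a : ℂ} (ha : a ∈ X.singularPts B) :
    ‖circlePt b a r - a‖ = r := by
  have h1 := h.pos
  have h2 := h.norm_sub ha
  have h3 : ‖b - a‖ ≠ 0 := by linarith
  rw [circlePt, add_sub_cancel_left, norm_mul, norm_div, Complex.norm_real, Complex.norm_real,
    norm_norm, div_self h3, mul_one, Real.norm_of_nonneg h1.le]

lemma IsContourBase.le_dist_of_mem_segment {a : ℂ} (ha : a ∈ X.singularPts B) {ζ : ℂ}
    (hζ : ζ ∈ segment ℝ b (circlePt b a r)) {a' : ℂ} (ha' : a' ∈ X.singularPts B) :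
    r ≤ dist ζ a' := by
  have h1 := h.pos
  have h2 := h.norm_sub ha
  have h3 : 0 < ‖b - a‖ := by linarith
  obtain ⟨t, s, ht, hs, hts, rfl⟩ := hζ
  have e : t • b + s • circlePt b a r = a + ((t + s * (r / ‖b - a‖) : ℝ) : ℂ) * (b - a) := by
    have hts' : (t : ℂ) + s = 1 := by exact_mod_cast hts
    simp only [circlePt, Complex.real_smul]
    push_cast
    linear_combination a * hts'
  have hs1 : s ≤ 1 := by linarith
  rcases eq_or_ne a' a with rfl | hne
  · rw [e, dist_eq_norm, add_sub_cancel_left, norm_mul, Complex.norm_real,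
      Real.norm_of_nonneg (by positivity), add_mul, mul_assoc, div_mul_cancel₀ _ h3.ne']
    nlinarith
  · have hlt := (h.star.2 a ha).2 a' ha' hne (t • b + s • circlePt b a r) ?_
    · linarith
    · rw [e]
      have hρ : r / ‖b - a‖ ≤ 1 := (div_le_one h3).2 (by linarith)
      have hρ0 : 0 ≤ r / ‖b - a‖ := by positivity
      refine ⟨t + s * (r / ‖b - a‖), 1 - (t + s * (r / ‖b - a‖)), by positivity, ?_, by ring, ?_⟩
      · nlinarith
      · simp only [Complex.real_smul]
        push_cast
        ring

lemma IsContourBase.le_dist_of_mem_closedBall {a : ℂ} (ha : a ∈ X.singularPts B) {a' : ℂ}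
    (ha' : a' ∈ X.singularPts B) (hne : a' ≠ a) : 2 * r < dist a a' :=
  (h.star.2 a ha).2 a' ha' hne a (right_mem_segment ℝ b a)

variable (hx : ∀ l, dist (realPt l x) (realPt l B) < r)
include hx

omit h in
lemma sqDist_ne_zero_of_le {ζ : ℂ} (hζ : ∀ l, r ≤ dist ζ (realPt l B)) : sqDist x ζ ≠ 0 := by
  intro h0
  rw [sqDist_eq, mul_eq_zero, sub_eq_zero, sub_eq_zero] at h0
  rcases h0 with h0 | h0
  · have h1 := hx 0
    rw [realPt_zero x, ← h0] at h1
    exact h1.not_ge (hζ 0)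
  · have h1 := hx 1
    rw [realPt_one x, ← h0, Complex.conj_conj] at h1
    exact h1.not_ge (hζ 1)

lemma IsContourBase.sqDist_ne_zero {a : ℂ} (ha : a ∈ X.singularPts B) {ζ : ℂ}
    (hζ : ζ ∈ segment ℝ b (circlePt b a r)) : sqDist x ζ ≠ 0 :=
  sqDist_ne_zero_of_le hx fun l => h.le_dist_of_mem_segment ha hζ (realPt_mem_singularPts B l)

/-- The final logarithm depends only on the plane segment, so the same `l'` serves all sheets, in
particular a return on a permuted one. -/
lemma IsContourBase.exists_segment (hu : X.IsHelmholtz k u) (hk : k ≠ 0) {a : ℂ}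
    (ha : a ∈ X.singularPts B) {l : ℂ} (hl : Complex.exp (2 * l) = k ^ 2 * sqDist x b) :
    ∃ l', Complex.exp (2 * l') = k ^ 2 * sqDist x (circlePt b a r) ∧ ∀ s : Θ.Fiber, ∃ c,
      X.IsGreenLift k u x (Path.segment b (circlePt b a r)) (Θ.sec none s b, l)
        (Θ.sec none s (circlePt b a r), l') c
        (Θ.prim k u none s x (circlePt b a r) - Θ.prim k u none s x b) := by
  have hseg : ∀ t, Path.segment b (circlePt b a r) t ∈ segment ℝ b (circlePt b a r) := fun t => by
    rw [segment_eq_image_lineMap]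
    exact ⟨t, t.2, rfl⟩
  have hg : Continuous fun ζ => k ^ 2 * sqDist x ζ := continuous_const.mul
    (Continuous.comp (g := fun p : (ℂ × ℂ) × ℂ => sqDist p.1 p.2) (f := fun ζ => (x, ζ))
      continuous_sqDist (continuous_const.prodMk continuous_id))
  have h0 := fun t => h.sqDist_ne_zero hx ha (hseg t)
  obtain ⟨l', L, hL⟩ := exists_log_path (Path.segment b (circlePt b a r)) hg
    (fun t => mul_ne_zero (pow_ne_zero 2 hk) (h0 t)) hl
  refine ⟨l', by simpa using hL 1, fun s => ⟨_, isGreenLift_of_section hu hk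
    (Θ.isSection_sec none s) (Θ.isRiemannPrimitive hu none s) (isSmoothPath_segment _ _)
    (fun t => h.segment_subset a ha (hseg t)) L h0 hL⟩⟩

/-- The two passages of the segment cancel up to the shift of the logarithm, which moves the
evaluation point of the primitive from the circle to `b`. -/
theorem IsContourBase.lasso_realPt (hu : X.IsHelmholtz k u) (hk : k ≠ 0) (i : Fin 2)
    (s : Θ.Fiber) {l : ℂ} (hl : Complex.exp (2 * l) = k ^ 2 * sqDist x b) :
    X.IsGreenLift k u x (lasso b (realPt i B) r) (Θ.sec none s b, l)
      (Θ.sec none s b, l + logTurn i * (Real.pi * Complex.I))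
      (Θ.half k u i none s x - logTurn i / 2 * Θ.prim k u none s x b) 0 := by
  have ha := realPt_mem_singularPts (X := X) B i
  obtain ⟨l', hl', hs⟩ := h.exists_segment hx hu hk ha hl
  obtain ⟨c, hc⟩ := hs s
  have hn := h.norm_circlePt_sub ha
  have h2 := Θ.isGreenLift_circle_realPt hu hk i s (x := x) (a := realPt i B)
    (p := circlePt b (realPt i B) r)
    (by rw [hn]; exact h.ball_subset i) (by rw [hn]; exact hx i) (fun i' hi' hmem => by
      rw [hn, Metric.mem_closedBall] at hmem
      have hne : realPt i' B ≠ realPt i B := by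
        have := h.ne
        fin_cases i <;> fin_cases i' <;> first | exact absurd rfl hi' | exact this | exact this.symm
      have h3 := h.le_dist_of_mem_closedBall ha (realPt_mem_singularPts B i') hne
      have h4 := hx i'
      have h5 := dist_triangle (realPt i B) (realPt i' x) (realPt i' B)
      have h6 := dist_comm (realPt i B) (realPt i' x)
      linarith) hl'
  have := IsGreenLift.lasso hk hc h2 hc
  convert this using 1 <;> ring

theorem IsContourBase.lasso_branchPt (hu : X.IsHelmholtz k u) (hk : k ≠ 0) (j : Fin N)
    (s : Θ.Fiber) {l : ℂ} (hl : Complex.exp (2 * l) = k ^ 2 * sqDist x b) :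
    ∃ c, X.IsGreenLift k u x (lasso b (X.branchPt j) r) (Θ.sec none s b, l)
      (Θ.sec none (Θ.perm j s) b, l) c
      (Θ.jump k u j s x + Θ.prim k u none (Θ.perm j s) x b - Θ.prim k u none s x b) := by
  have ha := branchPt_mem_singularPts (X := X) B j
  obtain ⟨l', hl', hs⟩ := h.exists_segment hx hu hk ha hl
  obtain ⟨c, hc⟩ := hs s
  obtain ⟨c', hc'⟩ := hs (Θ.perm j s)
  have hn := h.norm_circlePt_sub ha
  obtain ⟨R, hR, hrR⟩ := h.small j
  have hmem := h.segment_subset _ ha (right_mem_segment ℝ b _)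
  obtain ⟨c₁, hc₁⟩ := Θ.isGreenLift_circle_branchPt hu hk hR s (x := x) (l := l')
    (p := circlePt b (X.branchPt j) r) (by
      rw [coord, norm_div, hn, div_lt_iff₀ (norm_pos_iff.2 (Θ.base_sub_ne j))]
      exact hrR) (hmem j) (fun i => by
      rw [hn]
      have h3 := h.le_dist_of_mem_closedBall ha (realPt_mem_singularPts B i)
        fun h0 => h.notMem i ⟨j, h0.symm⟩
      have h4 := hx i
      have h5 := dist_triangle (X.branchPt j) (realPt i x) (realPt i B)
      have h6 := dist_comm (realPt i x) (X.branchPt j)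
      linarith) hl'
  have := IsGreenLift.lasso hk (n := 0) hc (by simpa using hc₁) hc'
  refine ⟨c + c₁ - c', ?_⟩
  convert this using 1
  · simp
  · simp
  · ring

/-- Green's integral over the basic contour. -/
theorem IsContourBase.isGreenIntegral_basicContour (hu : X.IsHelmholtz k u) (hk : k ≠ 0)
    (s : Θ.Fiber) : X.IsGreenIntegral k u (basicContour b (realPt 0 B) (realPt 1 B) r)
      (Θ.sec none s b) x (Θ.full k u s x) := by
  have hb : sqDist x b ≠ 0 :=
    h.sqDist_ne_zero hx (realPt_mem_singularPts B 0) (left_mem_segment ℝ b _)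
  obtain ⟨l, hl⟩ : ∃ l, Complex.exp (2 * l) = k ^ 2 * sqDist x b :=
    ⟨Complex.log (k ^ 2 * sqDist x b) / 2, by
      rw [mul_div_cancel₀ _ two_ne_zero, Complex.exp_log (mul_ne_zero (pow_ne_zero 2 hk) hb)]⟩
  have h1 := h.lasso_realPt hx hu hk 0 s hl
  have h2 := h.lasso_realPt hx hu hk 1 s (l := l + logTurn 0 * (Real.pi * Complex.I))
    (by rw [exp_two_mul_add_int_mul_pi, hl])
  -- The turns around A₁ and A₂ are +πi and -πi, so the kernel closes up and the two terms with the
  -- primitive at `b` cancel.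
  have e : l + logTurn 0 * (Real.pi * Complex.I) + logTurn 1 * (Real.pi * Complex.I) = l := by
    simp [logTurn]
  rw [e] at h2
  have h3 := (h1.trans h2).isGreenIntegral
  have e2 : Θ.full k u s x = Θ.half k u 0 none s x + Θ.half k u 1 none s x := rfl
  rw [e2]
  convert h3 using 1
  · rfl
  · simp only [logTurn]
    push_cast
    simp
    ring

/-- Green's integral over the double-eight contours. -/
theorem IsContourBase.isGreenIntegral_doubleEight (hu : X.IsHelmholtz k u) (hk : k ≠ 0)
    (i : Fin 2) (j : Fin N) (s : Θ.Fiber) :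
    X.IsGreenIntegral k u (doubleEight b (realPt i B) (X.branchPt j) r)
      (Θ.sec none s b) x (Θ.cross k u i j s x) := by
  have hb : sqDist x b ≠ 0 :=
    h.sqDist_ne_zero hx (realPt_mem_singularPts B 0) (left_mem_segment ℝ b _)
  obtain ⟨l, hl⟩ : ∃ l, Complex.exp (2 * l) = k ^ 2 * sqDist x b :=
    ⟨Complex.log (k ^ 2 * sqDist x b) / 2, by
      rw [mul_div_cancel₀ _ two_ne_zero, Complex.exp_log (mul_ne_zero (pow_ne_zero 2 hk) hb)]⟩
  have h1 := h.lasso_realPt hx hu hk i s hl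
  have h1' := h.lasso_realPt hx hu hk i (Θ.perm j s) hl
  obtain ⟨c, hc⟩ := h.lasso_branchPt hx hu hk j s hl
  -- The lasso around `P_j` is used with the logarithm shifted by a turn and then backwards without
  -- the shift: `c` cancels and minus half a turn times the integral of Riemann's form remains. The
  -- primitives at `b` cancel against it, leaving the jump.
  have h3 := (((h1.trans (hc.shift hk (logTurn i))).trans h1'.symm).trans hc.symm).isGreenIntegral
  have e : Θ.halfJump k u i j s x = logTurn i / 2 * Θ.jump k u j s x := by
    fin_cases i <;> simp [halfJump, logTurn] <;> ring
  convert h3 using 1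
  · rfl
  · simp only [cross, Pi.sub_apply, e]
    ring

end SlitSystem

end SommerfeldSurface

/-! ### Choice of the base point and the radius of the contours. -/

lemma eventually_segment_subset {E : Type*} [NormedAddCommGroup E] [NormedSpace ℝ E] {O : Set E}
    (hO : IsOpen O) {b₀ a : E} (h : segment ℝ b₀ a ⊆ O) : ∀ᶠ b in 𝓝 b₀, segment ℝ b a ⊆ O := by
  have hc : IsCompact (segment ℝ b₀ a) := by
    rw [segment_eq_image_lineMap]
    exact isCompact_Icc.image AffineMap.lineMap_continuous
  obtain ⟨δ, hδ, hsub⟩ := hc.exists_thickening_subset_open hO h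
  filter_upwards [Metric.ball_mem_nhds b₀ hδ] with b hb
  rintro _ ⟨t, s, ht, hs, hts, rfl⟩
  refine hsub (Metric.mem_thickening_iff.2 ⟨t • b₀ + s • a, ⟨t, s, ht, hs, hts, rfl⟩, ?_⟩)
  rw [dist_add_right, dist_smul₀, Real.norm_of_nonneg ht]
  have hb' : dist b b₀ < δ := hb
  nlinarith [dist_nonneg (x := b) (y := b₀)]

lemma notMem_segment_of_im_ne_zero {a a' b : ℂ} (h : ((a' - b) / (a - b)).im ≠ 0) :
    a' ∉ segment ℝ b a := by
  rintro ⟨t, s, -, -, hts, rfl⟩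
  apply h
  have hts' : (t : ℂ) + s = 1 := by exact_mod_cast hts
  have e : t • b + s • a - b = s * (a - b) := by
    simp only [Complex.real_smul]
    linear_combination b * hts'
  rw [e]
  rcases eq_or_ne (a - b) 0 with h0 | h0
  · simp [h0]
  · rw [mul_div_cancel_right₀ _ h0, Complex.ofReal_im]

/-- Points outside a segment have positive distance to it. -/
lemma eventually_forall_lt_dist_segment {b a a' : ℂ} (h : a' ∉ segment ℝ b a) :
    ∀ᶠ r in 𝓝[>] (0 : ℝ), ∀ w ∈ segment ℝ b a, 2 * r < dist w a' := by
  have hc : IsCompact (segment ℝ b a) := by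
    rw [segment_eq_image_lineMap]
    exact isCompact_Icc.image AffineMap.lineMap_continuous
  have hd := (hc.isClosed.notMem_iff_infDist_pos ⟨b, left_mem_segment ℝ b a⟩).1 h
  filter_upwards [Ioo_mem_nhdsGT (half_pos hd)] with r hr w hw
  have h1 := Metric.infDist_le_dist_of_mem (x := a') hw
  rw [dist_comm] at h1
  linarith [hr.2]

lemma exists_eq_combo_of_mem_segment_circlePt {a b : ℂ} {r : ℝ} (hr : 0 < r)
    (hab : r < dist b a) {ζ : ℂ} (hζ : ζ ∈ segment ℝ b (circlePt b a r)) :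
    ∃ c : ℝ, 0 < c ∧ c ≤ 1 ∧ ζ = c • b + (1 - c) • a := by
  rw [dist_eq_norm] at hab
  have h3 : 0 < ‖b - a‖ := hr.trans hab
  obtain ⟨t, s, ht, hs, hts, rfl⟩ := hζ
  have hρ : r / ‖b - a‖ < 1 := (div_lt_one h3).2 hab
  have hρ0 : 0 < r / ‖b - a‖ := by positivity
  refine ⟨t + s * (r / ‖b - a‖), ?_, by nlinarith, ?_⟩
  · rcases ht.eq_or_lt with h | h
    · have : s = 1 := by linarith
      rw [← h, this]
      linarith
    · positivity
  · have hts' : (t : ℂ) + s = 1 := by exact_mod_cast hts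
    simp only [circlePt, Complex.real_smul]
    push_cast
    linear_combination a * hts'

namespace SommerfeldSurface

variable {S : Type*} [TopologicalSpace S] [T2Space S] {M N : ℕ} {X : SommerfeldSurface S M N}

namespace SlitSystem

variable (Θ : X.SlitSystem) {B : ℂ × ℂ}

lemma eventually_segment_realPt_subset (hB : B ∈ Θ.chart none none) :
    ∀ᶠ b in 𝓝 Θ.base, ∀ l, segment ℝ b (realPt l B) ⊆ Θ.dom none := by
  rw [eventually_all]
  intro l
  refine eventually_segment_subset (Θ.isOpen_dom none)
    (Θ.starConvex_dom.segment_subset ?_)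
  fin_cases l
  · exact hB.1
  · exact hB.2

lemma eventually_segment_branchPt_subset :
    ∀ᶠ b in 𝓝 Θ.base, ∀ i j, i ≠ j →
      segment ℝ b (X.branchPt j) ⊆ Θ.coord i ⁻¹' Complex.slitPlane := by
  simp only [eventually_all]
  intro i j hij
  refine eventually_segment_subset (Complex.isOpen_slitPlane.preimage (Θ.continuous_coord i)) ?_
  rintro _ ⟨t, s, ht, hs, hts, rfl⟩
  rw [Set.mem_preimage, Θ.coord_combo i hts, coord_base]
  exact Complex.starConvex_one_slitPlane (Θ.coord_branchPt_mem hij) ht hs hts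

theorem exists_isContourBase (hB : B ∈ Θ.chart none none) (hB' : B ∉ Set.range toC2) :
    ∃ b ∈ Θ.dom none, ∃ r, Θ.IsContourBase B b r := by
  have hne : realPt 0 B ≠ realPt 1 B := by
    intro h
    have h1 := congrArg Complex.re h
    have h2 := congrArg Complex.im h
    simp only [realPt, if_true, one_ne_zero, if_false] at h1 h2
    refine hB' ⟨⟨B.1.re, B.2.re⟩, Prod.ext (Complex.ext rfl ?_) (Complex.ext rfl ?_)⟩
    · simp only [toC2, Complex.ofReal_im]; linarith
    · simp only [toC2, Complex.ofReal_im]; linarith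
  have hfin : (X.singularPts B).Finite :=
    (by simp : ({realPt 0 B, realPt 1 B} : Set ℂ).Finite).union
    (Set.finite_range _)
  obtain ⟨O, hO, hOo, hbO⟩ := mem_nhds_iff.1 (((Θ.isOpen_dom none).eventually_mem Θ.base_mem).and
    ((Θ.eventually_segment_realPt_subset hB).and Θ.eventually_segment_branchPt_subset))
  -- The base of the slit system need not be in general position to the real points of `B`, so it is
  -- perturbed within a neighbourhood in which the segments still avoid the cuts.
  obtain ⟨b, hb, hbE, hgen⟩ := exists_generic_base hfin hOo ⟨_, hbO⟩
  obtain ⟨hb0, hb1, hb2⟩ := hO hb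
  have hreal : ∀ l, realPt l B ∈ Θ.dom none := by
    intro l
    fin_cases l
    · exact hB.1
    · exact hB.2
  refine ⟨b, hb0, ?_⟩
  have e1 : ∀ᶠ r in 𝓝[>] (0 : ℝ), ∀ a ∈ X.singularPts B, 2 * r < dist b a := by
    rw [Filter.eventually_all_finite hfin]
    intro a ha
    have : 0 < dist b a := dist_pos.2 fun h => hbE (h ▸ ha)
    filter_upwards [Ioo_mem_nhdsGT (half_pos this)] with r hr
    linarith [hr.2]
  have e2 : ∀ᶠ r in 𝓝[>] (0 : ℝ), ∀ a ∈ X.singularPts B, ∀ a' ∈ X.singularPts B, a' ≠ a →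
      ∀ w ∈ segment ℝ b a, 2 * r < dist w a' := by
    rw [Filter.eventually_all_finite hfin]
    intro a ha
    rw [Filter.eventually_all_finite hfin]
    intro a' ha'
    rw [eventually_imp_distrib_left]
    exact fun h => eventually_forall_lt_dist_segment
      (notMem_segment_of_im_ne_zero (hgen a ha a' ha' h.symm))
  have e3 : ∀ᶠ r in 𝓝[>] (0 : ℝ), ∀ l, Metric.closedBall (realPt l B) r ⊆ Θ.dom none := by
    rw [eventually_all]
    intro l
    obtain ⟨ε, hε, hsub⟩ := Metric.isOpen_iff.1 (Θ.isOpen_dom none) _ (hreal l)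
    filter_upwards [Ioo_mem_nhdsGT hε] with r hr
    exact (Metric.closedBall_subset_ball hr.2).trans hsub
  have e4 : ∀ᶠ r in 𝓝[>] (0 : ℝ), ∀ j, ∃ R, Θ.IsSmall j R ∧ r < R * ‖Θ.base - X.branchPt j‖ := by
    rw [eventually_all]
    intro j
    obtain ⟨R, hR, hR0⟩ := ((Θ.eventually_isSmall j).and self_mem_nhdsWithin).exists
    have h1 : 0 < R * ‖Θ.base - X.branchPt j‖ := mul_pos hR0 (norm_pos_iff.2 (Θ.base_sub_ne j))
    filter_upwards [Ioo_mem_nhdsGT h1] with r hr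
    exact ⟨R, hR, hr.2⟩
  obtain ⟨r, ⟨⟨⟨h1, h2⟩, h3⟩, h4⟩, hr⟩ := ((((e1.and e2).and e3).and e4).and
    self_mem_nhdsWithin).exists
  have hr : 0 < r := hr
  refine ⟨r, ⟨by linarith, fun a ha => ⟨h1 a ha, h2 a ha⟩⟩, hne,
    fun l => Θ.notMem_of_mem_dom (hreal l), fun a ha ζ hζ => ?_, h3, h4⟩
  obtain ⟨c, hc0, hc1, rfl⟩ := exists_eq_combo_of_mem_segment_circlePt hr
    (by linarith [h1 a ha]) hζ
  have hseg : c • b + (1 - c) • a ∈ segment ℝ b a :=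
    ⟨c, 1 - c, hc0.le, by linarith, by ring, rfl⟩
  rcases ha with (rfl | rfl) | ⟨j, rfl⟩
  · exact hb1 0 hseg
  · exact hb1 1 hseg
  · intro i
    rcases eq_or_ne i j with rfl | hij
    -- On the segment towards the branch point itself the coordinate is a positive multiple of that
    -- of `b`, and the slit plane is stable under positive scaling.
    · rw [Θ.coord_combo i (by ring), coord_branchPt, smul_zero, add_zero]
      have := Complex.mem_slitPlane_iff.1 (hb0 i)
      rw [Complex.mem_slitPlane_iff, Complex.real_smul, Complex.re_ofReal_mul,
        Complex.im_ofReal_mul]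
      exact this.imp (mul_pos hc0) (mul_ne_zero hc0.ne')
    · exact hb2 i j hij hseg

/-- The points of the surface over a point of the slit plane. -/
def fiberEquiv {b : ℂ} (hb : b ∈ Θ.dom none) : Θ.Fiber ≃ X.proj ⁻¹' {b} :=
  Equiv.ofBijective (fun s => ⟨Θ.sec none s b, (Θ.isSection_sec none s).proj_eq _ hb⟩)
    ⟨fun _ _ h => Θ.sec_none_injective hb (congrArg Subtype.val h), fun s => by
      obtain ⟨s', hs'⟩ := Θ.exists_sec_eq hb s.2
      exact ⟨s', Subtype.ext hs'⟩⟩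

end SlitSystem

end SommerfeldSurface

/-! ### Counting the generators. -/

section Combinatorics

/-- A spanning tree of the graph whose edges connect `s` with `σ j s`. -/
lemma exists_spanning_tree {F J : Type*} [Finite F] (σ : J → Equiv.Perm F)
    (htrans : ∀ T : Set F, (∀ j, ∀ s ∈ T, σ j s ∈ T) → T.Nonempty → T = Set.univ) (s₀ : F) :
    ∃ E : Finset (J × F), E.card = Nat.card F - 1 ∧ ∀ T : Set F, s₀ ∈ T →
      (∀ e ∈ E, e.2 ∈ T ↔ σ e.1 e.2 ∈ T) → T = Set.univ := by
  classical
  have := Fintype.ofFinite F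
  have grow : ∀ n, n < Nat.card F → ∃ (W : Finset F) (E : Finset (J × F)), s₀ ∈ W ∧
      W.card = n + 1 ∧ E.card = n ∧ (∀ e ∈ E, σ e.1 e.2 ∈ W) ∧ ∀ T : Set F, s₀ ∈ T →
        (∀ e ∈ E, e.2 ∈ T ↔ σ e.1 e.2 ∈ T) → (W : Set F) ⊆ T := by
    intro n
    induction n with
    | zero => exact fun _ => ⟨{s₀}, ∅, by simp, by simp, by simp, by simp, by simp +contextual⟩
    | succ n ih =>
      intro hn
      obtain ⟨W, E, hs, hW, hE, hEW, hT⟩ := ih (by omega)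
      -- Otherwise the tree built so far would be closed under all permutations, hence everything by
      -- transitivity, against the bound on its size.
      have hex : ∃ j, ∃ s ∈ W, σ j s ∉ W := by
        by_contra! hcon
        have huniv := htrans (W : Set F) (fun j s h => hcon j s h) ⟨s₀, hs⟩
        have : W = Finset.univ := by exact_mod_cast huniv
        rw [this, Finset.card_univ, ← Nat.card_eq_fintype_card] at hW
        omega
      obtain ⟨j, s, hsW, hjs⟩ := hex
      refine ⟨insert (σ j s) W, insert (j, s) E, Finset.mem_insert_of_mem hs, ?_, ?_, ?_, ?_⟩
      · rw [Finset.card_insert_of_notMem hjs, hW]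
      · rw [Finset.card_insert_of_notMem (fun h => hjs (hEW _ h)), hE]
      · intro e he
        rcases Finset.mem_insert.1 he with rfl | he
        · exact Finset.mem_insert_self _ _
        · exact Finset.mem_insert_of_mem (hEW e he)
      · intro T h0 he
        have h1 := hT T h0 fun e h => he e (Finset.mem_insert_of_mem h)
        rw [Finset.coe_insert]
        exact Set.insert_subset ((he (j, s) (Finset.mem_insert_self _ _)).1 (h1 hsW)) h1
  have hpos : 0 < Nat.card F := Nat.card_pos_iff.2 ⟨⟨s₀⟩, inferInstance⟩
  obtain ⟨W, E, -, hW, hE, -, hT⟩ := grow (Nat.card F - 1) (by omega)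
  refine ⟨E, hE, fun T h0 he => Set.eq_univ_of_univ_subset ?_⟩
  have : W = Finset.univ := by
    rw [← Finset.card_eq_iff_eq_univ, hW, ← Nat.card_eq_fintype_card]
    omega
  simpa [this] using hT T h0 he

/-- The basic solution, and the differences across the cuts. -/
def generator {F J V : Type*} (f₀ : V) (D : Fin 2 → J → F → V) : Option (Fin 2 × J × F) → V
  | none => f₀
  | some (l, j, s) => D l j s

/-- In each class the vanishing sum expresses one D₀ through the others. The D₁ along a spanning
tree then link all f(s) to f(s₀), and the relation D₀ + D₁ = f(s) - f(σ_j s) returns the remaining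
D₁. -/
theorem exists_generators {F V J : Type*} [Finite F] [Fintype J] [AddCommGroup V]
    (σ : J → Equiv.Perm F)
    (htrans : ∀ T : Set F, (∀ j, ∀ s ∈ T, σ j s ∈ T) → T.Nonempty → T = Set.univ)
    {C : J → Type*} (cl : ∀ j, F → C j) (hsurj : ∀ j, Function.Surjective (cl j))
    (hcl : ∀ j s, cl j (σ j s) = cl j s) {D : Fin 2 → J → F → V} {f : F → V}
    (hD : ∀ j s, D 0 j s + D 1 j s = f s - f (σ j s))
    (hsum : ∀ j (T : Finset F), (∀ s, σ j s ∈ T ↔ s ∈ T) → ∑ s ∈ T, D 0 j s = 0) (s₀ : F)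
    {Q : ℕ} (hQ : Nat.card F + ∑ j, (Nat.card F - Nat.card (C j)) = Q) :
    ∃ κ : Fin Q → Option (Fin 2 × J × F),
      Function.Injective κ ∧ none ∈ Set.range κ ∧
      (∀ l j s, D l j s ∈ Submodule.span ℤ (Set.range (generator (f s₀) D ∘ κ))) ∧
      ∀ s, f s ∈ Submodule.span ℤ (Set.range (generator (f s₀) D ∘ κ)) := by
  classical
  subst hQ
  have := Fintype.ofFinite F
  obtain ⟨E, hE, hET⟩ := exists_spanning_tree σ htrans s₀
  choose rep hrep using hsurj
  have hinj : ∀ j, Function.Injective (rep j) := fun j => Function.LeftInverse.injective (hrep j)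
  -- The index set: f(s₀), the D₀ away from one representative per class, and the D₁ on the tree
  -- edges.
  let ι := Option ((Σ j, {s // s ∉ Set.range (rep j)}) ⊕ E)
  let κ₀ : ι → Option (Fin 2 × J × F) :=
    Option.map (Sum.elim (fun a => (0, a.1, a.2.1)) fun e => (1, e.1.1, e.1.2))
  have hcard : Fintype.card ι = Nat.card F + ∑ j, (Nat.card F - Nat.card (C j)) := by
    have hpos : 0 < Fintype.card F := Fintype.card_pos_iff.2 ⟨s₀⟩
    have h1 : ∀ j, Fintype.card {s // s ∉ Set.range (rep j)} = Nat.card F - Nat.card (C j) := by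
      intro j
      rw [Fintype.card_subtype_compl, Nat.card_eq_fintype_card]
      congr 1
      rw [← Nat.card_eq_fintype_card]
      exact Nat.card_range_of_injective (hinj j)
    rw [Fintype.card_option, Fintype.card_sum, Fintype.card_sigma, Fintype.card_coe, hE]
    simp only [h1, Nat.card_eq_fintype_card]
    omega
  have hκ₀ : Function.Injective κ₀ := by
    refine Option.map_injective ?_
    rintro (⟨j, s, hs⟩ | ⟨⟨j, s⟩, hs⟩) (⟨j', s', hs'⟩ | ⟨⟨j', s'⟩, hs'⟩) h
    · simp only [Sum.elim_inl, Prod.mk.injEq, true_and] at h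
      obtain ⟨rfl, rfl⟩ := h
      rfl
    · simp at h
    · simp at h
    · simp only [Sum.elim_inr, Prod.mk.injEq, true_and] at h
      obtain ⟨rfl, rfl⟩ := h
      rfl
  let e := (Fintype.equivFinOfCardEq hcard).symm
  set H := Submodule.span ℤ (Set.range (generator (f s₀) D ∘ κ₀ ∘ e)) with hH
  have hmem : ∀ i : ι, generator (f s₀) D (κ₀ i) ∈ H := fun i =>
    Submodule.subset_span ⟨e.symm i, by simp⟩
  have h0 : ∀ j s, D 0 j s ∈ H := by
    intro j s
    by_cases hs : s ∈ Set.range (rep j)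
    · obtain ⟨c, rfl⟩ := hs
      have h1 := hsum j (Finset.univ.filter fun s => cl j s = c) fun s => by simp [hcl]
      rw [← Finset.add_sum_erase _ _ (a := rep j c) (by simp [hrep])] at h1
      rw [eq_neg_of_add_eq_zero_left h1]
      refine Submodule.neg_mem _ (Submodule.sum_mem _ fun s hs => ?_)
      rw [Finset.mem_erase, Finset.mem_filter] at hs
      refine hmem (some (Sum.inl ⟨j, s, ?_⟩))
      rintro ⟨c', rfl⟩
      rw [hrep] at hs
      exact hs.1 (by rw [hs.2.2])
    · exact hmem (some (Sum.inl ⟨j, s, hs⟩))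
  have hf0 : f s₀ ∈ H := hmem none
  have hf : ∀ s, f s ∈ H := by
    have := hET {s | f s ∈ H} hf0 fun a ha => by
      have h1 : D 1 a.1 a.2 ∈ H := hmem (some (Sum.inr ⟨a, ha⟩))
      have h2 := Submodule.add_mem _ (h0 a.1 a.2) h1
      rw [hD] at h2
      exact ⟨fun h => by simpa using Submodule.sub_mem _ h h2,
        fun h => by simpa using Submodule.add_mem _ h2 h⟩
    exact fun s => (Set.ext_iff.1 this s).2 trivial
  refine ⟨κ₀ ∘ e, hκ₀.comp e.injective, ⟨e.symm none, by simp [κ₀]⟩, fun l j s => ?_, hf⟩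
  fin_cases l
  · exact h0 j s
  · have : D 1 j s = f s - f (σ j s) - D 0 j s := by rw [← hD]; abel
    change D 1 j s ∈ H
    rw [this]
    exact Submodule.sub_mem _ (Submodule.sub_mem _ (hf _) (hf _)) (h0 j s)

end Combinatorics

/-! ### Assembly: generators of the lattice and their contours. -/

namespace SommerfeldSurface

variable {S : Type*} [TopologicalSpace S] [T2Space S] {M N : ℕ} {X : SommerfeldSurface S M N}
  {k : ℂ} {u : S → ℂ}

namespace SlitSystem

variable (Θ : X.SlitSystem)

/-- Over an invariant set the half-solutions cancel after reindexing, and the jumps sum to zero by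
the Meixner condition. -/
lemma sum_cross_eq_zero (hu : X.IsHelmholtz k u) (l : Fin 2) (j : Fin N) (T : Finset Θ.Fiber)
    (hT : ∀ s, Θ.perm j s ∈ T ↔ s ∈ T) : ∑ s ∈ T, Θ.cross k u l j s = 0 := by
  ext x
  have h1 := Θ.sum_jump_eq_zero hu j T hT x
  have h2 : ∑ s ∈ T, Θ.half k u l none (Θ.perm j s) x = ∑ s ∈ T, Θ.half k u l none s x :=
    Finset.sum_equiv (Θ.perm j) (fun s => (hT s).symm) fun _ _ => rfl
  have h3 : ∑ s ∈ T, Θ.halfJump k u l j s x = 0 := by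
    fin_cases l
    · simp [halfJump, ← Finset.sum_div, h1]
    · simp [halfJump, ← Finset.sum_div, h1]
  simp only [Finset.sum_apply, cross, Pi.sub_apply, Finset.sum_sub_distrib, h2, h3, sub_self,
    Pi.zero_apply]

/-- Generators of the lattice of branches. -/
theorem exists_generators [PreconnectedSpace S] (hu : X.IsHelmholtz k u) (s₀ : Θ.Fiber) :
    ∃ κ : Fin X.basisSize → Option (Fin 2 × Fin N × Θ.Fiber), Function.Injective κ ∧
      none ∈ Set.range κ ∧ ∀ v ∈ Θ.lattice k u, ∀ s, ∃ β : Fin X.basisSize → ℤ,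
        Θ.full k u s + v =
          ∑ q, β q • generator (Θ.full k u s₀) (Θ.cross k u) (κ q) := by
  choose cl hsurj hcl using Θ.exists_class
  have hQ : Nat.card Θ.Fiber + ∑ j, (Nat.card Θ.Fiber - Nat.card (X.proj ⁻¹' {X.branchPt j})) =
      X.basisSize := by
    simp only [Θ.card_fiber, basisSize, Nat.card_coe_set_eq]
  obtain ⟨κ, h1, h2, h3, h4⟩ := _root_.exists_generators Θ.perm
    (fun T hT hne => Θ.eq_univ_of_perm_invariant hT hne) cl hsurj hcl (D := Θ.cross k u)
    (f := Θ.full k u) (Θ.cross_add_cross k u) (Θ.sum_cross_eq_zero hu 0) s₀ hQ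
  refine ⟨κ, h1, h2, fun v hv s => ?_⟩
  have hv' : v ∈ Submodule.span ℤ (Set.range (generator (Θ.full k u s₀) (Θ.cross k u) ∘ κ)) := by
    have : Θ.lattice k u ≤ (Submodule.span ℤ
        (Set.range (generator (Θ.full k u s₀) (Θ.cross k u) ∘ κ))).toAddSubgroup := by
      rw [lattice, AddSubgroup.closure_le]
      rintro _ ⟨⟨l, j, s⟩, rfl⟩
      exact h3 l j s
    exact this hv
  obtain ⟨β, hβ⟩ := (Submodule.mem_span_range_iff_exists_fun ℤ).1 (Submodule.add_mem _ (h4 s) hv')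
  exact ⟨β, hβ.symm⟩

lemma forall_generator {p : (ℂ × ℂ → ℂ) → Prop} {s₀ : Θ.Fiber} (h₀ : p (Θ.full k u s₀))
    (h : ∀ l j s, p (Θ.cross k u l j s)) (i : Option (Fin 2 × Fin N × Θ.Fiber)) :
    p (generator (Θ.full k u s₀) (Θ.cross k u) i) :=
  match i with
  | none => h₀
  | some (l, j, s) => h l j s

lemma analyticOnNhd_generator (hu : X.IsHelmholtz k u) (s₀ : Θ.Fiber)
    (i : Option (Fin 2 × Fin N × Θ.Fiber)) :
    AnalyticOnNhd ℂ (generator (Θ.full k u s₀) (Θ.cross k u) i) (Θ.chart none none) :=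
  Θ.forall_generator (p := fun v => AnalyticOnNhd ℂ v (Θ.chart none none))
    (Θ.analyticOnNhd_full hu s₀)
    (fun l j s => Θ.analyticOnNhd_of_mem_lattice hu (Θ.cross_mem k u l j s)) i

lemma complexHelmholtzAt_generator (hu : X.IsHelmholtz k u) (s₀ : Θ.Fiber)
    (i : Option (Fin 2 × Fin N × Θ.Fiber)) {x : ℂ × ℂ} (hx : x ∈ Θ.chart none none) :
    ComplexHelmholtzAt k (generator (Θ.full k u s₀) (Θ.cross k u) i) x := by
  rw [(Θ.analyticOnNhd_generator hu s₀ i x hx).complexHelmholtzAt_iff]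
  exact Θ.forall_generator (p := fun v => helmholtzOp k v x = 0) (Θ.helmholtzOp_full hu s₀ x hx)
    (fun l j s => Θ.helmholtzOp_cross hu l j s x hx) i

/-- The generators are Green's integrals over the contours. -/
theorem IsContourBase.isGreenIntegral_generator {Θ : X.SlitSystem} {B x : ℂ × ℂ} {b : ℂ} {r : ℝ}
    (h : Θ.IsContourBase B b r) (hb : b ∈ Θ.dom none)
    (hx : ∀ l, dist (realPt l x) (realPt l B) < r) (hu : X.IsHelmholtz k u) (hk : k ≠ 0)
    (s₀ : Θ.Fiber) (i : Option (Fin 2 × Fin N × Θ.Fiber)) :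
    X.IsGreenIntegral k u
      (X.contour B b r (i.map (Prod.map id (Prod.map id (Θ.fiberEquiv hb)))))
      (X.liftStart (Θ.fiberEquiv hb s₀) (i.map (Prod.map id (Prod.map id (Θ.fiberEquiv hb)))))
      x (generator (Θ.full k u s₀) (Θ.cross k u) i x) :=
  match i with
  | none => h.isGreenIntegral_basicContour hx hu hk s₀
  | some (l, j, s) => h.isGreenIntegral_doubleEight hx hu hk l j s

end SlitSystem

/-- A system of cuts which avoids the real points associated with a given point. -/
lemma exists_slitSystem_chart {A : ℂ × ℂ} (hA : A ∉ X.branchLines) :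
    ∃ Θ : X.SlitSystem, A ∈ Θ.chart none none := by
  have hfin : (X.singularPts A).Finite :=
    (by simp : ({realPt 0 A, realPt 1 A} : Set ℂ).Finite).union (Set.finite_range _)
  obtain ⟨b, -, hb, hgen⟩ := exists_generic_base hfin isOpen_univ ⟨0, trivial⟩
  obtain ⟨Θ, rfl⟩ := X.exists_slitSystem (b := b) (fun h => hb (Or.inr h))
    fun i j hij => hgen _ (Or.inr ⟨j, rfl⟩) _ (Or.inr ⟨i, rfl⟩)
      (X.branchPt_injective.ne hij.symm)
  have key : ∀ l, realPt l A ∈ Θ.dom none := by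
    intro l j
    have h1 := hgen _ (Or.inr ⟨j, rfl⟩) _ (SlitSystem.realPt_mem_singularPts A l)
      fun h => (X.notMem_branchLines_iff A).1 hA l ⟨j, h⟩
    have h2 : X.branchPt j - Θ.base ≠ 0 := sub_ne_zero.2 (Θ.base_ne j).symm
    have h3 := Θ.base_sub_ne j
    have e : Θ.coord j (realPt l A) =
        1 - (realPt l A - Θ.base) / (X.branchPt j - Θ.base) := by
      rw [SlitSystem.coord, ← neg_sub (X.branchPt j) Θ.base, div_neg, eq_sub_iff_add_eq,
        neg_add_eq_sub, ← sub_div, sub_sub_sub_cancel_left, div_self h2]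
    rw [Complex.mem_slitPlane_iff, e, Complex.sub_im, Complex.one_im, zero_sub]
    exact Or.inr (neg_ne_zero.2 h1)
  exact ⟨Θ, key 0, key 1⟩

end SommerfeldSurface

end

theorem mainTheorem1 {S : Type*} [TopologicalSpace S] [T2Space S] [ConnectedSpace S] {M N : ℕ}
    (X : SommerfeldSurface S M N) {k : ℂ} (hk : 0 < k.re) (hk' : 0 ≤ k.im)
    {u : S → ℂ} (hu : X.IsHelmholtz k u) {A : ℂ × ℂ} (hA : A ∉ X.branchLines) :
    ∃ U : Set (ℂ × ℂ), IsOpen U ∧ IsConnected U ∧ A ∈ U ∧ Disjoint U X.branchLines ∧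
      ∃ g : Fin X.basisSize → ℂ × ℂ → ℂ,
        -- the basis functions are analytic solutions of the complex Helmholtz equation in `U`
        (∀ q, AnalyticOnNhd ℂ (g q) U ∧ ∀ x ∈ U, ComplexHelmholtzAt k (g q) x) ∧
        -- `u` continues along every path `σ` off `T` from a real point to `A`, to a branch in `U`
        (∀ (s₀ : S) (σ : Path (toC2 (X.proj s₀)) A), (∀ t, σ t ∉ X.branchLines) →
          ∃ v : ℂ × ℂ → ℂ, AnalyticOnNhd ℂ v U ∧ X.IsBranch u s₀ σ v) ∧
        -- every branch is an integer linear combination of the basis functions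
        (∀ (s₀ : S) (σ : Path (toC2 (X.proj s₀)) A), (∀ t, σ t ∉ X.branchLines) →
          ∀ v : ℂ × ℂ → ℂ, AnalyticOnNhd ℂ v U → X.IsBranch u s₀ σ v →
            ∃ β : Fin X.basisSize → ℤ, ∀ x ∈ U, v x = ∑ q, (β q : ℂ) * g q x) ∧
        -- near every non-real point of `U` the basis functions are Green's integrals over a lift of
        -- the basic contour and over distinct lifts of double-eight contours
        (∀ B ∈ U, B ∉ Set.range toC2 →
          ∃ (b : ℂ) (r : ℝ) (s₁ : X.proj ⁻¹' {b})
            (κ : Fin X.basisSize → Option (Fin 2 × Fin N × X.proj ⁻¹' {b})),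
            X.IsStarBase B b r ∧ Function.Injective κ ∧ none ∈ Set.range κ ∧
            ∀ q, ∀ᶠ x in 𝓝 B,
              X.IsGreenIntegral k u (X.contour B b r (κ q)) (X.liftStart s₁ (κ q)) x (g q x)) := by
  have hk0 : k ≠ 0 := by
    rintro rfl
    simp at hk
  -- The cuts are chosen to miss the real points of `A`. The neighbourhood is the whole set of
  -- points with both real points in the slit plane.
  obtain ⟨Θ, hAc⟩ := X.exists_slitSystem_chart hA
  obtain ⟨s₁⟩ := Θ.nonempty_fiber
  obtain ⟨κ, hκ, hnone, hspan⟩ := Θ.exists_generators hu s₁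
  refine ⟨Θ.chart none none, Θ.isOpen_chart none none,
    ⟨⟨A, hAc⟩, Θ.isPreconnected_chart none none⟩, hAc, ?_,
    fun q => generator (Θ.full k u s₁) (Θ.cross k u) (κ q), fun q =>
      ⟨Θ.analyticOnNhd_generator hu s₁ _, fun x hx => Θ.complexHelmholtzAt_generator hu s₁ _ hx⟩,
    fun s₀ σ hσ => ?_, fun s₀ σ hσ v hv hvb => ?_, fun B hB hB' => ?_⟩
  · refine Set.disjoint_left.2 fun x hx => (X.notMem_branchLines_iff x).2 fun l => ?_
    fin_cases l
    · exact Θ.notMem_of_mem_dom hx.1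
    · exact Θ.notMem_of_mem_dom hx.2
  · obtain ⟨l, hl, h⟩ := SommerfeldSurface.SlitSystem.exists_isBranch hu s₁ hAc s₀ σ hσ
    exact ⟨_, (Θ.analyticOnNhd_full hu s₁).add (Θ.analyticOnNhd_of_mem_lattice hu hl), h⟩
  · obtain ⟨l, hl, h⟩ := SommerfeldSurface.SlitSystem.eventuallyEq_of_isBranch hu s₁ hAc hσ hvb
    obtain ⟨β, hβ⟩ := hspan l hl s₁
    refine ⟨β, fun x hx => ?_⟩
    rw [hv.eqOn_of_preconnected_of_eventuallyEq
      ((Θ.analyticOnNhd_full hu s₁).add (Θ.analyticOnNhd_of_mem_lattice hu hl))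
      (Θ.isPreconnected_chart none none) hAc h hx, hβ, Finset.sum_apply]
    simp only [Pi.smul_apply, zsmul_eq_mul]
  -- The functions were fixed before `B`; only the contours depend on it. The sheet labels are
  -- carried from the fibre over the base of the slit system to the fibre over `b`.
  · obtain ⟨b, hb, r, h⟩ := Θ.exists_isContourBase hB hB'
    refine ⟨b, r, Θ.fiberEquiv hb s₁,
      fun q => (κ q).map (Prod.map id (Prod.map id (Θ.fiberEquiv hb))), h.isStarBase,
      (Option.map_injective (Function.injective_id.prodMap (Function.injective_id.prodMap
        (Θ.fiberEquiv hb).injective))).comp hκ, ?_, fun q => ?_⟩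
    · obtain ⟨q, hq⟩ := hnone
      exact ⟨q, by simp [hq]⟩
    · have hx : ∀ᶠ x in 𝓝 B, ∀ l, dist (realPt l x) (realPt l B) < r :=
        eventually_all.2 fun l => (continuous_realPt l).continuousAt.eventually
          (Metric.ball_mem_nhds _ h.pos)
      filter_upwards [hx] with x hx
      exact h.isGreenIntegral_generator hb hx hu hk0 s₁ (κ q)
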